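/- Let $F$ be a $p$-adic field (a non-archimedean local field of characteristic $0$), with normalized absolute value $|\cdot|$ (a uniformizer has absolute value $q^{-1}$, where $q$ is the cardinality of the residue field), let $\psi : F \to \mathbb{C}^\times$ be a non-trivial continuous unitary additive character, and let $dx$ be the Haar measure on $F$ that is self-dual with respect to $\psi$. Let $n \geq 1$ and write $G_m = GL_m(F)$, $M_m$ for the $m\times m$ matrices over $F$, $N_m \subset G_m$ for the upper triangular matrices with diagonal entries $1$, $P_m \subset G_m$ for the matrices with last row $(0,\dots,0,1)$, and $V_m \subset M_m$ for the strictly lower triangular matrices. For $u \in N_m$ put $\psi(u) = \psi\bigl(\sum_{i=1}^{m-1} u_{i,i+1}\bigr)$. Let $\sigma_n$ be the permutation matrix of the permutation of $\{1,\dots,2n\}$ sending $i \mapsto 2i-1$ and $n+i \mapsto 2i$ for $1 \le i \le n$ (so $\sigma_n e_j = e_{\sigma_n(j)}$). For $X \in M_n$ and $g \in G_n$ put $$h(X,g) = \sigma_n \begin{pmatrix} 1 & X \\ 0 & 1\end{pmatrix}\begin{pmatrix} g & 0 \\ 0 & g\end{pmatrix}\sigma_n^{-1},$$ let $H_n = \{h(X,g)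 : X \in M_n,\ g \in G_n\} \subset G_{2n}$, $H_n^P = H_n \cap P_{2n}$, and let $\theta$ be the character of $H_n$ with $\theta(h(X,g)) = \psi(\mathrm{Tr}\, X)$. The measures are as follows. On $M_n$, $N_m$ and $V_n$ take the product of the measures $dx$ over the free coordinates; on $G_m$ take $dg = |\det g|^{-m}\prod_{i,j} dg_{i,j}$; on $P_n = U_nG_{n-1}$, where $U_n \simeq F^{n-1}$ is the group of unipotent matrices that differ from the identity only in the last column, take the right Haar measure that is the product of the measures on $U_n$ and $G_{n-1}$; on $N_n\backslash G_n$ and $N_n \backslash P_n$ take the quotient measures. On $H_n$ put $\int_{H_n} \varphi(s)\,ds = \int_{G_n}\int_{M_n} \varphi(h(X,g))\,dX\,dg$. On the coset spaces $(H_n\cap N_{2n})\backslash H_n$ and $(H_n^P\cap N_{2n})\backslash H_n^P$ put $$\int \varphi(\xi)\,d\xi = \int_{N_n\backslash G_n}\int_{V_n}\varphi(h(X,g))\,dX\,dg, \qquad \int \varphi(\xi_p)\,d\xi_p = \int_{N_n\backslash P_n}\int_{V_n}\varphi(h(X,p))\,dX\,dp .$$ Let $f : G_{2n}\to\mathbb{C}$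 be locally constant with compact support, and for $g_1, g_2\in G_{2n}$ let $$W_f(g_1,g_2) = \int_{N_{2n}} f(g_1^{-1}ug_2)\,\psi(u)^{-1}\,du .$$ Then the integrals defining $W_f$ and the integral $\int_{H_n} f(s)\theta(s)^{-1}ds$ converge absolutely, the function $(\xi_p,\xi) \mapsto W_f(\xi_p,\xi)\theta(\xi)^{-1}\theta(\xi_p)$ is absolutely integrable on $\bigl((H_n^P\cap N_{2n})\backslash H_n^P\bigr) \times \bigl((H_n\cap N_{2n})\backslash H_n\bigr)$, and $$\int_{H_n} f(s)\,\theta(s)^{-1}\,ds = \int_{(H_n^P\cap N_{2n})\backslash H_n^P}\ \int_{(H_n\cap N_{2n})\backslash H_n} W_f(\xi_p,\xi)\,\theta(\xi)^{-1}\,\theta(\xi_p)\,d\xi\,d\xi_p .$$ -/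

import Mathlib

open MeasureTheory Matrix
open scoped ENNReal

namespace LinearPeriod

noncomputable section

/-! ### The field, the additive character and the measure on the field -/

/-- The space `𝒮(X)` of locally constant functions with compact support on a totally
disconnected space. -/
def IsSchwartzBruhat {X : Type*} [TopologicalSpace X] (f : X → ℂ) : Prop :=
  IsLocallyConstant f ∧ HasCompactSupport f

/-- The absolute value is the normalized one: a uniformizer has absolute value `q⁻¹`, where `q` is
the cardinality of the residue field. -/
def IsNormalizedAbs (F : Type*) [NormedField F] [IsUltrametricDist F] : Prop :=
  ∀ ϖ : (NormedField.valuation (K := F)).valuationSubring, Irreducible ϖ →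
    ‖(ϖ : F)‖ = (Nat.card (IsLocalRing.ResidueField
      (NormedField.valuation (K := F)).valuationSubring) : ℝ)⁻¹

variable {F : Type*} [NontriviallyNormedField F]

/-- The Fourier transform `φ ↦ (y ↦ ∫ φ(t) ψ(ty) dt)` on `F`. -/
def fourier [MeasurableSpace F] (ψ : AddChar F Circle) (μ : Measure F) (φ : F → ℂ) (y : F) : ℂ :=
  ∫ t, φ t * (ψ (t * y) : ℂ) ∂μ

/-- The measure `μ` is self-dual with respect to `ψ`: applying the Fourier transform twice to
`φ ∈ 𝒮(F)` gives `x ↦ φ(-x)`. -/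
def IsSelfDual [MeasurableSpace F] (ψ : AddChar F Circle) (μ : Measure F) : Prop :=
  ∀ φ : F → ℂ, IsSchwartzBruhat φ → ∀ x, fourier ψ μ (fourier ψ μ φ) x = φ (-x)

/-! ### Groups of matrices -/

instance matrixMeasurableSpace {m n α : Type*} [MeasurableSpace α] :
    MeasurableSpace (Matrix m n α) :=
  inferInstanceAs (MeasurableSpace (m → n → α))

/-- The matrix with the given coefficients at the positions `(i, j)` with `r i j`, and the
coefficients of `A` elsewhere. -/
def fillMatrix {n : ℕ} (A : Matrix (Fin n) (Fin n) F) (r : Fin n → Fin n → Prop)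
    [DecidableRel r] (x : {p : Fin n × Fin n // r p.1 p.2} → F) : Matrix (Fin n) (Fin n) F :=
  Matrix.of fun i j => if h : r i j then x ⟨(i, j), h⟩ else A i j

variable (F) in
/-- The group `N_n` of upper triangular matrices with diagonal entries `1`. -/
def unip (n : ℕ) : Subgroup (GL (Fin n) F) where
  carrier := {u | ∀ i j, j ≤ i → u i j = (1 : Matrix (Fin n) (Fin n) F) i j}
  one_mem' := fun _ _ _ => rfl
  mul_mem' := by
    intro a b ha hb i j hij
    simp only [Set.mem_ofPred_eq] at ha hb
    rw [Units.val_mul, Matrix.mul_apply, Finset.sum_eq_single i]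
    · rw [ha i i le_rfl, hb i j hij, Matrix.one_apply_eq, one_mul]
    · intro k _ hk
      rcases lt_or_gt_of_ne hk with h | h
      · rw [ha i k h.le, Matrix.one_apply_ne (Ne.symm hk), zero_mul]
      · rw [hb k j (hij.trans h.le), Matrix.one_apply_ne (ne_of_gt (hij.trans_lt h)), mul_zero]
    · simp
  inv_mem' := by
    intro a ha
    simp only [Set.mem_ofPred_eq] at ha ⊢
    have hbt : (a : Matrix (Fin n) (Fin n) F).BlockTriangular id := fun i j hij => by
      have h : j < i := hij
      rw [ha i j h.le, Matrix.one_apply_ne (ne_of_gt h)]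
    have : Invertible (a : Matrix (Fin n) (Fin n) F) := a.invertible
    have hinv := blockTriangular_inv_of_blockTriangular hbt
    rw [← Matrix.coe_units_inv] at hinv
    intro i j hij
    rcases eq_or_lt_of_le hij with rfl | h
    · have h1 := congrArg (fun A : GL (Fin n) F => A.val j j) (mul_inv_cancel a)
      rw [Units.val_mul, Matrix.mul_apply, Finset.sum_eq_single j] at h1
      · rw [ha j j le_rfl, Matrix.one_apply_eq, one_mul] at h1
        exact h1
      · intro k _ hk
        rcases lt_or_gt_of_ne hk with h | h
        · rw [ha j k h.le, Matrix.one_apply_ne (Ne.symm hk), zero_mul]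
        · rw [hinv h, mul_zero]
      · simp
    · rw [hinv h, Matrix.one_apply_ne (ne_of_gt h)]

/-- The element of `N_n` with given coordinates above the diagonal. -/
def unipOfCoords {n : ℕ} (x : {p : Fin n × Fin n // p.1 < p.2} → F) : unip F n :=
  ⟨GeneralLinearGroup.mkOfDetNeZero (fillMatrix 1 (· < ·) x) (by
      rw [Matrix.det_of_isUpperTriangular]
      · simp [fillMatrix]
      · intro i j hij
        have h : j < i := hij
        simp [fillMatrix, not_lt_of_gt h, Matrix.one_apply_ne (ne_of_gt h)]), by
    intro i j hij
    change fillMatrix 1 (· < ·) x i j = _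
    simp [fillMatrix, not_lt_of_ge hij]⟩

variable (F) in
/-- The space `V_n` of strictly lower triangular matrices. -/
def strictLower (n : ℕ) : Submodule F (Matrix (Fin n) (Fin n) F) where
  carrier := {X | ∀ i j, i ≤ j → X i j = 0}
  zero_mem' := fun _ _ _ => rfl
  add_mem' := fun {a b} ha hb i j hij => by
    rw [Matrix.add_apply, ha i j hij, hb i j hij, add_zero]
  smul_mem' := fun c a ha i j hij => by
    rw [Matrix.smul_apply, ha i j hij, smul_zero]

/-- The element of `V_n` with given coordinates below the diagonal. -/
def strictLowerOfCoords {n : ℕ} (x : {p : Fin n × Fin n // p.2 < p.1} → F) : strictLower F n :=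
  ⟨fillMatrix 0 (fun i j => j < i) x, fun i j hij => by
    simp [fillMatrix, not_lt_of_ge hij]⟩

variable (F) in
/-- The mirabolic group `P_n` of invertible matrices with last row `(0, …, 0, 1)`. -/
def mirabolic (n : ℕ) : Subgroup (GL (Fin n) F) where
  carrier := {p | ∀ i j : Fin n, (i : ℕ) + 1 = n → p i j = (1 : Matrix (Fin n) (Fin n) F) i j}
  one_mem' := fun _ _ _ => rfl
  mul_mem' := by
    intro a b ha hb i j hi
    simp only [Set.mem_ofPred_eq] at ha hb
    rw [Units.val_mul, Matrix.mul_apply, Finset.sum_congr rfl (fun k _ => by rw [ha i k hi]),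
      ← Matrix.mul_apply, Matrix.one_mul, hb i j hi]
  inv_mem' := by
    intro a ha i j hi
    simp only [Set.mem_ofPred_eq] at ha
    have h1 := congrArg (fun A : GL (Fin n) F => A.val i j) (mul_inv_cancel a)
    rw [Units.val_mul, Matrix.mul_apply, Finset.sum_congr rfl (fun k _ => by rw [ha i k hi]),
      ← Matrix.mul_apply, Matrix.one_mul] at h1
    exact h1

theorem unip_le_mirabolic (n : ℕ) : unip F n ≤ mirabolic F n := by
  intro u hu i j hi
  exact hu i j (Fin.le_def.2 (by omega))

/-- The element `u_x diag(g, 1) = (g x; 0 1)` of `P_{m+1} = U_{m+1} G_m`, where `u_x ∈ U_{m+1}` is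
the unipotent element with last column `(x, 1)`. -/
def mirabolicMk {m : ℕ} (x : Fin m → F) (g : GL (Fin m) F) : mirabolic F (m + 1) :=
  ⟨GeneralLinearGroup.mkOfDetNeZero
      (Matrix.reindex finSumFinEquiv finSumFinEquiv
        (Matrix.fromBlocks (g : Matrix (Fin m) (Fin m) F) (Matrix.of fun i (_ : Fin 1) => x i) 0 1))
      (by
        rw [Matrix.det_reindex_self, Matrix.det_fromBlocks_zero₂₁, Matrix.det_one, mul_one]
        exact g.det.ne_zero), by
    intro i j hi
    obtain rfl : i = finSumFinEquiv (Sum.inr (0 : Fin 1)) := Fin.ext (by simp at hi ⊢; omega)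
    obtain ⟨j, rfl⟩ := finSumFinEquiv.surjective j
    change Matrix.reindex finSumFinEquiv finSumFinEquiv _ _ _ = _
    rcases j with j | j
    · simp [Matrix.one_apply, Fin.ext_iff, (ne_of_gt j.2)]
    · simp [Matrix.one_apply, Fin.ext_iff]⟩

/-- The bijection `{1, …, n} ⊔ {1, …, n} → {1, …, 2n}` sending `i` in the first copy to `2i - 1`
and `i` in the second copy to `2i` (here the indices start from `0`). With the usual identification
of the source with `{1, …, 2n}`, this is the permutation `σ_n`. -/
def shuffle (n : ℕ) : Fin n ⊕ Fin n ≃ Fin (2 * n) where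
  toFun := Sum.elim (fun i => ⟨2 * i, by omega⟩) (fun i => ⟨2 * i + 1, by omega⟩)
  invFun k := if (k : ℕ) % 2 = 0 then Sum.inl ⟨k / 2, by omega⟩ else Sum.inr ⟨k / 2, by omega⟩
  left_inv := by
    rintro (i | i)
    · simp
    · have h : (2 * (i : ℕ) + 1) / 2 = i := by omega
      simp [Nat.add_mod, h]
  right_inv := by
    intro k
    rcases Nat.mod_two_eq_zero_or_one k with h | h
    · simp only [h, if_true, Sum.elim_inl, Fin.ext_iff]
      omega
    · simp only [h, one_ne_zero, if_false, Sum.elim_inr, Fin.ext_iff]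
      omega

/-- The matrix `(1 X; 0 1)`. -/
def upperBlock {n : ℕ} (X : Matrix (Fin n) (Fin n) F) : GL (Fin n ⊕ Fin n) F where
  val := Matrix.fromBlocks 1 X 0 1
  inv := Matrix.fromBlocks 1 (-X) 0 1
  val_inv := by simp [Matrix.fromBlocks_multiply]
  inv_val := by simp [Matrix.fromBlocks_multiply]

/-- The matrix `(g 0; 0 g)`. -/
def diagBlock {n : ℕ} (g : GL (Fin n) F) : GL (Fin n ⊕ Fin n) F where
  val := Matrix.fromBlocks g.val 0 0 g.val
  inv := Matrix.fromBlocks g.inv 0 0 g.inv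
  val_inv := by rw [Matrix.fromBlocks_multiply, g.val_inv]; simp
  inv_val := by rw [Matrix.fromBlocks_multiply, g.inv_val]; simp

/-- The map `A ↦ σ_n A σ_n⁻¹`: the coefficient of `A` at `(i, j)` is moved to
`(σ_n(i), σ_n(j))`. -/
def conjShuffle (n : ℕ) : GL (Fin n ⊕ Fin n) F ≃* GL (Fin (2 * n)) F :=
  Units.mapEquiv (Matrix.reindexAlgEquiv F F (shuffle n)).toMulEquiv

/-- The element `σ_n (1 X; 0 1) (g 0; 0 g) σ_n⁻¹` of `GL_{2n}`. -/
def shalikaMk {n : ℕ} (X : Matrix (Fin n) (Fin n) F) (g : GL (Fin n) F) : GL (Fin (2 * n)) F :=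
  conjShuffle n (upperBlock X * diagBlock g)

theorem upperBlock_mul_diagBlock_val {n : ℕ} (X : Matrix (Fin n) (Fin n) F) (g : GL (Fin n) F) :
    ((upperBlock X * diagBlock g : GL (Fin n ⊕ Fin n) F) : Matrix (Fin n ⊕ Fin n) (Fin n ⊕ Fin n) F)
      = Matrix.fromBlocks g.val (X * g.val) 0 g.val := by
  rw [Units.val_mul]
  simp [upperBlock, diagBlock, Matrix.fromBlocks_multiply]

theorem shalikaMk_mul {n : ℕ} (X Y : Matrix (Fin n) (Fin n) F) (g k : GL (Fin n) F) :
    shalikaMk X g * shalikaMk Y k = shalikaMk (X + g.val * Y * g.inv) (g * k) := by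
  unfold shalikaMk
  rw [← map_mul]
  congr 1
  apply Units.ext
  rw [Units.val_mul (upperBlock X * diagBlock g), upperBlock_mul_diagBlock_val,
    upperBlock_mul_diagBlock_val, upperBlock_mul_diagBlock_val, Matrix.fromBlocks_multiply,
    Matrix.fromBlocks_inj, Units.val_mul]
  refine ⟨?_, ?_, ?_, ?_⟩
  · simp
  · have h : g.inv * (g.val * k.val) = k.val := by
      rw [← Matrix.mul_assoc, g.inv_val, Matrix.one_mul]
    rw [Matrix.add_mul, Matrix.mul_assoc (g.val * Y), h, add_comm]
    simp only [Matrix.mul_assoc]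
  · simp
  · simp

theorem shalikaMk_zero_one {n : ℕ} :
    shalikaMk (0 : Matrix (Fin n) (Fin n) F) (1 : GL (Fin n) F) = 1 := by
  unfold shalikaMk
  rw [MulEquiv.map_eq_one_iff]
  apply Units.ext
  rw [upperBlock_mul_diagBlock_val]
  simp

variable (F) in
/-- The group `H_n` of the matrices `σ_n (1 X; 0 1) (g 0; 0 g) σ_n⁻¹`. -/
def shalika (n : ℕ) : Subgroup (GL (Fin (2 * n)) F) where
  carrier := {h | ∃ X g, shalikaMk X g = h}
  one_mem' := ⟨0, 1, shalikaMk_zero_one⟩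
  mul_mem' := by
    rintro _ _ ⟨X, g, rfl⟩ ⟨Y, k, rfl⟩
    exact ⟨_, _, (shalikaMk_mul X Y g k).symm⟩
  inv_mem' := by
    rintro _ ⟨X, g, rfl⟩
    refine ⟨-(g.inv * X * g.val), g⁻¹, ?_⟩
    rw [eq_inv_iff_mul_eq_one, shalikaMk_mul, inv_mul_cancel]
    have h : -(g.inv * X * g.val) + (g⁻¹).val * X * (g⁻¹).inv = 0 := neg_add_cancel _
    rw [h, shalikaMk_zero_one]

variable (F) in
/-- The group `H_n^P = H_n ∩ P_{2n}`. -/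
def shalikaP (n : ℕ) : Subgroup (GL (Fin (2 * n)) F) := shalika F n ⊓ mirabolic F (2 * n)

theorem shalikaMk_mem {n : ℕ} (X : Matrix (Fin n) (Fin n) F) (g : GL (Fin n) F) :
    shalikaMk X g ∈ shalika F n := ⟨X, g, rfl⟩

theorem shalikaMk_mem_shalikaP {n : ℕ} (X : Matrix (Fin n) (Fin n) F) (p : mirabolic F n) :
    shalikaMk X (p : GL (Fin n) F) ∈ shalikaP F n := by
  refine ⟨shalikaMk_mem X p, ?_⟩
  intro i j hi
  obtain ⟨i, rfl⟩ := (shuffle n).surjective i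
  obtain ⟨j, rfl⟩ := (shuffle n).surjective j
  have hv : (shalikaMk X (p : GL (Fin n) F)) (shuffle n i) (shuffle n j)
      = Matrix.fromBlocks (p : GL (Fin n) F).val (X * (p : GL (Fin n) F).val) 0
        (p : GL (Fin n) F).val i j := by
    rw [← upperBlock_mul_diagBlock_val]
    change (Matrix.reindex (shuffle n) (shuffle n) _) _ _ = _
    simp
  rw [hv]
  rcases i with i | i
  · simp [shuffle] at hi
    omega
  · have hi' : (i : ℕ) + 1 = n := by
      simp [shuffle] at hi
      omega
    rcases j with j | j
    · rw [Matrix.one_apply_ne (by simp)]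
      simp
    · have := p.2 i j hi'
      simp only [Matrix.fromBlocks_apply₂₂, Matrix.one_apply, EmbeddingLike.apply_eq_iff_eq,
        Sum.inr.injEq] at this ⊢
      exact this

/-- The element `σ_n (1 X; 0 1) (g 0; 0 g) σ_n⁻¹` of `H_n`. -/
def toShalika {n : ℕ} (X : Matrix (Fin n) (Fin n) F) (g : GL (Fin n) F) : shalika F n :=
  ⟨shalikaMk X g, shalikaMk_mem X g⟩

/-- The element `σ_n (1 X; 0 1) (p 0; 0 p) σ_n⁻¹` of `H_n^P`, for `p ∈ P_n`. -/
def toShalikaP {n : ℕ} (X : Matrix (Fin n) (Fin n) F) (p : mirabolic F n) : shalikaP F n :=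
  ⟨shalikaMk X (p : GL (Fin n) F), shalikaMk_mem_shalikaP X p⟩

theorem shalikaMk_left_injective {n : ℕ} {X Y : Matrix (Fin n) (Fin n) F} {g k : GL (Fin n) F}
    (h : shalikaMk X g = shalikaMk Y k) : X = Y := by
  have h1 := congrArg Units.val ((conjShuffle n).injective h)
  rw [upperBlock_mul_diagBlock_val, upperBlock_mul_diagBlock_val, Matrix.fromBlocks_inj] at h1
  obtain ⟨h11, h12, -, -⟩ := h1
  rw [h11] at h12
  have h2 := congrArg (· * k.inv) h12
  simpa only [Matrix.mul_assoc, k.val_inv, Matrix.mul_one] using h2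

/-- The character `θ` of `H_n`, sending `σ_n (1 X; 0 1) (g 0; 0 g) σ_n⁻¹` to `ψ(Tr X)`. -/
def theta (ψ : AddChar F Circle) {n : ℕ} (h : shalika F n) : Circle :=
  ψ (Matrix.trace h.2.choose)

theorem theta_shalikaMk (ψ : AddChar F Circle) {n : ℕ} (X : Matrix (Fin n) (Fin n) F)
    (g : GL (Fin n) F) : theta ψ (toShalika X g) = ψ (Matrix.trace X) := by
  have h : shalikaMk X g ∈ shalika F n := shalikaMk_mem X g
  obtain ⟨k, hk⟩ := h.choose_spec
  exact congrArg (fun Y => ψ (Matrix.trace Y)) (shalikaMk_left_injective hk)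

/-- The character of `N_n` defined by `ψ`, namely `u ↦ ψ(u_{1,2} + ⋯ + u_{n-1,n})`. -/
def psiUnip (ψ : AddChar F Circle) {n : ℕ} (u : unip F n) : Circle :=
  ψ (∑ i : Fin n, ∑ j : Fin n, if (i : ℕ) + 1 = j then (u : GL (Fin n) F) i j else 0)

/-! ### Measures -/

section Measures

/-- The space of cosets `N \ G`. -/
abbrev LeftQuotient {G : Type*} [Group G] (N : Subgroup G) : Type _ :=
  Quotient (QuotientGroup.rightRel N)

/-- The measure `ρ` on `N \ G` is the quotient of the measure `μ` on `G` by the measure `ν` on `N`: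
one has `∫_G f(g) dμ(g) = ∫_{N \ G} ∫_N f(u g) dν(u) dρ(g)`. The inner integral does not depend on
the representative `g` of the coset when `ν` is invariant under right translations. -/
def IsQuotientMeasure {G : Type*} [Group G] [MeasurableSpace G] (N : Subgroup G)
    (μ : Measure G) (ν : Measure N) (ρ : Measure (LeftQuotient N)) : Prop :=
  ∀ f : G → ℝ≥0∞, Measurable f →
    ∫⁻ g, f g ∂μ = ∫⁻ q : LeftQuotient N, (∫⁻ u : N, f (u * q.out) ∂ν) ∂ρ

open Classical in
/-- The quotient measure of `μ` by `ν`. -/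
def quotientMeasure {G : Type*} [Group G] [MeasurableSpace G] (N : Subgroup G)
    (μ : Measure G) (ν : Measure N) : Measure (LeftQuotient N) :=
  if h : ∃ ρ, IsQuotientMeasure N μ ν ρ then h.choose else 0

variable [MeasurableSpace F] (μ : Measure F)

/-- The measure `dX = ∏ dX_{i,j}` on `M_n`. -/
def matrixMeasure (n : ℕ) : Measure (Matrix (Fin n) (Fin n) F) :=
  (Measure.pi fun _ : Fin n => Measure.pi fun _ : Fin n => μ :
    Measure (Fin n → Fin n → F))

/-- The measure `dg = |det g|⁻ⁿ ∏ dg_{i,j}` on `G_n`. -/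
def glMeasure (n : ℕ) : Measure (GL (Fin n) F) :=
  ((matrixMeasure μ n).comap Units.val).withDensity fun g => (‖g.val.det‖ₑ ^ n)⁻¹

/-- The measure `du = ∏_{i<j} du_{i,j}` on `N_n`. -/
def unipMeasure (n : ℕ) : Measure (unip F n) :=
  (Measure.pi fun _ => μ).map unipOfCoords

/-- The measure `dX = ∏_{j<i} dX_{i,j}` on `V_n`. -/
def strictLowerMeasure (n : ℕ) : Measure (strictLower F n) :=
  (Measure.pi fun _ => μ).map strictLowerOfCoords

/-- The right Haar measure on `P_n = U_n G_{n-1}` which is the product of the measures on `U_n` and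
on `G_{n-1}` (for `n = 0`, the group is trivial). -/
def mirabolicMeasure : (n : ℕ) → Measure (mirabolic F n)
  | 0 => Measure.dirac 1
  | m + 1 => ((Measure.pi fun _ : Fin m => μ).prod (glMeasure μ m)).map
      fun y => mirabolicMk y.1 y.2

/-- The quotient measure on `N_n \ G_n`. -/
def unipQuotGL (n : ℕ) : Measure (LeftQuotient (unip F n)) :=
  quotientMeasure (unip F n) (glMeasure μ n) (unipMeasure μ n)

/-- The quotient measure on `N_n \ P_n`. -/
def unipQuotMirabolic (n : ℕ) : Measure (LeftQuotient ((unip F n).subgroupOf (mirabolic F n))) :=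
  quotientMeasure ((unip F n).subgroupOf (mirabolic F n)) (mirabolicMeasure μ n)
    ((unipMeasure μ n).map (Subgroup.subgroupOfEquivOfLe (unip_le_mirabolic n)).symm)

/-- The measure on `H_n`:
`∫_{H_n} f(s) ds = ∫_{G_n} ∫_{M_n} f(σ_n (1 X; 0 1) (g 0; 0 g) σ_n⁻¹) dX dg`. -/
def shalikaMeasure (n : ℕ) : Measure (shalika F n) :=
  ((glMeasure μ n).prod (matrixMeasure μ n)).map
    fun y => toShalika y.2 y.1

variable (F) in
/-- The space `(H_n ∩ N_{2n}) \ H_n`. -/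
abbrev ShalikaQuot (n : ℕ) : Type _ :=
  LeftQuotient ((unip F (2 * n)).subgroupOf (shalika F n))

variable (F) in
/-- The space `(H_n^P ∩ N_{2n}) \ H_n^P`. -/
abbrev ShalikaPQuot (n : ℕ) : Type _ :=
  LeftQuotient ((unip F (2 * n)).subgroupOf (shalikaP F n))

/-- The measure on `(H_n ∩ N_{2n}) \ H_n`:
`∫ φ(ξ) dξ = ∫_{N_n \ G_n} ∫_{V_n} φ(σ_n (1 X; 0 1) (g 0; 0 g) σ_n⁻¹) dX dg`. The inner
integral does not depend on the representative `g` of the coset. -/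
def shalikaQuotMeasure (n : ℕ) : Measure (ShalikaQuot F n) :=
  (unipQuotGL μ n).bind fun q => (strictLowerMeasure μ n).map fun X : strictLower F n =>
    (Quotient.mk _ (toShalika (X : Matrix (Fin n) (Fin n) F) q.out) : ShalikaQuot F n)

/-- The measure on `(H_n^P ∩ N_{2n}) \ H_n^P`:
`∫ φ(ξ) dξ = ∫_{N_n \ P_n} ∫_{V_n} φ(σ_n (1 X; 0 1) (p 0; 0 p) σ_n⁻¹) dX dp`. The inner
integral does not depend on the representative `p` of the coset. -/
def shalikaPQuotMeasure (n : ℕ) : Measure (ShalikaPQuot F n) :=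
  (unipQuotMirabolic μ n).bind fun q => (strictLowerMeasure μ n).map fun X : strictLower F n =>
    (Quotient.mk _ (toShalikaP (X : Matrix (Fin n) (Fin n) F) q.out) : ShalikaPQuot F n)

/-- The function `W_f(g₁, g₂) = ∫_{N_k} f(g₁⁻¹ u g₂) ψ(u)⁻¹ du` on `G_k × G_k`. -/
def whittaker (ψ : AddChar F Circle) {k : ℕ} (f : GL (Fin k) F → ℂ) (g₁ g₂ : GL (Fin k) F) : ℂ :=
  ∫ u : unip F k, f (g₁⁻¹ * (u : GL (Fin k) F) * g₂) * (psiUnip ψ u : ℂ)⁻¹ ∂(unipMeasure μ k)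

/-- The function `(ξ_p, ξ) ↦ W_f(ξ_p, ξ) θ(ξ)⁻¹ θ(ξ_p)`. It is invariant under left translations
of each variable by `N_{2n}`, so that it can be computed on any representatives of the cosets. -/
def unfoldedIntegrand (ψ : AddChar F Circle) {n : ℕ} (f : GL (Fin (2 * n)) F → ℂ)
    (ξp : ShalikaPQuot F n) (ξ : ShalikaQuot F n) : ℂ :=
  whittaker μ ψ f (ξp.out : GL (Fin (2 * n)) F) (ξ.out : GL (Fin (2 * n)) F)
    * (theta ψ ξ.out : ℂ)⁻¹ * (theta ψ ⟨ξp.out.1, ξp.out.2.1⟩ : ℂ)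

end Measures

end

end LinearPeriod

open MeasureTheory Matrix
open scoped ENNReal

namespace LinearPeriod

noncomputable section

set_option linter.unusedSectionVars false

/-! ### The module of the absolute value -/

section Field

variable {F : Type*} [NontriviallyNormedField F] [IsUltrametricDist F] [ProperSpace F]

/-! Put H = H_n, N = N_{2n} and Ψ(g) = ∫_H f(gs) θ(s)⁻¹ ds. The left-hand side is Ψ(1), and Ψ(gs) =
θ(s)Ψ(g) for s in H. Before conjugation by σ_n every matrix is a 2 × 2 block matrix.

Unfolding. Since σ_n interlaces the two halves of the indices, N is the product of the group Ω of
matrices w = (1 0; C 1+D), with C and D strictly upper triangular, and of N ∩ H. On N ∩ H the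
characters ψ and θ agree, and ψ(w) sees only the superdiagonal of C. Inserting the definition of W_f
and gluing N ∩ H back to (N ∩ H)\H turns the inner integral into ∫_Ω Ψ(ξ_p⁻¹ w) ψ(w)⁻¹ dw
(`lintegral_unfold`, `integral_whittaker`).

Inversion. It remains to see that the integral of this over ξ_p is Ψ(1). This holds for every
function with the equivariance of Ψ under the mirabolic part of H that is Schwartz–Bruhat along Ω,
provided the integral converges (`integral_flagMeasure`). The cosets of ξ_p are represented by (1 X;
0 1) diag(b', b'), where X is strictly lower triangular and b' = (b 0; 0 1) with b lower triangular
of size n-1. The last column c of C is Fourier dual to the last row y of b, and the last column d of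
D is dual to the last row x of X. Integrating the other coordinates first is the same statement in
size n-1 for the integral of Ψ over the last columns. That integral is equivariant up to an extra
|det|⁻², so a power |det|⁻ᵉ is carried through the induction (`colIntegral_equivariant`,
`flagMeasure_succ`). Fourier inversion in (c, y) and then in (d, x) finishes the step
(`integral_colBlock`).

Convergence. Fubini requires that M(ξ_p) = ∫ |W_f(ξ_p, ξ)| dξ be integrable
(`lintegral_massIntegral_lt_top`). Use Iwasawa coordinates diag(A) x k for ξ_p, with A = (a, 1).
Conjugating small root elements through ξ_p into N, and using the invariance of f under a small
neighbourhood of 1, shows that M vanishes unless x is bounded and |A_i| ≤ R |A_{i+1}|. Rescaling Ω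
by A gives M ≤ C δ(A)² with δ(A) = ∏_{i<j} |A_i/A_j|. The integral over X gives back one factor
δ(A)⁻¹, and the modulus in the measure on N_{n-1}\G_{n-1} leaves essentially ∫ |det a| d^×a over
bounded a.

Measures. The quotient measures are obtained by choice from a characterizing identity, so a
uniqueness argument is needed before they can be computed. The Gauss decomposition of the Haar
measure then identifies them with images of the right Haar measure on lower triangular matrices
(`lintegral_glMeasure_eq_lower`, `quotientMeasure_eq_map`). -/

theorem norm_sub_le_max_norm (x y : F) : ‖x - y‖ ≤ max ‖x‖ ‖y‖ := by
  rw [sub_eq_add_neg, ← norm_neg y]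
  exact IsUltrametricDist.norm_add_le_max _ _

/-- A generator of the value group of `F` of absolute value less than `1`. -/
structure IsUniformizer (ϖ : F) : Prop where
  norm_pos : 0 < ‖ϖ‖
  norm_lt_one : ‖ϖ‖ < 1
  norm_le : ∀ x : F, ‖x‖ < 1 → ‖x‖ ≤ ‖ϖ‖

/-- In an ultrametric space the open unit ball is closed, hence compact by properness, and the norm
attains its maximum on it. -/
theorem exists_isUniformizer : ∃ ϖ : F, IsUniformizer ϖ := by
  obtain ⟨y, hy0, hy1⟩ := NormedField.exists_norm_lt_one F
  have hc : IsCompact (Metric.ball (0 : F) 1) := by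
    refine (isCompact_closedBall (0 : F) 1).of_isClosed_subset ?_ Metric.ball_subset_closedBall
    exact IsUltrametricDist.isClosed_ball 0 1
  obtain ⟨ϖ, hϖ, hmax⟩ := hc.exists_isMaxOn ⟨0, by simp⟩ continuous_norm.continuousOn
  refine ⟨ϖ, ⟨?_, by simpa using hϖ, fun x hx => hmax (by simpa using hx)⟩⟩
  exact hy0.trans_le (hmax (by simpa using hy1))

/-- If |x| lay strictly between two consecutive powers of |ϖ|, dividing x by a power of ϖ would give
an element of norm strictly between |ϖ| and 1. -/
theorem IsUniformizer.exists_zpow {ϖ : F} (h : IsUniformizer ϖ) {x : F} (hx : x ≠ 0) :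
    ∃ k : ℤ, ‖x‖ = ‖ϖ‖ ^ k := by
  have hϖ : (ϖ : F) ≠ 0 := norm_pos_iff.1 h.norm_pos
  obtain ⟨k, hk1, hk2⟩ := exists_mem_Ioc_zpow (norm_pos_iff.2 hx)
    ((one_lt_inv₀ h.norm_pos).2 h.norm_lt_one)
  refine ⟨-(k + 1), ?_⟩
  rw [_root_.inv_zpow', ← norm_zpow] at hk1 hk2
  rw [← norm_zpow]
  have hp : 0 < ‖ϖ ^ (-(k + 1))‖ := norm_pos_iff.2 (zpow_ne_zero _ hϖ)
  refine le_antisymm hk2 (not_lt.1 fun hlt => ?_)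
  have h1 : ‖x / ϖ ^ (-(k + 1))‖ < 1 := by rw [norm_div]; exact (div_lt_one hp).2 hlt
  have h2 := h.norm_le _ h1
  rw [norm_div, div_le_iff₀ hp, ← norm_mul, ← zpow_one_add₀ hϖ] at h2
  have h3 : (1 : ℤ) + -(k + 1) = -k := by ring
  rw [h3] at h2
  exact absurd hk1 (not_lt.2 h2)

variable [MeasurableSpace F] [BorelSpace F] {μ : Measure F}

/-- The measure `μ` satisfies `d(ax) = |a| dx`. -/
def HasNormScaling (μ : Measure F) : Prop :=
  ∀ a : F, a ≠ 0 → μ.map (a * ·) = ‖a‖ₑ⁻¹ • μ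

theorem exists_map_mul_eq_smul [μ.IsAddHaarMeasure] {a : F} (ha : a ≠ 0) :
    ∃ c : ℝ≥0∞, μ.map (a * ·) = c • μ := by
  have : (μ.map (a * ·)).IsAddHaarMeasure := by
    have := (AddAut.mulLeft (Units.mk0 a ha)).isAddHaarMeasure_map μ
      (continuous_const.mul continuous_id) (continuous_const.mul continuous_id)
    exact this
  exact ⟨_, Measure.isAddLeftInvariant_eq_smul (μ.map (a * ·)) μ⟩

theorem norm_preimage_mul {a : F} (ha : a ≠ 0) (r : ℝ) :
    (a * ·) ⁻¹' (Metric.closedBall (0 : F) r) = Metric.closedBall 0 (r / ‖a‖) := by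
  ext x
  simp [le_div_iff₀ (norm_pos_iff.2 ha), mul_comm]

/-- The unit ball is the disjoint union of q translates of the ball of radius |ϖ|, one for each
residue class, and |ϖ| = q⁻¹. This is where the normalization of the absolute value enters. -/
theorem measure_closedBall_uniformizer [μ.IsAddHaarMeasure] (hF : IsNormalizedAbs F) {ϖ : F}
    (h : IsUniformizer ϖ) : ‖ϖ‖ₑ * μ (Metric.closedBall 0 1) = μ (Metric.closedBall 0 ‖ϖ‖) := by
  set O := (NormedField.valuation (K := F)).valuationSubring
  have memO : ∀ x : F, x ∈ O ↔ ‖x‖ ≤ 1 := fun x => by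
    rw [Valuation.mem_valuationSubring_iff]; rfl
  have isU : ∀ x : O, IsUnit x ↔ ‖(x : F)‖ = 1 := by
    intro x
    constructor
    · rintro ⟨u, rfl⟩
      have h1 := (memO _).1 (u : O).2
      have h2 := (memO _).1 ((u⁻¹ : Oˣ) : O).2
      have h3 : ‖((u : O) : F)‖ * ‖(((u⁻¹ : Oˣ) : O) : F)‖ = 1 := by
        rw [← norm_mul, ← MulMemClass.coe_mul, Units.mul_inv]; simp
      nlinarith [norm_nonneg ((u : O) : F), norm_nonneg (((u⁻¹ : Oˣ) : O) : F)]
    · intro hx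
      have hx0 : (x : F) ≠ 0 := by rintro h0; simp [h0] at hx
      refine IsUnit.of_mul_eq_one ⟨(x : F)⁻¹, (memO _).2 (by simp [hx])⟩ ?_
      apply Subtype.ext
      simp [hx0]
  let π : O := ⟨ϖ, (memO _).2 h.norm_lt_one.le⟩
  have hlt : ∀ x : O, ¬ IsUnit x → ‖(x : F)‖ ≤ ‖ϖ‖ := fun x hx =>
    h.norm_le _ (lt_of_le_of_ne ((memO _).1 x.2) fun h1 => hx ((isU x).2 h1))
  have hirr : Irreducible π := by
    refine ⟨fun hu => h.norm_lt_one.ne ((isU π).1 hu), fun a b hab => ?_⟩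
    by_contra! hcon
    have h1 := hlt a hcon.1
    have h2 := hlt b hcon.2
    have h3 : ‖ϖ‖ = ‖(a : F)‖ * ‖(b : F)‖ := by
      rw [← norm_mul, ← MulMemClass.coe_mul, ← hab]
    nlinarith [h.norm_pos, h.norm_lt_one, norm_nonneg (a : F), norm_nonneg (b : F)]
  have hq := hF π hirr
  set k := IsLocalRing.ResidueField O
  -- An infinite residue field is excluded by the normalization itself: `Nat.card` would be `0`, and
  -- its inverse would give ‖ϖ‖ = 0.
  have hfin : Finite k := by
    by_contra hinf
    rw [not_finite_iff_infinite] at hinf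
    rw [Nat.card_eq_zero_of_infinite] at hq
    have := h.norm_pos
    simp [π] at hq
    simp [hq] at this
  have := Fintype.ofFinite k
  have hsurj := IsLocalRing.residue_surjective (R := O)
  choose s hs using hsurj
  have hres : ∀ x y : O, IsLocalRing.residue O x = IsLocalRing.residue O y ↔
      ‖(x : F) - y‖ ≤ ‖ϖ‖ := by
    intro x y
    rw [← sub_eq_zero, ← map_sub, IsLocalRing.residue_eq_zero_iff, IsLocalRing.mem_maximalIdeal,
      mem_nonunits_iff]
    refine ⟨fun hu => hlt _ hu, fun hle hu => ?_⟩
    have := (isU _).1 hu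
    rw [AddSubgroupClass.coe_sub] at this
    rw [this] at hle
    exact absurd h.norm_lt_one (not_lt.2 hle)
  have hun : Metric.closedBall (0 : F) 1 =
      ⋃ c : k, (fun x => -(s c : F) + x) ⁻¹' (Metric.closedBall 0 ‖ϖ‖) := by
    ext x
    simp only [Set.mem_iUnion, Set.mem_preimage, mem_closedBall_zero_iff]
    constructor
    · intro hx
      let x' : O := ⟨x, (memO x).2 hx⟩
      refine ⟨IsLocalRing.residue O x', ?_⟩
      have := (hres x' (s (IsLocalRing.residue O x'))).1 (hs _).symm
      rwa [neg_add_eq_sub]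
    · rintro ⟨c, hc⟩
      rw [neg_add_eq_sub] at hc
      have h1 : ‖x - s c + s c‖ ≤ max ‖x - s c‖ ‖(s c : F)‖ :=
        IsUltrametricDist.norm_add_le_max _ _
      rw [sub_add_cancel] at h1
      exact h1.trans (max_le (hc.trans h.norm_lt_one.le) ((memO _).1 (s c).2))
  have hmeas : μ (Metric.closedBall (0 : F) 1) = Nat.card k * μ (Metric.closedBall 0 ‖ϖ‖) := by
    rw [hun, measure_iUnion]
    · simp_rw [measure_preimage_add]
      rw [tsum_fintype, Finset.sum_const, Nat.card_eq_fintype_card, nsmul_eq_mul]; rfl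
    · intro c d hcd
      refine Set.disjoint_left.2 fun x hx hy => hcd ?_
      rw [← hs c, ← hs d, hres]
      simp only [Set.mem_preimage, mem_closedBall_zero_iff, neg_add_eq_sub] at hx hy
      have h1 : ‖(x - s d) - (x - s c)‖ ≤ max ‖x - s d‖ ‖x - s c‖ :=
        norm_sub_le_max_norm _ _
      rw [sub_sub_sub_cancel_left] at h1
      exact h1.trans (max_le hy hx)
    · intro c
      exact (measurable_const_add _) measurableSet_closedBall
  have hk0 : (Nat.card k : ℝ) ≠ 0 := by
    rw [Nat.cast_ne_zero]; exact Nat.card_ne_zero.2 ⟨inferInstance, hfin⟩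
  have he : ‖ϖ‖ₑ = (Nat.card k : ℝ≥0∞)⁻¹ := by
    have h1 : ‖ϖ‖ = (Nat.card k : ℝ)⁻¹ := hq
    rw [← ofReal_norm, h1, ENNReal.ofReal_inv_of_pos (by positivity), ENNReal.ofReal_natCast]
  rw [hmeas, he, ← mul_assoc, ENNReal.inv_mul_cancel, one_mul]
  · exact_mod_cast hk0
  · simp

/-- The scalars that satisfy the identity form a group. It contains the elements of norm 1, which
preserve the unit ball, and a uniformizer, and these generate the multiplicative group. -/
theorem hasNormScaling_of_isNormalizedAbs [μ.IsAddHaarMeasure] (hF : IsNormalizedAbs F) :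
    HasNormScaling μ := by
  obtain ⟨ϖ, h⟩ := exists_isUniformizer (F := F)
  have hϖ : (ϖ : F) ≠ 0 := norm_pos_iff.1 h.norm_pos
  have hball : ∀ r : ℝ, 0 < r → μ (Metric.closedBall (0 : F) r) ≠ 0 ∧
      μ (Metric.closedBall (0 : F) r) ≠ ∞ := fun r hr =>
    ⟨(Metric.measure_closedBall_pos μ _ hr).ne', (isCompact_closedBall _ _).measure_ne_top⟩
  have hm : ∀ a : F, Measurable (a * · : F → F) := fun a => measurable_const_mul a
  -- the scalars satisfying the identity are stable under products and inverses
  have hmul : ∀ a b : F, a ≠ 0 → b ≠ 0 → μ.map (a * ·) = ‖a‖ₑ⁻¹ • μ → μ.map (b * ·) = ‖b‖ₑ⁻¹ • μ →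
      μ.map ((a * b) * ·) = ‖a * b‖ₑ⁻¹ • μ := by
    intro a b ha hb h1 h2
    have : ((a * b) * · : F → F) = (a * ·) ∘ (b * ·) := by ext; simp [mul_assoc]
    rw [this, ← Measure.map_map (hm _) (hm _), h2, Measure.map_smul, h1, smul_smul, enorm_mul,
      ENNReal.mul_inv (by simp) (by simp), mul_comm]
  have hinv : ∀ a : F, a ≠ 0 → μ.map (a * ·) = ‖a‖ₑ⁻¹ • μ →
      μ.map (a⁻¹ * ·) = ‖a⁻¹‖ₑ⁻¹ • μ := by
    intro a ha h1
    have h2 := congrArg (Measure.map (a⁻¹ * ·)) h1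
    rw [Measure.map_map (hm _) (hm _), Measure.map_smul] at h2
    have : (a⁻¹ * · : F → F) ∘ (a * ·) = id := by ext; simp [ha]
    rw [this, Measure.map_id] at h2
    conv_rhs => rw [h2]
    rw [smul_smul, enorm_inv ha, inv_inv, ENNReal.mul_inv_cancel (by simpa) (by simp), one_smul]
  have hone : ∀ a : F, ‖a‖ = 1 → μ.map (a * ·) = ‖a‖ₑ⁻¹ • μ := by
    intro a ha
    have ha0 : a ≠ 0 := by rintro rfl; simp at ha
    obtain ⟨c, hc⟩ := exists_map_mul_eq_smul (μ := μ) ha0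
    have h1 := congrArg (fun ν => ν (Metric.closedBall (0 : F) 1)) hc
    simp only [Measure.smul_apply, smul_eq_mul] at h1
    rw [Measure.map_apply (hm a) measurableSet_closedBall, norm_preimage_mul ha0, ha, div_one] at h1
    have h2 : c = 1 := by
      have := (ENNReal.mul_left_inj (hball 1 one_pos).1 (hball 1 one_pos).2).1
        ((one_mul _).trans h1)
      exact this.symm
    have h3 : ‖a‖ₑ = 1 := by rw [← ofReal_norm, ha, ENNReal.ofReal_one]
    rw [hc, h2, h3, inv_one]
  have hpi : μ.map (ϖ * ·) = ‖ϖ‖ₑ⁻¹ • μ := by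
    obtain ⟨c, hc⟩ := exists_map_mul_eq_smul (μ := μ) hϖ
    have h1 := congrArg (fun ν => ν (Metric.closedBall (0 : F) ‖ϖ‖)) hc
    simp only [Measure.smul_apply, smul_eq_mul] at h1
    rw [Measure.map_apply (hm _) measurableSet_closedBall, norm_preimage_mul hϖ,
      div_self h.norm_pos.ne', ← measure_closedBall_uniformizer hF h, ← mul_assoc] at h1
    have h2 := (ENNReal.mul_left_inj (hball 1 one_pos).1 (hball 1 one_pos).2).1
      ((one_mul _).trans h1)
    rw [hc, ENNReal.eq_inv_of_mul_eq_one_left h2.symm]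
  have hpow : ∀ k : ℤ, μ.map (ϖ ^ k * ·) = ‖ϖ ^ k‖ₑ⁻¹ • μ := by
    have hn : ∀ k : ℕ, μ.map (ϖ ^ k * ·) = ‖ϖ ^ k‖ₑ⁻¹ • μ := by
      intro k
      induction k with
      | zero => exact hone _ (by simp)
      | succ k ih => rw [pow_succ]; exact hmul _ _ (pow_ne_zero _ hϖ) hϖ ih hpi
    intro k
    obtain ⟨k, rfl | rfl⟩ := k.eq_nat_or_neg
    · simpa using hn k
    · simpa using hinv _ (pow_ne_zero k hϖ) (hn k)
  intro a ha
  obtain ⟨k, hk⟩ := h.exists_zpow ha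
  have hak : ϖ ^ k ≠ 0 := zpow_ne_zero _ hϖ
  have h1 := hmul (ϖ ^ k) (a / ϖ ^ k) hak (div_ne_zero ha hak) (hpow k)
    (hone _ (by rw [norm_div, norm_zpow, hk, div_self]; exact zpow_ne_zero _ h.norm_pos.ne'))
  rwa [mul_div_cancel₀ _ hak] at h1

end Field

/-! ### Linear changes of variables -/

section Linear

variable {F : Type*} [NontriviallyNormedField F] [ProperSpace F] [MeasurableSpace F]
  [BorelSpace F] {μ : Measure F} {ι : Type*} [Fintype ι]

/-- The product of the measures `μ` on the space of functions. -/
abbrev piMeasure (μ : Measure F) (ι : Type*) [Fintype ι] : Measure (ι → F) :=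
  Measure.pi fun _ => μ

theorem measurable_mulVec {κ : Type*} [Fintype κ] (M : Matrix κ ι F) :
    Measurable (M.mulVec : (ι → F) → κ → F) := by
  refine measurable_pi_lambda _ fun i => ?_
  simp only [Matrix.mulVec, dotProduct]
  exact Finset.measurable_sum _ fun j _ => (measurable_pi_apply j).const_mul _

theorem map_diagonal_piMeasure [DecidableEq ι] [SigmaFinite μ] (hs : HasNormScaling μ) {D : ι → F}
    (h : det (diagonal D) ≠ 0) :
    ‖det (diagonal D)‖ₑ • Measure.map (diagonal D).mulVec (piMeasure μ ι) = piMeasure μ ι := by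
  refine (Measure.pi_eq fun s hs' => ?_).symm
  simp only [det_diagonal, Measure.coe_smul, smul_eq_mul, Pi.smul_apply]
  rw [Measure.map_apply (measurable_mulVec _) (MeasurableSet.univ_pi hs')]
  have : ((diagonal D).mulVec ⁻¹' Set.pi Set.univ fun i : ι => s i) =
      Set.pi Set.univ fun i : ι => (D i * ·) ⁻¹' s i := by
    ext f
    simp [Matrix.mulVec_diagonal]
  have B : ∀ i, ‖D i‖ₑ * μ ((D i * ·) ⁻¹' s i) = μ (s i) := by
    intro i
    have A : D i ≠ 0 := by
      simp only [det_diagonal, Ne] at h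
      exact Finset.prod_ne_zero_iff.1 h i (Finset.mem_univ i)
    rw [← Measure.map_apply (measurable_const_mul _) (hs' i), hs _ A, Measure.smul_apply,
      smul_eq_mul, ← mul_assoc, ENNReal.mul_inv_cancel (by simpa) (by simp), one_mul]
  have hprod : ‖∏ i, D i‖ₑ = ∏ i, ‖D i‖ₑ := by
    simp_rw [← ofReal_norm, norm_prod]
    rw [ENNReal.ofReal_prod_of_nonneg fun i _ => norm_nonneg _]
  rw [this, Measure.pi_pi, hprod, ← Finset.prod_mul_distrib]
  simp only [B]

/-- With the other coordinates fixed, a transvection is a translation of a single coordinate, so it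
suffices to compare the marginals in that coordinate. -/
theorem map_transvection_piMeasure [DecidableEq ι] [SigmaFinite μ] [μ.IsAddLeftInvariant]
    (t : TransvectionStruct ι F) :
    Measure.map t.toMatrix.mulVec (piMeasure μ ι) = piMeasure μ ι := by
  have ht : Measurable t.toMatrix.mulVec := measurable_mulVec t.toMatrix
  refine (Measure.pi_eq fun s hs => ?_).symm
  have h2s : MeasurableSet (Set.univ.pi s) := .pi Set.countable_univ fun i _ => hs i
  simp_rw [← Measure.pi_pi, ← lintegral_indicator_one h2s]
  rw [lintegral_map (measurable_one.indicator h2s) ht]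
  refine lintegral_eq_of_lmarginal_eq {t.i} ((measurable_one.indicator h2s).comp ht)
    (measurable_one.indicator h2s) ?_
  simp_rw [lmarginal_singleton]
  ext x
  cases t with | mk t_i t_j t_hij t_c =>
  have : μ.IsAddRightInvariant := inferInstance
  simp [transvection, single_mulVec, t_hij.symm, ← Function.update_add, Matrix.add_mulVec,
    lintegral_add_right_eq_self fun xᵢ => Set.indicator (Set.univ.pi s) 1 (Function.update x t_i xᵢ)]

/-- Invertible matrices are products of diagonal matrices and transvections, and both sides are
multiplicative in the matrix. -/
theorem map_mulVec_piMeasure [DecidableEq ι] [SigmaFinite μ] [μ.IsAddLeftInvariant]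
    (hs : HasNormScaling μ) {M : Matrix ι ι F} (hM : det M ≠ 0) :
    Measure.map M.mulVec (piMeasure μ ι) = ‖det M‖ₑ⁻¹ • piMeasure μ ι := by
  apply diagonal_transvection_induction_of_det_ne_zero _ M hM
  · intro D hD
    conv_rhs => rw [← map_diagonal_piMeasure hs hD]
    rw [smul_smul, ENNReal.inv_mul_cancel (by simpa using hD) (by simp), one_smul]
  · intro t
    simp [Matrix.TransvectionStruct.det, map_transvection_piMeasure]
  · intro A B _ _ IHA IHB
    have : (A * B).mulVec = A.mulVec ∘ B.mulVec := by ext; simp [Matrix.mulVec_mulVec]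
    rw [this, ← Measure.map_map (measurable_mulVec _) (measurable_mulVec _), IHB, Measure.map_smul,
      IHA, smul_smul, det_mul, enorm_mul, ENNReal.mul_inv (by simp) (by simp), mul_comm]

theorem lintegral_mulVec [DecidableEq ι] [SigmaFinite μ] [μ.IsAddLeftInvariant]
    (hs : HasNormScaling μ) {M : Matrix ι ι F} (hM : det M ≠ 0) {f : (ι → F) → ℝ≥0∞}
    (hf : Measurable f) :
    ∫⁻ x, f (M.mulVec x) ∂(piMeasure μ ι) = ‖det M‖ₑ⁻¹ * ∫⁻ x, f x ∂(piMeasure μ ι) := by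
  rw [← lintegral_map hf (measurable_mulVec M), map_mulVec_piMeasure hs hM, lintegral_smul_measure,
    smul_eq_mul]

theorem measurePreserving_mulVec [DecidableEq ι] [SigmaFinite μ] [μ.IsAddLeftInvariant]
    (hs : HasNormScaling μ) {M : Matrix ι ι F} (hM : det M = 1) :
    MeasurePreserving M.mulVec (piMeasure μ ι) (piMeasure μ ι) :=
  ⟨measurable_mulVec M, by rw [map_mulVec_piMeasure hs (by simp [hM]), hM]; simp⟩

/-- A matrix that is unitriangular for some grading of the indices has determinant `1`. -/
theorem det_eq_one_of_grading {R : Type*} [CommRing R] [DecidableEq ι] (M : Matrix ι ι R)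
    (d : ι → ℤ) (h1 : ∀ p, M p p = 1) (h : ∀ p q, p ≠ q → d q ≤ d p → M p q = 0) : M.det = 1 := by
  have hbt : M.BlockTriangular d := fun p q hpq => h p q (by rintro rfl; exact lt_irrefl _ hpq) hpq.le
  rw [hbt.det]
  refine Finset.prod_eq_one fun a _ => ?_
  have : M.toSquareBlock d a = 1 := by
    ext p q
    rw [Matrix.toSquareBlock_def, Matrix.of_apply]
    rcases eq_or_ne p q with rfl | hpq
    · simp [h1]
    · rw [Matrix.one_apply_ne hpq]
      exact h _ _ (fun h => hpq (Subtype.ext h)) (by rw [p.2, q.2])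
  rw [this, det_one]

end Linear

/-! ### Coordinates on spaces of matrices -/

section Coordinates

variable {F : Type*} [NontriviallyNormedField F]

/-- The condition that `u` is upper triangular with diagonal entries `1`. -/
def IsUpperUnip {n : ℕ} (u : Matrix (Fin n) (Fin n) F) : Prop :=
  ∀ i j, j ≤ i → u i j = (1 : Matrix (Fin n) (Fin n) F) i j

theorem IsUpperUnip.one {n : ℕ} : IsUpperUnip (1 : Matrix (Fin n) (Fin n) F) := fun _ _ _ => rfl

theorem IsUpperUnip.diag {n : ℕ} {u : Matrix (Fin n) (Fin n) F} (h : IsUpperUnip u) (i : Fin n) :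
    u i i = 1 := by rw [h i i le_rfl, Matrix.one_apply_eq]

theorem IsUpperUnip.eq_zero {n : ℕ} {u : Matrix (Fin n) (Fin n) F} (h : IsUpperUnip u)
    {i j : Fin n} (hij : j < i) : u i j = 0 := by
  rw [h i j hij.le, Matrix.one_apply_ne hij.ne']

theorem IsUpperUnip.det {n : ℕ} {u : Matrix (Fin n) (Fin n) F} (h : IsUpperUnip u) :
    u.det = 1 := by
  have h0 : u.BlockTriangular id := fun i j hij => h.eq_zero hij
  rw [Matrix.det_of_isUpperTriangular h0]
  simp [h.diag]

theorem isUpperUnip_coe {n : ℕ} (u : unip F n) : IsUpperUnip (u : GL (Fin n) F).val := u.2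

theorem isUpperUnip_inv {n : ℕ} (u : unip F n) : IsUpperUnip (u : GL (Fin n) F).inv :=
  (u⁻¹).2

/-- The coefficients of a matrix at the positions satisfying `r`. -/
def coords {n : ℕ} (r : Fin n → Fin n → Prop) (A : Matrix (Fin n) (Fin n) F) :
    {p : Fin n × Fin n // r p.1 p.2} → F := fun p => A p.1.1 p.1.2

theorem fillMatrix_coords {n : ℕ} {A B : Matrix (Fin n) (Fin n) F} {r : Fin n → Fin n → Prop}
    [DecidableRel r] (h : ∀ i j, ¬ r i j → A i j = B i j) : fillMatrix A r (coords r B) = B := by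
  ext i j
  by_cases hij : r i j
  · simp [fillMatrix, coords, hij]
  · simp [fillMatrix, hij, h]

theorem fillMatrix_eq_add {n : ℕ} {A : Matrix (Fin n) (Fin n) F} {r : Fin n → Fin n → Prop}
    [DecidableRel r] (h : ∀ i j, r i j → A i j = 0) (x : {p : Fin n × Fin n // r p.1 p.2} → F) :
    fillMatrix A r x = A + fillMatrix 0 r x := by
  ext i j
  by_cases hij : r i j
  · simp [fillMatrix, hij, h]
  · simp [fillMatrix, hij]

variable [ProperSpace F] [MeasurableSpace F] [BorelSpace F] {μ : Measure F}

/-- The function on `ι` with given restrictions to the two parts of a decomposition of `ι`. -/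
def joinFun {ι κ ρ : Type*} (e : ι ≃ κ ⊕ ρ) (p : (κ → F) × (ρ → F)) : ι → F :=
  fun i => Sum.elim p.1 p.2 (e i)

theorem measurePreserving_joinFun {ι κ ρ : Type*} [Fintype ι] [Fintype κ] [Fintype ρ]
    [SigmaFinite μ] (e : ι ≃ κ ⊕ ρ) :
    MeasurePreserving (joinFun e) ((piMeasure μ κ).prod (piMeasure μ ρ)) (piMeasure μ ι) := by
  have h1 := measurePreserving_sumPiEquivProdPi_symm (fun _ : κ ⊕ ρ => μ)
  have h2 := measurePreserving_piCongrLeft (fun _ : ι => μ) e.symm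
  have h3 := h2.comp h1
  convert h3 using 1
  ext p i
  obtain ⟨i, rfl⟩ := e.symm.surjective i
  simp only [joinFun, Equiv.apply_symm_apply, Function.comp_apply, MeasurableEquiv.coe_piCongrLeft,
    Equiv.piCongrLeft_apply_apply, MeasurableEquiv.coe_sumPiEquivProdPi_symm]
  rcases i with i | i <;> simp

theorem lintegral_joinFun {ι κ ρ : Type*} [Fintype ι] [Fintype κ] [Fintype ρ]
    [SigmaFinite μ] (e : ι ≃ κ ⊕ ρ) {f : (ι → F) → ℝ≥0∞} (hf : Measurable f) :
    ∫⁻ x, f x ∂(piMeasure μ ι) =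
      ∫⁻ y, ∫⁻ z, f (joinFun e (y, z)) ∂(piMeasure μ ρ) ∂(piMeasure μ κ) := by
  have h := measurePreserving_joinFun (μ := μ) e
  rw [← h.lintegral_comp hf, lintegral_prod]
  exact (hf.comp h.measurable).aemeasurable

theorem lintegral_diag {ι : Type*} [Fintype ι] [SigmaFinite μ] [μ.IsAddLeftInvariant]
    (hs : HasNormScaling μ) {D : ι → F} (hD : ∀ i, D i ≠ 0) {f : (ι → F) → ℝ≥0∞}
    (hf : Measurable f) :
    ∫⁻ x, f (fun i => D i * x i) ∂(piMeasure μ ι) = (∏ i, ‖D i‖ₑ)⁻¹ * ∫⁻ x, f x ∂(piMeasure μ ι) := by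
  classical
  have h := lintegral_mulVec (μ := μ) hs (M := diagonal D)
    (by rw [det_diagonal]; exact Finset.prod_ne_zero_iff.2 fun i _ => hD i) hf
  have hprod : ‖∏ i, D i‖ₑ = ∏ i, ‖D i‖ₑ := by
    simp_rw [← ofReal_norm, norm_prod]
    rw [ENNReal.ofReal_prod_of_nonneg fun i _ => norm_nonneg _]
  rw [det_diagonal, hprod] at h
  rw [← h]
  congr! 3 with x
  ext i
  rw [Matrix.mulVec_diagonal]

/-- Multiplication on the left and on the right by upper triangular unipotent matrices, followed by
restriction to the given positions, preserves the measure. -/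
theorem measurePreserving_coords_mul {n : ℕ} [SigmaFinite μ] [μ.IsAddLeftInvariant]
    (hs : HasNormScaling μ) (r : Fin n → Fin n → Prop) [DecidableRel r]
    {u w : Matrix (Fin n) (Fin n) F} (hu : IsUpperUnip u) (hw : IsUpperUnip w) :
    MeasurePreserving (fun x => coords r (u * fillMatrix 0 r x * w))
      (piMeasure μ {p : Fin n × Fin n // r p.1 p.2})
      (piMeasure μ {p : Fin n × Fin n // r p.1 p.2}) := by
  classical
  let M : Matrix {p : Fin n × Fin n // r p.1 p.2} {p : Fin n × Fin n // r p.1 p.2} F :=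
    Matrix.of fun p q => u p.1.1 q.1.1 * w q.1.2 p.1.2
  have hM : M.det = 1 := by
    -- The grading is row minus column. A non-zero coefficient at (p, q) forces the row of p to be
    -- at most that of q and the column of q at most that of p, so the degree can only go up, and
    -- stays equal only for p = q.
    refine det_eq_one_of_grading M (fun p => (p.1.1 : ℤ) - (p.1.2 : ℤ)) (fun p => ?_) ?_
    · simp [M, hu.diag, hw.diag]
    · intro p q hpq hd
      by_contra hne
      have h1 : u p.1.1 q.1.1 ≠ 0 := fun h => hne (by simp [M, h])
      have h2 : w q.1.2 p.1.2 ≠ 0 := fun h => hne (by simp [M, h])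
      have h3 : p.1.1 ≤ q.1.1 := not_lt.1 fun h => h1 (hu.eq_zero h)
      have h4 : q.1.2 ≤ p.1.2 := not_lt.1 fun h => h2 (hw.eq_zero h)
      rw [Fin.le_def] at h3 h4
      exact hpq (Subtype.ext (Prod.ext (Fin.ext (by omega)) (Fin.ext (by omega))))
  convert measurePreserving_mulVec (μ := μ) hs hM using 1
  ext x p
  let G : Fin n × Fin n → F := fun q => u p.1.1 q.1 * fillMatrix 0 r x q.1 q.2 * w q.2 p.1.2
  have h1 : coords r (u * fillMatrix 0 r x * w) p = ∑ q, G q := by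
    simp only [coords, Matrix.mul_apply, Finset.sum_mul, Fintype.sum_prod_type, G]
    exact Finset.sum_comm
  have h2 : ∑ q, G q = ∑ q ∈ Finset.univ.filter (fun q : Fin n × Fin n => r q.1 q.2), G q := by
    refine (Finset.sum_filter_of_ne fun q _ hq => ?_).symm
    by_contra hr
    exact hq (by simp [G, fillMatrix, hr])
  rw [h1, h2, Finset.sum_subtype (p := fun q : Fin n × Fin n => r q.1 q.2) _ (by simp)]
  refine Finset.sum_congr rfl fun q _ => ?_
  simp only [G, M, Matrix.of_apply, fillMatrix, q.2, dite_true]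
  ring

end Coordinates

/-! ### Measurability on general linear groups -/

section ToGL

variable {F : Type*} [NontriviallyNormedField F] {ι : Type*} [Fintype ι] [DecidableEq ι]

open Classical in
/-- The element of `GL` defined by a matrix, or `1` if the matrix is not invertible. -/
def toGL (A : Matrix ι ι F) : GL ι F :=
  if h : A.det ≠ 0 then GeneralLinearGroup.mkOfDetNeZero A h else 1

theorem toGL_val {A : Matrix ι ι F} (h : A.det ≠ 0) : (toGL A).val = A := by
  simp only [toGL, dif_pos h]
  rfl

theorem det_ne_zero (g : GL ι F) : g.val.det ≠ 0 := g.det.ne_zero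

theorem toGL_coe (g : GL ι F) : toGL g.val = g := Units.ext (toGL_val (det_ne_zero g))

theorem toGL_eq {A : Matrix ι ι F} {g : GL ι F} (h : A = g.val) : toGL A = g := by
  rw [h, toGL_coe]

end ToGL

/-! ### Borel structure and Haar measure of the general linear group -/

section GeneralLinear

variable {F : Type*} [NontriviallyNormedField F] [ProperSpace F] [MeasurableSpace F] [BorelSpace F]
variable {ι : Type*} [Fintype ι] [DecidableEq ι] {α : Type*} [MeasurableSpace α]

instance matrixBorelSpace {κ : Type*} [Fintype κ] : BorelSpace (Matrix ι κ F) :=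
  inferInstanceAs (BorelSpace (ι → κ → F))

theorem measurable_matrix_iff {κ : Type*} {f : α → Matrix ι κ F} :
    Measurable f ↔ ∀ i j, Measurable fun a => f a i j := by
  refine ⟨fun h i j => (measurable_pi_apply j).comp ((measurable_pi_apply i).comp h), fun h => ?_⟩
  exact measurable_pi_lambda _ fun i => measurable_pi_lambda _ fun j => h i j

theorem measurable_matrix_apply {κ : Type*} {f : α → Matrix ι κ F} (h : Measurable f) (i : ι)
    (j : κ) : Measurable fun a => f a i j := measurable_matrix_iff.1 h i j

theorem measurable_matrix_mul {κ ρ : Type*} [Fintype κ] {f : α → Matrix ι κ F}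
    {g : α → Matrix κ ρ F} (hf : Measurable f) (hg : Measurable g) :
    Measurable fun a => f a * g a := by
  refine measurable_matrix_iff.2 fun i j => ?_
  simp only [Matrix.mul_apply]
  exact Finset.measurable_sum _ fun k _ =>
    (measurable_matrix_apply hf i k).mul (measurable_pi_apply j |>.comp ((measurable_pi_apply k).comp hg))

theorem measurable_det {f : α → Matrix ι ι F} (hf : Measurable f) :
    Measurable fun a => (f a).det := by
  have : Continuous fun A : Matrix ι ι F => A.det := continuous_id.matrix_det
  exact this.measurable.comp hf

theorem measurable_gl_iff {f : α → GL ι F} :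
    Measurable f ↔ ∀ i j, Measurable fun a => (f a).val i j := by
  rw [← measurable_matrix_iff]
  exact measurable_comap_iff

theorem measurable_gl_val {f : α → GL ι F} (hf : Measurable f) : Measurable fun a => (f a).val :=
  measurable_comap_iff.1 hf

/-- The inverse is the adjugate divided by the determinant, hence continuous in the coefficients at
invertible matrices. The topology of units is therefore the one induced from matrices, which is what
makes the induced σ-algebra the Borel one. -/
theorem isEmbedding_gl_val : Topology.IsEmbedding (Units.val : GL ι F → Matrix ι ι F) := by
  refine Units.isEmbedding_val_mk' (f := fun A => A⁻¹) ?_ fun u => (Matrix.coe_units_inv u).symm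
  intro A hA
  refine ContinuousAt.continuousWithinAt ?_
  have hd : A.det ≠ 0 := by
    have : IsUnit A := hA
    exact ((Matrix.isUnit_iff_isUnit_det A).1 this).ne_zero
  simp only [Matrix.inv_def, Ring.inverse_eq_inv']
  exact ((continuous_id.matrix_det.continuousAt).inv₀ hd).smul
    continuous_id.matrix_adjugate.continuousAt

instance glBorelSpace : BorelSpace (GL ι F) := by
  constructor
  rw [isEmbedding_gl_val.eq_induced, borel_comap, ← BorelSpace.measurable_eq (α := Matrix ι ι F)]
  rfl

instance glMeasurableMul₂ : MeasurableMul₂ (GL ι F) := by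
  refine ⟨measurable_comap_iff.2 ?_⟩
  exact measurable_matrix_mul (measurable_gl_val measurable_fst) (measurable_gl_val measurable_snd)

instance glMeasurableInv : MeasurableInv (GL ι F) :=
  ⟨(continuous_inv : Continuous fun g : GL ι F => g⁻¹).measurable⟩

theorem measurableSet_det_ne_zero : MeasurableSet {A : Matrix ι ι F | A.det ≠ 0} :=
  (measurable_det measurable_id) (measurableSet_singleton (0 : F)).compl

open Classical in
theorem measurable_toGL : Measurable (toGL : Matrix ι ι F → GL ι F) := by
  refine measurable_comap_iff.2 ?_
  have : (Units.val ∘ toGL : Matrix ι ι F → Matrix ι ι F) =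
      fun A => if A.det ≠ 0 then A else 1 := by
    ext1 A
    by_cases h : A.det = 0
    · simp [toGL, h]
    · simp [h, toGL_val]
  rw [this]
  exact Measurable.ite measurableSet_det_ne_zero measurable_id measurable_const

theorem range_gl_val : Set.range (Units.val : GL ι F → Matrix ι ι F) = {A | A.det ≠ 0} := by
  ext A
  exact ⟨by rintro ⟨g, rfl⟩; exact det_ne_zero g, fun h => ⟨toGL A, toGL_val h⟩⟩

theorem measurableEmbedding_gl_val : MeasurableEmbedding (Units.val : GL ι F → Matrix ι ι F) := by
  refine MeasurableEmbedding.of_measurable_inverse (comap_measurable _) ?_ measurable_toGL toGL_coe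
  rw [range_gl_val]
  exact measurableSet_det_ne_zero

variable {μ : Measure F}

theorem lintegral_glMeasure {n : ℕ} {f : GL (Fin n) F → ℝ≥0∞} (hf : Measurable f) :
    ∫⁻ g, f g ∂(glMeasure μ n) =
      ∫⁻ A in {A | A.det ≠ 0}, (‖A.det‖ₑ ^ n)⁻¹ * f (toGL A) ∂(matrixMeasure μ n) := by
  have hd : Measurable fun A : Matrix (Fin n) (Fin n) F => (‖A.det‖ₑ ^ n)⁻¹ :=
    ((measurable_det measurable_id).enorm.pow_const n).inv
  have hd' : Measurable fun g : GL (Fin n) F => (‖g.val.det‖ₑ ^ n)⁻¹ := hd.comp (comap_measurable _)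
  rw [glMeasure, lintegral_withDensity_eq_lintegral_mul _ hd' hf,
    ← range_gl_val, ← measurableEmbedding_gl_val.map_comap,
    measurableEmbedding_gl_val.lintegral_map]
  simp [toGL_coe]

instance sigmaFinite_matrixMeasure [SigmaFinite μ] (n : ℕ) : SigmaFinite (matrixMeasure μ n) :=
  inferInstanceAs (SigmaFinite (Measure.pi fun _ : Fin n => Measure.pi fun _ : Fin n => μ))

/-- As the image of a measure on the space of matrices, the Haar measure is visibly s-finite, as
needed for Fubini. -/
theorem glMeasure_eq_map (n : ℕ) : glMeasure μ n =
    (((matrixMeasure μ n).restrict {A | A.det ≠ 0}).withDensity fun A => (‖A.det‖ₑ ^ n)⁻¹).map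
      toGL := by
  have hd : Measurable fun A : Matrix (Fin n) (Fin n) F => (‖A.det‖ₑ ^ n)⁻¹ :=
    ((measurable_det measurable_id).enorm.pow_const n).inv
  refine Measure.ext_of_lintegral _ fun f hf => ?_
  have hf' : Measurable fun A => f (toGL A) := hf.comp measurable_toGL
  rw [lintegral_glMeasure hf, lintegral_map hf measurable_toGL,
    lintegral_withDensity_eq_lintegral_mul _ hd hf']
  rfl

instance sFinite_glMeasure [SigmaFinite μ] (n : ℕ) : SFinite (glMeasure μ n) := by
  rw [glMeasure_eq_map]
  infer_instance

theorem measurePreserving_uncurry [SigmaFinite μ] (n : ℕ) :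
    MeasurePreserving (fun (A : Matrix (Fin n) (Fin n) F) (p : Fin n × Fin n) => A p.1 p.2)
      (matrixMeasure μ n) (piMeasure μ (Fin n × Fin n)) := by
  have hm : Measurable fun (A : Matrix (Fin n) (Fin n) F) (p : Fin n × Fin n) => A p.1 p.2 :=
    measurable_pi_lambda _ fun p => measurable_matrix_apply measurable_id p.1 p.2
  refine ⟨hm, (Measure.pi_eq fun s hs => ?_).symm⟩
  rw [Measure.map_apply hm (.pi Set.countable_univ fun i _ => hs i)]
  have h1 : (fun (A : Fin n → Fin n → F) (p : Fin n × Fin n) => A p.1 p.2) ⁻¹'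
      (Set.univ.pi s) = Set.univ.pi fun i => Set.univ.pi fun j => s (i, j) := by
    ext A
    simp
  have h2 : (Measure.pi fun _ : Fin n => Measure.pi fun _ : Fin n => μ)
      (Set.univ.pi fun i => Set.univ.pi fun j => s (i, j)) = ∏ i, μ (s i) := by
    simp_rw [Measure.pi_pi]
    rw [Fintype.prod_prod_type]
  rw [← h2, ← h1]
  rfl

theorem measurePreserving_matrixOf [SigmaFinite μ] (n : ℕ) :
    MeasurePreserving (fun x : Fin n × Fin n → F => (Matrix.of fun i j => x (i, j)))
      (piMeasure μ (Fin n × Fin n)) (matrixMeasure μ n) := by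
  have hm : Measurable fun x : Fin n × Fin n → F => (Matrix.of fun i j => x (i, j)) :=
    measurable_matrix_iff.2 fun i j => measurable_pi_apply (i, j)
  refine ⟨hm, ?_⟩
  rw [← (measurePreserving_uncurry (μ := μ) n).map_eq, Measure.map_map hm
    (measurePreserving_uncurry (μ := μ) n).measurable]
  exact Measure.map_id

variable [SigmaFinite μ] [μ.IsAddLeftInvariant]

/-- On the n² coordinates the map A ↦ gAh is the Kronecker product of g and hᵀ, whose determinant is
det(g)ⁿ det(h)ⁿ. -/
theorem lintegral_matrixMeasure_mul (hs : HasNormScaling μ) {n : ℕ} (g h : GL (Fin n) F)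
    {f : Matrix (Fin n) (Fin n) F → ℝ≥0∞} (hf : Measurable f) :
    ∫⁻ A, f (g.val * A * h.val) ∂(matrixMeasure μ n) =
      (‖g.val.det‖ₑ ^ n * ‖h.val.det‖ₑ ^ n)⁻¹ * ∫⁻ A, f A ∂(matrixMeasure μ n) := by
  have hU := measurePreserving_matrixOf (μ := μ) n
  have hm : Measurable fun A : Matrix (Fin n) (Fin n) F => g.val * A * h.val :=
    measurable_matrix_mul (measurable_matrix_mul measurable_const measurable_id) measurable_const
  have hf' : Measurable fun A => f (g.val * A * h.val) := hf.comp hm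
  rw [← hU.lintegral_comp hf, ← hU.lintegral_comp hf']
  have hdet : (Matrix.kroneckerMap (fun x y => x * y) g.val h.valᵀ).det = g.val.det ^ n * h.val.det ^ n := by
    rw [Matrix.det_kronecker]; simp
  have hdet0 : (Matrix.kroneckerMap (fun x y => x * y) g.val h.valᵀ).det ≠ 0 := by
    rw [hdet]; exact mul_ne_zero (pow_ne_zero _ (det_ne_zero g)) (pow_ne_zero _ (det_ne_zero h))
  have := lintegral_mulVec (μ := μ) hs hdet0 (hf.comp hU.measurable)
  rw [hdet, enorm_mul, enorm_pow, enorm_pow] at this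
  simp only [Function.comp_def] at this ⊢
  rw [← this]
  congr! 3 with x
  ext i j
  simp only [Matrix.mul_apply, Matrix.of_apply, Matrix.mulVec, dotProduct, Finset.sum_mul,
    Matrix.kroneckerMap_apply, Fintype.sum_prod_type, Matrix.transpose_apply]
  rw [Finset.sum_comm]
  refine Finset.sum_congr rfl fun k _ => Finset.sum_congr rfl fun l _ => ?_
  ring

theorem lintegral_matrixMeasure_conj (hs : HasNormScaling μ) {n : ℕ} (g : GL (Fin n) F)
    {f : Matrix (Fin n) (Fin n) F → ℝ≥0∞} (hf : Measurable f) :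
    ∫⁻ A, f (g.val * A * g.inv) ∂(matrixMeasure μ n) = ∫⁻ A, f A ∂(matrixMeasure μ n) := by
  have h := lintegral_matrixMeasure_mul hs g g⁻¹ hf
  have h1 : ‖g.val.det‖ₑ ^ n * ‖(g⁻¹).val.det‖ₑ ^ n = 1 := by
    rw [← mul_pow, ← enorm_mul, ← Matrix.det_mul, ← Units.val_mul, mul_inv_cancel]
    simp
  rw [h1, inv_one, one_mul] at h
  exact h

/-- The Jacobian |det g₀|ⁿ of left multiplication is absorbed by the density |det|⁻ⁿ. -/
theorem lintegral_glMeasure_mul_left (hs : HasNormScaling μ) {n : ℕ} (g₀ : GL (Fin n) F)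
    {f : GL (Fin n) F → ℝ≥0∞} (hf : Measurable f) :
    ∫⁻ g, f (g₀ * g) ∂(glMeasure μ n) = ∫⁻ g, f g ∂(glMeasure μ n) := by
  have hd : Measurable fun A : Matrix (Fin n) (Fin n) F => (‖A.det‖ₑ ^ n)⁻¹ :=
    ((measurable_det measurable_id).enorm.pow_const n).inv
  have hm : Measurable fun A : Matrix (Fin n) (Fin n) F =>
      Set.indicator {A | A.det ≠ 0} (fun A => (‖A.det‖ₑ ^ n)⁻¹ * f (toGL A)) A :=
    (hd.mul (hf.comp measurable_toGL)).indicator measurableSet_det_ne_zero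
  have hf' : Measurable fun g => f (g₀ * g) := hf.comp (measurable_const_mul g₀)
  rw [lintegral_glMeasure hf, lintegral_glMeasure hf',
    ← lintegral_indicator measurableSet_det_ne_zero, ← lintegral_indicator measurableSet_det_ne_zero]
  have h := lintegral_matrixMeasure_mul hs g₀ 1 hm
  have h0 : ‖g₀.val.det‖ₑ ^ n ≠ 0 := pow_ne_zero _ (by simpa using det_ne_zero g₀)
  have h1 : ‖g₀.val.det‖ₑ ^ n ≠ ∞ := ENNReal.pow_ne_top (by simp)
  rw [Units.val_one, Matrix.det_one, enorm_one, one_pow, mul_one] at h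
  have h2 := congrArg (fun t => ‖g₀.val.det‖ₑ ^ n * t) h
  simp only [← mul_assoc, ENNReal.mul_inv_cancel h0 h1, one_mul] at h2
  rw [← h2, ← lintegral_const_mul _ (by
    refine hm.comp ?_
    exact measurable_matrix_mul (measurable_matrix_mul measurable_const measurable_id)
      measurable_const)]
  refine lintegral_congr fun A => ?_
  by_cases hA : A.det = 0
  · simp [hA, Set.indicator]
  · have hA' : (g₀.val * A).det ≠ 0 := by
      rw [Matrix.det_mul]; exact mul_ne_zero (det_ne_zero g₀) hA
    rw [Matrix.mul_one, Set.indicator_of_mem (show A ∈ {A | A.det ≠ 0} from hA),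
      Set.indicator_of_mem (show g₀.val * A ∈ {A | A.det ≠ 0} from hA'), Matrix.det_mul, enorm_mul,
      mul_pow, ENNReal.mul_inv (Or.inl h0) (Or.inl h1), ← mul_assoc, ← mul_assoc,
      ENNReal.mul_inv_cancel h0 h1, one_mul]
    congr 2
    exact (toGL_eq (by rw [Units.val_mul, toGL_val hA])).symm

end GeneralLinear

/-! ### Bordered matrices -/

section Border

variable {F : Type*} [NontriviallyNormedField F]

/-- The matrix `(A c; r t)`. -/
def border {m : ℕ} (A : Matrix (Fin m) (Fin m) F) (c r : Fin m → F) (t : F) :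
    Matrix (Fin (m + 1)) (Fin (m + 1)) F :=
  Matrix.reindex finSumFinEquiv finSumFinEquiv
    (Matrix.fromBlocks A (Matrix.of fun i (_ : Fin 1) => c i) (Matrix.of fun (_ : Fin 1) j => r j)
      (Matrix.of fun (_ _ : Fin 1) => t))

@[simp] theorem border_castSucc_castSucc {m : ℕ} (A : Matrix (Fin m) (Fin m) F) (c r : Fin m → F)
    (t : F) (i j : Fin m) : border A c r t i.castSucc j.castSucc = A i j := by
  simp [border]

@[simp] theorem border_castSucc_last {m : ℕ} (A : Matrix (Fin m) (Fin m) F) (c r : Fin m → F)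
    (t : F) (i : Fin m) : border A c r t i.castSucc (Fin.last m) = c i := by
  simp [border]

@[simp] theorem border_last_castSucc {m : ℕ} (A : Matrix (Fin m) (Fin m) F) (c r : Fin m → F)
    (t : F) (j : Fin m) : border A c r t (Fin.last m) j.castSucc = r j := by
  simp [border]

@[simp] theorem border_last_last {m : ℕ} (A : Matrix (Fin m) (Fin m) F) (c r : Fin m → F)
    (t : F) : border A c r t (Fin.last m) (Fin.last m) = t := by
  simp [border]

theorem border_ext {m : ℕ} {A B : Matrix (Fin (m + 1)) (Fin (m + 1)) F}
    (h1 : ∀ i j : Fin m, A i.castSucc j.castSucc = B i.castSucc j.castSucc)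
    (h2 : ∀ i : Fin m, A i.castSucc (Fin.last m) = B i.castSucc (Fin.last m))
    (h3 : ∀ j : Fin m, A (Fin.last m) j.castSucc = B (Fin.last m) j.castSucc)
    (h4 : A (Fin.last m) (Fin.last m) = B (Fin.last m) (Fin.last m)) : A = B := by
  ext i j
  refine Fin.lastCases ?_ (fun i => ?_) i <;> refine Fin.lastCases ?_ (fun j => ?_) j
  exacts [h4, h3 j, h2 i, h1 i j]

theorem border_self {m : ℕ} (A : Matrix (Fin (m + 1)) (Fin (m + 1)) F) :
    border (Matrix.of fun i j => A (Fin.castSucc i) (Fin.castSucc j))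
      (fun i => A i.castSucc (Fin.last m)) (fun j => A (Fin.last m) j.castSucc)
      (A (Fin.last m) (Fin.last m)) = A := by
  apply border_ext <;> simp

theorem border_mul {m : ℕ} (A A' : Matrix (Fin m) (Fin m) F) (c r c' r' : Fin m → F) (t t' : F) :
    border A c r t * border A' c' r' t' =
      border (A * A' + vecMulVec c r') (A *ᵥ c' + t' • c) (r ᵥ* A' + t • r') (r ⬝ᵥ c' + t * t') := by
  apply border_ext <;> intros <;>
    simp [Matrix.mul_apply, Fin.sum_univ_castSucc, vecMulVec_apply, Matrix.mulVec, Matrix.vecMul,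
      dotProduct, mul_comm]

theorem border_add {m : ℕ} (A A' : Matrix (Fin m) (Fin m) F) (c r c' r' : Fin m → F) (t t' : F) :
    border A c r t + border A' c' r' t' = border (A + A') (c + c') (r + r') (t + t') := by
  apply border_ext <;> intros <;> simp

theorem border_neg {m : ℕ} (A : Matrix (Fin m) (Fin m) F) (c r : Fin m → F) (t : F) :
    -border A c r t = border (-A) (-c) (-r) (-t) := by
  apply border_ext <;> intros <;> simp

theorem border_one {m : ℕ} : border (1 : Matrix (Fin m) (Fin m) F) 0 0 1 = 1 := by
  apply border_ext <;> intros <;> simp [Matrix.one_apply, Fin.ext_iff] <;> omega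

theorem border_zero {m : ℕ} : border (0 : Matrix (Fin m) (Fin m) F) 0 0 0 = 0 := by
  apply border_ext <;> intros <;> simp

theorem trace_border {m : ℕ} (A : Matrix (Fin m) (Fin m) F) (c r : Fin m → F) (t : F) :
    (border A c r t).trace = A.trace + t := by
  simp [Matrix.trace, Fin.sum_univ_castSucc]

theorem det_border_row_zero {m : ℕ} (A : Matrix (Fin m) (Fin m) F) (c : Fin m → F) (t : F) :
    (border A c 0 t).det = A.det * t := by
  have : (Matrix.of fun (_ : Fin 1) j => (0 : Fin m → F) j) = 0 := rfl
  rw [border, Matrix.det_reindex_self, this, Matrix.det_fromBlocks_zero₂₁]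
  simp

theorem det_border_col_zero {m : ℕ} (A : Matrix (Fin m) (Fin m) F) (r : Fin m → F) (t : F) :
    (border A 0 r t).det = A.det * t := by
  have : (Matrix.of fun i (_ : Fin 1) => (0 : Fin m → F) i) = 0 := rfl
  rw [border, Matrix.det_reindex_self, this, Matrix.det_fromBlocks_zero₁₂]
  simp

theorem mirabolicMk_val {m : ℕ} (x : Fin m → F) (g : GL (Fin m) F) :
    (mirabolicMk x g : GL (Fin (m + 1)) F).val = border g.val x 0 1 := by
  change Matrix.reindex finSumFinEquiv finSumFinEquiv _ = _
  rw [border]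
  congr 2
  ext i j
  fin_cases i; fin_cases j; rfl

/-- The embedding `g ↦ (g 0; 0 1)`. -/
def glEmb {m : ℕ} (g : GL (Fin m) F) : GL (Fin (m + 1)) F := mirabolicMk 0 g

theorem glEmb_val {m : ℕ} (g : GL (Fin m) F) : (glEmb g).val = border g.val 0 0 1 :=
  mirabolicMk_val 0 g

theorem glEmb_mul {m : ℕ} (g h : GL (Fin m) F) : glEmb (g * h) = glEmb g * glEmb h := by
  apply Units.ext
  rw [Units.val_mul, glEmb_val, glEmb_val, glEmb_val, border_mul]
  congr 1 <;> (try ext) <;> simp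

theorem glEmb_one {m : ℕ} : glEmb (1 : GL (Fin m) F) = 1 := by
  apply Units.ext
  rw [glEmb_val, Units.val_one, border_one, Units.val_one]

theorem glEmb_inv {m : ℕ} (g : GL (Fin m) F) : glEmb g⁻¹ = (glEmb g)⁻¹ := by
  rw [eq_inv_iff_mul_eq_one, ← glEmb_mul, inv_mul_cancel, glEmb_one]

theorem det_glEmb {m : ℕ} (g : GL (Fin m) F) : (glEmb g).val.det = g.val.det := by
  rw [glEmb_val, det_border_row_zero, mul_one]

theorem mirabolicMk_mul {m : ℕ} (x : Fin m → F) (g h : GL (Fin m) F) :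
    (mirabolicMk x (g * h) : GL (Fin (m + 1)) F) = mirabolicMk x g * glEmb h := by
  apply Units.ext
  rw [Units.val_mul, glEmb_val, mirabolicMk_val, mirabolicMk_val, border_mul]
  congr 1 <;> (try ext) <;> simp

/-- The identity matrix with last row replaced by `y` (when it is invertible). -/
def rowGL {m : ℕ} (y : Fin (m + 1) → F) : GL (Fin (m + 1)) F :=
  toGL (border 1 0 (fun i => y i.castSucc) (y (Fin.last m)))

theorem rowGL_val {m : ℕ} {y : Fin (m + 1) → F} (hy : y (Fin.last m) ≠ 0) :
    (rowGL y).val = border 1 0 (fun i => y i.castSucc) (y (Fin.last m)) :=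
  toGL_val (by rw [det_border_col_zero]; simpa using hy)

theorem det_rowGL {m : ℕ} {y : Fin (m + 1) → F} (hy : y (Fin.last m) ≠ 0) :
    (rowGL y).val.det = y (Fin.last m) := by
  rw [rowGL_val hy, det_border_col_zero]; simp

/-- The positions above the diagonal, divided into those not in the last column and those in the
last column. -/
def upperSplit (m : ℕ) : {p : Fin (m + 1) × Fin (m + 1) // p.1 < p.2} ≃
    {p : Fin m × Fin m // p.1 < p.2} ⊕ Fin m :=
  (Equiv.ofBijective (Sum.elim
    (fun p => ⟨(p.1.1.castSucc, p.1.2.castSucc), Fin.castSucc_lt_castSucc_iff.2 p.2⟩)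
    (fun i => ⟨(i.castSucc, Fin.last m), Fin.castSucc_lt_last i⟩)) (by
      constructor
      · rintro (⟨⟨i, j⟩, h⟩ | i) (⟨⟨i', j'⟩, h'⟩ | i') <;> simp [Fin.ext_iff] <;> omega
      · rintro ⟨⟨i, j⟩, h⟩
        induction i using Fin.lastCases with
        | last => exact absurd h (not_lt.2 (Fin.le_last j))
        | cast i =>
          induction j using Fin.lastCases with
          | last => exact ⟨Sum.inr i, rfl⟩
          | cast j => exact ⟨Sum.inl ⟨(i, j), Fin.castSucc_lt_castSucc_iff.1 h⟩, rfl⟩)).symm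

/-- The positions below the diagonal, divided into those not in the last row and those in the
last row. -/
def lowerSplit (m : ℕ) : {p : Fin (m + 1) × Fin (m + 1) // p.2 < p.1} ≃
    {p : Fin m × Fin m // p.2 < p.1} ⊕ Fin m :=
  (Equiv.ofBijective (Sum.elim
    (fun p => ⟨(p.1.1.castSucc, p.1.2.castSucc), Fin.castSucc_lt_castSucc_iff.2 p.2⟩)
    (fun i => ⟨(Fin.last m, i.castSucc), Fin.castSucc_lt_last i⟩)) (by
      constructor
      · rintro (⟨⟨i, j⟩, h⟩ | i) (⟨⟨i', j'⟩, h'⟩ | i') <;> simp [Fin.ext_iff] <;> omega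
      · rintro ⟨⟨i, j⟩, h⟩
        induction j using Fin.lastCases with
        | last => exact absurd h (not_lt.2 (Fin.le_last i))
        | cast j =>
          induction i using Fin.lastCases with
          | last => exact ⟨Sum.inr j, rfl⟩
          | cast i => exact ⟨Sum.inl ⟨(i, j), Fin.castSucc_lt_castSucc_iff.1 h⟩, rfl⟩)).symm

/-- All positions, divided into those in the last row, those in the rest of the last column, and
the other ones. -/
def fullSplit (m : ℕ) : Fin (m + 1) × Fin (m + 1) ≃ Fin (m + 1) ⊕ (Fin m ⊕ Fin m × Fin m) :=
  (Equiv.ofBijective (Sum.elim (fun j => (Fin.last m, j))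
    (Sum.elim (fun i => (i.castSucc, Fin.last m)) fun p => (p.1.castSucc, p.2.castSucc))) (by
      constructor
      · rintro (i | i | ⟨i, j⟩) (i' | i' | ⟨i', j'⟩) <;> simp [Fin.ext_iff] <;> omega
      · rintro ⟨i, j⟩
        induction i using Fin.lastCases with
        | last => exact ⟨Sum.inl j, rfl⟩
        | cast i =>
          induction j using Fin.lastCases with
          | last => exact ⟨Sum.inr (Sum.inl i), rfl⟩
          | cast j => exact ⟨Sum.inr (Sum.inr (i, j)), rfl⟩)).symm

theorem joinFun_apply_of_symm {ι κ ρ : Type*} (e : ι ≃ κ ⊕ ρ) (p : (κ → F) × (ρ → F)) {i : ι}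
    {s : κ ⊕ ρ} (h : e.symm s = i) : joinFun e p i = Sum.elim p.1 p.2 s := by
  rw [joinFun, ← h, Equiv.apply_symm_apply]

theorem fillMatrix_joinFun_upper {m : ℕ} (A : Matrix (Fin m) (Fin m) F) (t : F)
    (y : {p : Fin m × Fin m // p.1 < p.2} → F) (z : Fin m → F) :
    fillMatrix (border A 0 0 t) (· < ·) (joinFun (upperSplit m) (y, z)) =
      border (fillMatrix A (· < ·) y) z 0 t := by
  apply border_ext
  · intro i j
    by_cases h : i < j
    · simp only [fillMatrix, Matrix.of_apply, Fin.castSucc_lt_castSucc_iff, h, dite_true,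
        border_castSucc_castSucc]
      exact joinFun_apply_of_symm (upperSplit m) _ (s := Sum.inl ⟨(i, j), h⟩) rfl
    · simp [fillMatrix, h]
  · intro i
    simp only [fillMatrix, Matrix.of_apply, Fin.castSucc_lt_last, dite_true, border_castSucc_last]
    exact joinFun_apply_of_symm _ _ (s := Sum.inr i) rfl
  · intro i
    simp [fillMatrix, (Fin.castSucc_lt_last i).le]
  · simp [fillMatrix]

theorem fillMatrix_joinFun_lower {m : ℕ} (A : Matrix (Fin m) (Fin m) F) (t : F)
    (y : {p : Fin m × Fin m // p.2 < p.1} → F) (z : Fin m → F) :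
    fillMatrix (border A 0 0 t) (fun i j => j < i) (joinFun (lowerSplit m) (y, z)) =
      border (fillMatrix A (fun i j => j < i) y) 0 z t := by
  apply border_ext
  · intro i j
    by_cases h : j < i
    · simp only [fillMatrix, Matrix.of_apply, Fin.castSucc_lt_castSucc_iff, h, dite_true,
        border_castSucc_castSucc]
      exact joinFun_apply_of_symm (lowerSplit m) _ (s := Sum.inl ⟨(i, j), h⟩) rfl
    · simp [fillMatrix, h]
  · intro i
    simp [fillMatrix, (Fin.castSucc_lt_last i).le]
  · intro i
    simp only [fillMatrix, Matrix.of_apply, Fin.castSucc_lt_last, dite_true, border_last_castSucc]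
    exact joinFun_apply_of_symm _ _ (s := Sum.inr i) rfl
  · simp [fillMatrix]

theorem of_joinFun_full {m : ℕ} (y : Fin (m + 1) → F) (c : Fin m → F) (x : Fin m × Fin m → F) :
    (Matrix.of fun i j => joinFun (fullSplit m)
      (y, Sum.elim c x) (i, j)) =
      border (Matrix.of fun i j => x (i, j)) c (fun j => y j.castSucc) (y (Fin.last m)) := by
  apply border_ext
  · intro i j
    rw [border_castSucc_castSucc]
    exact joinFun_apply_of_symm _ _ (s := Sum.inr (Sum.inr (i, j))) rfl
  · intro i
    rw [border_castSucc_last]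
    exact joinFun_apply_of_symm _ _ (s := Sum.inr (Sum.inl i)) rfl
  · intro j
    rw [border_last_castSucc]
    exact joinFun_apply_of_symm _ _ (s := Sum.inl j.castSucc) rfl
  · rw [border_last_last]
    exact joinFun_apply_of_symm _ _ (s := Sum.inl (Fin.last m)) rfl

theorem unipOfCoords_val {n : ℕ} (x : {p : Fin n × Fin n // p.1 < p.2} → F) :
    (unipOfCoords x : GL (Fin n) F).val = fillMatrix 1 (· < ·) x := rfl

theorem unipOfCoords_joinFun {m : ℕ} (y : {p : Fin m × Fin m // p.1 < p.2} → F) (z : Fin m → F) :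
    (unipOfCoords (joinFun (upperSplit m) (y, z)) : GL (Fin (m + 1)) F) =
      mirabolicMk z (unipOfCoords y : GL (Fin m) F) := by
  apply Units.ext
  rw [mirabolicMk_val, unipOfCoords_val, unipOfCoords_val, ← fillMatrix_joinFun_upper, border_one]

theorem unipOfCoords_coords {n : ℕ} (u : unip F n) :
    unipOfCoords (coords (· < ·) (u : GL (Fin n) F).val) = u := by
  apply Subtype.ext; apply Units.ext
  rw [unipOfCoords_val]
  exact fillMatrix_coords fun i j hij => (u.2 i j (not_lt.1 hij)).symm

end Border

/-! ### Measurability of bordered matrices and of matrix coordinates -/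

section BorderMeasure

variable {F : Type*} [NontriviallyNormedField F] [ProperSpace F] [MeasurableSpace F] [BorelSpace F]
  {α : Type*} [MeasurableSpace α]

theorem measurable_border {m : ℕ} {A : α → Matrix (Fin m) (Fin m) F} {c r : α → Fin m → F}
    {t : α → F} (hA : Measurable A) (hc : Measurable c) (hr : Measurable r) (ht : Measurable t) :
    Measurable fun a => border (A a) (c a) (r a) (t a) := by
  refine measurable_matrix_iff.2 fun i j => ?_
  refine Fin.lastCases ?_ (fun i => ?_) i <;> refine Fin.lastCases ?_ (fun j => ?_) j
  · simpa using ht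
  · simpa [Function.comp_def] using (measurable_pi_apply j).comp hr
  · simpa [Function.comp_def] using (measurable_pi_apply i).comp hc
  · simpa using measurable_matrix_apply hA i j

theorem measurable_mirabolicMk {m : ℕ} {x : α → Fin m → F} {g : α → GL (Fin m) F}
    (hx : Measurable x) (hg : Measurable g) : Measurable fun a => mirabolicMk (x a) (g a) := by
  refine Measurable.subtype_mk (measurable_comap_iff.2 ?_)
  have : (Units.val ∘ fun a => (mirabolicMk (x a) (g a) : GL (Fin (m + 1)) F)) =
      fun a => border (g a).val (x a) 0 1 := by
    ext1 a
    exact mirabolicMk_val _ _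
  exact this ▸ measurable_border (measurable_gl_val hg) hx measurable_const measurable_const

theorem measurable_glEmb {m : ℕ} {g : α → GL (Fin m) F} (hg : Measurable g) :
    Measurable fun a => glEmb (g a) :=
  (measurable_mirabolicMk measurable_const hg).subtype_val

theorem measurable_rowGL {m : ℕ} : Measurable (rowGL : (Fin (m + 1) → F) → GL (Fin (m + 1)) F) := by
  refine measurable_toGL.comp (measurable_border measurable_const measurable_const ?_
    (measurable_pi_apply _))
  exact measurable_pi_lambda _ fun i => measurable_pi_apply _

theorem measurable_fillMatrix {n : ℕ} (A : Matrix (Fin n) (Fin n) F) (r : Fin n → Fin n → Prop)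
    [DecidableRel r] : Measurable (fillMatrix A r) := by
  refine measurable_matrix_iff.2 fun i j => ?_
  by_cases h : r i j
  · simpa [fillMatrix, h] using measurable_pi_apply _
  · simp [fillMatrix, h]

theorem measurable_coords {n : ℕ} (r : Fin n → Fin n → Prop) :
    Measurable (coords (F := F) r) :=
  measurable_pi_lambda _ fun _ => measurable_matrix_apply measurable_id _ _

theorem measurable_unipOfCoords {n : ℕ} :
    Measurable (unipOfCoords : ({p : Fin n × Fin n // p.1 < p.2} → F) → unip F n) :=
  measurable_comap_iff.2 (measurable_comap_iff.2 (measurable_fillMatrix 1 (· < ·)))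

end BorderMeasure

/-! ### The Gauss decomposition of the Haar measure -/

section Gauss

attribute [local irreducible] mirabolicMk toGL rowGL glEmb unipOfCoords

variable {F : Type*} [NontriviallyNormedField F] [ProperSpace F] [MeasurableSpace F] [BorelSpace F]
  {μ : Measure F}

theorem lintegral_unipMeasure {n : ℕ} {f : unip F n → ℝ≥0∞} (hf : Measurable f) :
    ∫⁻ u, f u ∂(unipMeasure μ n) = ∫⁻ x, f (unipOfCoords x) ∂(piMeasure μ _) :=
  lintegral_map hf measurable_unipOfCoords

variable (μ) in
/-- The right Haar measure on the group of lower triangular matrices, as a measure on `GL_m`. -/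
def lowerMeasure : (m : ℕ) → Measure (GL (Fin m) F)
  | 0 => Measure.dirac 1
  | m + 1 => (((lowerMeasure m).withDensity fun b => ‖b.val.det‖ₑ⁻¹).prod
      ((piMeasure μ (Fin (m + 1))).withDensity fun y => ‖y (Fin.last m)‖ₑ⁻¹)).map
      fun p => glEmb p.1 * rowGL p.2

variable [SigmaFinite μ]

instance sFinite_unipMeasure (n : ℕ) : SFinite (unipMeasure μ n) := by
  unfold unipMeasure
  infer_instance

instance sFinite_lowerMeasure (m : ℕ) : SFinite (lowerMeasure μ m) := by
  induction m with
  | zero => rw [lowerMeasure]; infer_instance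
  | succ m ih => rw [lowerMeasure]; infer_instance

theorem lintegral_map_prod_withDensity {α β γ : Type*} [MeasurableSpace α] [MeasurableSpace β]
    [MeasurableSpace γ] {ν : Measure α} {π : Measure β} [SFinite ν] [SFinite π] {d : α → ℝ≥0∞}
    {e : β → ℝ≥0∞} (hd : Measurable d) (he : Measurable e) {T : α × β → γ} (hT : Measurable T)
    {f : γ → ℝ≥0∞} (hf : Measurable f) :
    ∫⁻ z, f z ∂(((ν.withDensity d).prod (π.withDensity e)).map T) =
      ∫⁻ a, d a * ∫⁻ b, e b * f (T (a, b)) ∂π ∂ν := by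
  have hf' : Measurable fun p => f (T p) := hf.comp hT
  rw [lintegral_map hf hT, lintegral_prod _ hf'.aemeasurable,
    lintegral_withDensity_eq_lintegral_mul _ hd hf'.lintegral_prod_right']
  refine lintegral_congr fun a => ?_
  have hfa : Measurable fun b => f (T (a, b)) := hf'.comp measurable_prodMk_left
  rw [Pi.mul_apply, lintegral_withDensity_eq_lintegral_mul _ he hfa]
  rfl

theorem lintegral_lowerMeasure_succ {m : ℕ} {f : GL (Fin (m + 1)) F → ℝ≥0∞} (hf : Measurable f) :
    ∫⁻ b, f b ∂(lowerMeasure μ (m + 1)) = ∫⁻ b, ‖b.val.det‖ₑ⁻¹ *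
      ∫⁻ y, ‖y (Fin.last m)‖ₑ⁻¹ * f (glEmb b * rowGL y) ∂(piMeasure μ (Fin (m + 1)))
      ∂(lowerMeasure μ m) := by
  have hm : Measurable fun p : GL (Fin m) F × (Fin (m + 1) → F) => glEmb p.1 * rowGL p.2 :=
    (measurable_glEmb measurable_fst).mul (measurable_rowGL.comp measurable_snd)
  have hd : Measurable fun b : GL (Fin m) F => ‖b.val.det‖ₑ⁻¹ :=
    (measurable_det (measurable_gl_val measurable_id)).enorm.inv
  have hy : Measurable fun y : Fin (m + 1) → F => ‖y (Fin.last m)‖ₑ⁻¹ :=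
    (measurable_pi_apply _).enorm.inv
  exact lintegral_map_prod_withDensity hd hy hm hf

variable [μ.IsAddLeftInvariant]

/-- Writing u = 1 + x gives u₁uu₂ = u₁u₂ + u₁xu₂. In coordinates this is a translation composed with
a linear map that is unitriangular for the grading by row minus column. -/
theorem measurePreserving_unip_mul (hs : HasNormScaling μ) {n : ℕ} (u₁ u₂ : unip F n) :
    MeasurePreserving (fun u => u₁ * u * u₂) (unipMeasure μ n) (unipMeasure μ n) := by
  have hcoe : ∀ u : unip F n, Measurable fun _ : unip F n => (u : GL (Fin n) F) :=
    fun _ => measurable_const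
  have hm : Measurable fun u : unip F n => u₁ * u * u₂ :=
    Measurable.subtype_mk
      ((measurable_const.mul measurable_subtype_coe).mul measurable_const)
  refine ⟨hm, ?_⟩
  have h1 := (measurePreserving_coords_mul (μ := μ) hs (· < ·) u₁.2 u₂.2)
  have h2 := (measurePreserving_add_left (piMeasure μ {p : Fin n × Fin n // p.1 < p.2})
    (coords (· < ·) ((u₁ : GL (Fin n) F).val * (u₂ : GL (Fin n) F).val))).comp h1
  have h3 : (fun u => u₁ * u * u₂) ∘ unipOfCoords = unipOfCoords (F := F) ∘
      ((coords (· < ·) ((u₁ : GL (Fin n) F).val * (u₂ : GL (Fin n) F).val) + ·) ∘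
        fun x => coords (· < ·) ((u₁ : GL (Fin n) F).val * fillMatrix 0 (· < ·) x *
          (u₂ : GL (Fin n) F).val)) := by
    ext1 x
    rw [Function.comp_apply, ← unipOfCoords_coords (u₁ * unipOfCoords x * u₂)]
    simp only [Function.comp_apply]
    congr 1
    have h4 : (unipOfCoords x : GL (Fin n) F).val = 1 + fillMatrix 0 (· < ·) x := by
      rw [unipOfCoords_val, fillMatrix_eq_add]
      intro i j hij
      exact Matrix.one_apply_ne hij.ne
    have h5 : ((u₁ * unipOfCoords x * u₂ : unip F n) : GL (Fin n) F).val =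
        (u₁ : GL (Fin n) F).val * (u₂ : GL (Fin n) F).val + (u₁ : GL (Fin n) F).val *
          fillMatrix 0 (· < ·) x * (u₂ : GL (Fin n) F).val := by
      rw [Subgroup.coe_mul, Subgroup.coe_mul, Units.val_mul, Units.val_mul, h4, Matrix.mul_add,
        Matrix.mul_one, Matrix.add_mul]
    rw [h5]
    rfl
  rw [unipMeasure, Measure.map_map hm measurable_unipOfCoords, h3,
    ← Measure.map_map measurable_unipOfCoords h2.measurable, h2.map_eq]

theorem lintegral_unip_mul_right (hs : HasNormScaling μ) {n : ℕ} (u₀ : unip F n)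
    {f : unip F n → ℝ≥0∞} (hf : Measurable f) :
    ∫⁻ u, f (u * u₀) ∂(unipMeasure μ n) = ∫⁻ u, f u ∂(unipMeasure μ n) := by
  have h := (measurePreserving_unip_mul hs 1 u₀).lintegral_comp hf
  simpa using h

theorem lintegral_matrixMeasure_succ {m : ℕ}
    {f : Matrix (Fin (m + 1)) (Fin (m + 1)) F → ℝ≥0∞} (hf : Measurable f) :
    ∫⁻ A, f A ∂(matrixMeasure μ (m + 1)) = ∫⁻ y : Fin (m + 1) → F, ∫⁻ c : Fin m → F, ∫⁻ A,
      f (border A c (fun j => y j.castSucc) (y (Fin.last m))) ∂(matrixMeasure μ m)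
      ∂(piMeasure μ _) ∂(piMeasure μ _) := by
  have h1 := measurePreserving_matrixOf (μ := μ) (m + 1)
  have hf1 : Measurable fun x : Fin (m + 1) × Fin (m + 1) → F => f (Matrix.of fun i j => x (i, j)) :=
    hf.comp h1.measurable
  rw [← h1.lintegral_comp hf, lintegral_joinFun (fullSplit m) hf1]
  refine lintegral_congr fun y => ?_
  have hf2 : Measurable fun z : Fin m ⊕ Fin m × Fin m → F =>
      f (Matrix.of fun i j => joinFun (fullSplit m) (y, z) (i, j)) :=
    hf1.comp ((measurePreserving_joinFun (μ := μ) (fullSplit m)).measurable.comp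
      measurable_prodMk_left)
  rw [lintegral_joinFun (Equiv.refl _) hf2]
  refine lintegral_congr fun c => ?_
  have hf3 : Measurable fun A : Matrix (Fin m) (Fin m) F =>
      f (border A c (fun j => y j.castSucc) (y (Fin.last m))) :=
    hf.comp (measurable_border measurable_id measurable_const measurable_const measurable_const)
  rw [← (measurePreserving_matrixOf (μ := μ) m).lintegral_comp hf3]
  refine lintegral_congr fun x => ?_
  rw [← of_joinFun_full]
  rfl

theorem lintegral_matrixMeasure_add {n : ℕ} (B : Matrix (Fin n) (Fin n) F)
    {f : Matrix (Fin n) (Fin n) F → ℝ≥0∞} (hf : Measurable f) :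
    ∫⁻ A, f (A + B) ∂(matrixMeasure μ n) = ∫⁻ A, f A ∂(matrixMeasure μ n) := by
  have h1 := measurePreserving_matrixOf (μ := μ) n
  have hf1 : Measurable fun A => f (A + B) := by
    refine hf.comp (measurable_matrix_iff.2 fun i j => ?_)
    exact (measurable_matrix_apply measurable_id i j).add_const _
  rw [← h1.lintegral_comp hf, ← h1.lintegral_comp hf1]
  exact lintegral_add_right_eq_self (μ := piMeasure μ (Fin n × Fin n))
    (fun x => f (Matrix.of fun i j => x (i, j))) (fun p => B p.1 p.2)

theorem ae_ne_zero [NullSingletonClass μ] {ι : Type*} [Fintype ι] (i : ι) :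
    ∀ᵐ y : ι → F ∂(piMeasure μ ι), y i ≠ 0 := by
  have h : (piMeasure μ ι) ((Function.eval i) ⁻¹' {0}) = 0 :=
    Measure.pi_hyperplane (fun _ => μ) i 0
  exact measure_mono_null (fun y hy => by simpa using hy) h

theorem lintegral_smul_right (hs : HasNormScaling μ) {m : ℕ} {t : F} (ht : t ≠ 0)
    {f : (Fin m → F) → ℝ≥0∞} (hf : Measurable f) :
    ‖t‖ₑ ^ m * ∫⁻ c, f (t • c) ∂(piMeasure μ _) = ∫⁻ c, f c ∂(piMeasure μ _) := by
  have h := lintegral_diag (μ := μ) (ι := Fin m) hs (D := fun _ => t) (fun _ => ht) hf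
  rw [Finset.prod_const, Finset.card_univ, Fintype.card_fin] at h
  have h0 : ‖t‖ₑ ^ m ≠ 0 := pow_ne_zero _ (by simpa using ht)
  have h1 : ‖t‖ₑ ^ m ≠ ∞ := ENNReal.pow_ne_top (by simp)
  have h2 : ∫⁻ c, f (t • c) ∂(piMeasure μ _) = (‖t‖ₑ ^ m)⁻¹ * ∫⁻ c, f c ∂(piMeasure μ _) := h
  rw [h2, ← mul_assoc, ENNReal.mul_inv_cancel h0 h1, one_mul]

/-- For a fixed last row with corner t ≠ 0, pass to the Schur complement by translating A by c r/t,
then rescale c by t. The Jacobian |t|ᵐ against the density |t|^{-(m+1)} leaves |t|⁻¹. The functions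
G and E are kept abstract so that the determinant condition stays out of the computation. -/
theorem lintegral_matrixMeasure_gauss [NullSingletonClass μ] (hs : HasNormScaling μ) {m : ℕ}
    {G : Matrix (Fin (m + 1)) (Fin (m + 1)) F → ℝ≥0∞} (hG : Measurable G)
    {E : Matrix (Fin m) (Fin m) F → (Fin (m + 1) → F) → (Fin m → F) → ℝ≥0∞}
    (hE : Measurable fun p : (Matrix (Fin m) (Fin m) F × (Fin (m + 1) → F)) × (Fin m → F) =>
      E p.1.1 p.1.2 p.2)
    (hGE : ∀ A y c, y (Fin.last m) ≠ 0 →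
      G (border (A + vecMulVec ((y (Fin.last m))⁻¹ • c) fun j => y j.castSucc) c
        (fun j => y j.castSucc) (y (Fin.last m))) =
      (‖y (Fin.last m)‖ₑ ^ (m + 1))⁻¹ * E A y ((y (Fin.last m))⁻¹ • c)) :
    ∫⁻ A, G A ∂(matrixMeasure μ (m + 1)) = ∫⁻ A, ∫⁻ y, ‖y (Fin.last m)‖ₑ⁻¹ *
      ∫⁻ c, E A y c ∂(piMeasure μ (Fin m)) ∂(piMeasure μ (Fin (m + 1))) ∂(matrixMeasure μ m) := by
  have hy : Measurable fun y : Fin (m + 1) → F => ‖y (Fin.last m)‖ₑ⁻¹ :=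
    (measurable_pi_apply _).enorm.inv
  have hE1 : Measurable fun p : Matrix (Fin m) (Fin m) F × (Fin (m + 1) → F) =>
      ∫⁻ c, E p.1 p.2 c ∂(piMeasure μ (Fin m)) := hE.lintegral_prod_right'
  have hE2 : Measurable fun p : Matrix (Fin m) (Fin m) F × (Fin (m + 1) → F) =>
      ‖p.2 (Fin.last m)‖ₑ⁻¹ * ∫⁻ c, E p.1 p.2 c ∂(piMeasure μ (Fin m)) :=
    (hy.comp measurable_snd).mul hE1
  have hsw := lintegral_lintegral_swap (μ := matrixMeasure μ m) (ν := piMeasure μ (Fin (m + 1)))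
    (f := fun A y => ‖y (Fin.last m)‖ₑ⁻¹ * ∫⁻ c, E A y c ∂(piMeasure μ (Fin m))) hE2.aemeasurable
  rw [lintegral_matrixMeasure_succ hG, hsw]
  refine lintegral_congr_ae ?_
  -- Matrices whose corner vanishes form a null set, so the Gauss decomposition is available almost
  -- everywhere.
  filter_upwards [ae_ne_zero (μ := μ) (Fin.last m)] with y ht
  have hGE' := fun A c => hGE A y c ht
  generalize y (Fin.last m) = t at ht hGE' ⊢
  have ht0 : ‖t‖ₑ ≠ 0 := by simpa using ht
  have hstep : ∀ c : Fin m → F,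
      ∫⁻ A, G (border A c (fun j => y j.castSucc) t) ∂(matrixMeasure μ m) =
      ∫⁻ A, (‖t‖ₑ ^ (m + 1))⁻¹ * E A y (t⁻¹ • c) ∂(matrixMeasure μ m) := by
    intro c
    have hGc : Measurable fun A => G (border A c (fun j => y j.castSucc) t) :=
      hG.comp (measurable_border measurable_id measurable_const measurable_const measurable_const)
    rw [← lintegral_matrixMeasure_add (μ := μ) (vecMulVec (t⁻¹ • c) fun j => y j.castSucc) hGc]
    exact lintegral_congr fun A => hGE' A c
  have hts : Measurable fun c : Fin m → F => t⁻¹ • c := measurable_const_smul _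
  have hEs : Measurable fun p : (Fin m → F) × Matrix (Fin m) (Fin m) F =>
      (‖t‖ₑ ^ (m + 1))⁻¹ * E p.2 y (t⁻¹ • p.1) := by
    refine measurable_const.mul ?_
    exact hE.comp ((measurable_snd.prodMk measurable_const).prodMk (hts.comp measurable_fst))
  have hsw2 := lintegral_lintegral_swap (μ := piMeasure μ (Fin m)) (ν := matrixMeasure μ m)
    (f := fun c A => (‖t‖ₑ ^ (m + 1))⁻¹ * E A y (t⁻¹ • c)) hEs.aemeasurable
  rw [lintegral_congr hstep, hsw2]
  refine lintegral_congr fun A => ?_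
  have hEc' : Measurable fun c => E A y (t⁻¹ • c) :=
    hE.comp ((measurable_const (a := (A, y))).prodMk hts)
  rw [lintegral_const_mul _ hEc', ← lintegral_smul_right hs ht hEc']
  simp only [smul_smul, inv_mul_cancel₀ ht, one_smul]
  have hc : (‖t‖ₑ ^ (m + 1))⁻¹ * ‖t‖ₑ ^ m = ‖t‖ₑ⁻¹ := by
    rw [pow_succ, ENNReal.mul_inv (Or.inl (pow_ne_zero _ ht0))
      (Or.inl (ENNReal.pow_ne_top (by simp))), mul_right_comm,
      ENNReal.inv_mul_cancel (pow_ne_zero _ ht0) (ENNReal.pow_ne_top (by simp)), one_mul]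
  rw [← mul_assoc, hc]

theorem border_gauss {m : ℕ} (A : Matrix (Fin m) (Fin m) F) (c r : Fin m → F) {t : F}
    (ht : t ≠ 0) : border (A + vecMulVec (t⁻¹ • c) r) c r t =
      border 1 (t⁻¹ • c) 0 1 * border A 0 r t := by
  rw [border_mul]
  congr 1 <;> simp [ht, smul_smul]

/-- Integration over `GL_{m+1}` by means of the decomposition
`(A c; r t) = (1 c/t; 0 1) (A - c r / t, 0; 0 1) (1 0; r t)`. -/
theorem lintegral_glMeasure_succ [NullSingletonClass μ] (hs : HasNormScaling μ) {m : ℕ}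
    {f : GL (Fin (m + 1)) F → ℝ≥0∞} (hf : Measurable f) :
    ∫⁻ g, f g ∂(glMeasure μ (m + 1)) = ∫⁻ g, ‖g.val.det‖ₑ⁻¹ *
      ∫⁻ y, ‖y (Fin.last m)‖ₑ⁻¹ * ∫⁻ c, f (mirabolicMk c g * rowGL y) ∂(piMeasure μ (Fin m))
      ∂(piMeasure μ (Fin (m + 1))) ∂(glMeasure μ m) := by
  have hd : ∀ k l, Measurable fun A : Matrix (Fin k) (Fin k) F => (‖A.det‖ₑ ^ l)⁻¹ := fun k l =>
    ((measurable_det measurable_id).enorm.pow_const l).inv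
  have hG : Measurable fun A : Matrix (Fin (m + 1)) (Fin (m + 1)) F => Set.indicator
      {A | A.det ≠ 0} (fun A => (‖A.det‖ₑ ^ (m + 1))⁻¹ * f (toGL A)) A :=
    ((hd _ _).mul (hf.comp measurable_toGL)).indicator measurableSet_det_ne_zero
  have hB : Measurable fun p : (GL (Fin m) F × (Fin (m + 1) → F)) × (Fin m → F) =>
      f (mirabolicMk p.2 p.1.1 * rowGL p.1.2) :=
    hf.comp ((measurable_mirabolicMk measurable_snd (measurable_fst.comp
      measurable_fst)).subtype_val.mul (measurable_rowGL.comp (measurable_snd.comp measurable_fst)))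
  have hB0 : Measurable fun p : GL (Fin m) F × (Fin (m + 1) → F) =>
      ∫⁻ c, f (mirabolicMk c p.1 * rowGL p.2) ∂(piMeasure μ (Fin m)) :=
    hB.lintegral_prod_right'
  have hB1 : Measurable fun p : GL (Fin m) F × (Fin (m + 1) → F) =>
      ‖p.2 (Fin.last m)‖ₑ⁻¹ * ∫⁻ c, f (mirabolicMk c p.1 * rowGL p.2) ∂(piMeasure μ (Fin m)) :=
    ((measurable_pi_apply (Fin.last m)).comp measurable_snd).enorm.inv.mul hB0
  have hB2 : Measurable fun g : GL (Fin m) F => ∫⁻ y, ‖y (Fin.last m)‖ₑ⁻¹ *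
      ∫⁻ c, f (mirabolicMk c g * rowGL y) ∂(piMeasure μ (Fin m)) ∂(piMeasure μ (Fin (m + 1))) :=
    hB1.lintegral_prod_right'
  have hR : Measurable fun g : GL (Fin m) F => ‖g.val.det‖ₑ⁻¹ *
      ∫⁻ y, ‖y (Fin.last m)‖ₑ⁻¹ * ∫⁻ c, f (mirabolicMk c g * rowGL y) ∂(piMeasure μ (Fin m))
      ∂(piMeasure μ (Fin (m + 1))) :=
    (measurable_det (measurable_gl_val measurable_id)).enorm.inv.mul hB2
  have hI : Measurable fun A : Matrix (Fin m) (Fin m) F => Set.indicator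
      {A | A.det ≠ 0} (fun A => (‖A.det‖ₑ ^ (m + 1))⁻¹) A :=
    (hd _ _).indicator measurableSet_det_ne_zero
  have hE : Measurable fun p : (Matrix (Fin m) (Fin m) F × (Fin (m + 1) → F)) × (Fin m → F) =>
      Set.indicator {A | A.det ≠ 0} (fun A => (‖A.det‖ₑ ^ (m + 1))⁻¹) p.1.1 *
        f (mirabolicMk p.2 (toGL p.1.1) * rowGL p.1.2) := by
    refine (hI.comp (measurable_fst.comp measurable_fst)).mul ?_
    exact hB.fun_comp (((measurable_toGL.comp (measurable_fst.comp measurable_fst)).prodMk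
      (measurable_snd.comp measurable_fst)).prodMk measurable_snd)
  rw [lintegral_glMeasure hf, lintegral_glMeasure hR, ← lintegral_indicator measurableSet_det_ne_zero,
    ← lintegral_indicator measurableSet_det_ne_zero, lintegral_matrixMeasure_gauss (μ := μ) hs hG
      (E := fun A y c => Set.indicator {A | A.det ≠ 0} (fun A => (‖A.det‖ₑ ^ (m + 1))⁻¹) A *
        f (mirabolicMk c (toGL A) * rowGL y)) hE]
  · refine lintegral_congr fun A => ?_
    by_cases hA : A.det = 0
    · simp [Set.indicator, hA]
    · have hA' : A ∈ {A : Matrix (Fin m) (Fin m) F | A.det ≠ 0} := hA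
      rw [Set.indicator_of_mem hA', Set.indicator_of_mem hA', toGL_val hA, ← mul_assoc]
      have hB3 : Measurable fun y : Fin (m + 1) → F => ‖y (Fin.last m)‖ₑ⁻¹ *
          ∫⁻ c, f (mirabolicMk c (toGL A) * rowGL y) ∂(piMeasure μ (Fin m)) :=
        (measurable_pi_apply (Fin.last m)).enorm.inv.mul
          (hB0.fun_comp (measurable_prodMk_left (x := toGL A)))
      have h1 : (‖A.det‖ₑ ^ m)⁻¹ * ‖A.det‖ₑ⁻¹ = (‖A.det‖ₑ ^ (m + 1))⁻¹ := by
        rw [pow_succ, ENNReal.mul_inv (Or.inr (by simp)) (Or.inr (by simpa using hA))]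
      rw [h1, ← lintegral_const_mul _ hB3]
      refine lintegral_congr fun y => ?_
      have hB4 : Measurable fun c : Fin m → F => f (mirabolicMk c (toGL A) * rowGL y) :=
        hB.fun_comp (measurable_prodMk_left (x := (toGL A, y)))
      rw [lintegral_const_mul _ hB4, mul_left_comm]
  · intro A y c ht
    have hdet : (border (A + vecMulVec ((y (Fin.last m))⁻¹ • c) fun j => y j.castSucc) c
        (fun j => y j.castSucc) (y (Fin.last m))).det = A.det * y (Fin.last m) := by
      rw [border_gauss _ _ _ ht, Matrix.det_mul, det_border_row_zero, det_border_col_zero]; simp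
    by_cases hA : A.det = 0
    · simp only [Set.indicator, Set.mem_ofPred_eq, hdet, hA, zero_mul, ne_eq, not_true_eq_false,
        if_false, mul_zero]
    · have hA' : A.det * y (Fin.last m) ≠ 0 := mul_ne_zero hA ht
      simp only [Set.indicator, Set.mem_ofPred_eq, hdet, hA, hA', ne_eq, not_false_eq_true, if_true]
      rw [enorm_mul, mul_pow, ENNReal.mul_inv (Or.inl (pow_ne_zero _ (by simpa using hA)))
        (Or.inl (ENNReal.pow_ne_top (by simp))), mul_comm ((‖A.det‖ₑ ^ (m + 1))⁻¹), mul_assoc]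
      congr 3
      refine toGL_eq ?_
      rw [border_gauss _ _ _ ht, Units.val_mul, mirabolicMk_val, rowGL_val ht, toGL_val hA,
        border_mul, border_mul]
      congr 1 <;> simp

/-- Haar measure on the open cell N_m B⁻, by induction on m. One step of the Gauss decomposition
peels off the last row and column; the column together with N_m makes up N_{m+1}, while the row
together with the smaller lower triangular matrix makes up the larger one. Left multiplication by
N_m does not affect the weight |det|⁻¹. -/
theorem lintegral_glMeasure_eq_lower [NullSingletonClass μ] (hs : HasNormScaling μ) {m : ℕ}
    {f : GL (Fin m) F → ℝ≥0∞} (hf : Measurable f) :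
    ∫⁻ g, f g ∂(glMeasure μ m) =
      ∫⁻ b, ∫⁻ u, f ((u : GL (Fin m) F) * b) ∂(unipMeasure μ m) ∂(lowerMeasure μ m) := by
  induction m with
  | zero =>
    have h1 : ∀ g : GL (Fin 0) F, g = 1 := fun g => Units.ext (Subsingleton.elim _ _)
    have h2 : ∀ A : Matrix (Fin 0) (Fin 0) F, A.det = 1 := fun A => Matrix.det_fin_zero
    rw [lowerMeasure, lintegral_glMeasure hf]
    simp only [h2, h1 (toGL _), ne_eq, one_ne_zero, not_false_eq_true, pow_zero, inv_one, one_mul]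
    have hf' : Measurable fun u : unip F 0 => f ((u : GL (Fin 0) F) * 1) :=
      hf.comp (measurable_subtype_coe.mul measurable_const)
    rw [lintegral_dirac, lintegral_unipMeasure hf']
    simp only [h1 ((_ : GL (Fin 0) F) * 1), lintegral_const]
    congr 1
    have h3 : (matrixMeasure μ 0) Set.univ = 1 := by
      refine (Measure.pi_univ (fun _ : Fin 0 => Measure.pi fun _ : Fin 0 => μ)).trans ?_
      simp
    simpa using h3
  | succ m ih =>
    have hB : Measurable fun p : (GL (Fin m) F × (Fin (m + 1) → F)) × (Fin m → F) =>
        f (mirabolicMk p.2 p.1.1 * rowGL p.1.2) :=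
      hf.comp ((measurable_mirabolicMk measurable_snd (measurable_fst.comp
        measurable_fst)).subtype_val.mul
          (measurable_rowGL.comp (measurable_snd.comp measurable_fst)))
    have hB0 : Measurable fun p : GL (Fin m) F × (Fin (m + 1) → F) =>
        ∫⁻ c, f (mirabolicMk c p.1 * rowGL p.2) ∂(piMeasure μ (Fin m)) :=
      hB.lintegral_prod_right'
    have hB1 : Measurable fun p : GL (Fin m) F × (Fin (m + 1) → F) =>
        ‖p.2 (Fin.last m)‖ₑ⁻¹ * ∫⁻ c, f (mirabolicMk c p.1 * rowGL p.2) ∂(piMeasure μ (Fin m)) :=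
      ((measurable_pi_apply (Fin.last m)).comp measurable_snd).enorm.inv.mul hB0
    have hB2 : Measurable fun g : GL (Fin m) F => ∫⁻ y, ‖y (Fin.last m)‖ₑ⁻¹ *
        ∫⁻ c, f (mirabolicMk c g * rowGL y) ∂(piMeasure μ (Fin m)) ∂(piMeasure μ (Fin (m + 1))) :=
      hB1.lintegral_prod_right'
    have hR : Measurable fun g : GL (Fin m) F => ‖g.val.det‖ₑ⁻¹ *
        ∫⁻ y, ‖y (Fin.last m)‖ₑ⁻¹ * ∫⁻ c, f (mirabolicMk c g * rowGL y) ∂(piMeasure μ (Fin m))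
        ∂(piMeasure μ (Fin (m + 1))) :=
      (measurable_det (measurable_gl_val measurable_id)).enorm.inv.mul hB2
    have hU : Measurable fun p : GL (Fin (m + 1)) F × unip F (m + 1) =>
        f ((p.2 : GL (Fin (m + 1)) F) * p.1) :=
      hf.comp ((measurable_subtype_coe.comp measurable_snd).mul measurable_fst)
    have hU1 : Measurable fun b : GL (Fin (m + 1)) F =>
        ∫⁻ u, f ((u : GL (Fin (m + 1)) F) * b) ∂(unipMeasure μ (m + 1)) :=
      hU.lintegral_prod_right'
    rw [lintegral_glMeasure_succ hs hf, ih hR, lintegral_lowerMeasure_succ hU1]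
    refine lintegral_congr fun b => ?_
    have hb : ∀ u : unip F m, ((u : GL (Fin m) F) * b).val.det = b.val.det := fun u => by
      rw [Units.val_mul, Matrix.det_mul, (isUpperUnip_coe u).det, one_mul]
    simp only [hb]
    have hB2b : Measurable fun u : unip F m => ∫⁻ y, ‖y (Fin.last m)‖ₑ⁻¹ *
        ∫⁻ c, f (mirabolicMk c ((u : GL (Fin m) F) * b) * rowGL y) ∂(piMeasure μ (Fin m))
        ∂(piMeasure μ (Fin (m + 1))) :=
      hB2.comp (measurable_subtype_coe.mul measurable_const)
    rw [lintegral_const_mul _ hB2b]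
    congr 1
    have hB3 : Measurable fun p : unip F m × (Fin (m + 1) → F) => ‖p.2 (Fin.last m)‖ₑ⁻¹ *
        ∫⁻ c, f (mirabolicMk c ((p.1 : GL (Fin m) F) * b) * rowGL p.2) ∂(piMeasure μ (Fin m)) :=
      ((measurable_pi_apply (Fin.last m)).comp measurable_snd).enorm.inv.mul
        (hB0.fun_comp (((measurable_subtype_coe.comp measurable_fst).mul measurable_const).prodMk
          measurable_snd))
    have hsw := lintegral_lintegral_swap (μ := unipMeasure μ m) (ν := piMeasure μ (Fin (m + 1)))
      (f := fun u y => ‖y (Fin.last m)‖ₑ⁻¹ *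
        ∫⁻ c, f (mirabolicMk c ((u : GL (Fin m) F) * b) * rowGL y) ∂(piMeasure μ (Fin m)))
      hB3.aemeasurable
    rw [hsw]
    refine lintegral_congr fun y => ?_
    have hB4 : Measurable fun u : unip F m =>
        ∫⁻ c, f (mirabolicMk c ((u : GL (Fin m) F) * b) * rowGL y) ∂(piMeasure μ (Fin m)) := by
      have h1 : Measurable fun p : unip F m × (Fin m → F) =>
          f (mirabolicMk p.2 ((p.1 : GL (Fin m) F) * b) * rowGL y) :=
        hB.fun_comp ((((measurable_subtype_coe.comp measurable_fst).mul measurable_const).prodMk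
          measurable_const).prodMk measurable_snd)
      exact h1.lintegral_prod_right'
    have hU2 : Measurable fun u : unip F (m + 1) =>
        f ((u : GL (Fin (m + 1)) F) * (glEmb b * rowGL y)) :=
      hU.comp (measurable_prodMk_left (x := glEmb b * rowGL y))
    have hU3 : Measurable fun x : {p : Fin (m + 1) × Fin (m + 1) // p.1 < p.2} → F =>
        f ((unipOfCoords x : GL (Fin (m + 1)) F) * (glEmb b * rowGL y)) :=
      hU2.comp measurable_unipOfCoords
    rw [lintegral_const_mul _ hB4, lintegral_unipMeasure hB4, lintegral_unipMeasure hU2,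
      lintegral_joinFun (upperSplit m) hU3]
    simp only [unipOfCoords_joinFun, mirabolicMk_mul, mul_assoc]

end Gauss

/-! ### Quotient measures -/

section Quotient

variable {G : Type*} [Group G] [MeasurableSpace G] [MeasurableMul₂ G] {N : Subgroup G}
  {ν : Measure N} [SFinite ν]

theorem exists_out_eq (N : Subgroup G) (g : G) :
    ∃ u : N, (Quotient.mk (QuotientGroup.rightRel N) g).out = u * g := by
  have h : (QuotientGroup.rightRel N) g ((Quotient.mk (QuotientGroup.rightRel N) g).out) :=
    (QuotientGroup.rightRel N).symm (Quotient.mk_out g)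
  rw [QuotientGroup.rightRel_apply] at h
  exact ⟨⟨_, h⟩, by simp⟩

theorem mk_mul_eq (u : N) (g : G) :
    Quotient.mk (QuotientGroup.rightRel N) (u * g) = Quotient.mk _ g := by
  refine Quotient.sound ?_
  change (QuotientGroup.rightRel N) _ _
  rw [QuotientGroup.rightRel_apply]
  simp

theorem measurable_lintegral_mul {f : G → ℝ≥0∞} (hf : Measurable f) :
    Measurable fun g => ∫⁻ u : N, f (u * g) ∂ν := by
  have h : Measurable fun p : G × N => f (p.2 * p.1) :=
    hf.comp ((measurable_subtype_coe.comp measurable_snd).mul measurable_fst)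
  exact h.lintegral_prod_right'

/-- The chosen representative differs from g by a left factor in N, which right invariance of ν
absorbs. Integrals along cosets can thus be computed at any representative. -/
theorem lintegral_out_eq (hinv : ∀ (u₀ : N) (f : N → ℝ≥0∞), Measurable f →
    ∫⁻ u, f (u * u₀) ∂ν = ∫⁻ u, f u ∂ν) {f : G → ℝ≥0∞} (hf : Measurable f) (g : G) :
    ∫⁻ u : N, f (u * (Quotient.mk (QuotientGroup.rightRel N) g).out) ∂ν =
      ∫⁻ u : N, f (u * g) ∂ν := by
  obtain ⟨u₀, hu₀⟩ := exists_out_eq N g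
  have h1 : Measurable fun u : N => f (u * g) :=
    hf.comp (measurable_subtype_coe.mul measurable_const)
  rw [hu₀, ← hinv u₀ _ h1]
  simp only [Subgroup.coe_mul, mul_assoc]

theorem measurable_lintegral_out (hinv : ∀ (u₀ : N) (f : N → ℝ≥0∞), Measurable f →
    ∫⁻ u, f (u * u₀) ∂ν = ∫⁻ u, f u ∂ν) {f : G → ℝ≥0∞} (hf : Measurable f) :
    Measurable fun q : LeftQuotient N => ∫⁻ u : N, f (u * q.out) ∂ν := by
  refine measurable_from_quotient.2 ?_
  have h : (fun q : LeftQuotient N => ∫⁻ u : N, f (u * q.out) ∂ν) ∘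
      (Quotient.mk'' : G → LeftQuotient N) = fun g => ∫⁻ u : N, f (u * g) ∂ν :=
    funext fun g => lintegral_out_eq hinv hf g
  rw [h]
  exact measurable_lintegral_mul hf

/-- A quotient measure is determined as soon as there is a weight on the group whose integrals
along the cosets are positive and finite. -/
theorem IsQuotientMeasure.apply_eq {μ : Measure G} (hinv : ∀ (u₀ : N) (f : N → ℝ≥0∞), Measurable f →
    ∫⁻ u, f (u * u₀) ∂ν = ∫⁻ u, f u ∂ν) {w : G → ℝ≥0∞} (hw : Measurable w)
    (h0 : ∀ g, ∫⁻ u : N, w (u * g) ∂ν ≠ 0) (h1 : ∀ g, ∫⁻ u : N, w (u * g) ∂ν ≠ ∞)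
    {ρ : Measure (LeftQuotient N)} (hρ : IsQuotientMeasure N μ ν ρ) {A : Set (LeftQuotient N)}
    (hA : MeasurableSet A) :
    ρ A = ∫⁻ g, (Quotient.mk (QuotientGroup.rightRel N) ⁻¹' A).indicator
      (fun g => (∫⁻ u : N, w (u * g) ∂ν)⁻¹ * w g) g ∂μ := by
  have hA' : MeasurableSet (Quotient.mk (QuotientGroup.rightRel N) ⁻¹' A) :=
    measurable_quotient_mk'' hA
  have hm : Measurable ((Quotient.mk (QuotientGroup.rightRel N) ⁻¹' A).indicator
      (fun g => (∫⁻ u : N, w (u * g) ∂ν)⁻¹ * w g)) :=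
    ((measurable_lintegral_mul hw).inv.mul hw).indicator hA'
  -- The test function is w, normalized to have integral 1 along every coset and cut off to the
  -- preimage of A. Its integral along a coset is the indicator of A, so μ determines ρ(A).
  rw [hρ _ hm, ← lintegral_indicator_one hA]
  refine lintegral_congr fun q => ?_
  obtain ⟨g, rfl⟩ := Quotient.exists_rep q
  rw [lintegral_out_eq hinv hm]
  have hinvg : ∀ u₀ : N, ∫⁻ u : N, w (u * (u₀ * g)) ∂ν = ∫⁻ u : N, w (u * g) ∂ν := fun u₀ => by
    have hwg : Measurable fun u : N => w (u * g) :=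
      hw.comp (measurable_subtype_coe.mul measurable_const)
    rw [← hinv u₀ _ hwg]
    simp only [Subgroup.coe_mul, mul_assoc]
  by_cases hg : Quotient.mk (QuotientGroup.rightRel N) g ∈ A
  · have hg' : ∀ u : N, (u * g : G) ∈ Quotient.mk (QuotientGroup.rightRel N) ⁻¹' A := fun u => by
      rw [Set.mem_preimage, mk_mul_eq]; exact hg
    have hwg : Measurable fun u : N => w (u * g) :=
      hw.comp (measurable_subtype_coe.mul measurable_const)
    simp only [Set.indicator_of_mem (hg' _), Set.indicator_of_mem hg, Pi.one_apply, hinvg]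
    rw [lintegral_const_mul _ hwg, ENNReal.inv_mul_cancel (h0 g) (h1 g)]
  · have hg' : ∀ u : N, (u * g : G) ∉ Quotient.mk (QuotientGroup.rightRel N) ⁻¹' A := fun u => by
      rw [Set.mem_preimage, mk_mul_eq]; exact hg
    simp only [Set.indicator_of_notMem (hg' _), Set.indicator_of_notMem hg, lintegral_zero]

/-- Existence: a map `j` along which μ disintegrates as ν times β provides the quotient measure as
an image of β. -/
theorem isQuotientMeasure_map {μ : Measure G} (hinv : ∀ (u₀ : N) (f : N → ℝ≥0∞), Measurable f →
    ∫⁻ u, f (u * u₀) ∂ν = ∫⁻ u, f u ∂ν) {B : Type*} [MeasurableSpace B] {β : Measure B}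
    {j : B → G} (hj : Measurable j) (hdec : ∀ f : G → ℝ≥0∞, Measurable f →
      ∫⁻ g, f g ∂μ = ∫⁻ b, ∫⁻ u : N, f (u * j b) ∂ν ∂β) :
    IsQuotientMeasure N μ ν (β.map fun b => Quotient.mk (QuotientGroup.rightRel N) (j b)) := by
  intro f hf
  have hmk : Measurable fun b => Quotient.mk (QuotientGroup.rightRel N) (j b) :=
    measurable_quotient_mk''.comp hj
  rw [hdec f hf, lintegral_map (measurable_lintegral_out hinv hf) hmk]
  exact lintegral_congr fun b => (lintegral_out_eq hinv hf (j b)).symm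

/-- Take w = Σ ε_k 1_{S_k} with ε_k > 0 and Σ ε_k c_k < 1. The bound c_k on the coset slices gives
finiteness; positivity holds because the S_k cover the group and ν is not zero. -/
theorem exists_weight {S : ℕ → Set G} (hS : ∀ k, MeasurableSet (S k)) (hcov : ∀ g, ∃ k, g ∈ S k)
    {c : ℕ → ℝ≥0∞} (hc : ∀ k, c k ≠ ∞) (hSc : ∀ k (g : G), ν {u : N | u * g ∈ S k} ≤ c k)
    (hν : ν Set.univ ≠ 0) : ∃ w : G → ℝ≥0∞, Measurable w ∧ (∀ g, ∫⁻ u : N, w (u * g) ∂ν ≠ 0) ∧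
      ∀ g, ∫⁻ u : N, w (u * g) ∂ν ≠ ∞ := by
  obtain ⟨ε, hε0, hε⟩ := ENNReal.exists_pos_tsum_mul_lt_of_countable (ε := 1) one_ne_zero c hc
  have hm : ∀ k, Measurable ((S k).indicator fun _ => (ε k : ℝ≥0∞)) := fun k =>
    measurable_const.indicator (hS k)
  have hset : ∀ k (g : G), MeasurableSet {u : N | u * g ∈ S k} := fun k g =>
    (measurable_subtype_coe.mul measurable_const) (hS k)
  have hint : ∀ g, ∫⁻ u : N, (∑' k, (S k).indicator (fun _ => (ε k : ℝ≥0∞)) (u * g)) ∂ν =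
      ∑' k, (ε k : ℝ≥0∞) * ν {u : N | u * g ∈ S k} := fun g => by
    have hmg : ∀ k, Measurable fun u : N => (S k).indicator (fun _ => (ε k : ℝ≥0∞)) (u * g) :=
      fun k => (hm k).comp (measurable_subtype_coe.mul measurable_const)
    rw [lintegral_tsum fun k => (hmg k).aemeasurable]
    refine tsum_congr fun k => ?_
    have h1 : ∀ u : N, (S k).indicator (fun _ => (ε k : ℝ≥0∞)) (u * g) =
        {u : N | u * g ∈ S k}.indicator (fun _ => (ε k : ℝ≥0∞)) u := fun u => by
      simp [Set.indicator]
    simp only [h1]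
    rw [lintegral_indicator_const (hset k g)]
  refine ⟨fun g => ∑' k, (S k).indicator (fun _ => (ε k : ℝ≥0∞)) g,
    Measurable.tsum hm, fun g => ?_, fun g => ?_⟩
  · rw [hint g, Ne, ENNReal.tsum_eq_zero]
    intro h
    apply hν
    have h2 : ∀ k, ν {u : N | u * g ∈ S k} = 0 := fun k =>
      (mul_eq_zero.1 (h k)).resolve_left (by simpa using (hε0 k).ne')
    have h3 : (Set.univ : Set N) = ⋃ k, {u : N | u * g ∈ S k} := by
      ext u
      simpa using hcov (u * g)
    rw [h3]
    exact measure_iUnion_null h2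
  · rw [hint g]
    refine ne_top_of_le_ne_top ENNReal.one_ne_top (le_trans (ENNReal.tsum_le_tsum fun k => ?_) hε.le)
    rw [mul_comm]
    gcongr
    exact hSc k g

/-- Since `quotientMeasure` is a chosen solution of its defining property, knowing one solution is
not enough. The exhaustion by the sets `S k` supplies the weight that forces uniqueness. -/
theorem quotientMeasure_eq_map {μ : Measure G} (hinv : ∀ (u₀ : N) (f : N → ℝ≥0∞), Measurable f →
    ∫⁻ u, f (u * u₀) ∂ν = ∫⁻ u, f u ∂ν) {B : Type*} [MeasurableSpace B] {β : Measure B}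
    {j : B → G} (hj : Measurable j) (hdec : ∀ f : G → ℝ≥0∞, Measurable f →
      ∫⁻ g, f g ∂μ = ∫⁻ b, ∫⁻ u : N, f (u * j b) ∂ν ∂β)
    {S : ℕ → Set G} (hS : ∀ k, MeasurableSet (S k)) (hcov : ∀ g, ∃ k, g ∈ S k)
    {c : ℕ → ℝ≥0∞} (hc : ∀ k, c k ≠ ∞) (hSc : ∀ k (g : G), ν {u : N | u * g ∈ S k} ≤ c k)
    (hν : ν Set.univ ≠ 0) :
    quotientMeasure N μ ν = β.map fun b => Quotient.mk (QuotientGroup.rightRel N) (j b) := by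
  have h := isQuotientMeasure_map hinv hj hdec
  have hex : ∃ ρ, IsQuotientMeasure N μ ν ρ := ⟨_, h⟩
  obtain ⟨w, hw, h0, h1⟩ := exists_weight hS hcov hc hSc hν
  rw [quotientMeasure, dif_pos hex]
  ext A hA
  rw [hex.choose_spec.apply_eq hinv hw h0 h1 hA, h.apply_eq hinv hw h0 h1 hA]

/-- The measures on the coset spaces of H_n integrate, over N\G, image measures formed at the chosen
representative. Invariance of these image measures under N lets `j b` replace that representative,
and also shows that the kernel is measurable on the quotient. -/
theorem bind_map_out_eq {B V Q : Type*} [MeasurableSpace B] [MeasurableSpace V] [MeasurableSpace Q]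
    {β : Measure B} {lam : Measure V} [SFinite lam] {j : B → G} (hj : Measurable j)
    {T : V → G → Q} (hT : Measurable fun p : G × V => T p.2 p.1)
    (hinv : ∀ (u : N) g, lam.map (fun X => T X (u * g)) = lam.map fun X => T X g) :
    (β.map fun b => Quotient.mk (QuotientGroup.rightRel N) (j b)).bind
      (fun q => lam.map fun X => T X q.out) = (β.prod lam).map fun p => T p.2 (j p.1) := by
  have hTg : ∀ g, Measurable fun X => T X g := fun g => hT.comp measurable_prodMk_left
  have hκ : ∀ g, lam.map (fun X => T X (Quotient.mk (QuotientGroup.rightRel N) g).out) =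
      lam.map fun X => T X g := fun g => by
    obtain ⟨u, hu⟩ := exists_out_eq N g
    rw [hu, hinv]
  have hmeas : Measurable fun q : LeftQuotient N => lam.map fun X => T X q.out := by
    refine measurable_from_quotient.2 ?_
    have h : (fun q : LeftQuotient N => lam.map fun X => T X q.out) ∘
        (Quotient.mk'' : G → LeftQuotient N) = fun g => lam.map fun X => T X g := funext hκ
    rw [h]
    refine Measure.measurable_of_measurable_coe _ fun A hA => ?_
    have h1 : ∀ g, (lam.map fun X => T X g) A = lam (Prod.mk g ⁻¹' ((fun p : G × V =>
        T p.2 p.1) ⁻¹' A)) := fun g => Measure.map_apply (hTg g) hA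
    simp only [h1]
    exact measurable_measure_prodMk_left (hT hA)
  have hmk : Measurable fun b => Quotient.mk (QuotientGroup.rightRel N) (j b) :=
    measurable_quotient_mk''.comp hj
  have hTj : Measurable fun p : B × V => T p.2 (j p.1) :=
    hT.comp ((hj.comp measurable_fst).prodMk measurable_snd)
  ext A hA
  have hmeasA : Measurable fun q : LeftQuotient N => (lam.map fun X => T X q.out) A :=
    (Measure.measurable_coe hA).comp hmeas
  rw [Measure.bind_apply hA hmeas.aemeasurable, lintegral_map hmeasA hmk,
    Measure.map_apply hTj hA, Measure.prod_apply (hTj hA)]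
  refine lintegral_congr fun b => ?_
  rw [hκ, Measure.map_apply (hTg _) hA]
  rfl

end Quotient

/-! ### Bounded subsets of the groups -/

section Bounded

instance subgroupMeasurableMul₂ {G : Type*} [Group G] [MeasurableSpace G] [MeasurableMul₂ G]
    (H : Subgroup G) : MeasurableMul₂ H :=
  ⟨Measurable.subtype_mk ((measurable_subtype_coe.comp measurable_fst).mul
    (measurable_subtype_coe.comp measurable_snd))⟩

variable {F : Type*} [NontriviallyNormedField F]

/-- All coefficients have norm at most `R`. -/
def MatBdd {ι κ : Type*} (A : Matrix ι κ F) (R : ℝ) : Prop := ∀ i j, ‖A i j‖ ≤ R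

theorem MatBdd.mono {ι κ : Type*} {A : Matrix ι κ F} {R S : ℝ} (h : MatBdd A R) (hRS : R ≤ S) :
    MatBdd A S := fun i j => (h i j).trans hRS

theorem MatBdd.mul [IsUltrametricDist F] {ι κ ρ : Type*} [Fintype κ] {A : Matrix ι κ F}
    {B : Matrix κ ρ F} {R S : ℝ} (hA : MatBdd A R) (hB : MatBdd B S) (hR : 0 ≤ R) (hS : 0 ≤ S) :
    MatBdd (A * B) (R * S) := fun i j => by
  rw [Matrix.mul_apply]
  refine IsUltrametricDist.norm_sum_le_of_forall_le_of_nonneg (mul_nonneg hR hS) fun k _ => ?_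
  rw [norm_mul]
  exact mul_le_mul (hA i k) (hB k j) (norm_nonneg _) hR

theorem exists_matBdd {ι κ : Type*} [Finite ι] [Finite κ] (A : Matrix ι κ F) :
    ∃ R : ℝ, 0 ≤ R ∧ MatBdd A R := by
  cases nonempty_fintype ι
  cases nonempty_fintype κ
  refine ⟨∑ i, ∑ j, ‖A i j‖, by positivity, fun i j => ?_⟩
  exact (Finset.single_le_sum (f := fun j => ‖A i j‖) (fun _ _ => norm_nonneg _)
    (Finset.mem_univ j)).trans (Finset.single_le_sum (f := fun i => ∑ j, ‖A i j‖)
      (fun _ _ => Finset.sum_nonneg fun _ _ => norm_nonneg _) (Finset.mem_univ i))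

variable {ι : Type*} [Fintype ι] [DecidableEq ι]

/-- The invertible matrices whose coefficients, and those of whose inverse, have norm at
most `R`. -/
def boundedGL (ι : Type*) [Fintype ι] [DecidableEq ι] (F : Type*) [NontriviallyNormedField F]
    (R : ℝ) : Set (GL ι F) := {g | MatBdd g.val R ∧ MatBdd (g⁻¹).val R}

theorem exists_mem_boundedGL (g : GL ι F) : ∃ k : ℕ, g ∈ boundedGL ι F k := by
  obtain ⟨R, -, hR⟩ := exists_matBdd g.val
  obtain ⟨S, -, hS⟩ := exists_matBdd (g⁻¹).val
  obtain ⟨k, hk⟩ := exists_nat_ge (max R S)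
  exact ⟨k, hR.mono ((le_max_left _ _).trans hk), hS.mono ((le_max_right _ _).trans hk)⟩

variable [IsUltrametricDist F] [ProperSpace F] [MeasurableSpace F] [BorelSpace F]
  {μ : Measure F} [μ.IsAddHaarMeasure]

theorem measurableSet_boundedGL (R : ℝ) : MeasurableSet (boundedGL ι F R) := by
  have h : boundedGL ι F R = (⋂ i, ⋂ j, {g : GL ι F | ‖g.val i j‖ ≤ R}) ∩
      ⋂ i, ⋂ j, {g : GL ι F | ‖(g⁻¹).val i j‖ ≤ R} := by
    ext g; simp [boundedGL, MatBdd]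
  rw [h]
  refine (MeasurableSet.iInter fun i => MeasurableSet.iInter fun j => ?_).inter
    (MeasurableSet.iInter fun i => MeasurableSet.iInter fun j => ?_)
  · exact measurableSet_le (measurable_matrix_apply (measurable_gl_val measurable_id) i j).norm
      measurable_const
  · exact measurableSet_le (measurable_matrix_apply (measurable_gl_val measurable_inv) i j).norm
      measurable_const

theorem measurableSet_unip_matBdd {n : ℕ} (R : ℝ) :
    MeasurableSet {u : unip F n | MatBdd (u : GL (Fin n) F).val R} := by
  have h : {u : unip F n | MatBdd (u : GL (Fin n) F).val R} =
      ⋂ i, ⋂ j, {u : unip F n | ‖(u : GL (Fin n) F).val i j‖ ≤ R} := by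
    ext g; simp [MatBdd]
  rw [h]
  exact MeasurableSet.iInter fun i => MeasurableSet.iInter fun j =>
    measurableSet_le (measurable_matrix_apply (measurable_gl_val measurable_subtype_coe) i j).norm
      measurable_const

theorem piMeasure_bdd_lt_top {κ : Type*} [Fintype κ] (R : ℝ) :
    piMeasure μ κ {x | ∀ k, ‖x k‖ ≤ R} < ∞ := by
  have h : {x : κ → F | ∀ k, ‖x k‖ ≤ R} = Set.univ.pi fun _ => Metric.closedBall 0 R := by
    ext x; simp
  rw [h, Measure.pi_pi]
  exact ENNReal.prod_lt_top fun _ _ => (isCompact_closedBall 0 R).measure_lt_top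

theorem unipMeasure_bdd_lt_top {n : ℕ} (R : ℝ) :
    unipMeasure μ n {u | MatBdd (u : GL (Fin n) F).val R} < ∞ := by
  rw [unipMeasure, Measure.map_apply measurable_unipOfCoords (measurableSet_unip_matBdd R)]
  refine (measure_mono fun x hx => ?_).trans_lt (piMeasure_bdd_lt_top (μ := μ) R)
  intro p
  have h := hx p.1.1 p.1.2
  rw [unipOfCoords_val] at h
  simpa [fillMatrix, p.2] using h

theorem unipMeasure_univ_ne_zero {n : ℕ} : unipMeasure μ n Set.univ ≠ 0 := by
  rw [unipMeasure, Measure.map_apply measurable_unipOfCoords MeasurableSet.univ, Set.preimage_univ,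
    Measure.pi_univ]
  exact Finset.prod_ne_zero_iff.2 fun _ _ => (NeZero.ne μ ∘ Measure.measure_univ_eq_zero.1)

/-- If u₀g and ug both lie in the bounded set, then uu₀⁻¹ = (ug)(u₀g)⁻¹ has coefficients bounded by
R². The slices are thus translates of subsets of one fixed set of finite measure, uniformly in g. -/
theorem unipMeasure_coset_le (hs : HasNormScaling μ) {n : ℕ} {R : ℝ} (hR : 0 ≤ R)
    (g : GL (Fin n) F) :
    unipMeasure μ n {u | (u : GL (Fin n) F) * g ∈ boundedGL (Fin n) F R} ≤
      unipMeasure μ n {u | MatBdd (u : GL (Fin n) F).val (R * R)} := by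
  by_cases h : ∃ u₀ : unip F n, (u₀ : GL (Fin n) F) * g ∈ boundedGL (Fin n) F R
  · obtain ⟨u₀, hu₀⟩ := h
    have h1 := measurePreserving_unip_mul (μ := μ) hs 1 u₀⁻¹
    rw [← h1.measure_preimage (measurableSet_unip_matBdd (R * R)).nullMeasurableSet]
    refine measure_mono fun u hu => ?_
    have h2 : ((1 * u * u₀⁻¹ : unip F n) : GL (Fin n) F) =
        ((u : GL (Fin n) F) * g) * ((u₀ : GL (Fin n) F) * g)⁻¹ := by
      simp
    change MatBdd ((1 * u * u₀⁻¹ : unip F n) : GL (Fin n) F).val (R * R)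
    rw [h2, Units.val_mul]
    exact hu.1.mul hu₀.2 hR hR
  · have : {u : unip F n | (u : GL (Fin n) F) * g ∈ boundedGL (Fin n) F R} = ∅ := by
      ext u; simpa using fun hu => h ⟨u, hu⟩
    rw [this]; simp

/-- The quotient measure on `N_n \ G_n` is the image of the measure on lower triangular
matrices. -/
theorem unipQuotGL_eq_map (hs : HasNormScaling μ) (n : ℕ) : unipQuotGL μ n =
    (lowerMeasure μ n).map fun b => Quotient.mk (QuotientGroup.rightRel (unip F n)) b :=
  quotientMeasure_eq_map (S := fun k : ℕ => boundedGL (Fin n) F k)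
    (c := fun k => unipMeasure μ n {u | MatBdd (u : GL (Fin n) F).val ((k : ℝ) * k)})
    (fun u₀ _ hf => lintegral_unip_mul_right hs u₀ hf) measurable_id
    (fun _ hf => lintegral_glMeasure_eq_lower hs hf) (fun k => measurableSet_boundedGL (k : ℝ))
    exists_mem_boundedGL (fun _ => (unipMeasure_bdd_lt_top _).ne)
    (fun k g => unipMeasure_coset_le hs k.cast_nonneg g) unipMeasure_univ_ne_zero

/-- The coordinates of U_{m+1} and the factor N_m from the Gauss decomposition of G_m together make
up N_{m+1}. -/
theorem lintegral_mirabolicMeasure_eq_lower (hs : HasNormScaling μ) {m : ℕ}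
    {f : mirabolic F (m + 1) → ℝ≥0∞} (hf : Measurable f) :
    ∫⁻ p, f p ∂(mirabolicMeasure μ (m + 1)) = ∫⁻ b, ∫⁻ u,
      f ((Subgroup.subgroupOfEquivOfLe (unip_le_mirabolic (m + 1))).symm u * mirabolicMk 0 b)
        ∂(unipMeasure μ (m + 1)) ∂(lowerMeasure μ m) := by
  have hm : Measurable fun y : (Fin m → F) × GL (Fin m) F => mirabolicMk y.1 y.2 :=
    measurable_mirabolicMk measurable_fst measurable_snd
  have hf1 : Measurable fun y : (Fin m → F) × GL (Fin m) F => f (mirabolicMk y.1 y.2) := hf.comp hm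
  have hf1' : Measurable fun g : GL (Fin m) F => ∫⁻ x, f (mirabolicMk x g) ∂(piMeasure μ _) :=
    hf1.lintegral_prod_left'
  rw [mirabolicMeasure, lintegral_map hf hm, lintegral_prod_symm _ hf1.aemeasurable,
    lintegral_glMeasure_eq_lower hs hf1']
  refine lintegral_congr fun b => ?_
  have he : ∀ u : unip F (m + 1), (((Subgroup.subgroupOfEquivOfLe
      (unip_le_mirabolic (m + 1))).symm u : mirabolic F (m + 1)) : GL (Fin (m + 1)) F) = u :=
    fun u => rfl
  have hf2 : Measurable fun u : unip F (m + 1) => f ((Subgroup.subgroupOfEquivOfLe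
      (unip_le_mirabolic (m + 1))).symm u * mirabolicMk 0 b) := by
    refine hf.comp (measurable_comap_iff.2 ?_)
    exact (measurable_subtype_coe (p := fun g => g ∈ unip F (m + 1))).mul
      (measurable_const (a := (mirabolicMk 0 b : GL (Fin (m + 1)) F)))
  have hf3 : Measurable fun x : {p : Fin (m + 1) × Fin (m + 1) // p.1 < p.2} → F =>
      f ((Subgroup.subgroupOfEquivOfLe (unip_le_mirabolic (m + 1))).symm (unipOfCoords x) *
        mirabolicMk 0 b) := hf2.comp measurable_unipOfCoords
  have hf4 : Measurable fun u : unip F m => ∫⁻ x, f (mirabolicMk x (u * b)) ∂(piMeasure μ _) :=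
    hf1'.comp (measurable_subtype_coe.mul measurable_const)
  rw [lintegral_unipMeasure hf4, lintegral_unipMeasure hf2, lintegral_joinFun (upperSplit m) hf3]
  refine lintegral_congr fun x => lintegral_congr fun z => congrArg f ?_
  apply Subtype.ext
  rw [mirabolicMk_mul, Subgroup.coe_mul, he, unipOfCoords_joinFun]
  rfl

theorem unipQuotMirabolic_eq_map (hs : HasNormScaling μ) (m : ℕ) : unipQuotMirabolic μ (m + 1) =
    (lowerMeasure μ m).map fun b => Quotient.mk
      (QuotientGroup.rightRel ((unip F (m + 1)).subgroupOf (mirabolic F (m + 1))))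
      (mirabolicMk 0 b) := by
  have he : Measurable (Subgroup.subgroupOfEquivOfLe (unip_le_mirabolic (F := F) (m + 1))).symm :=
    measurable_comap_iff.2 (measurable_comap_iff.2 measurable_subtype_coe)
  have hmap : ∀ f : (unip F (m + 1)).subgroupOf (mirabolic F (m + 1)) → ℝ≥0∞, Measurable f →
      ∫⁻ u, f u ∂((unipMeasure μ (m + 1)).map (Subgroup.subgroupOfEquivOfLe
        (unip_le_mirabolic (m + 1))).symm) = ∫⁻ u, f ((Subgroup.subgroupOfEquivOfLe
        (unip_le_mirabolic (m + 1))).symm u) ∂(unipMeasure μ (m + 1)) :=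
    fun f hf => lintegral_map hf he
  have hS : ∀ R : ℝ, MeasurableSet {p : mirabolic F (m + 1) | (p : GL (Fin (m + 1)) F) ∈
      boundedGL (Fin (m + 1)) F R} := fun R => measurable_subtype_coe (measurableSet_boundedGL R)
  refine quotientMeasure_eq_map
    (S := fun k : ℕ => {p | (p : GL (Fin (m + 1)) F) ∈ boundedGL (Fin (m + 1)) F k})
    (c := fun k => unipMeasure μ (m + 1) {u | MatBdd (u : GL (Fin (m + 1)) F).val ((k : ℝ) * k)})
    (fun u₀ f hf => ?_) (measurable_mirabolicMk measurable_const measurable_id)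
    (fun f hf => ?_) (fun k => hS k)
    (fun p => exists_mem_boundedGL _) (fun _ => (unipMeasure_bdd_lt_top _).ne)
    (fun k g => ?_) ?_
  · have h1 : Measurable fun u => f ((Subgroup.subgroupOfEquivOfLe
        (unip_le_mirabolic (m + 1))).symm u) := hf.comp he
    rw [hmap f hf, hmap (fun u => f (u * u₀)) (hf.comp (measurable_id.mul_const u₀)),
      ← lintegral_unip_mul_right hs (Subgroup.subgroupOfEquivOfLe (unip_le_mirabolic (m + 1)) u₀) h1]
    simp
  · rw [lintegral_mirabolicMeasure_eq_lower hs hf]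
    refine lintegral_congr fun b => ?_
    rw [hmap (fun u => f (u * mirabolicMk 0 b))
      (hf.comp (measurable_subtype_coe.mul measurable_const))]
  · rw [Measure.map_apply he]
    · exact unipMeasure_coset_le hs k.cast_nonneg (g : GL (Fin (m + 1)) F)
    · exact (measurable_subtype_coe.mul measurable_const) (hS k)
  · rw [Measure.map_apply he MeasurableSet.univ]
    exact unipMeasure_univ_ne_zero

end Bounded

/-! ### The measures on the coset spaces of the Shalika subgroup -/

section ShalikaQuotient

variable {F : Type*} [NontriviallyNormedField F]

theorem conjShuffle_apply {n : ℕ} (A : GL (Fin n ⊕ Fin n) F) (i j : Fin n ⊕ Fin n) :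
    (conjShuffle n A).val (shuffle n i) (shuffle n j) = A.val i j := by
  change (Matrix.reindex (shuffle n) (shuffle n) _) _ _ = _
  simp

theorem shalikaMk_apply {n : ℕ} (X : Matrix (Fin n) (Fin n) F) (g : GL (Fin n) F)
    (i j : Fin n ⊕ Fin n) : (shalikaMk X g).val (shuffle n i) (shuffle n j) =
      Matrix.fromBlocks g.val (X * g.val) 0 g.val i j := by
  rw [shalikaMk, conjShuffle_apply, upperBlock_mul_diagBlock_val]

/-- Upper triangular matrices, with arbitrary diagonal. -/
def IsUpper {n : ℕ} (Y : Matrix (Fin n) (Fin n) F) : Prop := ∀ i j, j < i → Y i j = 0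

theorem IsUpper.mul {n : ℕ} {Y Z : Matrix (Fin n) (Fin n) F} (hY : IsUpper Y) (hZ : IsUpper Z) :
    IsUpper (Y * Z) := fun i j hij => by
  rw [Matrix.mul_apply]
  refine Finset.sum_eq_zero fun k _ => ?_
  rcases lt_or_ge k i with h | h
  · rw [hY i k h, zero_mul]
  · rw [hZ k j (hij.trans_le h), mul_zero]

theorem IsUpperUnip.isUpper {n : ℕ} {u : Matrix (Fin n) (Fin n) F} (hu : IsUpperUnip u) :
    IsUpper u := fun _ _ hij => hu.eq_zero hij

/-- Under the shuffle the indices of the first block become 2i and those of the second 2j+1. Since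
2i < 2j+1 exactly when i ≤ j, the upper right block may have a non-zero diagonal. -/
theorem shalikaMk_mem_unip {n : ℕ} {Y : Matrix (Fin n) (Fin n) F} (hY : IsUpper Y) (u : unip F n) :
    shalikaMk Y (u : GL (Fin n) F) ∈ unip F (2 * n) := by
  intro i j hij
  obtain ⟨i, rfl⟩ := (shuffle n).surjective i
  obtain ⟨j, rfl⟩ := (shuffle n).surjective j
  refine (shalikaMk_apply Y _ i j).trans ?_
  rw [Matrix.one_apply]
  rcases i with i | i <;> rcases j with j | j
  · have h : j ≤ i := by simp [shuffle] at hij; omega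
    simp [u.2 i j h, Matrix.one_apply]
  · have h : j < i := by simp [shuffle] at hij; omega
    simp [hY.mul (isUpperUnip_coe u).isUpper i j h]
  · simp
  · have h : j ≤ i := by simp [shuffle] at hij; omega
    simp [u.2 i j h, Matrix.one_apply]

theorem isUpper_sub_fillMatrix {n : ℕ} (Z : Matrix (Fin n) (Fin n) F) :
    IsUpper (Z - fillMatrix 0 (fun i j => j < i) (coords (fun i j => j < i) Z)) := fun i j hij => by
  simp [fillMatrix, coords, hij]

/-- Moving an element of `N_n` from the right factor to the left. -/
theorem shalikaMk_unip_mul {n : ℕ} (X : Matrix (Fin n) (Fin n) F) (u : unip F n)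
    (g : GL (Fin n) F) : ∃ v ∈ unip F (2 * n), v ∈ shalika F n ∧ v ∈ shalikaP F n ∧
      shalikaMk X (u * g) = v * shalikaMk (fillMatrix 0 (fun i j => j < i)
        (coords (fun i j => j < i)
          ((u : GL (Fin n) F).inv * X * (u : GL (Fin n) F).val))) g := by
  set L := fillMatrix 0 (fun i j => j < i) (coords (fun i j => j < i)
          ((u : GL (Fin n) F).inv * X * (u : GL (Fin n) F).val)) with hL
  -- L is the strictly lower part of u⁻¹Xu, so X - uLu⁻¹ is the conjugate by u of an upper
  -- triangular matrix and can be moved into N_{2n}.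
  have h1 : X - (u : GL (Fin n) F).val * L * (u : GL (Fin n) F).inv = (u : GL (Fin n) F).val *
      ((u : GL (Fin n) F).inv * X * (u : GL (Fin n) F).val - L) * (u : GL (Fin n) F).inv := by
    rw [Matrix.mul_sub, Matrix.sub_mul]
    congr 1
    simp only [← Matrix.mul_assoc, (u : GL (Fin n) F).val_inv, Matrix.one_mul]
    rw [Matrix.mul_assoc, (u : GL (Fin n) F).val_inv, Matrix.mul_one]
  have h2 : IsUpper (X - (u : GL (Fin n) F).val * L * (u : GL (Fin n) F).inv) := by
    rw [h1]
    exact ((isUpperUnip_coe u).isUpper.mul (isUpper_sub_fillMatrix _)).mul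
      (isUpperUnip_inv u).isUpper
  have h3 : shalikaMk (X - (u : GL (Fin n) F).val * L * (u : GL (Fin n) F).inv)
      (u : GL (Fin n) F) ∈ shalikaP F n :=
    shalikaMk_mem_shalikaP _ (⟨u, unip_le_mirabolic n u.2⟩ : mirabolic F n)
  have h4 : shalikaMk X (u * g) = shalikaMk (X - (u : GL (Fin n) F).val * L *
      (u : GL (Fin n) F).inv) (u : GL (Fin n) F) * shalikaMk L g := by
    rw [shalikaMk_mul, sub_add_cancel]
  exact ⟨_, shalikaMk_mem_unip h2 u, h3.1, h3, h4⟩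

variable [ProperSpace F] [MeasurableSpace F] [BorelSpace F] {α : Type*} [MeasurableSpace α]

theorem measurable_shalikaMk {n : ℕ} {X : α → Matrix (Fin n) (Fin n) F} {g : α → GL (Fin n) F}
    (hX : Measurable X) (hg : Measurable g) : Measurable fun a => shalikaMk (X a) (g a) := by
  refine measurable_gl_iff.2 fun i j => ?_
  obtain ⟨i, rfl⟩ := (shuffle n).surjective i
  obtain ⟨j, rfl⟩ := (shuffle n).surjective j
  simp only [shalikaMk_apply]
  rcases i with i | i <;> rcases j with j | j
  · exact measurable_matrix_apply (measurable_gl_val hg) i j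
  · exact measurable_matrix_apply (measurable_matrix_mul hX (measurable_gl_val hg)) i j
  · exact measurable_const
  · exact measurable_matrix_apply (measurable_gl_val hg) i j

theorem measurable_strictLowerOfCoords {n : ℕ} :
    Measurable (strictLowerOfCoords : ({p : Fin n × Fin n // p.2 < p.1} → F) → strictLower F n) :=
  measurable_comap_iff.2 (measurable_fillMatrix 0 fun i j => j < i)

variable {μ : Measure F} [SigmaFinite μ] [μ.IsAddLeftInvariant]

instance sFinite_strictLowerMeasure (n : ℕ) : SFinite (strictLowerMeasure μ n) := by
  unfold strictLowerMeasure
  infer_instance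

/-- V_n is identified with M_n modulo upper triangular matrices. On this quotient conjugation by N_n
acts by unitriangular, hence volume preserving, maps. -/
theorem measurePreserving_strictLower_conj (hs : HasNormScaling μ) {n : ℕ} (u : unip F n) :
    MeasurePreserving (fun X : strictLower F n => strictLowerOfCoords (coords (fun i j => j < i)
      ((u : GL (Fin n) F).inv * (X : Matrix (Fin n) (Fin n) F) * (u : GL (Fin n) F).val)))
      (strictLowerMeasure μ n) (strictLowerMeasure μ n) := by
  have hm : Measurable fun X : strictLower F n => strictLowerOfCoords (coords (fun i j => j < i)
      ((u : GL (Fin n) F).inv * (X : Matrix (Fin n) (Fin n) F) * (u : GL (Fin n) F).val)) :=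
    measurable_strictLowerOfCoords.comp ((measurable_coords _).comp (measurable_matrix_mul
      (measurable_matrix_mul measurable_const measurable_subtype_coe) measurable_const))
  have h1 := measurePreserving_coords_mul (μ := μ) hs (fun i j => j < i) (isUpperUnip_inv u)
    (isUpperUnip_coe u)
  have h2 : strictLowerMeasure μ n = (piMeasure μ _).map strictLowerOfCoords := rfl
  refine ⟨hm, ?_⟩
  rw [h2, Measure.map_map hm measurable_strictLowerOfCoords]
  conv_rhs => rw [← h1.map_eq, Measure.map_map measurable_strictLowerOfCoords h1.measurable]
  rfl

attribute [local irreducible] shalikaMk coords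

/-- Replacing g by ug changes the coset of (X, g) only through the unimodular action of u on V_n, so
the image measure at g depends only on N_n g, and lower triangular representatives may be used. -/
theorem shalikaQuotMeasure_eq_map {μ : Measure F} [μ.IsAddHaarMeasure] [IsUltrametricDist F]
    (hs : HasNormScaling μ) (n : ℕ) :
    shalikaQuotMeasure μ n = ((lowerMeasure μ n).prod (strictLowerMeasure μ n)).map fun p =>
      (Quotient.mk _ (toShalika (p.2 : Matrix (Fin n) (Fin n) F) p.1) : ShalikaQuot F n) := by
  have hT : Measurable fun p : GL (Fin n) F × strictLower F n =>
      (Quotient.mk _ (toShalika (p.2 : Matrix (Fin n) (Fin n) F) p.1) : ShalikaQuot F n) :=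
    measurable_quotient_mk''.comp (Measurable.subtype_mk
      (measurable_shalikaMk (measurable_subtype_coe.comp measurable_snd) measurable_fst))
  have hTg : ∀ g, Measurable fun X : strictLower F n =>
      (Quotient.mk _ (toShalika (X : Matrix (Fin n) (Fin n) F) g) : ShalikaQuot F n) := fun g =>
    hT.comp measurable_prodMk_left
  rw [shalikaQuotMeasure, unipQuotGL_eq_map hs]
  refine bind_map_out_eq (N := unip F n) (T := fun (X : strictLower F n) g =>
    (Quotient.mk _ (toShalika (X : Matrix (Fin n) (Fin n) F) g) : ShalikaQuot F n))
    measurable_id hT fun u g => ?_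
  have h1 := measurePreserving_strictLower_conj (μ := μ) hs u
  conv_rhs => rw [← h1.map_eq, Measure.map_map (hTg g) h1.measurable]
  congr 1
  ext1 X
  obtain ⟨v, hv, hv', -, h⟩ := shalikaMk_unip_mul (X : Matrix (Fin n) (Fin n) F) u g
  have h2 : toShalika (X : Matrix (Fin n) (Fin n) F) (u * g) = (⟨v, hv'⟩ : shalika F n) *
      toShalika (strictLowerOfCoords (coords (fun i j => j < i) ((u : GL (Fin n) F).inv *
        (X : Matrix (Fin n) (Fin n) F) * (u : GL (Fin n) F).val)) : strictLower F n) g :=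
    Subtype.ext h
  rw [h2]
  exact mk_mul_eq (N := (unip F (2 * n)).subgroupOf (shalika F n)) ⟨⟨v, hv'⟩, hv⟩ _

theorem shalikaPQuotMeasure_eq_map {μ : Measure F} [μ.IsAddHaarMeasure] [IsUltrametricDist F]
    (hs : HasNormScaling μ) (m : ℕ) : shalikaPQuotMeasure μ (m + 1) =
      ((lowerMeasure μ m).prod (strictLowerMeasure μ (m + 1))).map fun p =>
      (Quotient.mk _ (toShalikaP (p.2 : Matrix (Fin (m + 1)) (Fin (m + 1)) F) (mirabolicMk 0 p.1)) :
        ShalikaPQuot F (m + 1)) := by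
  have hT : Measurable fun p : mirabolic F (m + 1) × strictLower F (m + 1) => (Quotient.mk _
      (toShalikaP (p.2 : Matrix (Fin (m + 1)) (Fin (m + 1)) F) p.1) : ShalikaPQuot F (m + 1)) :=
    measurable_quotient_mk''.comp (Measurable.subtype_mk
      (measurable_shalikaMk (measurable_subtype_coe.comp measurable_snd)
        (measurable_subtype_coe.comp measurable_fst)))
  have hTg : ∀ g, Measurable fun X : strictLower F (m + 1) => (Quotient.mk _
      (toShalikaP (X : Matrix (Fin (m + 1)) (Fin (m + 1)) F) g) : ShalikaPQuot F (m + 1)) :=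
    fun g => hT.comp measurable_prodMk_left
  rw [shalikaPQuotMeasure, unipQuotMirabolic_eq_map hs]
  refine bind_map_out_eq (N := (unip F (m + 1)).subgroupOf (mirabolic F (m + 1)))
    (T := fun (X : strictLower F (m + 1)) g =>
    (Quotient.mk _ (toShalikaP (X : Matrix (Fin (m + 1)) (Fin (m + 1)) F) g) :
      ShalikaPQuot F (m + 1)))
    (measurable_mirabolicMk measurable_const measurable_id) hT fun u' g => ?_
  obtain ⟨u, hu⟩ : ∃ u : unip F (m + 1), ((u' : mirabolic F (m + 1)) : GL (Fin (m + 1)) F) = u :=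
    ⟨⟨_, u'.2⟩, rfl⟩
  have h1 := measurePreserving_strictLower_conj (μ := μ) hs u
  conv_rhs => rw [← h1.map_eq, Measure.map_map (hTg g) h1.measurable]
  congr 1
  ext1 X
  obtain ⟨v, hv, -, hv', h⟩ := shalikaMk_unip_mul (X : Matrix (Fin (m + 1)) (Fin (m + 1)) F) u g
  have h2 : toShalikaP (X : Matrix (Fin (m + 1)) (Fin (m + 1)) F) (u' * g) =
      (⟨v, hv'⟩ : shalikaP F (m + 1)) * toShalikaP (strictLowerOfCoords (coords (fun i j => j < i)
        ((u : GL (Fin (m + 1)) F).inv * (X : Matrix (Fin (m + 1)) (Fin (m + 1)) F) *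
          (u : GL (Fin (m + 1)) F).val)) : strictLower F (m + 1)) g := by
    apply Subtype.ext
    refine Eq.trans ?_ h
    simp only [toShalikaP, Subgroup.coe_mul, hu]
  rw [h2]
  exact mk_mul_eq (N := (unip F (2 * (m + 1))).subgroupOf (shalikaP F (m + 1))) ⟨⟨v, hv'⟩, hv⟩ _

end ShalikaQuotient

/-! ### Locally constant functions with compact support on the linear group -/

section SchwartzGL

variable {F : Type*} [NontriviallyNormedField F] {ι : Type*} [Fintype ι] [DecidableEq ι]

/-- The invertible matrices which are `ε`-close to the identity, together with their inverse. -/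
def nearOne (ι : Type*) [Fintype ι] [DecidableEq ι] (F : Type*) [NontriviallyNormedField F]
    (ε : ℝ) : Set (GL ι F) := {k | MatBdd (k.val - 1) ε ∧ MatBdd ((k⁻¹).val - 1) ε}

theorem exists_finset_bound (C : ι → ι → ℝ) : ∃ R : ℝ, 0 ≤ R ∧ ∀ i j, C i j ≤ R := by
  refine ⟨∑ i, ∑ j, |C i j|, by positivity, fun i j => (le_abs_self _).trans ?_⟩
  exact (Finset.single_le_sum (f := fun j => |C i j|) (fun _ _ => abs_nonneg _)
    (Finset.mem_univ j)).trans (Finset.single_le_sum (f := fun i => ∑ j, |C i j|)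
      (fun _ _ => Finset.sum_nonneg fun _ _ => abs_nonneg _) (Finset.mem_univ i))

theorem continuous_gl_apply (i j : ι) : Continuous fun g : GL ι F => g.val i j :=
  Units.continuous_val.matrix_elem i j

theorem continuous_gl_inv_apply (i j : ι) : Continuous fun g : GL ι F => (g⁻¹).val i j :=
  (continuous_gl_apply i j).comp continuous_inv

variable [ProperSpace F] [MeasurableSpace F] [BorelSpace F]

theorem exists_nearOne_subset {U : Set (GL ι F)} (hU : U ∈ nhds 1) :
    ∃ ε > 0, nearOne ι F ε ⊆ U := by
  rw [(isEmbedding_gl_val (ι := ι) (F := F)).nhds_eq_comap, Filter.mem_comap] at hU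
  obtain ⟨V, hV, hVU⟩ := hU
  obtain ⟨ε, hε, hεV⟩ := (Metric.mem_nhds_iff (α := ι → ι → F)).1 hV
  refine ⟨ε / 2, half_pos hε, fun k hk => hVU (hεV ?_)⟩
  change dist (fun i j => k.val i j : ι → ι → F) _ < ε
  refine (dist_pi_le_iff (half_pos hε).le).2 (fun i => (dist_pi_le_iff (half_pos hε).le).2
    fun j => ?_) |>.trans_lt (half_lt_self hε)
  rw [dist_eq_norm]
  exact hk.1 i j

theorem IsSchwartzBruhat.exists_support_bdd {f : GL ι F → ℂ} (hf : IsSchwartzBruhat f) :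
    ∃ R : ℝ, 1 ≤ R ∧ ∀ g, f g ≠ 0 → g ∈ boundedGL ι F R := by
  have hK : IsCompact (tsupport f) := hf.2
  have h1 : ∀ i j, ∃ C : ℝ, ∀ g ∈ tsupport f, ‖g.val i j‖ ≤ C := fun i j =>
    hK.exists_bound_of_continuousOn (continuous_gl_apply i j).continuousOn
  have h2 : ∀ i j, ∃ C : ℝ, ∀ g ∈ tsupport f, ‖(g⁻¹).val i j‖ ≤ C := fun i j =>
    hK.exists_bound_of_continuousOn (continuous_gl_inv_apply i j).continuousOn
  choose C1 hC1 using h1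
  choose C2 hC2 using h2
  obtain ⟨R1, -, hR1⟩ := exists_finset_bound C1
  obtain ⟨R2, -, hR2⟩ := exists_finset_bound C2
  refine ⟨max 1 (max R1 R2), le_max_left _ _, fun g hg => ?_⟩
  have hg' : g ∈ tsupport f := subset_tsupport f hg
  exact ⟨fun i j => (hC1 i j g hg').trans ((hR1 i j).trans
      ((le_max_left _ _).trans (le_max_right _ _))),
    fun i j => (hC2 i j g hg').trans ((hR2 i j).trans
      ((le_max_right _ _).trans (le_max_right _ _)))⟩

theorem IsSchwartzBruhat.exists_norm_le {f : GL ι F → ℂ} (hf : IsSchwartzBruhat f) :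
    ∃ M : ℝ, 0 ≤ M ∧ ∀ g, ‖f g‖ ≤ M := by
  obtain ⟨C, hC⟩ := hf.2.exists_bound_of_continuous hf.1.continuous
  exact ⟨C, (norm_nonneg _).trans (hC 1), hC⟩

/-- Compactness of the support makes local constancy uniform, by the tube lemma applied to the open
set of pairs (k, g) with f(kg) = f(g). -/
theorem IsSchwartzBruhat.exists_left_invariant {f : GL ι F → ℂ} (hf : IsSchwartzBruhat f) :
    ∃ ε > 0, ∀ k ∈ nearOne ι F ε, ∀ g, f (k * g) = f g := by
  have hK : IsCompact (tsupport f) := hf.2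
  have hopen : IsOpen {p : GL ι F × GL ι F | f (p.1 * p.2) = f p.2} := by
    have h1 : IsLocallyConstant fun p : GL ι F × GL ι F => f (p.1 * p.2) :=
      hf.1.comp_continuous continuous_mul
    have h2 : IsLocallyConstant fun p : GL ι F × GL ι F => f p.2 :=
      hf.1.comp_continuous continuous_snd
    exact (h1.prodMk h2) {q : ℂ × ℂ | q.1 = q.2}
  obtain ⟨U, V, hU, -, h1U, hKV, hUV⟩ := generalized_tube_lemma (s := {(1 : GL ι F)})
    isCompact_singleton hK hopen (by rintro ⟨k, g⟩ ⟨hk, -⟩; simp at hk; simp [hk])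
  -- The neighbourhood is made symmetric: when g is outside the support but kg is inside, the
  -- argument is applied to k⁻¹ and kg.
  have h1 : (U ∩ U⁻¹) ∈ nhds (1 : GL ι F) := by
    refine Filter.inter_mem (hU.mem_nhds (h1U rfl)) (hU.inv.mem_nhds ?_)
    simpa using h1U rfl
  obtain ⟨ε, hε, hεU⟩ := exists_nearOne_subset h1
  refine ⟨ε, hε, fun k hk g => ?_⟩
  have hkU := hεU hk
  by_cases hg : g ∈ tsupport f
  · exact hUV (Set.mk_mem_prod hkU.1 (hKV hg))
  by_cases hkg : k * g ∈ tsupport f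
  · have : f (k⁻¹ * (k * g)) = f (k * g) := hUV (Set.mk_mem_prod (Set.mem_inv.1 hkU.2) (hKV hkg))
    rw [inv_mul_cancel_left] at this
    exact this.symm
  · rw [image_eq_zero_of_notMem_tsupport hg, image_eq_zero_of_notMem_tsupport hkg]

theorem IsSchwartzBruhat.measurable {f : GL ι F → ℂ} (hf : IsSchwartzBruhat f) : Measurable f :=
  hf.1.continuous.measurable

end SchwartzGL

/-! ### Additive characters -/

section Character

variable {F : Type*} [NontriviallyNormedField F] {ψ : AddChar F Circle}

/-- The circle has no small subgroups. A small ball of F is stable under integer multiples, so all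
powers of ψ(t) stay near 1, which forces ψ(t) = 1. -/
theorem exists_character_ball (hψc : Continuous ψ) [IsUltrametricDist F] :
    ∃ δ > 0, ∀ t : F, ‖t‖ ≤ δ → ψ t = 1 := by
  have h0 : Filter.Tendsto (fun t => ‖((ψ t : Circle) : ℂ) - 1‖) (nhds 0) (nhds 0) := by
    have h : Continuous fun t => ‖((ψ t : Circle) : ℂ) - 1‖ := by fun_prop
    simpa using h.tendsto 0
  obtain ⟨δ, hδ, hball⟩ := Metric.eventually_nhds_iff.1 (h0.eventually_lt_const (by norm_num : (0 : ℝ) < 1 / 2))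
  refine ⟨δ / 2, half_pos hδ, fun t ht => ?_⟩
  -- Integers have norm at most 1, so every multiple 2ᵏt stays in the ball on which ψ is within 1/2
  -- of 1.
  have hpow : ∀ k : ℕ, ‖((ψ t : Circle) : ℂ) ^ 2 ^ k - 1‖ < 1 / 2 := fun k => by
    have h1 : ‖((2 ^ k : ℕ) : F) * t‖ ≤ ‖t‖ := by
      rw [norm_mul]
      exact mul_le_of_le_one_left (norm_nonneg _) (IsUltrametricDist.norm_natCast_le_one F _)
    have h2 := hball (y := (2 ^ k : ℕ) • t) (by
      rw [dist_zero_right, nsmul_eq_mul]; linarith)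
    rwa [AddChar.map_nsmul_eq_pow, Circle.coe_pow] at h2
  -- From z² - 1 = (z - 1)(z + 1) and |z + 1| ≥ 3/2, each squaring multiplies the distance to 1 by
  -- at least 3/2, which cannot remain bounded unless the distance is zero.
  have hgrow : ∀ k : ℕ, (3 / 2 : ℝ) ^ k * ‖((ψ t : Circle) : ℂ) - 1‖ ≤
      ‖((ψ t : Circle) : ℂ) ^ 2 ^ k - 1‖ := fun k => by
    induction k with
    | zero => simp
    | succ k ih =>
      have h3 : ((ψ t : Circle) : ℂ) ^ 2 ^ (k + 1) - 1 =
          (((ψ t : Circle) : ℂ) ^ 2 ^ k - 1) * (((ψ t : Circle) : ℂ) ^ 2 ^ k + 1) := by ring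
      have h4 : (3 / 2 : ℝ) ≤ ‖((ψ t : Circle) : ℂ) ^ 2 ^ k + 1‖ := by
        have h5 := norm_sub_norm_le (2 : ℂ) (-(((ψ t : Circle) : ℂ) ^ 2 ^ k - 1))
        rw [norm_neg] at h5
        have h6 : (2 : ℂ) - -(((ψ t : Circle) : ℂ) ^ 2 ^ k - 1) =
            ((ψ t : Circle) : ℂ) ^ 2 ^ k + 1 := by ring
        rw [h6] at h5
        have h7 : ‖(2 : ℂ)‖ = 2 := by simp
        linarith [hpow k]
      rw [h3, norm_mul, pow_succ]
      nlinarith [norm_nonneg (((ψ t : Circle) : ℂ) ^ 2 ^ k - 1)]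
  by_contra hne
  have hpos : 0 < ‖((ψ t : Circle) : ℂ) - 1‖ := by
    rw [norm_pos_iff, sub_ne_zero]
    exact fun h => hne (by ext; simpa using h)
  obtain ⟨k, hk⟩ := pow_unbounded_of_one_lt (1 / ‖((ψ t : Circle) : ℂ) - 1‖)
    (by norm_num : (1 : ℝ) < 3 / 2)
  rw [div_lt_iff₀ hpos] at hk
  linarith [hgrow k, hpow k]

/-- For a fixed a with ψ(a) ≠ 1, the element t = a/x is small as soon as x is large; the constant is
|a|. -/
theorem exists_character_ne_one (hψ : ψ ≠ 1) : ∃ A : ℝ, 0 < A ∧ ∀ (δ : ℝ) (x : F), 0 < δ →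
    A / δ < ‖x‖ → ∃ t : F, ‖t‖ ≤ δ ∧ ψ (t * x) ≠ 1 := by
  obtain ⟨a, ha⟩ : ∃ a, ψ a ≠ 1 := by
    by_contra! h
    exact hψ (by ext t; simp [h t])
  have ha0 : a ≠ 0 := fun h => ha (by simp [h])
  refine ⟨‖a‖, norm_pos_iff.2 ha0, fun δ x hδ hx => ⟨a / x, ?_, ?_⟩⟩
  · have hx0 : 0 < ‖x‖ := (div_pos (norm_pos_iff.2 ha0) hδ).trans hx
    rw [norm_div, div_le_iff₀ hx0]
    rw [div_lt_iff₀ hδ] at hx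
    linarith
  · have hx0 : x ≠ 0 := norm_pos_iff.1 ((div_pos (norm_pos_iff.2 ha0) hδ).trans hx)
    rwa [div_mul_cancel₀ _ hx0]

end Character

/-! ### The characters of the unipotent group and of the Shalika subgroup -/

section Characters

variable {F : Type*} [NontriviallyNormedField F]

/-- The sum of the coefficients just above the diagonal. -/
def superSum {n : ℕ} (A : Matrix (Fin n) (Fin n) F) : F :=
  ∑ i : Fin n, ∑ j : Fin n, if (i : ℕ) + 1 = j then A i j else 0

theorem psiUnip_eq (ψ : AddChar F Circle) {n : ℕ} (u : unip F n) :
    psiUnip ψ u = ψ (superSum (u : GL (Fin n) F).val) := rfl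

theorem IsUpperUnip.mul_apply_succ {n : ℕ} {A B : Matrix (Fin n) (Fin n) F} (hA : IsUpperUnip A)
    (hB : IsUpperUnip B) {i j : Fin n} (hij : (i : ℕ) + 1 = j) :
    (A * B) i j = A i j + B i j := by
  have hne : i ≠ j := by intro h; rw [h] at hij; omega
  rw [Matrix.mul_apply, ← Finset.sum_subset (Finset.subset_univ {i, j}), Finset.sum_pair hne,
    hA.diag, hB.diag, one_mul, mul_one, add_comm]
  intro k _ hk
  simp only [Finset.mem_insert, Finset.mem_singleton, not_or] at hk
  rcases lt_or_gt_of_ne hk.1 with h | h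
  · rw [hA.eq_zero h, zero_mul]
  · have : j < k := by
      rw [Fin.lt_def] at h ⊢
      have : (k : ℕ) ≠ j := fun h' => hk.2 (Fin.ext h')
      omega
    rw [hB.eq_zero this, mul_zero]

theorem IsUpperUnip.superSum_mul {n : ℕ} {A B : Matrix (Fin n) (Fin n) F} (hA : IsUpperUnip A)
    (hB : IsUpperUnip B) : superSum (A * B) = superSum A + superSum B := by
  simp only [superSum, ← Finset.sum_add_distrib]
  refine Finset.sum_congr rfl fun i _ => Finset.sum_congr rfl fun j _ => ?_
  split_ifs with h
  · exact hA.mul_apply_succ hB h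
  · simp

theorem psiUnip_mul (ψ : AddChar F Circle) {n : ℕ} (u v : unip F n) :
    psiUnip ψ (u * v) = psiUnip ψ u * psiUnip ψ v := by
  rw [psiUnip_eq, Subgroup.coe_mul, Units.val_mul,
    (isUpperUnip_coe u).superSum_mul (isUpperUnip_coe v), AddChar.map_add_eq_mul]
  rfl

/-- After shuffling, superdiagonal positions are of two kinds: (2i, 2i+1), which comes from the
diagonal of the upper right block, and (2i+1, 2i+2), which comes from the superdiagonal of the lower
left block. -/
theorem superSum_conjShuffle {n : ℕ} (A : GL (Fin n ⊕ Fin n) F) :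
    superSum (conjShuffle n A).val = A.val.toBlocks₁₂.trace + superSum A.val.toBlocks₂₁ := by
  rw [superSum, ← (shuffle n).sum_comp]
  simp_rw [← (shuffle n).sum_comp (fun q => if (((shuffle n _ : Fin (2 * n)) : ℕ) + 1 = (q : ℕ)) then
    (conjShuffle n A).val _ q else 0), conjShuffle_apply, Fintype.sum_sum_type]
  congr 1
  · refine Finset.sum_congr rfl fun i _ => ?_
    rw [Finset.sum_eq_zero, zero_add, Finset.sum_eq_single i]
    · simp [shuffle, Matrix.toBlocks₁₂]
    · intro j _ hj
      refine if_neg fun h => hj (Fin.ext ?_)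
      simp [shuffle] at h
      omega
    · simp
    · intro j _
      refine if_neg fun h => ?_
      simp [shuffle] at h
      omega
  · refine Finset.sum_congr rfl fun i _ => ?_
    rw [add_comm, Finset.sum_eq_zero, zero_add]
    · refine Finset.sum_congr rfl fun j _ => ?_
      refine if_congr ?_ rfl rfl
      simp [shuffle]
      omega
    · intro j _
      refine if_neg fun h => ?_
      simp [shuffle] at h
      omega

theorem superSum_shalikaMk {n : ℕ} (X : Matrix (Fin n) (Fin n) F) (g : GL (Fin n) F) :
    superSum (shalikaMk X g).val = (X * g.val).trace := by
  rw [shalikaMk, superSum_conjShuffle, upperBlock_mul_diagBlock_val]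
  simp [superSum]

theorem trace_conj {n : ℕ} (g : GL (Fin n) F) (X : Matrix (Fin n) (Fin n) F) :
    (g.val * X * g.inv).trace = X.trace := by
  rw [Matrix.trace_mul_comm, ← Matrix.mul_assoc, g.inv_val, Matrix.one_mul]

theorem toShalika_mul {n : ℕ} (X Y : Matrix (Fin n) (Fin n) F) (g k : GL (Fin n) F) :
    toShalika X g * toShalika Y k = toShalika (X + g.val * Y * g.inv) (g * k) :=
  Subtype.ext (shalikaMk_mul X Y g k)

theorem exists_eq_toShalika {n : ℕ} (s : shalika F n) : ∃ X g, s = toShalika X g := by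
  obtain ⟨s, X, g, rfl⟩ := s
  exact ⟨X, g, rfl⟩

theorem theta_mul (ψ : AddChar F Circle) {n : ℕ} (s t : shalika F n) :
    theta ψ (s * t) = theta ψ s * theta ψ t := by
  obtain ⟨X, g, rfl⟩ := exists_eq_toShalika s
  obtain ⟨Y, k, rfl⟩ := exists_eq_toShalika t
  rw [toShalika_mul, theta_shalikaMk, theta_shalikaMk, theta_shalikaMk, Matrix.trace_add,
    trace_conj, AddChar.map_add_eq_mul]

theorem IsUpper.trace_mul {n : ℕ} {Y u : Matrix (Fin n) (Fin n) F} (hY : IsUpper Y)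
    (hu : IsUpperUnip u) : (Y * u).trace = Y.trace := by
  refine Finset.sum_congr rfl fun i _ => ?_
  rw [Matrix.diag_apply, Matrix.mul_apply, Finset.sum_eq_single i, hu.diag, mul_one,
    Matrix.diag_apply]
  · intro k _ hk
    rcases lt_or_gt_of_ne hk with h | h
    · rw [hY i k h, zero_mul]
    · rw [hu.eq_zero h, mul_zero]
  · simp

theorem exists_of_shalikaMk_mem_unip {n : ℕ} {X : Matrix (Fin n) (Fin n) F} {g : GL (Fin n) F}
    (h : shalikaMk X g ∈ unip F (2 * n)) : g ∈ unip F n ∧ IsUpper X := by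
  have hg : g ∈ unip F n := fun i j hij => by
    have h1 := h (shuffle n (Sum.inl i)) (shuffle n (Sum.inl j)) (by simp [shuffle]; omega)
    refine Eq.trans ?_ (h1.trans ?_)
    · exact (shalikaMk_apply X g (Sum.inl i) (Sum.inl j)).symm
    · simp [Matrix.one_apply]
  refine ⟨hg, ?_⟩
  have h2 : IsUpper (X * g.val) := fun i j hij => by
    have h1 := h (shuffle n (Sum.inl i)) (shuffle n (Sum.inr j)) (by simp [shuffle]; omega)
    refine (shalikaMk_apply X g (Sum.inl i) (Sum.inr j)).symm.trans (h1.trans ?_)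
    simp
  have h3 : X = X * g.val * g.inv := by rw [Matrix.mul_assoc, g.val_inv, Matrix.mul_one]
  rw [h3]
  exact h2.mul (isUpperUnip_inv ⟨g, hg⟩).isUpper

/-- On H_n ∩ N_{2n} the matrix X is upper triangular and g unipotent, and the generic character
gives Tr(Xg), which is then Tr X. This compatibility makes the integrand of the theorem descend to
cosets. -/
theorem theta_eq_psiUnip (ψ : AddChar F Circle) {n : ℕ} (s : shalika F n)
    (hs : (s : GL (Fin (2 * n)) F) ∈ unip F (2 * n)) :
    theta ψ s = psiUnip ψ ⟨(s : GL (Fin (2 * n)) F), hs⟩ := by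
  obtain ⟨X, g, rfl⟩ := exists_eq_toShalika s
  obtain ⟨hg, hX⟩ := exists_of_shalikaMk_mem_unip hs
  rw [theta_shalikaMk, psiUnip_eq]
  congr 1
  exact (hX.trace_mul (isUpperUnip_coe ⟨g, hg⟩)).symm.trans (superSum_shalikaMk X g).symm

end Characters

/-! ### Measurability and equivariance of the Whittaker function -/

section Whittaker

variable {F : Type*} [NontriviallyNormedField F] [ProperSpace F] [MeasurableSpace F] [BorelSpace F]
  {ψ : AddChar F Circle}

theorem measurable_superSum {α : Type*} [MeasurableSpace α] {n : ℕ}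
    {A : α → Matrix (Fin n) (Fin n) F} (hA : Measurable A) : Measurable fun a => superSum (A a) := by
  unfold superSum
  refine Finset.measurable_sum _ fun i _ => Finset.measurable_sum _ fun j _ => ?_
  split_ifs
  · exact measurable_matrix_apply hA i j
  · exact measurable_const

theorem measurable_character (hψc : Continuous ψ) : Measurable fun t => ((ψ t : Circle) : ℂ) :=
  (by fun_prop : Continuous fun t => ((ψ t : Circle) : ℂ)).measurable

theorem measurable_psiUnip (hψc : Continuous ψ) {n : ℕ} :
    Measurable fun u : unip F n => ((psiUnip ψ u : Circle) : ℂ) :=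
  (measurable_character hψc).comp (measurable_superSum (measurable_gl_val measurable_subtype_coe))

/-- θ is defined by choosing X; measurability comes from recovering X from the coefficients of s, as
the block Xg times the inverse of the block g. -/
theorem measurable_theta (hψc : Continuous ψ) {n : ℕ} :
    Measurable fun s : shalika F n => ((theta ψ s : Circle) : ℂ) := by
  have h : ∀ s : shalika F n, theta ψ s = ψ (Matrix.trace
      (Matrix.of (fun i j => (s : GL (Fin (2 * n)) F).val (shuffle n (Sum.inl i))
        (shuffle n (Sum.inr j))) * ((toGL (Matrix.of fun i j => (s : GL (Fin (2 * n)) F).val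
          (shuffle n (Sum.inl i)) (shuffle n (Sum.inl j))))⁻¹).val)) := fun s => by
    obtain ⟨X, g, rfl⟩ := exists_eq_toShalika s
    have h1 : (Matrix.of (fun i j => (toShalika X g : GL (Fin (2 * n)) F).val
        (shuffle n (Sum.inl i)) (shuffle n (Sum.inr j)))) = X * g.val := by
      ext i j
      exact shalikaMk_apply X g (Sum.inl i) (Sum.inr j)
    have h2 : (Matrix.of (fun i j => (toShalika X g : GL (Fin (2 * n)) F).val
        (shuffle n (Sum.inl i)) (shuffle n (Sum.inl j)))) = g.val := by
      ext i j
      exact shalikaMk_apply X g (Sum.inl i) (Sum.inl j)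
    rw [theta_shalikaMk, h1, h2, toGL_coe, Matrix.mul_assoc, ← Units.val_mul, mul_inv_cancel,
      Units.val_one, Matrix.mul_one]
  simp only [h]
  refine (measurable_character hψc).comp ?_
  have h3 : ∀ i j, Measurable fun s : shalika F n => (s : GL (Fin (2 * n)) F).val i j := fun i j =>
    measurable_matrix_apply (measurable_gl_val measurable_subtype_coe) i j
  have h4 : Measurable fun s : shalika F n => (Matrix.of (fun i j =>
      (s : GL (Fin (2 * n)) F).val (shuffle n (Sum.inl i)) (shuffle n (Sum.inr j))) *
      ((toGL (Matrix.of fun i j => (s : GL (Fin (2 * n)) F).val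
          (shuffle n (Sum.inl i)) (shuffle n (Sum.inl j))))⁻¹).val) := by
    refine measurable_matrix_mul (measurable_matrix_iff.2 fun i j => h3 _ _)
      (measurable_gl_val (measurable_toGL.comp ?_).inv)
    exact measurable_matrix_iff.2 fun i j => h3 _ _
  exact Finset.measurable_sum _ fun i _ => measurable_matrix_apply h4 i i

variable {μ : Measure F} [SigmaFinite μ]

theorem measurable_whittaker_integrand (hψc : Continuous ψ) {n : ℕ} {f : GL (Fin n) F → ℂ}
    (hf : Measurable f) : Measurable fun p : (GL (Fin n) F × GL (Fin n) F) × unip F n =>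
      f (p.1.1⁻¹ * (p.2 : GL (Fin n) F) * p.1.2) * (psiUnip ψ p.2 : ℂ)⁻¹ :=
  (hf.comp (((measurable_fst.comp measurable_fst).inv.mul
    (measurable_subtype_coe.comp measurable_snd)).mul (measurable_snd.comp measurable_fst))).mul
    ((measurable_psiUnip hψc).comp measurable_snd).inv

theorem measurable_whittaker_integrand_right (hψc : Continuous ψ) {n : ℕ} {f : GL (Fin n) F → ℂ}
    (hf : Measurable f) (g₁ g₂ : GL (Fin n) F) : Measurable fun u : unip F n =>
      f (g₁⁻¹ * (u : GL (Fin n) F) * g₂) * (psiUnip ψ u : ℂ)⁻¹ :=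
  (hf.comp ((measurable_const.mul measurable_subtype_coe).mul measurable_const)).mul
    (measurable_psiUnip hψc).inv

theorem measurable_whittaker (hψc : Continuous ψ) {n : ℕ} {f : GL (Fin n) F → ℂ}
    (hf : Measurable f) : Measurable fun p : GL (Fin n) F × GL (Fin n) F =>
      whittaker μ ψ f p.1 p.2 :=
  ((measurable_whittaker_integrand hψc hf).stronglyMeasurable.integral_prod_right'
    (ν := unipMeasure μ n)).measurable

/-- Substitute u ↦ u₁uu₂⁻¹ in the defining integral. -/
theorem whittaker_unip_mul [μ.IsAddLeftInvariant] (hs : HasNormScaling μ) (hψc : Continuous ψ)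
    {n : ℕ} {f : GL (Fin n) F → ℂ} (hf : Measurable f) (u₁ u₂ : unip F n) (g₁ g₂ : GL (Fin n) F) :
    whittaker μ ψ f (u₁ * g₁) (u₂ * g₂) =
      (psiUnip ψ u₁ : ℂ)⁻¹ * (psiUnip ψ u₂ : ℂ) * whittaker μ ψ f g₁ g₂ := by
  have h1 := measurePreserving_unip_mul (μ := μ) hs u₁ u₂⁻¹
  have hm : Measurable fun u : unip F n => f ((u₁ * g₁)⁻¹ * (u : GL (Fin n) F) * (u₂ * g₂)) *
      (psiUnip ψ u : ℂ)⁻¹ :=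
    measurable_whittaker_integrand_right hψc hf _ _
  rw [whittaker, ← h1.map_eq, integral_map h1.measurable.aemeasurable
    hm.stronglyMeasurable.aestronglyMeasurable, whittaker, ← integral_const_mul]
  refine integral_congr_ae (Filter.Eventually.of_forall fun u => ?_)
  have h2 : (u₁ * g₁)⁻¹ * ((u₁ * u * u₂⁻¹ : unip F n) : GL (Fin n) F) * (u₂ * g₂) =
      g₁⁻¹ * (u : GL (Fin n) F) * g₂ := by
    simp only [Subgroup.coe_mul, Subgroup.coe_inv]; group
  have h3 : (psiUnip ψ (u₁ * u * u₂⁻¹) : ℂ)⁻¹ =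
      (psiUnip ψ u₁ : ℂ)⁻¹ * (psiUnip ψ u₂ : ℂ) * (psiUnip ψ u : ℂ)⁻¹ := by
    have h4 : psiUnip ψ u₂⁻¹ * psiUnip ψ u₂ = 1 := by
      rw [← psiUnip_mul, inv_mul_cancel, psiUnip_eq]
      simp [superSum, Matrix.one_apply, Fin.ext_iff]
      refine (congrArg ψ (Finset.sum_eq_zero fun i _ => Finset.sum_eq_zero fun j _ => ?_)).trans
        (AddChar.map_zero_eq_one ψ)
      split_ifs <;> first | rfl | omega
    rw [psiUnip_mul, psiUnip_mul, eq_inv_of_mul_eq_one_left h4]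
    simp only [Circle.coe_mul, Circle.coe_inv, mul_inv, inv_inv]
    ring
  simp only [h2, h3]
  ring

theorem whittaker_left_invariant {n : ℕ} {f : GL (Fin n) F → ℂ} {k : GL (Fin n) F}
    (hk : ∀ g, f (k⁻¹ * g) = f g) (g₁ g₂ : GL (Fin n) F) :
    whittaker μ ψ f (g₁ * k) g₂ = whittaker μ ψ f g₁ g₂ := by
  unfold whittaker
  simp only [_root_.mul_inv_rev, mul_assoc, hk]

end Whittaker

/-! ### The integrand on the coset spaces -/

section Unfolded

variable {F : Type*} [NontriviallyNormedField F] [ProperSpace F] [MeasurableSpace F] [BorelSpace F]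
  {ψ : AddChar F Circle} {μ : Measure F} [SigmaFinite μ] [μ.IsAddLeftInvariant]

/-- The factors by which W_f changes with the representatives are exactly cancelled by those of θ,
since θ and ψ agree on the intersection with N_{2n}. -/
theorem unfoldedIntegrand_mk (hs : HasNormScaling μ) (hψc : Continuous ψ) {n : ℕ}
    {f : GL (Fin (2 * n)) F → ℂ} (hf : Measurable f) (s : shalikaP F n) (t : shalika F n) :
    unfoldedIntegrand μ ψ f (Quotient.mk _ s) (Quotient.mk _ t) =
      whittaker μ ψ f (s : GL (Fin (2 * n)) F) (t : GL (Fin (2 * n)) F) *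
        (theta ψ t : ℂ)⁻¹ * (theta ψ ⟨s.1, s.2.1⟩ : ℂ) := by
  obtain ⟨u, hu⟩ := exists_out_eq ((unip F (2 * n)).subgroupOf (shalikaP F n)) s
  obtain ⟨v, hv⟩ := exists_out_eq ((unip F (2 * n)).subgroupOf (shalika F n)) t
  have h1 : theta ψ (⟨((u : shalikaP F n) * s).1, ((u : shalikaP F n) * s).2.1⟩ : shalika F n) =
      psiUnip ψ ⟨u.1.1, u.2⟩ * theta ψ ⟨s.1, s.2.1⟩ := by
    rw [← theta_eq_psiUnip ψ ⟨u.1.1, u.1.2.1⟩ u.2, ← theta_mul]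
    rfl
  have h2 : theta ψ ((v : shalika F n) * t) = psiUnip ψ ⟨v.1.1, v.2⟩ * theta ψ t := by
    rw [← theta_eq_psiUnip ψ v.1 v.2, theta_mul]
  have h3 := whittaker_unip_mul (μ := μ) hs hψc hf ⟨u.1.1, u.2⟩ ⟨v.1.1, v.2⟩
    (s : GL (Fin (2 * n)) F) (t : GL (Fin (2 * n)) F)
  have key : ∀ (a : shalikaP F n) (b : shalika F n), a = u * s → b = v * t →
      whittaker μ ψ f (a : GL (Fin (2 * n)) F) (b : GL (Fin (2 * n)) F) *
        (theta ψ b : ℂ)⁻¹ * (theta ψ ⟨a.1, a.2.1⟩ : ℂ) =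
      whittaker μ ψ f (s : GL (Fin (2 * n)) F) (t : GL (Fin (2 * n)) F) *
        (theta ψ t : ℂ)⁻¹ * (theta ψ ⟨s.1, s.2.1⟩ : ℂ) := by
    rintro a b rfl rfl
    rw [h1, h2]
    refine (congrArg (fun z : ℂ => z * _ * _) h3).trans ?_
    simp only [Circle.coe_mul]
    have h4 : ((psiUnip ψ ⟨u.1.1, u.2⟩ : Circle) : ℂ) ≠ 0 := Circle.coe_ne_zero _
    have h5 : ((psiUnip ψ ⟨v.1.1, v.2⟩ : Circle) : ℂ) ≠ 0 := Circle.coe_ne_zero _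
    have h6 : ((theta ψ t : Circle) : ℂ) ≠ 0 := Circle.coe_ne_zero _
    field_simp
  exact key _ _ hu hv

instance secondCountable_gl {ι : Type*} [Fintype ι] [DecidableEq ι] :
    SecondCountableTopology (GL ι F) := by
  have : SecondCountableTopology (Matrix ι ι F) :=
    inferInstanceAs (SecondCountableTopology (ι → ι → F))
  exact (isEmbedding_gl_val (ι := ι) (F := F)).secondCountableTopology

theorem nearOne_mem_nhds {ι : Type*} [Fintype ι] [DecidableEq ι] {ε : ℝ} (hε : 0 < ε) :
    nearOne ι F ε ∈ nhds (1 : GL ι F) := by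
  have h : nearOne ι F ε = (⋂ i, ⋂ j, {g : GL ι F | ‖g.val i j - (1 : Matrix ι ι F) i j‖ ≤ ε}) ∩
      ⋂ i, ⋂ j, {g : GL ι F | ‖(g⁻¹).val i j - (1 : Matrix ι ι F) i j‖ ≤ ε} := by
    ext g; simp [nearOne, MatBdd]
  rw [h]
  refine Filter.inter_mem (Filter.iInter_mem.2 fun i => Filter.iInter_mem.2 fun j => ?_)
    (Filter.iInter_mem.2 fun i => Filter.iInter_mem.2 fun j => ?_)
  · have hc : Continuous fun g : GL ι F => ‖g.val i j - (1 : Matrix ι ι F) i j‖ :=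
      ((continuous_gl_apply i j).sub continuous_const).norm
    refine (hc.tendsto 1).eventually_le_const ?_
    simpa using hε
  · have hc : Continuous fun g : GL ι F => ‖(g⁻¹).val i j - (1 : Matrix ι ι F) i j‖ :=
      ((continuous_gl_inv_apply i j).sub continuous_const).norm
    refine (hc.tendsto 1).eventually_le_const ?_
    simpa using hε

/-- Near the identity Xg is small and g⁻¹ is integral, so X = (Xg)g⁻¹ has small trace, on which ψ is
trivial. -/
theorem theta_nearOne [IsUltrametricDist F] (hψc : Continuous ψ) (n : ℕ) : ∃ ε > 0, ∀ s : shalika F n,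
    (s : GL (Fin (2 * n)) F) ∈ nearOne (Fin (2 * n)) F ε → theta ψ s = 1 := by
  obtain ⟨δ, hδ, hball⟩ := exists_character_ball hψc
  -- The bound 1 keeps g⁻¹ integral, and the bound δ makes Xg, hence X, fall in the ball where ψ is
  -- trivial.
  refine ⟨min 1 δ, lt_min one_pos hδ, fun s hsε => ?_⟩
  obtain ⟨X, g, rfl⟩ := exists_eq_toShalika s
  have hinv : (toShalika X g : GL (Fin (2 * n)) F)⁻¹ = shalikaMk (-(g.inv * X * g.val)) g⁻¹ := by
    rw [inv_eq_iff_mul_eq_one]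
    change shalikaMk X g * _ = 1
    rw [shalikaMk_mul, mul_inv_cancel]
    have h : X + g.val * -(g.inv * X * g.val) * g.inv = 0 := by
      rw [Matrix.mul_neg, Matrix.neg_mul, ← Matrix.mul_assoc, ← Matrix.mul_assoc, g.val_inv,
        Matrix.one_mul, Matrix.mul_assoc, g.val_inv, Matrix.mul_one, add_neg_cancel]
    rw [h, shalikaMk_zero_one]
  have h1 : MatBdd (X * g.val) (min 1 δ) := fun i j => by
    have h2 := hsε.1 (shuffle n (Sum.inl i)) (shuffle n (Sum.inr j))
    rw [Matrix.sub_apply] at h2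
    rw [show (toShalika X g : GL (Fin (2 * n)) F).val (shuffle n (Sum.inl i))
      (shuffle n (Sum.inr j)) = (X * g.val) i j from shalikaMk_apply X g (Sum.inl i) (Sum.inr j)] at h2
    simpa using h2
  have h2 : MatBdd g.inv 1 := fun i j => by
    have h3 := hsε.2 (shuffle n (Sum.inl i)) (shuffle n (Sum.inl j))
    rw [hinv, Matrix.sub_apply, shalikaMk_apply] at h3
    have h4 : ‖(g⁻¹).val i j - (1 : Matrix (Fin n) (Fin n) F) i j‖ ≤ 1 := by
      refine le_trans (le_of_eq ?_) (h3.trans (min_le_left _ _))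
      simp [Matrix.one_apply]
    have h5 : g.inv i j = ((g⁻¹).val i j - (1 : Matrix (Fin n) (Fin n) F) i j) +
      (1 : Matrix (Fin n) (Fin n) F) i j := by rw [sub_add_cancel]; rfl
    rw [h5]
    refine (IsUltrametricDist.norm_add_le_max _ _).trans (max_le h4 ?_)
    rw [Matrix.one_apply]; split_ifs <;> simp
  have h3 : X = X * g.val * g.inv := by rw [Matrix.mul_assoc, g.val_inv, Matrix.mul_one]
  have h4 : MatBdd X δ := by
    rw [h3]
    refine (h1.mul h2 (lt_min one_pos hδ).le zero_le_one).mono ?_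
    rw [mul_one]; exact min_le_right _ _
  rw [theta_shalikaMk]
  exact hball _ (IsUltrametricDist.norm_sum_le_of_forall_le_of_nonneg hδ.le fun i _ => h4 i i)

theorem nearOne_mono {ι : Type*} [Fintype ι] [DecidableEq ι] {ε ε' : ℝ} (h : ε ≤ ε') :
    nearOne ι F ε ⊆ nearOne ι F ε' := fun _ hk => ⟨hk.1.mono h, hk.2.mono h⟩

theorem nearOne_inv {ι : Type*} [Fintype ι] [DecidableEq ι] {ε : ℝ} {k : GL ι F}
    (hk : k ∈ nearOne ι F ε) : k⁻¹ ∈ nearOne ι F ε := ⟨hk.2, by rw [inv_inv]; exact hk.1⟩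

attribute [local irreducible] whittaker theta nearOne unfoldedIntegrand

theorem measurable_unfoldedIntegrand_right (hs : HasNormScaling μ) (hψc : Continuous ψ) {n : ℕ}
    {f : GL (Fin (2 * n)) F → ℂ} (hf : Measurable f) (s : shalikaP F n) :
    Measurable fun q : ShalikaQuot F n => unfoldedIntegrand μ ψ f (Quotient.mk _ s) q := by
  refine measurable_from_quotient.2 ?_
  have h : (fun q : ShalikaQuot F n => unfoldedIntegrand μ ψ f (Quotient.mk _ s) q) ∘
      (Quotient.mk'' : shalika F n → ShalikaQuot F n) = fun t : shalika F n =>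
      whittaker μ ψ f (s : GL (Fin (2 * n)) F) (t : GL (Fin (2 * n)) F) *
        (theta ψ t : ℂ)⁻¹ * (theta ψ ⟨s.1, s.2.1⟩ : ℂ) :=
    funext fun t => unfoldedIntegrand_mk hs hψc hf s t
  rw [h]
  refine Measurable.mul (Measurable.mul ?_ (measurable_theta hψc).inv) measurable_const
  have h1 : Measurable fun t : shalika F n => ((s : GL (Fin (2 * n)) F), (t : GL (Fin (2 * n)) F)) :=
    measurable_const.prodMk measurable_subtype_coe
  exact (measurable_whittaker (μ := μ) hψc hf).comp h1

/-- Translates of the interior of V by a dense sequence cover the group, and the index is the first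
translate that meets the coset. The conditions are measurable on the quotient because their
preimages are unions of open sets. -/
theorem exists_measurable_index {G : Type*} [Group G] [TopologicalSpace G] [IsTopologicalGroup G]
    [SecondCountableTopology G] [MeasurableSpace G] [BorelSpace G] (N : Subgroup G) {V : Set G}
    (hV : V ∈ nhds 1) : ∃ (d : ℕ → G) (idx : LeftQuotient N → ℕ), Measurable idx ∧
      ∀ q, ∃ k ∈ V, Quotient.mk _ (d (idx q) * k) = q := by
  classical
  have hV1 : (1 : G) ∈ interior V := mem_interior_iff_mem_nhds.2 hV
  set d : ℕ → G := TopologicalSpace.denseSeq G with hd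
  have hex : ∀ q : LeftQuotient N, ∃ i, ∃ k ∈ interior V, Quotient.mk _ (d i * k) = q := by
    intro q
    obtain ⟨s, rfl⟩ := Quotient.exists_rep q
    have hopen : IsOpen {t : G | t⁻¹ * s ∈ interior V} :=
      isOpen_interior.preimage (continuous_inv.mul continuous_const)
    obtain ⟨i, hi⟩ := (TopologicalSpace.denseRange_denseSeq G).exists_mem_open hopen
      ⟨s, by simpa using hV1⟩
    exact ⟨i, _, hi, by rw [← hd, mul_inv_cancel_left]⟩
  have hmeas : ∀ i, MeasurableSet
      {q : LeftQuotient N | ∃ k ∈ interior V, Quotient.mk _ (d i * k) = q} := by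
    intro i
    rw [measurableSet_quotient]
    have h1 : (Quotient.mk'' ⁻¹' {q : LeftQuotient N | ∃ k ∈ interior V,
        Quotient.mk _ (d i * k) = q} : Set G) =
        ⋃ u : N, {s | (d i)⁻¹ * ((u : G) * s) ∈ interior V} := by
      ext s
      simp only [Set.mem_preimage, Set.mem_ofPred_eq, Set.mem_iUnion]
      constructor
      · rintro ⟨k, hk, hks⟩
        have h2 : (QuotientGroup.rightRel N) s (d i * k) := Quotient.exact hks.symm
        rw [QuotientGroup.rightRel_apply] at h2
        exact ⟨⟨_, h2⟩, by simpa using hk⟩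
      · rintro ⟨u, hu⟩
        refine ⟨_, hu, ?_⟩
        rw [mul_inv_cancel_left]
        exact mk_mul_eq u s
    rw [h1]
    refine (isOpen_iUnion fun u => isOpen_interior.preimage ?_).measurableSet
    exact continuous_const.mul (continuous_const.mul continuous_id)
  refine ⟨d, fun q => Nat.find (hex q), measurable_find hex hmeas, fun q => ?_⟩
  obtain ⟨k, hk, hkq⟩ := Nat.find_spec (hex q)
  exact ⟨k, interior_subset hk, hkq⟩

theorem unfoldedIntegrand_mul_right (hs : HasNormScaling μ) (hψc : Continuous ψ) {n : ℕ}
    {f : GL (Fin (2 * n)) F → ℂ} (hf : Measurable f) {k : shalikaP F n}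
    (hfk : ∀ g, f ((k : GL (Fin (2 * n)) F)⁻¹ * g) = f g)
    (hk : theta ψ (⟨k.1, k.2.1⟩ : shalika F n) = 1) (s : shalikaP F n) (q : ShalikaQuot F n) :
    unfoldedIntegrand μ ψ f (Quotient.mk _ (s * k)) q =
      unfoldedIntegrand μ ψ f (Quotient.mk _ s) q := by
  obtain ⟨t, rfl⟩ := Quotient.exists_rep q
  rw [unfoldedIntegrand_mk hs hψc hf, unfoldedIntegrand_mk hs hψc hf]
  have h1 : theta ψ (⟨(s * k).1, (s * k).2.1⟩ : shalika F n) = theta ψ ⟨s.1, s.2.1⟩ := by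
    have h2 := theta_mul ψ (⟨s.1, s.2.1⟩ : shalika F n) ⟨k.1, k.2.1⟩
    rw [hk, mul_one] at h2
    exact h2
  rw [h1, Subgroup.coe_mul, whittaker_left_invariant hfk]

/-- Joint measurability is delicate because each factor carries a quotient σ-algebra, whose product
need not be the quotient of the product σ-algebra. Invariance under right translation of the first
variable by a neighbourhood of 1 lets this variable enter only through a countable measurable index.
-/
theorem measurable_unfoldedIntegrand [IsUltrametricDist F] (hs : HasNormScaling μ)
    (hψc : Continuous ψ) {n : ℕ} {f : GL (Fin (2 * n)) F → ℂ} (hf : IsSchwartzBruhat f) :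
    Measurable fun ξ : ShalikaPQuot F n × ShalikaQuot F n => unfoldedIntegrand μ ψ f ξ.1 ξ.2 := by
  obtain ⟨ε₁, hε₁, hf₁⟩ := hf.exists_left_invariant
  obtain ⟨ε₂, hε₂, hθ⟩ := theta_nearOne (F := F) hψc n
  have hV1 : {s : shalikaP F n | (s : GL (Fin (2 * n)) F) ∈ nearOne (Fin (2 * n)) F (min ε₁ ε₂)} ∈
      nhds (1 : shalikaP F n) :=
    (continuous_subtype_val.tendsto (1 : shalikaP F n)) (nearOne_mem_nhds (lt_min hε₁ hε₂))
  have : SecondCountableTopology (shalikaP F n) :=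
    TopologicalSpace.Subtype.secondCountableTopology (shalikaP F n : Set (GL (Fin (2 * n)) F))
  obtain ⟨d, idx, hidx, hd⟩ :=
    exists_measurable_index ((unip F (2 * n)).subgroupOf (shalikaP F n)) hV1
  have hG : Measurable fun p : ShalikaQuot F n × ℕ =>
      unfoldedIntegrand μ ψ f (Quotient.mk _ (d p.2)) p.1 :=
    measurable_from_prod_countable_left fun i =>
      measurable_unfoldedIntegrand_right hs hψc hf.measurable (d i)
  have heq : (fun ξ : ShalikaPQuot F n × ShalikaQuot F n => unfoldedIntegrand μ ψ f ξ.1 ξ.2) =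
      fun ξ => unfoldedIntegrand μ ψ f (Quotient.mk _ (d (idx ξ.1))) ξ.2 := by
    ext ξ
    obtain ⟨k, hk, hkq⟩ := hd ξ.1
    conv_lhs => rw [← hkq]
    exact unfoldedIntegrand_mul_right hs hψc hf.measurable
      (fun g => hf₁ _ (nearOne_inv (nearOne_mono (min_le_left _ _) hk)) g)
      (hθ ⟨k.1, k.2.1⟩ (nearOne_mono (min_le_right _ _) hk)) _ _
  have hpair : Measurable fun ξ : ShalikaPQuot F n × ShalikaQuot F n => (ξ.2, idx ξ.1) :=
    measurable_snd.prodMk (hidx.comp measurable_fst)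
  rw [heq]
  exact hG.comp hpair

end Unfolded

/-! ### The decomposition of the unipotent group along the Shalika subgroup -/

section UnipDecomposition

variable {F : Type*} [NontriviallyNormedField F]

/-- The matrix `(1 0; C U)`. -/
def lowBlock {n : ℕ} (C : Matrix (Fin n) (Fin n) F) (U : GL (Fin n) F) : GL (Fin n ⊕ Fin n) F where
  val := Matrix.fromBlocks 1 0 C U.val
  inv := Matrix.fromBlocks 1 0 (-(U.inv * C)) U.inv
  val_inv := by
    rw [Matrix.fromBlocks_multiply, Matrix.mul_neg, ← Matrix.mul_assoc, U.val_inv]; simp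
  inv_val := by
    rw [Matrix.fromBlocks_multiply, U.inv_val]; simp

theorem lowBlock_val {n : ℕ} (C : Matrix (Fin n) (Fin n) F) (U : GL (Fin n) F) :
    (lowBlock C U).val = Matrix.fromBlocks 1 0 C U.val := rfl

variable (F) in
/-- Pairs of strictly upper triangular matrices, given by their coordinates. -/
abbrev UpperPairs (n : ℕ) : Type _ :=
  ({p : Fin n × Fin n // p.1 < p.2} → F) × ({p : Fin n × Fin n // p.1 < p.2} → F)

/-- The matrix `(1 0; C 1+D)` where `C` and `D` are strictly upper triangular. -/
def complBlock {n : ℕ} (w : UpperPairs F n) : GL (Fin n ⊕ Fin n) F :=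
  lowBlock (fillMatrix 0 (· < ·) w.1) (unipOfCoords w.2 : GL (Fin n) F)

theorem complBlock_val {n : ℕ} (w : UpperPairs F n) : (complBlock w).val =
    Matrix.fromBlocks 1 0 (fillMatrix 0 (· < ·) w.1) (fillMatrix 1 (· < ·) w.2) := rfl

/-- The positions above the diagonal in `{1, …, 2n}`, sorted by the parity of the row and of the
column. -/
def shufflePos (n : ℕ) : {p : Fin n × Fin n // p.1 < p.2} ⊕ ({p : Fin n × Fin n // p.1 ≤ p.2} ⊕
      ({p : Fin n × Fin n // p.1 < p.2} ⊕ {p : Fin n × Fin n // p.1 < p.2})) →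
    {p : Fin (2 * n) × Fin (2 * n) // p.1 < p.2}
  | Sum.inl p => ⟨(shuffle n (Sum.inl p.1.1), shuffle n (Sum.inl p.1.2)), by
      have := p.2; simp [shuffle]; omega⟩
  | Sum.inr (Sum.inl p) => ⟨(shuffle n (Sum.inl p.1.1), shuffle n (Sum.inr p.1.2)), by
      have := p.2; simp [shuffle]; omega⟩
  | Sum.inr (Sum.inr (Sum.inl p)) => ⟨(shuffle n (Sum.inr p.1.1), shuffle n (Sum.inl p.1.2)), by
      have := p.2; simp [shuffle]; omega⟩
  | Sum.inr (Sum.inr (Sum.inr p)) => ⟨(shuffle n (Sum.inr p.1.1), shuffle n (Sum.inr p.1.2)), by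
      have := p.2; simp [shuffle]; omega⟩

/-- The inverse of `shufflePos`. -/
def shuffleSplit (n : ℕ) : {p : Fin (2 * n) × Fin (2 * n) // p.1 < p.2} ≃
    {p : Fin n × Fin n // p.1 < p.2} ⊕ ({p : Fin n × Fin n // p.1 ≤ p.2} ⊕
      ({p : Fin n × Fin n // p.1 < p.2} ⊕ {p : Fin n × Fin n // p.1 < p.2})) :=
  (Equiv.ofBijective (shufflePos n) (by
      constructor
      · rintro (⟨⟨i, j⟩, h⟩ | ⟨⟨i, j⟩, h⟩ | ⟨⟨i, j⟩, h⟩ | ⟨⟨i, j⟩, h⟩)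
          (⟨⟨i', j'⟩, h'⟩ | ⟨⟨i', j'⟩, h'⟩ | ⟨⟨i', j'⟩, h'⟩ | ⟨⟨i', j'⟩, h'⟩) <;>
          simp [shufflePos]
      · rintro ⟨⟨p, q⟩, h⟩
        obtain ⟨p, rfl⟩ := (shuffle n).surjective p
        obtain ⟨q, rfl⟩ := (shuffle n).surjective q
        rcases p with i | i <;> rcases q with j | j
        · exact ⟨Sum.inl ⟨(i, j), by simp [shuffle] at h; simpa using h⟩, rfl⟩
        · exact ⟨Sum.inr (Sum.inl ⟨(i, j), by simp [shuffle] at h; simp; omega⟩), rfl⟩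
        · exact ⟨Sum.inr (Sum.inr (Sum.inl ⟨(i, j), by simp [shuffle] at h; simp; omega⟩)), rfl⟩
        · exact ⟨Sum.inr (Sum.inr (Sum.inr ⟨(i, j), by simp [shuffle] at h; simpa using h⟩)),
            rfl⟩)).symm

theorem unipOfCoords_shuffle {n : ℕ} (a c d : {p : Fin n × Fin n // p.1 < p.2} → F)
    (b : {p : Fin n × Fin n // p.1 ≤ p.2} → F) {A : GL (Fin n ⊕ Fin n) F}
    (hA : A.val = Matrix.fromBlocks (fillMatrix 1 (· < ·) a) (fillMatrix 0 (· ≤ ·) b)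
      (fillMatrix 0 (· < ·) c) (fillMatrix 1 (· < ·) d)) :
    (unipOfCoords (joinFun (shuffleSplit n) (a, joinFun (Equiv.refl _)
      (b, joinFun (Equiv.refl _) (c, d)))) : GL (Fin (2 * n)) F) = conjShuffle n A := by
  apply Units.ext
  ext p q
  obtain ⟨p, rfl⟩ := (shuffle n).surjective p
  obtain ⟨q, rfl⟩ := (shuffle n).surjective q
  rw [conjShuffle_apply, unipOfCoords_val, hA, fillMatrix, Matrix.of_apply]
  rcases p with i | i <;> rcases q with j | j
  · by_cases h : i < j
    · have h' : shuffle n (Sum.inl i) < shuffle n (Sum.inl j) := by simp [shuffle]; omega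
      simp only [h', h, dite_true, Matrix.fromBlocks_apply₁₁, fillMatrix, Matrix.of_apply]
      exact joinFun_apply_of_symm (shuffleSplit n) _ (s := Sum.inl ⟨(i, j), h⟩) rfl
    · have h' : ¬ shuffle n (Sum.inl i) < shuffle n (Sum.inl j) := by simp [shuffle]; omega
      simp only [h', h, dite_false, Matrix.fromBlocks_apply₁₁, fillMatrix, Matrix.of_apply]
      simp [Matrix.one_apply]
  · by_cases h : i ≤ j
    · have h' : shuffle n (Sum.inl i) < shuffle n (Sum.inr j) := by simp [shuffle]; omega
      simp only [h', h, dite_true, Matrix.fromBlocks_apply₁₂, fillMatrix, Matrix.of_apply]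
      exact joinFun_apply_of_symm (shuffleSplit n) _ (s := Sum.inr (Sum.inl ⟨(i, j), h⟩)) rfl
    · have h' : ¬ shuffle n (Sum.inl i) < shuffle n (Sum.inr j) := by simp [shuffle]; omega
      simp only [h', h, dite_false, Matrix.fromBlocks_apply₁₂, fillMatrix, Matrix.of_apply]
      simp
  · by_cases h : i < j
    · have h' : shuffle n (Sum.inr i) < shuffle n (Sum.inl j) := by simp [shuffle]; omega
      simp only [h', h, dite_true, Matrix.fromBlocks_apply₂₁, fillMatrix, Matrix.of_apply]
      exact joinFun_apply_of_symm (shuffleSplit n) _ (s := Sum.inr (Sum.inr (Sum.inl ⟨(i, j), h⟩))) rfl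
    · have h' : ¬ shuffle n (Sum.inr i) < shuffle n (Sum.inl j) := by simp [shuffle]; omega
      simp only [h', h, dite_false, Matrix.fromBlocks_apply₂₁, fillMatrix, Matrix.of_apply]
      simp
  · by_cases h : i < j
    · have h' : shuffle n (Sum.inr i) < shuffle n (Sum.inr j) := by simp [shuffle]; omega
      simp only [h', h, dite_true, Matrix.fromBlocks_apply₂₂, fillMatrix, Matrix.of_apply]
      exact joinFun_apply_of_symm (shuffleSplit n) _ (s := Sum.inr (Sum.inr (Sum.inr ⟨(i, j), h⟩))) rfl
    · have h' : ¬ shuffle n (Sum.inr i) < shuffle n (Sum.inr j) := by simp [shuffle]; omega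
      simp only [h', h, dite_false, Matrix.fromBlocks_apply₂₂, fillMatrix, Matrix.of_apply]
      simp [Matrix.one_apply]

/-- Strictly upper triangular matrices. -/
def IsStrictUpper {n : ℕ} (Y : Matrix (Fin n) (Fin n) F) : Prop := ∀ i j, j ≤ i → Y i j = 0

theorem IsStrictUpper.mul_isUpper {n : ℕ} {Y Z : Matrix (Fin n) (Fin n) F} (hY : IsStrictUpper Y)
    (hZ : IsUpper Z) : IsStrictUpper (Y * Z) := fun i j hij => by
  rw [Matrix.mul_apply]
  refine Finset.sum_eq_zero fun k _ => ?_
  rcases le_or_gt k i with h | h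
  · rw [hY i k h, zero_mul]
  · rw [hZ k j (hij.trans_lt h), mul_zero]

theorem isStrictUpper_fillMatrix {n : ℕ} (x : {p : Fin n × Fin n // p.1 < p.2} → F) :
    IsStrictUpper (fillMatrix 0 (· < ·) x) := fun i j hij => by
  simp [fillMatrix, not_lt.2 hij]

theorem isUpper_fillMatrix {n : ℕ} (x : {p : Fin n × Fin n // p.1 ≤ p.2} → F) :
    IsUpper (fillMatrix 0 (· ≤ ·) x) := fun i j hij => by
  simp [fillMatrix, not_le.2 hij]

theorem IsStrictUpper.fillMatrix_coords {n : ℕ} {Y : Matrix (Fin n) (Fin n) F}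
    (h : IsStrictUpper Y) : fillMatrix 0 (· < ·) (coords (· < ·) Y) = Y :=
  LinearPeriod.fillMatrix_coords fun i j hij => by rw [h i j (not_lt.1 hij)]; rfl

theorem IsUpper.fillMatrix_coords {n : ℕ} {Y : Matrix (Fin n) (Fin n) F}
    (h : IsUpper Y) : fillMatrix 0 (· ≤ ·) (coords (· ≤ ·) Y) = Y :=
  LinearPeriod.fillMatrix_coords fun i j hij => by rw [h i j (not_le.1 hij)]; rfl

theorem IsUpperUnip.fillMatrix_coords {n : ℕ} {Y : Matrix (Fin n) (Fin n) F}
    (h : IsUpperUnip Y) : fillMatrix 1 (· < ·) (coords (· < ·) Y) = Y :=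
  LinearPeriod.fillMatrix_coords fun i j hij => (h i j (not_lt.1 hij)).symm

theorem isUpperUnip_fillMatrix {n : ℕ} (x : {p : Fin n × Fin n // p.1 < p.2} → F) :
    IsUpperUnip (fillMatrix 1 (· < ·) x) := isUpperUnip_coe (unipOfCoords x)

theorem fillMatrix_one_eq {n : ℕ} (x : {p : Fin n × Fin n // p.1 < p.2} → F) :
    fillMatrix 1 (· < ·) x = 1 + fillMatrix 0 (· < ·) x :=
  fillMatrix_eq_add (fun _ _ hij => Matrix.one_apply_ne hij.ne) x

theorem IsUpperUnip.add_isStrictUpper {n : ℕ} {Y Z : Matrix (Fin n) (Fin n) F}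
    (hY : IsUpperUnip Y) (hZ : IsStrictUpper Z) : IsUpperUnip (Y + Z) := fun i j hij => by
  rw [Matrix.add_apply, hZ i j hij, add_zero, hY i j hij]

theorem complBlock_mul_val {n : ℕ} (w : UpperPairs F n) (a : GL (Fin n) F)
    (Y : Matrix (Fin n) (Fin n) F) :
    (complBlock w * (diagBlock a * upperBlock Y) : GL (Fin n ⊕ Fin n) F).val =
      Matrix.fromBlocks a.val (a.val * Y) (fillMatrix 0 (· < ·) w.1 * a.val)
        (fillMatrix 0 (· < ·) w.1 * a.val * Y + fillMatrix 1 (· < ·) w.2 * a.val) := by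
  rw [Units.val_mul, Units.val_mul, complBlock_val]
  simp [diagBlock, upperBlock, Matrix.fromBlocks_multiply, Matrix.mul_assoc]

variable [ProperSpace F] [MeasurableSpace F] [BorelSpace F]

theorem measurable_conjShuffle {n : ℕ} {α : Type*} [MeasurableSpace α]
    {A : α → GL (Fin n ⊕ Fin n) F} (hA : Measurable A) : Measurable fun a => conjShuffle n (A a) := by
  refine measurable_gl_iff.2 fun i j => ?_
  obtain ⟨i, rfl⟩ := (shuffle n).surjective i
  obtain ⟨j, rfl⟩ := (shuffle n).surjective j
  simp only [conjShuffle_apply]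
  exact measurable_gl_iff.1 hA i j

theorem measurable_fromBlocks_iff {n : ℕ} {α : Type*} [MeasurableSpace α]
    {g : α → GL (Fin n ⊕ Fin n) F} {A B C D : α → Matrix (Fin n) (Fin n) F} (hA : Measurable A)
    (hB : Measurable B) (hC : Measurable C) (hD : Measurable D)
    (h : ∀ a, (g a).val = Matrix.fromBlocks (A a) (B a) (C a) (D a)) : Measurable g := by
  refine measurable_gl_iff.2 fun i j => ?_
  simp only [h]
  rcases i with i | i <;> rcases j with j | j
  · exact measurable_matrix_apply hA i j
  · exact measurable_matrix_apply hB i j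
  · exact measurable_matrix_apply hC i j
  · exact measurable_matrix_apply hD i j

theorem measurable_complBlock {n : ℕ} : Measurable (complBlock : UpperPairs F n → _) :=
  measurable_fromBlocks_iff measurable_const measurable_const
    ((measurable_fillMatrix 0 (· < ·)).comp measurable_fst)
    ((measurable_fillMatrix 1 (· < ·)).comp measurable_snd) complBlock_val

theorem measurable_upperBlock {n : ℕ} : Measurable (upperBlock : Matrix (Fin n) (Fin n) F → _) :=
  measurable_fromBlocks_iff measurable_const measurable_id measurable_const measurable_const
    fun _ => rfl

theorem measurable_diagBlock {n : ℕ} : Measurable (diagBlock : GL (Fin n) F → _) :=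
  measurable_fromBlocks_iff (measurable_gl_val measurable_id) measurable_const measurable_const
    (measurable_gl_val measurable_id) fun _ => rfl

variable {μ : Measure F} [SigmaFinite μ] [μ.IsAddLeftInvariant]

variable (μ) in
/-- The product measure on pairs of strictly upper triangular matrices. -/
abbrev upperPairsMeasure (n : ℕ) : Measure (UpperPairs F n) :=
  (piMeasure μ {p : Fin n × Fin n // p.1 < p.2}).prod
    (piMeasure μ {p : Fin n × Fin n // p.1 < p.2})

attribute [local irreducible] conjShuffle unipOfCoords

theorem lintegral_unip_shuffle {n : ℕ} {T : GL (Fin (2 * n)) F → ℝ≥0∞} (hT : Measurable T) :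
    ∫⁻ u, T (u : GL (Fin (2 * n)) F) ∂(unipMeasure μ (2 * n)) =
      ∫⁻ a, ∫⁻ b, ∫⁻ c, ∫⁻ d, T (unipOfCoords (joinFun (shuffleSplit n) (a, joinFun (Equiv.refl _)
      (b, joinFun (Equiv.refl _) (c, d)))) : GL (Fin (2 * n)) F) ∂(piMeasure μ _) ∂(piMeasure μ _)
        ∂(piMeasure μ _) ∂(piMeasure μ _) := by
  have h0 : Measurable fun u : unip F (2 * n) => T (u : GL (Fin (2 * n)) F) :=
    hT.comp measurable_subtype_coe
  have h1 : Measurable fun x : {p : Fin (2 * n) × Fin (2 * n) // p.1 < p.2} → F =>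
      T (unipOfCoords x : GL (Fin (2 * n)) F) :=
    h0.comp measurable_unipOfCoords
  rw [lintegral_unipMeasure h0, lintegral_joinFun (shuffleSplit n) h1]
  refine lintegral_congr fun a => ?_
  have h2 : Measurable fun z => T (unipOfCoords (joinFun (shuffleSplit n) (a, z)) :
      GL (Fin (2 * n)) F) :=
    h1.comp ((measurePreserving_joinFun (μ := μ) (shuffleSplit n)).measurable.comp
      measurable_prodMk_left)
  rw [lintegral_joinFun (Equiv.refl _) h2]
  refine lintegral_congr fun b => ?_
  have h3 : Measurable fun z => T (unipOfCoords (joinFun (shuffleSplit n) (a, joinFun (Equiv.refl _)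
      (b, z))) : GL (Fin (2 * n)) F) :=
    h2.comp ((measurePreserving_joinFun (μ := μ) (Equiv.refl _)).measurable.comp
      measurable_prodMk_left)
  exact lintegral_joinFun (Equiv.refl _) h3

end UnipDecomposition

/-! ### Unfolding the integral over the coset space of the Shalika subgroup -/

section Unfolding

variable {F : Type*} [NontriviallyNormedField F]

theorem superSum_add {n : ℕ} (A B : Matrix (Fin n) (Fin n) F) :
    superSum (A + B) = superSum A + superSum B := by
  simp only [superSum, ← Finset.sum_add_distrib]
  refine Finset.sum_congr rfl fun i _ => Finset.sum_congr rfl fun j _ => ?_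
  split_ifs <;> simp

theorem superSum_one {n : ℕ} : superSum (1 : Matrix (Fin n) (Fin n) F) = 0 := by
  refine Finset.sum_eq_zero fun i _ => Finset.sum_eq_zero fun j _ => ?_
  split_ifs with h
  · exact Matrix.one_apply_ne (by rintro rfl; omega)
  · rfl

theorem IsStrictUpper.superSum_mul {n : ℕ} {C A : Matrix (Fin n) (Fin n) F} (hC : IsStrictUpper C)
    (hA : IsUpperUnip A) : superSum (C * A) = superSum C := by
  have h := (IsUpperUnip.one.add_isStrictUpper hC).superSum_mul hA
  rw [Matrix.add_mul, Matrix.one_mul, superSum_add, superSum_add, superSum_one, zero_add,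
    add_comm (superSum C)] at h
  exact add_left_cancel h

/-- The lower left block is Ca and the upper right block is aY. A unipotent factor a changes neither
the superdiagonal of a strictly upper triangular C nor the trace of an upper triangular Y. -/
theorem superSum_complBlock_mul {n : ℕ} (w : UpperPairs F n) (a : unip F n)
    {Y : Matrix (Fin n) (Fin n) F} (hY : IsUpper Y) :
    superSum (conjShuffle n (complBlock w * (diagBlock (a : GL (Fin n) F) * upperBlock Y))).val =
      superSum (fillMatrix 0 (· < ·) w.1) + Y.trace := by
  rw [superSum_conjShuffle, complBlock_mul_val, Matrix.toBlocks_fromBlocks₁₂,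
    Matrix.toBlocks_fromBlocks₂₁, (isStrictUpper_fillMatrix w.1).superSum_mul (isUpperUnip_coe a),
    Matrix.trace_mul_comm, hY.trace_mul (isUpperUnip_coe a), add_comm]

/-- All positions, divided into those below the diagonal and the other ones. -/
def triSplit (n : ℕ) : Fin n × Fin n ≃
    {p : Fin n × Fin n // p.2 < p.1} ⊕ {p : Fin n × Fin n // p.1 ≤ p.2} :=
  ((Equiv.sumCongr (Equiv.refl _) (Equiv.subtypeEquivRight fun _ => not_lt.symm)).trans
    (Equiv.sumCompl fun p : Fin n × Fin n => p.2 < p.1)).symm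

theorem of_joinFun_triSplit {n : ℕ} (x : {p : Fin n × Fin n // p.2 < p.1} → F)
    (y : {p : Fin n × Fin n // p.1 ≤ p.2} → F) :
    (Matrix.of fun i j => joinFun (triSplit n) (x, y) (i, j)) =
      fillMatrix 0 (fun i j => j < i) x + fillMatrix 0 (· ≤ ·) y := by
  ext i j
  rw [Matrix.of_apply, Matrix.add_apply]
  rcases lt_or_ge j i with h | h
  · refine (joinFun_apply_of_symm (triSplit n) _ (s := Sum.inl ⟨(i, j), h⟩) rfl).trans ?_
    simp [fillMatrix, h, not_le.2 h]
  · refine (joinFun_apply_of_symm (triSplit n) _ (s := Sum.inr ⟨(i, j), h⟩) rfl).trans ?_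
    simp [fillMatrix, h, not_lt.2 h]

variable [ProperSpace F] [MeasurableSpace F] [BorelSpace F] {μ : Measure F} [SigmaFinite μ]

theorem lintegral_strictLowerMeasure {n : ℕ} {f : strictLower F n → ℝ≥0∞} (hf : Measurable f) :
    ∫⁻ X, f X ∂(strictLowerMeasure μ n) = ∫⁻ x, f (strictLowerOfCoords x) ∂(piMeasure μ _) :=
  lintegral_map hf measurable_strictLowerOfCoords

theorem measurable_add_fill {n : ℕ} : Measurable fun p : strictLower F n ×
    ({p : Fin n × Fin n // p.1 ≤ p.2} → F) =>
      (p.1 : Matrix (Fin n) (Fin n) F) + fillMatrix 0 (· ≤ ·) p.2 :=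
  measurable_matrix_iff.2 fun i j =>
    (measurable_matrix_apply (measurable_subtype_coe.comp measurable_fst) i j).add
      (measurable_matrix_apply ((measurable_fillMatrix 0 (· ≤ ·)).comp measurable_snd) i j)

theorem lintegral_matrixMeasure_tri {n : ℕ} {G : Matrix (Fin n) (Fin n) F → ℝ≥0∞}
    (hG : Measurable G) : ∫⁻ Z, G Z ∂(matrixMeasure μ n) =
      ∫⁻ X : strictLower F n, ∫⁻ y, G ((X : Matrix (Fin n) (Fin n) F) + fillMatrix 0 (· ≤ ·) y)
        ∂(piMeasure μ _) ∂(strictLowerMeasure μ n) := by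
  have h1 := measurePreserving_matrixOf (μ := μ) n
  have h2 : Measurable fun x : Fin n × Fin n → F => G (Matrix.of fun i j => x (i, j)) :=
    hG.comp h1.measurable
  have h3 : Measurable fun X : strictLower F n =>
      ∫⁻ y, G ((X : Matrix (Fin n) (Fin n) F) + fillMatrix 0 (· ≤ ·) y) ∂(piMeasure μ _) :=
    (hG.comp measurable_add_fill).lintegral_prod_right'
  rw [← h1.lintegral_comp hG, lintegral_joinFun (triSplit n) h2, lintegral_strictLowerMeasure h3]
  refine lintegral_congr fun x => lintegral_congr fun y => congrArg G ?_
  exact of_joinFun_triSplit x y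

variable [μ.IsAddLeftInvariant]

attribute [local irreducible] conjShuffle unipOfCoords

/-- A skew product: C ↦ CA is unimodular, and for fixed C the second coordinate undergoes the same
linear map followed by a translation. -/
theorem measurePreserving_upperPairs_mul (hs : HasNormScaling μ) {n : ℕ}
    {A : Matrix (Fin n) (Fin n) F} (hA : IsUpperUnip A) (Y : Matrix (Fin n) (Fin n) F) :
    MeasurePreserving (fun w : UpperPairs F n =>
      (coords (· < ·) (fillMatrix 0 (· < ·) w.1 * A), coords (· < ·)
        (fillMatrix 0 (· < ·) w.1 * A * Y + fillMatrix 1 (· < ·) w.2 * A)))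
      (upperPairsMeasure μ n) (upperPairsMeasure μ n) := by
  have h1 : MeasurePreserving (fun x => coords (· < ·) (fillMatrix 0 (· < ·) x * A))
      (piMeasure μ {p : Fin n × Fin n // p.1 < p.2}) (piMeasure μ _) := by
    have h := measurePreserving_coords_mul (μ := μ) hs (· < ·) IsUpperUnip.one hA
    simpa only [Matrix.one_mul] using h
  have hfill : ∀ B : Matrix (Fin n) (Fin n) F, Measurable
      (fun x : UpperPairs F n => fillMatrix B (· < ·) x.1) := fun B =>
    (measurable_fillMatrix B (· < ·)).comp measurable_fst
  have hfill' : ∀ B : Matrix (Fin n) (Fin n) F, Measurable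
      (fun x : UpperPairs F n => fillMatrix B (· < ·) x.2) := fun B =>
    (measurable_fillMatrix B (· < ·)).comp measurable_snd
  refine h1.skew_product (g := fun c d => coords (· < ·)
        (fillMatrix 0 (· < ·) c * A * Y + fillMatrix 1 (· < ·) d * A)) ?_ ?_
  · refine (measurable_coords _).comp (measurable_matrix_iff.2 fun i j => ?_)
    exact (measurable_matrix_apply (measurable_matrix_mul (measurable_matrix_mul (hfill 0)
      measurable_const) measurable_const) i j).add
      (measurable_matrix_apply (measurable_matrix_mul (hfill' 1) measurable_const) i j)
  · refine Filter.Eventually.of_forall fun c => ?_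
    have h2 := (measurePreserving_add_left (piMeasure μ {p : Fin n × Fin n // p.1 < p.2})
      (coords (· < ·) (fillMatrix 0 (· < ·) c * A * Y + A))).comp h1
    refine Eq.trans ?_ h2.map_eq
    congr 1
    ext1 d
    rw [fillMatrix_one_eq, Matrix.add_mul, Matrix.one_mul, ← add_assoc]
    rfl

theorem measurable_complBlock_mul {n : ℕ} {α : Type*} [MeasurableSpace α] {w : α → UpperPairs F n}
    {g : α → GL (Fin n ⊕ Fin n) F} (hw : Measurable w) (hg : Measurable g) :
    Measurable fun a => conjShuffle n (complBlock (w a) * g a) :=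
  measurable_conjShuffle ((measurable_complBlock.comp hw).mul hg)

/-- This is the factorization of N_{2n} as the complement times N_{2n} ∩ H_n. The four blocks of the
product are a, aY, Ca and CaY + (1+D)a, so the passage from the coordinates of N_{2n} to (a, Y, C,
D) is successively unimodular. -/
theorem lintegral_unip_block (hs : HasNormScaling μ) {n : ℕ} {T : GL (Fin (2 * n)) F → ℝ≥0∞}
    (hT : Measurable T) :
    ∫⁻ u, T (u : GL (Fin (2 * n)) F) ∂(unipMeasure μ (2 * n)) =
      ∫⁻ a : unip F n, ∫⁻ y, ∫⁻ w, T (conjShuffle n (complBlock w *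
        (diagBlock (a : GL (Fin n) F) * upperBlock (fillMatrix 0 (· ≤ ·) y))))
        ∂(upperPairsMeasure μ n) ∂(piMeasure μ _) ∂(unipMeasure μ n) := by
  have hR : Measurable fun p : (unip F n × ({p : Fin n × Fin n // p.1 ≤ p.2} → F)) ×
      UpperPairs F n => T (conjShuffle n (complBlock p.2 *
        (diagBlock (p.1.1 : GL (Fin n) F) * upperBlock (fillMatrix 0 (· ≤ ·) p.1.2)))) :=
    hT.comp (measurable_complBlock_mul measurable_snd ((measurable_diagBlock.comp
      (measurable_subtype_coe.comp (measurable_fst.comp measurable_fst))).mul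
      (measurable_upperBlock.comp ((measurable_fillMatrix 0 (· ≤ ·)).comp
        (measurable_snd.comp measurable_fst)))))
  have hR2 : Measurable fun a : unip F n => ∫⁻ y, ∫⁻ w, T (conjShuffle n (complBlock w *
        (diagBlock (a : GL (Fin n) F) * upperBlock (fillMatrix 0 (· ≤ ·) y))))
        ∂(upperPairsMeasure μ n) ∂(piMeasure μ _) :=
    (hR.lintegral_prod_right').lintegral_prod_right'
  rw [lintegral_unip_shuffle hT, lintegral_unipMeasure hR2]
  refine lintegral_congr fun a => ?_
  have hU : Measurable fun p : ({p : Fin n × Fin n // p.1 ≤ p.2} → F) × UpperPairs F n =>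
      T (unipOfCoords (joinFun (shuffleSplit n) (a, joinFun (Equiv.refl _)
        (p.1, joinFun (Equiv.refl _) (p.2.1, p.2.2)))) : GL (Fin (2 * n)) F) := by
    have h1 : Measurable fun u : unip F (2 * n) => T (u : GL (Fin (2 * n)) F) :=
      hT.comp measurable_subtype_coe
    have h2 : ∀ {κ ρ ι : Type} [Fintype κ] [Fintype ρ] [Fintype ι] (e : ι ≃ κ ⊕ ρ), Measurable
      (joinFun e : (κ → F) × (ρ → F) → ι → F) := fun e =>
        (measurePreserving_joinFun (μ := μ) e).measurable
    exact h1.comp (measurable_unipOfCoords.comp ((h2 _).comp (measurable_const.prodMk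
      ((h2 _).comp (measurable_fst.prodMk ((h2 _).comp measurable_snd))))))
  have hU1 : ∀ b, Measurable fun w : UpperPairs F n =>
      T (unipOfCoords (joinFun (shuffleSplit n) (a, joinFun (Equiv.refl _)
        (b, joinFun (Equiv.refl _) (w.1, w.2)))) : GL (Fin (2 * n)) F) := fun b =>
    hU.comp (measurable_prodMk_left (x := b))
  have hU2 : Measurable fun b => ∫⁻ w : UpperPairs F n,
      T (unipOfCoords (joinFun (shuffleSplit n) (a, joinFun (Equiv.refl _)
        (b, joinFun (Equiv.refl _) (w.1, w.2)))) : GL (Fin (2 * n)) F) ∂(upperPairsMeasure μ n) :=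
    hU.lintegral_prod_right'
  have hA : IsUpperUnip (unipOfCoords a : GL (Fin n) F).val := isUpperUnip_coe _
  have hA' : (unipOfCoords a : GL (Fin n) F).val = fillMatrix 1 (· < ·) a := unipOfCoords_val a
  have h1 := measurePreserving_coords_mul (μ := μ) hs (· ≤ ·) hA IsUpperUnip.one
  simp_rw [← lintegral_prod _ (hU1 _).aemeasurable]
  rw [← h1.lintegral_comp hU2]
  refine lintegral_congr fun y => ?_
  have h2 := measurePreserving_upperPairs_mul (μ := μ) hs hA (fillMatrix 0 (· ≤ ·) y)
  rw [← h2.lintegral_comp (hU1 _)]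
  refine lintegral_congr fun w => congrArg T ?_
  refine unipOfCoords_shuffle _ _ _ _ ?_
  rw [complBlock_mul_val]
  congr 1
  · rw [Matrix.mul_one, (hA.isUpper.mul (isUpper_fillMatrix y)).fillMatrix_coords]
  · rw [((isStrictUpper_fillMatrix w.1).mul_isUpper hA.isUpper).fillMatrix_coords]
  · rw [IsUpperUnip.fillMatrix_coords]
    have h3 : fillMatrix 1 (· < ·) w.2 * (unipOfCoords a : GL (Fin n) F).val =
      (unipOfCoords w.2 * unipOfCoords a : GL (Fin n) F).val := by
      rw [Units.val_mul, unipOfCoords_val w.2]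
    rw [add_comm, h3]
    exact (isUpperUnip_coe (unipOfCoords w.2 * unipOfCoords a)).add_isStrictUpper
      (((isStrictUpper_fillMatrix w.1).mul_isUpper hA.isUpper).mul_isUpper (isUpper_fillMatrix y))

end Unfolding

/-! ### Gluing the unipotent integral to the coset space of the Shalika subgroup -/

section UnfoldingShalika

variable {F : Type*} [NontriviallyNormedField F]

theorem upperBlock_add {n : ℕ} (X Y : Matrix (Fin n) (Fin n) F) :
    upperBlock (X + Y) = upperBlock X * upperBlock Y := by
  apply Units.ext
  rw [Units.val_mul]
  simp [upperBlock, Matrix.fromBlocks_multiply, add_comm]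

theorem upperBlock_zero {n : ℕ} : upperBlock (0 : Matrix (Fin n) (Fin n) F) = 1 := by
  apply Units.ext
  simp [upperBlock]

theorem upperBlock_neg {n : ℕ} (X : Matrix (Fin n) (Fin n) F) :
    upperBlock (-X) = (upperBlock X)⁻¹ := by
  rw [eq_inv_iff_mul_eq_one, ← upperBlock_add, neg_add_cancel, upperBlock_zero]

theorem diagBlock_mul {n : ℕ} (g h : GL (Fin n) F) :
    diagBlock (g * h) = diagBlock g * diagBlock h := by
  apply Units.ext
  rw [Units.val_mul]
  simp [diagBlock, Matrix.fromBlocks_multiply]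

theorem diagBlock_one {n : ℕ} : diagBlock (1 : GL (Fin n) F) = 1 := by
  apply Units.ext
  simp [diagBlock]

theorem diagBlock_inv {n : ℕ} (g : GL (Fin n) F) : diagBlock g⁻¹ = (diagBlock g)⁻¹ := rfl

theorem diagBlock_mul_upperBlock {n : ℕ} (g : GL (Fin n) F) (X : Matrix (Fin n) (Fin n) F) :
    diagBlock g * upperBlock X = upperBlock (g.val * X * g.inv) * diagBlock g := by
  apply Units.ext
  rw [Units.val_mul, Units.val_mul]
  simp [diagBlock, upperBlock, Matrix.fromBlocks_multiply, Matrix.mul_assoc]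

theorem trace_strictLower {n : ℕ} (X : strictLower F n) :
    (X : Matrix (Fin n) (Fin n) F).trace = 0 :=
  Finset.sum_eq_zero fun i _ => X.2 i i le_rfl

variable [ProperSpace F] [MeasurableSpace F] [BorelSpace F] {μ : Measure F} [SigmaFinite μ]
  [μ.IsAddLeftInvariant]

attribute [local irreducible] conjShuffle unipOfCoords shalikaMk upperBlock diagBlock complBlock

theorem measurable_trace {α : Type*} [MeasurableSpace α] {n : ℕ}
    {A : α → Matrix (Fin n) (Fin n) F} (hA : Measurable A) : Measurable fun a => (A a).trace :=
  Finset.measurable_sum _ fun i _ => measurable_matrix_apply hA i i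

theorem measurable_gl_conj {α : Type*} [MeasurableSpace α] {n : ℕ} {g : α → GL (Fin n) F}
    {A : α → Matrix (Fin n) (Fin n) F} (hg : Measurable g) (hA : Measurable A) :
    Measurable fun a => (g a).val * A a * (g a).inv :=
  measurable_matrix_mul (measurable_matrix_mul (measurable_gl_val hg) hA)
    (measurable_gl_val hg.inv)

/-- Factor u as w · diag(a) · upper(Y) and absorb the last two factors into the coset
representative, using diag(a) upper(Y) upper(X) diag(b) = upper(a(X+Y)a⁻¹) diag(ab). The trace of X
vanishes, so the argument of the character is that of w plus Tr(X+Y). -/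
theorem lintegral_unip_mul_shalika (hs : HasNormScaling μ) {n : ℕ}
    {T : GL (Fin (2 * n)) F × F → ℝ≥0∞} (hT : Measurable T) (X : strictLower F n)
    (b : GL (Fin n) F) {S : GL (Fin n ⊕ Fin n) F × F → ℝ≥0∞}
    (hS : ∀ h s, S (h, s) = ∫⁻ w, T (conjShuffle n (complBlock w * h),
      superSum (fillMatrix 0 (· < ·) w.1) + s) ∂(upperPairsMeasure μ n)) :
    ∫⁻ u, T ((u : GL (Fin (2 * n)) F) * shalikaMk (X : Matrix (Fin n) (Fin n) F) b,
      superSum (u : GL (Fin (2 * n)) F).val) ∂(unipMeasure μ (2 * n)) =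
    ∫⁻ a : unip F n, ∫⁻ y, S (upperBlock ((a : GL (Fin n) F).val *
      ((X : Matrix (Fin n) (Fin n) F) + fillMatrix 0 (· ≤ ·) y) * (a : GL (Fin n) F).inv) *
      diagBlock ((a : GL (Fin n) F) * b),
      ((X : Matrix (Fin n) (Fin n) F) + fillMatrix 0 (· ≤ ·) y).trace)
      ∂(piMeasure μ _) ∂(unipMeasure μ n) := by
  have h1 : Measurable fun u : GL (Fin (2 * n)) F =>
      T (u * shalikaMk (X : Matrix (Fin n) (Fin n) F) b, superSum u.val) :=
    hT.comp ((measurable_id.mul measurable_const).prodMk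
      (measurable_superSum (measurable_gl_val measurable_id)))
  rw [lintegral_unip_block hs h1]
  refine lintegral_congr fun a => lintegral_congr fun y => ?_
  rw [hS]
  refine lintegral_congr fun w => ?_
  have h2 : shalikaMk (X : Matrix (Fin n) (Fin n) F) b =
      conjShuffle n (upperBlock (X : Matrix (Fin n) (Fin n) F) * diagBlock b) := by
    unfold shalikaMk; rfl
  have h3 : diagBlock (a : GL (Fin n) F) * upperBlock (fillMatrix 0 (· ≤ ·) y) *
      (upperBlock (X : Matrix (Fin n) (Fin n) F) * diagBlock b) =
      upperBlock ((a : GL (Fin n) F).val *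
      ((X : Matrix (Fin n) (Fin n) F) + fillMatrix 0 (· ≤ ·) y) * (a : GL (Fin n) F).inv) *
      diagBlock ((a : GL (Fin n) F) * b) := by
    rw [← mul_assoc, mul_assoc (diagBlock (a : GL (Fin n) F)), ← upperBlock_add,
      diagBlock_mul_upperBlock, diagBlock_mul, add_comm, mul_assoc]
  rw [superSum_complBlock_mul w a (isUpper_fillMatrix y), h2, ← map_mul, mul_assoc, h3,
    Matrix.trace_add, trace_strictLower, zero_add]

/-- A strictly lower X and an upper triangular Y add up to an arbitrary Z, and a unipotent a times a
lower triangular b gives an arbitrary g; the remaining conjugation of Z by a preserves dZ. The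
second variable of T records the argument of ψ, so the identity for non-negative T yields an
equality of measures that also governs the oscillating integrals. -/
theorem lintegral_unfold [NullSingletonClass μ] (hs : HasNormScaling μ) {n : ℕ}
    {T : GL (Fin (2 * n)) F × F → ℝ≥0∞} (hT : Measurable T) :
    ∫⁻ b, ∫⁻ X : strictLower F n, ∫⁻ u,
      T ((u : GL (Fin (2 * n)) F) * shalikaMk (X : Matrix (Fin n) (Fin n) F) b,
        superSum (u : GL (Fin (2 * n)) F).val) ∂(unipMeasure μ (2 * n)) ∂(strictLowerMeasure μ n)
        ∂(lowerMeasure μ n) =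
    ∫⁻ g, ∫⁻ Z, ∫⁻ w, T (conjShuffle n (complBlock w * (upperBlock Z * diagBlock g)),
      superSum (fillMatrix 0 (· < ·) w.1) + Z.trace) ∂(upperPairsMeasure μ n)
      ∂(matrixMeasure μ n) ∂(glMeasure μ n) := by
  have hS0 : Measurable fun p : (GL (Fin n ⊕ Fin n) F × F) × UpperPairs F n =>
      T (conjShuffle n (complBlock p.2 * p.1.1), superSum (fillMatrix 0 (· < ·) p.2.1) + p.1.2) :=
    hT.comp ((measurable_complBlock_mul measurable_snd (measurable_fst.comp measurable_fst)).prodMk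
      ((measurable_superSum ((measurable_fillMatrix 0 (· < ·)).comp
        (measurable_fst.comp measurable_snd))).add (measurable_snd.comp measurable_fst)))
  obtain ⟨S, hS⟩ : ∃ S : GL (Fin n ⊕ Fin n) F × F → ℝ≥0∞, S = fun p =>
      ∫⁻ w, T (conjShuffle n (complBlock w * p.1), superSum (fillMatrix 0 (· < ·) w.1) + p.2)
        ∂(upperPairsMeasure μ n) := ⟨_, rfl⟩
  have hSm : Measurable S := by rw [hS]; exact hS0.lintegral_prod_right'
  have hS1 : ∀ h s, S (h, s) = ∫⁻ w, T (conjShuffle n (complBlock w * h),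
      superSum (fillMatrix 0 (· < ·) w.1) + s) ∂(upperPairsMeasure μ n) := fun h s => by rw [hS]
  simp only [lintegral_unip_mul_shalika hs hT _ _ hS1, ← hS1]
  have hSg : Measurable fun p : GL (Fin n) F × Matrix (Fin n) (Fin n) F =>
      S (upperBlock p.2 * diagBlock p.1, p.2.trace) :=
    hSm.comp (((measurable_upperBlock.comp measurable_snd).mul (measurable_diagBlock.comp
      measurable_fst)).prodMk (measurable_trace measurable_snd))
  have hSg1 : Measurable fun g : GL (Fin n) F =>
      ∫⁻ Z, S (upperBlock Z * diagBlock g, Z.trace) ∂(matrixMeasure μ n) :=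
    hSg.lintegral_prod_right'
  rw [lintegral_glMeasure_eq_lower hs hSg1]
  refine lintegral_congr fun b => ?_
  have hE : Measurable fun p : (unip F n × strictLower F n) ×
      ({p : Fin n × Fin n // p.1 ≤ p.2} → F) => S (upperBlock ((p.1.1 : GL (Fin n) F).val *
      ((p.1.2 : Matrix (Fin n) (Fin n) F) + fillMatrix 0 (· ≤ ·) p.2) *
        (p.1.1 : GL (Fin n) F).inv) * diagBlock ((p.1.1 : GL (Fin n) F) * b),
      ((p.1.2 : Matrix (Fin n) (Fin n) F) + fillMatrix 0 (· ≤ ·) p.2).trace) := by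
    have h1 : Measurable fun p : (unip F n × strictLower F n) ×
      ({p : Fin n × Fin n // p.1 ≤ p.2} → F) => (p.1.1 : GL (Fin n) F) :=
      measurable_subtype_coe.comp (measurable_fst.comp measurable_fst)
    have h2 : Measurable fun p : (unip F n × strictLower F n) ×
      ({p : Fin n × Fin n // p.1 ≤ p.2} → F) =>
        (p.1.2 : Matrix (Fin n) (Fin n) F) + fillMatrix 0 (· ≤ ·) p.2 :=
      measurable_add_fill.comp ((measurable_snd.comp measurable_fst).prodMk measurable_snd)
    exact hSm.comp (((measurable_upperBlock.comp (measurable_gl_conj h1 h2)).mul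
      (measurable_diagBlock.comp (h1.mul measurable_const))).prodMk (measurable_trace h2))
  have hE1 : Measurable fun p : unip F n × strictLower F n => ∫⁻ y, S (upperBlock
      ((p.1 : GL (Fin n) F).val * ((p.2 : Matrix (Fin n) (Fin n) F) + fillMatrix 0 (· ≤ ·) y) *
        (p.1 : GL (Fin n) F).inv) * diagBlock ((p.1 : GL (Fin n) F) * b),
      Matrix.trace ((p.2 : Matrix (Fin n) (Fin n) F) + fillMatrix 0 (· ≤ ·) y)) ∂(piMeasure μ _) :=
    hE.lintegral_prod_right' (ν := piMeasure μ _)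
  have hsw := lintegral_lintegral_swap (μ := unipMeasure μ n) (ν := strictLowerMeasure μ n)
    (f := fun (a : unip F n) (X : strictLower F n) => ∫⁻ y, S (upperBlock
      ((a : GL (Fin n) F).val * ((X : Matrix (Fin n) (Fin n) F) + fillMatrix 0 (· ≤ ·) y) *
        (a : GL (Fin n) F).inv) * diagBlock ((a : GL (Fin n) F) * b),
      Matrix.trace ((X : Matrix (Fin n) (Fin n) F) + fillMatrix 0 (· ≤ ·) y)) ∂(piMeasure μ _))
    hE1.aemeasurable
  rw [← hsw]
  refine lintegral_congr fun a => ?_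
  have hZ : Measurable fun Z : Matrix (Fin n) (Fin n) F =>
      S (upperBlock Z * diagBlock ((a : GL (Fin n) F) * b), Z.trace) :=
    hSm.comp ((measurable_upperBlock.mul measurable_const).prodMk (measurable_trace measurable_id))
  have hZ1 : Measurable fun Z : Matrix (Fin n) (Fin n) F =>
      S (upperBlock ((a : GL (Fin n) F).val * Z * (a : GL (Fin n) F).inv) *
        diagBlock ((a : GL (Fin n) F) * b), Z.trace) :=
    hSm.comp (((measurable_upperBlock.comp (measurable_gl_conj measurable_const
      measurable_id)).mul measurable_const).prodMk (measurable_trace measurable_id))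
  rw [← lintegral_matrixMeasure_conj hs (a : GL (Fin n) F) hZ, ← lintegral_matrixMeasure_tri hZ1]
  simp only [trace_conj]

end UnfoldingShalika

/-! ### Uniformly locally constant functions and Fourier inversion -/

section Fourier

/-- A function which is invariant under translations by a ball and vanishes outside a ball. -/
structure IsSB {E : Type*} [SeminormedAddCommGroup E] (φ : E → ℂ) : Prop where
  exists_inv : ∃ ε > 0, ∀ v l : E, ‖l‖ ≤ ε → φ (v + l) = φ v
  exists_supp : ∃ R : ℝ, ∀ v, R < ‖v‖ → φ v = 0

namespace IsSB

variable {E E' : Type*} [SeminormedAddCommGroup E] [SeminormedAddCommGroup E'] {φ : E → ℂ}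

theorem continuous (h : IsSB φ) : Continuous φ := by
  obtain ⟨ε, hε, hinv⟩ := h.exists_inv
  refine IsLocallyConstant.continuous ((IsLocallyConstant.iff_eventually_eq _).2 fun v => ?_)
  filter_upwards [Metric.closedBall_mem_nhds v hε] with w hw
  have h1 := hinv v (w - v) (by rwa [Metric.mem_closedBall, dist_eq_norm] at hw)
  rwa [add_sub_cancel] at h1

theorem hasCompactSupport [ProperSpace E] (h : IsSB φ) : HasCompactSupport φ := by
  obtain ⟨R, hR⟩ := h.exists_supp
  refine HasCompactSupport.intro (isCompact_closedBall (0 : E) R) fun v hv => hR v ?_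
  simpa using hv

theorem integrable [ProperSpace E] [MeasurableSpace E] [BorelSpace E] (h : IsSB φ)
    (ν : Measure E) [IsFiniteMeasureOnCompacts ν] : Integrable φ ν :=
  h.continuous.integrable_of_hasCompactSupport h.hasCompactSupport

theorem comp (h : IsSB φ) {L : E' → E} (hL : ∀ v l, ∃ l', L (v + l) = L v + l' ∧ ‖l'‖ ≤ ‖l‖)
    (hL' : ∀ v, ‖v‖ ≤ ‖L v‖) : IsSB fun v => φ (L v) := by
  obtain ⟨ε, hε, hinv⟩ := h.exists_inv
  obtain ⟨R, hR⟩ := h.exists_supp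
  refine ⟨⟨ε, hε, fun v l hl => ?_⟩, ⟨R, fun v hv => hR _ (hv.trans_le (hL' v))⟩⟩
  obtain ⟨l', h1, h2⟩ := hL v l
  rw [h1, hinv _ _ (h2.trans hl)]

theorem integral_right [MeasurableSpace E'] {φ : E × E' → ℂ} (h : IsSB φ) (ν : Measure E')
    (χ : E' → ℂ) : IsSB fun v => ∫ w, φ (v, w) * χ w ∂ν := by
  obtain ⟨ε, hε, hinv⟩ := h.exists_inv
  obtain ⟨R, hR⟩ := h.exists_supp
  refine ⟨⟨ε, hε, fun v l hl => ?_⟩, ⟨R, fun v hv => ?_⟩⟩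
  · refine integral_congr_ae (Filter.Eventually.of_forall fun w => ?_)
    have h1 := hinv (v, w) (l, 0) (by simpa [Prod.norm_def] using hl)
    simp only [Prod.mk_add_mk, add_zero] at h1
    simp only [h1]
  · have h1 : ∀ w, φ (v, w) = 0 := fun w => hR _ (hv.trans_le (by simp [Prod.norm_def]))
    simp [h1]

end IsSB

variable {F : Type*} [NontriviallyNormedField F] {ψ : AddChar F Circle}

/-- The elements `t` such that `ψ (t x) = 1` for all `x` in a ball. -/
def perpBall (ψ : AddChar F Circle) (ε : ℝ) : Set F := {t | ∀ x : F, ‖x‖ ≤ ε → ψ (t * x) = 1}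

theorem isClosed_perpBall (hψc : Continuous ψ) (ε : ℝ) : IsClosed (perpBall ψ ε) := by
  have h : perpBall ψ ε = ⋂ x : F, ⋂ _ : ‖x‖ ≤ ε, {t | ψ (t * x) = 1} := by
    ext t; simp [perpBall]
  rw [h]
  exact isClosed_iInter fun x => isClosed_iInter fun _ =>
    isClosed_eq (hψc.comp (continuous_mul_const x)) continuous_const

theorem exists_perpBall_subset (hψ : ψ ≠ 1) {ε : ℝ} (hε : 0 < ε) :
    ∃ R : ℝ, perpBall ψ ε ⊆ Metric.closedBall 0 R := by
  obtain ⟨A, -, hA'⟩ := exists_character_ne_one hψ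
  refine ⟨A / ε, fun t ht => ?_⟩
  by_contra hlt
  rw [Metric.mem_closedBall, dist_zero_right, not_le] at hlt
  obtain ⟨x, hx, hx'⟩ := hA' ε t hε hlt
  exact hx' (by rw [mul_comm]; exact ht x hx)

variable [ProperSpace F] [MeasurableSpace F] [BorelSpace F] {μ : Measure F} [μ.IsAddHaarMeasure]

theorem measure_perpBall_lt_top (hψ : ψ ≠ 1) {ε : ℝ} (hε : 0 < ε) : μ (perpBall ψ ε) < ∞ := by
  obtain ⟨R, hR⟩ := exists_perpBall_subset hψ hε
  exact (measure_mono hR).trans_lt (isCompact_closedBall 0 R).measure_lt_top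

variable [IsUltrametricDist F]

theorem add_mem_closedBall_iff {ε : ℝ} {x t : F} (hx : ‖x‖ ≤ ε) :
    t + x ∈ Metric.closedBall (0 : F) ε ↔ t ∈ Metric.closedBall (0 : F) ε := by
  simp only [Metric.mem_closedBall, dist_zero_right]
  constructor
  · intro h
    have h1 := norm_sub_le_max_norm (t + x) x
    rw [add_sub_cancel_right] at h1
    exact h1.trans (max_le h hx)
  · intro h
    exact (IsUltrametricDist.norm_add_le_max t x).trans (max_le h hx)

-- The ball is a group, so either ψ(·y) is trivial on it or translating by an element on which it is
-- not shows that the integral vanishes.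
open Classical in
theorem fourier_ball {ε : ℝ} (y : F) :
    fourier ψ μ ((Metric.closedBall (0 : F) ε).indicator 1) y =
      (perpBall ψ ε).indicator (fun _ => (μ.real (Metric.closedBall 0 ε) : ℂ)) y := by
  have h0 : ∀ t, (Metric.closedBall (0 : F) ε).indicator (1 : F → ℂ) t * (ψ (t * y) : ℂ) =
      (Metric.closedBall (0 : F) ε).indicator (fun t => (ψ (t * y) : ℂ)) t := fun t => by
    by_cases ht : t ∈ Metric.closedBall (0 : F) ε <;> simp [Set.indicator, ht]
  have hm : MeasurableSet (Metric.closedBall (0 : F) ε) := measurableSet_closedBall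
  rw [fourier]
  by_cases hy : y ∈ perpBall ψ ε
  · rw [Set.indicator_of_mem hy]
    simp only [h0]
    rw [integral_indicator hm, setIntegral_congr_fun (g := fun _ => (1 : ℂ)) hm]
    · simp [Measure.real]
    · intro t ht
      have : ψ (t * y) = 1 := by
        rw [mul_comm]; exact hy t (by simpa using ht)
      simp [this]
  · rw [Set.indicator_of_notMem hy]
    obtain ⟨x, hx, hx'⟩ : ∃ x : F, ‖x‖ ≤ ε ∧ ψ (y * x) ≠ 1 := by
      by_contra! h
      exact hy h
    set I := ∫ t, (Metric.closedBall (0 : F) ε).indicator (1 : F → ℂ) t * (ψ (t * y) : ℂ) ∂μ with hI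
    have h1 : I = (ψ (y * x) : ℂ) * I := by
      conv_lhs => rw [hI, ← integral_add_right_eq_self _ x]
      rw [hI, ← integral_const_mul]
      refine integral_congr_ae (Filter.Eventually.of_forall fun t => ?_)
      have h2 : (Metric.closedBall (0 : F) ε).indicator (1 : F → ℂ) (t + x) =
          (Metric.closedBall (0 : F) ε).indicator (1 : F → ℂ) t := by
        simp only [Set.indicator, add_mem_closedBall_iff hx, Pi.one_apply]
      simp only [h2]
      rw [add_mul, AddChar.map_add_eq_mul, Circle.coe_mul, mul_comm x y]
      ring
    have h3 : (1 - (ψ (y * x) : ℂ)) * I = 0 := by rw [sub_mul, one_mul, ← h1, sub_self]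
    refine (mul_eq_zero.1 h3).resolve_left fun h => hx' ?_
    ext
    simpa using (sub_eq_zero.1 h).symm

theorem isSchwartzBruhat_ball {ε : ℝ} (hε : 0 < ε) :
    IsSchwartzBruhat ((Metric.closedBall (0 : F) ε).indicator (1 : F → ℂ)) := by
  constructor
  · refine (IsLocallyConstant.iff_eventually_eq _).2 fun v => ?_
    filter_upwards [Metric.closedBall_mem_nhds v hε] with w hw
    have h := add_mem_closedBall_iff (t := v) (x := w - v) (ε := ε)
      (by rwa [Metric.mem_closedBall, dist_eq_norm] at hw)
    rw [add_sub_cancel] at h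
    classical
    simp only [Set.indicator, h, Pi.one_apply]
  · refine HasCompactSupport.intro (isCompact_closedBall (0 : F) ε) fun t ht => ?_
    simp [Set.indicator, ht]

/-- Self-duality is used here, for the indicator of a ball, whose first transform has just been
computed. -/
theorem integral_perpBall (hμ : IsSelfDual ψ μ) {ε : ℝ} (hε : 0 < ε) (x : F) :
    ∫ t, (perpBall ψ ε).indicator (fun t => (ψ (t * x) : ℂ)) t ∂μ =
      (Metric.closedBall (0 : F) ε).indicator
        (fun _ => ((μ.real (Metric.closedBall 0 ε) : ℂ))⁻¹) x := by
  classical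
  have hpos : (μ.real (Metric.closedBall (0 : F) ε) : ℂ) ≠ 0 := by
    have h1 : 0 < μ (Metric.closedBall (0 : F) ε) := Metric.measure_closedBall_pos μ 0 hε
    have h2 : μ (Metric.closedBall (0 : F) ε) < ∞ := (isCompact_closedBall 0 ε).measure_lt_top
    exact_mod_cast (ENNReal.toReal_pos h1.ne' h2.ne).ne'
  have h1 := hμ _ (isSchwartzBruhat_ball hε) x
  have h2 : fourier ψ μ ((Metric.closedBall (0 : F) ε).indicator 1) =
      (perpBall ψ ε).indicator (fun _ => (μ.real (Metric.closedBall 0 ε) : ℂ)) :=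
    funext fourier_ball
  rw [h2, fourier] at h1
  have h3 : ∀ t, (perpBall ψ ε).indicator (fun _ => (μ.real (Metric.closedBall 0 ε) : ℂ)) t *
      (ψ (t * x) : ℂ) = (μ.real (Metric.closedBall 0 ε) : ℂ) *
        (perpBall ψ ε).indicator (fun t => (ψ (t * x) : ℂ)) t := fun t => by
    by_cases ht : t ∈ perpBall ψ ε <;> simp [Set.indicator, ht]
  simp only [h3] at h1
  rw [integral_const_mul] at h1
  rw [← mul_right_inj' hpos, h1]
  by_cases hx : x ∈ Metric.closedBall (0 : F) ε
  · have hx' : -x ∈ Metric.closedBall (0 : F) ε := by simpa using hx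
    rw [Set.indicator_of_mem hx, Set.indicator_of_mem hx', mul_inv_cancel₀ hpos]; rfl
  · have hx' : -x ∉ Metric.closedBall (0 : F) ε := by simpa using hx
    rw [Set.indicator_of_notMem hx, Set.indicator_of_notMem hx', mul_zero]

variable {κ : Type*} [Fintype κ]

/-- Translating the i-th coordinate by a suitable x in the ball multiplies the integral by ψ(y_i x)
≠ 1. -/
theorem fourier_vanish {φ : (κ → F) → ℂ} {ε : ℝ}
    (hinv : ∀ v l : κ → F, ‖l‖ ≤ ε → φ (v + l) = φ v) {y : κ → F}
    (hy : ¬ ∀ i, y i ∈ perpBall ψ ε) :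
    ∫ c, φ c * (ψ (-(y ⬝ᵥ c)) : ℂ) ∂(piMeasure μ κ) = 0 := by
  classical
  push Not at hy
  obtain ⟨i, hi⟩ := hy
  obtain ⟨x, hx, hx'⟩ : ∃ x : F, ‖x‖ ≤ ε ∧ ψ (y i * x) ≠ 1 := by
    by_contra! h
    exact hi h
  set I := ∫ c, φ c * (ψ (-(y ⬝ᵥ c)) : ℂ) ∂(piMeasure μ κ) with hI
  have h1 : I = (ψ (y i * x) : ℂ) * I := by
    conv_lhs => rw [hI, ← integral_add_right_eq_self _ (Pi.single i (-x))]
    rw [hI, ← integral_const_mul]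
    refine integral_congr_ae (Filter.Eventually.of_forall fun c => ?_)
    have h2 : φ (c + Pi.single i (-x)) = φ c := by
      refine hinv _ _ ?_
      rw [Pi.norm_single, norm_neg]
      exact hx
    simp only [h2]
    rw [dotProduct_add, dotProduct_single, mul_neg, neg_add, neg_neg, AddChar.map_add_eq_mul,
      Circle.coe_mul]
    ring
  have h3 : (1 - (ψ (y i * x) : ℂ)) * I = 0 := by rw [sub_mul, one_mul, ← h1, sub_self]
  refine (mul_eq_zero.1 h3).resolve_left fun h => hx' ?_
  ext
  simpa using (sub_eq_zero.1 h).symm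

/-- The transform of φ lives on a product of annihilators, which has finite volume. After Fubini the
integral over y becomes a normalized indicator of the ball in c, and on this ball φ equals φ(0). -/
theorem fourier_inversion (hψc : Continuous ψ) (hψ : ψ ≠ 1) (hμ : IsSelfDual ψ μ)
    {φ : (κ → F) → ℂ} (hφ : IsSB φ) :
    ∫ y, ∫ c, φ c * (ψ (-(y ⬝ᵥ c)) : ℂ) ∂(piMeasure μ κ) ∂(piMeasure μ κ) = φ 0 := by
  classical
  obtain ⟨ε, hε, hinv⟩ := hφ.exists_inv
  -- The character is truncated to the annihilator. This does not change the transform of φ, and it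
  -- makes the double integrand integrable and a product over the coordinates.
  set χ : (κ → F) → (κ → F) → ℂ := fun c y =>
    ∏ i, (perpBall ψ ε).indicator (fun t => (ψ (t * (-c i)) : ℂ)) (y i) with hχ
  have hχ1 : ∀ c y, (∀ i, y i ∈ perpBall ψ ε) → χ c y = (ψ (-(y ⬝ᵥ c)) : ℂ) := fun c y hy => by
    have h : -(y ⬝ᵥ c) = ∑ i, y i * (-c i) := by simp [dotProduct]
    have h2 : (ψ (∑ i, y i * (-c i)) : ℂ) = ∏ i, (ψ (y i * (-c i)) : ℂ) := by
      have := map_prod (Circle.coeHom.comp ψ.toMonoidHom)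
        (fun i => Multiplicative.ofAdd (y i * (-c i))) Finset.univ
      exact this
    rw [h, h2]
    exact Finset.prod_congr rfl fun i _ => Set.indicator_of_mem (hy i) _
  have hχ0 : ∀ c y, (¬ ∀ i, y i ∈ perpBall ψ ε) → χ c y = 0 := fun c y hy => by
    push Not at hy
    obtain ⟨i, hi⟩ := hy
    exact Finset.prod_eq_zero (Finset.mem_univ i) (Set.indicator_of_notMem hi _)
  have h1 : ∀ y, ∫ c, φ c * (ψ (-(y ⬝ᵥ c)) : ℂ) ∂(piMeasure μ κ) =
      ∫ c, φ c * χ c y ∂(piMeasure μ κ) := fun y => by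
    by_cases hy : ∀ i, y i ∈ perpBall ψ ε
    · simp only [hχ1 _ _ hy]
    · rw [fourier_vanish hinv hy]
      simp [hχ0 _ _ hy]
  simp only [h1]
  have hpm : MeasurableSet (perpBall ψ ε) := (isClosed_perpBall hψc ε).measurableSet
  have hint : Integrable (fun p : (κ → F) × (κ → F) => φ p.2 * χ p.2 p.1)
      ((piMeasure μ κ).prod (piMeasure μ κ)) := by
    have hPi : MeasurableSet (Set.univ.pi fun _ : κ => perpBall ψ ε) :=
      MeasurableSet.univ_pi fun _ => hpm
    have hfin : piMeasure μ κ (Set.univ.pi fun _ : κ => perpBall ψ ε) ≠ ∞ := by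
      rw [piMeasure, Measure.pi_pi]
      exact ENNReal.prod_ne_top fun i _ => (measure_perpBall_lt_top hψ hε).ne
    have h2 : Integrable ((Set.univ.pi fun _ : κ => perpBall ψ ε).indicator fun _ => (1 : ℂ))
        (piMeasure μ κ) :=
      (integrable_indicator_iff hPi).2 (integrableOn_const hfin)
    have h3 := h2.mul_prod (hφ.integrable (piMeasure μ κ))
    have h4 : Measurable fun p : (κ → F) × (κ → F) => (ψ (-(p.1 ⬝ᵥ p.2)) : ℂ) := by
      have : Continuous fun p : (κ → F) × (κ → F) => (ψ (-(p.1 ⬝ᵥ p.2)) : ℂ) := by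
        unfold dotProduct
        fun_prop
      exact this.measurable
    refine (h3.mul_bdd (c := 1) h4.aestronglyMeasurable
      (Filter.Eventually.of_forall fun p => (Circle.norm_coe _).le)).congr
      (Filter.Eventually.of_forall fun p => ?_)
    by_cases hy : ∀ i, p.1 i ∈ perpBall ψ ε
    · have : p.1 ∈ Set.univ.pi fun _ : κ => perpBall ψ ε := fun i _ => hy i
      simp only [Set.indicator_of_mem this, one_mul, hχ1 _ _ hy]
    · have : p.1 ∉ Set.univ.pi fun _ : κ => perpBall ψ ε := fun h => hy fun i => h i trivial
      simp only [Set.indicator_of_notMem this, zero_mul, hχ0 _ _ hy, mul_zero]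
  rw [integral_integral_swap hint]
  have h5 : ∀ c, ∫ y, φ c * χ c y ∂(piMeasure μ κ) = φ 0 * ∏ i,
      (Metric.closedBall (0 : F) ε).indicator
        (fun _ => ((μ.real (Metric.closedBall 0 ε) : ℂ))⁻¹) (c i) := fun c => by
    rw [integral_const_mul]
    have h6 : ∫ y, χ c y ∂(piMeasure μ κ) = ∏ i, (Metric.closedBall (0 : F) ε).indicator
        (fun _ => ((μ.real (Metric.closedBall 0 ε) : ℂ))⁻¹) (c i) := by
      rw [hχ]
      simp only
      rw [piMeasure, integral_fintype_prod_eq_prod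
        (fun i t => (perpBall ψ ε).indicator (fun t => (ψ (t * (-c i)) : ℂ)) t)]
      refine Finset.prod_congr rfl fun i _ => ?_
      rw [integral_perpBall hμ hε]
      have : -c i ∈ Metric.closedBall (0 : F) ε ↔ c i ∈ Metric.closedBall (0 : F) ε := by simp
      simp only [Set.indicator, this]
    rw [h6]
    by_cases hc : ∀ i, c i ∈ Metric.closedBall (0 : F) ε
    · have h7 := hinv 0 c ((pi_norm_le_iff_of_nonneg hε.le).2 fun i => by simpa using hc i)
      rw [zero_add] at h7
      rw [h7]
    · push Not at hc
      obtain ⟨i, hi⟩ := hc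
      rw [Finset.prod_eq_zero (Finset.mem_univ i) (Set.indicator_of_notMem hi _), mul_zero,
        mul_zero]
  simp only [h5]
  rw [integral_const_mul, piMeasure, integral_fintype_prod_eq_prod (fun _ t =>
    (Metric.closedBall (0 : F) ε).indicator
        (fun _ => ((μ.real (Metric.closedBall 0 ε) : ℂ))⁻¹) t)]
  have hpos : (μ.real (Metric.closedBall (0 : F) ε) : ℂ) ≠ 0 := by
    have h1 : 0 < μ (Metric.closedBall (0 : F) ε) := Metric.measure_closedBall_pos μ 0 hε
    have h2 : μ (Metric.closedBall (0 : F) ε) < ∞ := (isCompact_closedBall 0 ε).measure_lt_top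
    exact_mod_cast (ENNReal.toReal_pos h1.ne' h2.ne).ne'
  rw [integral_indicator measurableSet_closedBall, setIntegral_const, Complex.real_smul,
    mul_inv_cancel₀ hpos]
  simp

end Fourier

/-! ### Embedding a smaller pair of blocks -/

section BlockEmb

variable {F : Type*} [NontriviallyNormedField F] {k : ℕ}

/-- The blocks of a matrix, bordered so as to obtain a homomorphism. -/
def blockEmbMatrix (A : Matrix (Fin k ⊕ Fin k) (Fin k ⊕ Fin k) F) :
    Matrix (Fin (k + 1) ⊕ Fin (k + 1)) (Fin (k + 1) ⊕ Fin (k + 1)) F :=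
  Matrix.fromBlocks (border A.toBlocks₁₁ 0 0 1) (border A.toBlocks₁₂ 0 0 0)
    (border A.toBlocks₂₁ 0 0 0) (border A.toBlocks₂₂ 0 0 1)

theorem blockEmbMatrix_fromBlocks (A B C D : Matrix (Fin k) (Fin k) F) :
    blockEmbMatrix (Matrix.fromBlocks A B C D) = Matrix.fromBlocks (border A 0 0 1)
      (border B 0 0 0) (border C 0 0 0) (border D 0 0 1) := by
  simp [blockEmbMatrix]

theorem blockEmbMatrix_mul (A B : Matrix (Fin k ⊕ Fin k) (Fin k ⊕ Fin k) F) :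
    blockEmbMatrix A * blockEmbMatrix B = blockEmbMatrix (A * B) := by
  rw [← Matrix.fromBlocks_toBlocks A, ← Matrix.fromBlocks_toBlocks B, Matrix.fromBlocks_multiply,
    blockEmbMatrix_fromBlocks, blockEmbMatrix_fromBlocks, blockEmbMatrix_fromBlocks,
    Matrix.fromBlocks_multiply]
  simp [border_mul, border_add]

theorem blockEmbMatrix_one :
    blockEmbMatrix (1 : Matrix (Fin k ⊕ Fin k) (Fin k ⊕ Fin k) F) = 1 := by
  rw [← Matrix.fromBlocks_one, blockEmbMatrix_fromBlocks, border_one, border_zero,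
    Matrix.fromBlocks_one]

/-- The embedding `GL_{2k} → GL_{2(k+1)}` that borders every block. -/
def blockEmb (g : GL (Fin k ⊕ Fin k) F) : GL (Fin (k + 1) ⊕ Fin (k + 1)) F where
  val := blockEmbMatrix g.val
  inv := blockEmbMatrix g.inv
  val_inv := by rw [blockEmbMatrix_mul, g.val_inv, blockEmbMatrix_one]
  inv_val := by rw [blockEmbMatrix_mul, g.inv_val, blockEmbMatrix_one]

theorem blockEmb_val (g : GL (Fin k ⊕ Fin k) F) : (blockEmb g).val = blockEmbMatrix g.val := rfl

theorem blockEmb_mul (g h : GL (Fin k ⊕ Fin k) F) :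
    blockEmb (g * h) = blockEmb g * blockEmb h :=
  Units.ext (blockEmbMatrix_mul _ _).symm

theorem blockEmb_one : blockEmb (1 : GL (Fin k ⊕ Fin k) F) = 1 := Units.ext blockEmbMatrix_one

theorem blockEmb_inv (g : GL (Fin k ⊕ Fin k) F) : blockEmb g⁻¹ = (blockEmb g)⁻¹ := rfl

theorem blockEmb_upperBlock (X : Matrix (Fin k) (Fin k) F) :
    blockEmb (upperBlock X) = upperBlock (border X 0 0 0) := by
  apply Units.ext
  rw [blockEmb_val]
  change blockEmbMatrix (Matrix.fromBlocks 1 X 0 1) = Matrix.fromBlocks 1 _ 0 1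
  rw [blockEmbMatrix_fromBlocks, border_one, border_zero]

theorem blockEmb_diagBlock (g : GL (Fin k) F) :
    blockEmb (diagBlock g) = diagBlock (glEmb g) := by
  apply Units.ext
  rw [blockEmb_val]
  change blockEmbMatrix (Matrix.fromBlocks g.val 0 0 g.val) =
    Matrix.fromBlocks (glEmb g).val 0 0 (glEmb g).val
  rw [blockEmbMatrix_fromBlocks, border_zero, glEmb_val]

/-- The matrix `(1 0; C 1+D)`, where `C` and `D` vanish outside the last column. -/
def colBlock (p : (Fin k → F) × (Fin k → F)) : GL (Fin (k + 1) ⊕ Fin (k + 1)) F :=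
  lowBlock (border 0 p.1 0 0) (mirabolicMk p.2 1 : GL (Fin (k + 1)) F)

theorem colBlock_val (p : (Fin k → F) × (Fin k → F)) : (colBlock p).val =
    Matrix.fromBlocks 1 0 (border 0 p.1 0 0) (border 1 p.2 0 1) := by
  rw [colBlock, lowBlock_val, mirabolicMk_val, Units.val_one]

/-- The coordinates of a pair of strictly upper triangular matrices from those of the matrices
without the last row and column and those of the last columns. -/
def joinPair (q : UpperPairs F k × ((Fin k → F) × (Fin k → F))) : UpperPairs F (k + 1) :=
  (joinFun (upperSplit k) (q.1.1, q.2.1), joinFun (upperSplit k) (q.1.2, q.2.2))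

theorem complBlock_joinPair_val (q : UpperPairs F k × ((Fin k → F) × (Fin k → F))) :
    (complBlock (joinPair q)).val = Matrix.fromBlocks 1 0
      (border (fillMatrix 0 (· < ·) q.1.1) q.2.1 0 0)
      (border (fillMatrix 1 (· < ·) q.1.2) q.2.2 0 1) := by
  have h0 : (0 : Matrix (Fin (k + 1)) (Fin (k + 1)) F) = border 0 0 0 0 := border_zero.symm
  have h1 : (1 : Matrix (Fin (k + 1)) (Fin (k + 1)) F) = border 1 0 0 1 := border_one.symm
  rw [complBlock_val, joinPair, ← fillMatrix_joinFun_upper, ← fillMatrix_joinFun_upper, border_zero,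
    border_one]

/-- Splits an element of the complement into one of smaller size and its last columns, which are
twisted only by the unipotent matrix 1 + D. -/
theorem blockEmb_complBlock_mul_colBlock (w : UpperPairs F k) (p : (Fin k → F) × (Fin k → F)) :
    blockEmb (complBlock w) * colBlock p = complBlock (joinPair (w,
      (fillMatrix 1 (· < ·) w.2 *ᵥ p.1, fillMatrix 1 (· < ·) w.2 *ᵥ p.2))) := by
  apply Units.ext
  rw [Units.val_mul, complBlock_joinPair_val, blockEmb_val, complBlock_val, colBlock_val,
    blockEmbMatrix_fromBlocks, Matrix.fromBlocks_multiply]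
  simp [border_one, border_zero, border_mul, border_add]

theorem fillMatrix_zero_coords {n : ℕ} (A : Matrix (Fin n) (Fin n) F)
    (h : ∀ i j, i < j → A i j = 0) : fillMatrix A (· < ·) 0 = A := by
  ext i j
  by_cases hij : i < j <;> simp [fillMatrix, hij, h]

theorem complBlock_zero {n : ℕ} : complBlock (0 : UpperPairs F n) = 1 := by
  apply Units.ext
  rw [complBlock_val, Prod.fst_zero, Prod.snd_zero, fillMatrix_zero_coords 0 (fun _ _ _ => rfl),
    fillMatrix_zero_coords _ (fun _ _ h => Matrix.one_apply_ne h.ne), Matrix.fromBlocks_one]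
  rfl

theorem colBlock_eq (p : (Fin k → F) × (Fin k → F)) : colBlock p = complBlock (joinPair (0, p)) := by
  have h := blockEmb_complBlock_mul_colBlock (0 : UpperPairs F k) p
  rw [complBlock_zero, blockEmb_one, one_mul, Prod.snd_zero,
    fillMatrix_zero_coords _ (fun _ _ h => Matrix.one_apply_ne h.ne), one_mulVec, one_mulVec] at h
  exact h

theorem colBlock_zero : colBlock (0 : (Fin k → F) × (Fin k → F)) = 1 := by
  apply Units.ext
  rw [colBlock_val]
  simp [border_zero, border_one]

/-- Carries (1 X; 0 1) from the left of the last columns to their right. The price is a shear of the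
second column by Xc, a unipotent diagonal factor, and an upper block whose trace is still Tr X. -/
theorem blockEmb_upperBlock_mul_colBlock (X : Matrix (Fin k) (Fin k) F)
    (p : (Fin k → F) × (Fin k → F)) :
    blockEmb (upperBlock X) * colBlock p = colBlock (p.1, p.2 - X *ᵥ p.1) *
      diagBlock (mirabolicMk (X *ᵥ p.1) 1 : GL (Fin (k + 1)) F) *
        upperBlock (border X (X *ᵥ p.2) 0 0) := by
  apply Units.ext
  rw [Units.val_mul, Units.val_mul, Units.val_mul, blockEmb_upperBlock, colBlock_val, colBlock_val]
  simp only [upperBlock, diagBlock, mirabolicMk_val, Matrix.fromBlocks_multiply, Units.val_one]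
  simp [border_mul, border_add, ← border_one]

theorem diagBlock_mul_colBlock (g : GL (Fin k) F) (p : (Fin k → F) × (Fin k → F)) :
    diagBlock (glEmb g) * colBlock p =
      colBlock (g.val *ᵥ p.1, g.val *ᵥ p.2) * diagBlock (glEmb g) := by
  apply Units.ext
  rw [Units.val_mul, Units.val_mul, colBlock_val, colBlock_val]
  simp only [diagBlock, glEmb_val, Matrix.fromBlocks_multiply]
  simp [border_mul]

/-- Once the column c is zero, commuting the last row x past the column d creates a corner x · d.
Its trace produces the Fourier kernel that pairs x with d. -/
theorem upperBlock_mul_colBlock_zero (x d : Fin k → F) :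
    upperBlock (border 0 0 x 0) * colBlock (0, d) =
      colBlock (0, d) * upperBlock (border 0 0 x (x ⬝ᵥ d)) := by
  apply Units.ext
  rw [Units.val_mul, Units.val_mul, colBlock_val]
  simp only [upperBlock, Matrix.fromBlocks_multiply]
  simp [border_mul, border_zero]

theorem superSum_border {m : ℕ} (A : Matrix (Fin (m + 1)) (Fin (m + 1)) F) (c : Fin (m + 1) → F)
    (t : F) : superSum (border A c 0 t) = superSum A + c (Fin.last m) := by
  have h1 : ∀ i : Fin (m + 1), (∑ j : Fin (m + 2),
      if (i.castSucc : ℕ) + 1 = j then border A c 0 t i.castSucc j else 0) =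
      (∑ j : Fin (m + 1), if (i : ℕ) + 1 = j then A i j else 0) +
        if i = Fin.last m then c i else 0 := fun i => by
    rw [Fin.sum_univ_castSucc]
    congr 1
    · simp
    · simp [Fin.ext_iff]
  rw [superSum, Fin.sum_univ_castSucc, Finset.sum_congr rfl fun i _ => h1 i,
    Finset.sum_add_distrib, superSum]
  have h2 : (∑ j : Fin (m + 2), if ((Fin.last (m + 1) : Fin (m + 2)) : ℕ) + 1 = j then
      border A c 0 t (Fin.last (m + 1)) j else 0) = 0 :=
    Finset.sum_eq_zero fun j _ => if_neg (by have := j.2; simp; omega)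
  rw [h2, add_zero, Finset.sum_ite_eq' Finset.univ (Fin.last m)]
  simp

theorem superSum_joinPair {m : ℕ}
    (q : UpperPairs F (m + 1) × ((Fin (m + 1) → F) × (Fin (m + 1) → F))) :
    superSum (fillMatrix 0 (· < ·) (joinPair q).1) =
      superSum (fillMatrix 0 (· < ·) q.1.1) + q.2.1 (Fin.last m) := by
  have h : fillMatrix (0 : Matrix (Fin (m + 1 + 1)) (Fin (m + 1 + 1)) F) (· < ·) (joinPair q).1 =
      border (fillMatrix 0 (· < ·) q.1.1) q.2.1 0 0 := by
    rw [← fillMatrix_joinFun_upper, border_zero]; rfl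
  rw [h, superSum_border]

theorem joinPair_add (q q' : UpperPairs F k × ((Fin k → F) × (Fin k → F))) :
    joinPair (q + q') = joinPair q + joinPair q' := by
  have h : ∀ (a b : ({p : Fin k × Fin k // p.1 < p.2} → F) × (Fin k → F)),
      joinFun (upperSplit k) (a + b) = joinFun (upperSplit k) a + joinFun (upperSplit k) b := by
    intro a b
    ext i
    simp only [joinFun, Pi.add_apply]
    rcases upperSplit k i with j | j <;> rfl
  exact Prod.ext (h (q.1.1, q.2.1) (q'.1.1, q'.2.1)) (h (q.1.2, q.2.2) (q'.1.2, q'.2.2))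

theorem norm_joinFun {ι κ ρ : Type*} [Fintype ι] [Fintype κ] [Fintype ρ] (e : ι ≃ κ ⊕ ρ)
    (p : (κ → F) × (ρ → F)) : ‖joinFun e p‖ = ‖p‖ := by
  refine le_antisymm ((pi_norm_le_iff_of_nonneg (norm_nonneg _)).2 fun i => ?_) ?_
  · rw [joinFun]
    rcases e i with j | j
    · exact (norm_le_pi_norm p.1 j).trans (norm_fst_le p)
    · exact (norm_le_pi_norm p.2 j).trans (norm_snd_le p)
  · rw [Prod.norm_def]
    refine max_le ((pi_norm_le_iff_of_nonneg (norm_nonneg _)).2 fun j => ?_)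
      ((pi_norm_le_iff_of_nonneg (norm_nonneg _)).2 fun j => ?_)
    · have h := norm_le_pi_norm (joinFun e p) (e.symm (Sum.inl j))
      rwa [joinFun_apply_of_symm e p (s := Sum.inl j) rfl] at h
    · have h := norm_le_pi_norm (joinFun e p) (e.symm (Sum.inr j))
      rwa [joinFun_apply_of_symm e p (s := Sum.inr j) rfl] at h

theorem norm_joinPair (q : UpperPairs F k × ((Fin k → F) × (Fin k → F))) :
    ‖joinPair q‖ = ‖q‖ := by
  rw [joinPair, Prod.norm_def, norm_joinFun, norm_joinFun]
  simp only [Prod.norm_def]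
  exact max_max_max_comm _ _ _ _

end BlockEmb

/-! ### Fourier inversion along the complement of the Shalika subgroup -/

section Inversion

variable {F : Type*} [NontriviallyNormedField F] [ProperSpace F] [MeasurableSpace F] [BorelSpace F]
  {ψ : AddChar F Circle} {μ : Measure F} [μ.IsAddHaarMeasure]

/-- The functions on `GL_{2n}` on which the Shalika subgroup of the mirabolic group acts on the
right by a character, and which are Schwartz-Bruhat functions along the complement. -/
structure IsShalikaEquivariant (ψ : AddChar F Circle) (e : ℕ) {n : ℕ}
    (Ψ : GL (Fin n ⊕ Fin n) F → ℂ) : Prop where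
  upper : ∀ g X, Ψ (g * upperBlock X) = (ψ (Matrix.trace X) : ℂ) * Ψ g
  diag : ∀ g (γ : mirabolic F n), Ψ (g * diagBlock (γ : GL (Fin n) F)) =
    (((‖(γ : GL (Fin n) F).val.det‖ ^ e)⁻¹ : ℝ) : ℂ) * Ψ g
  isSB : ∀ g, IsSB fun w : UpperPairs F n => Ψ (g * complBlock w)

instance sFinite_upperPairsMeasure (n : ℕ) : SFinite (upperPairsMeasure μ n) :=
  Measure.prod.instSFinite

theorem continuous_superSum_fill (n : ℕ) : Continuous fun w : UpperPairs F n =>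
    superSum (fillMatrix 0 (· < ·) w.1) := by
  unfold superSum
  refine continuous_finsetSum _ fun i _ => continuous_finsetSum _ fun j _ => ?_
  split_ifs
  · by_cases hij : i < j
    · simp only [fillMatrix, Matrix.of_apply, hij, dite_true]
      fun_prop
    · simp only [fillMatrix, Matrix.of_apply, hij, dite_false]
      exact continuous_const
  · exact continuous_const

theorem integrable_mul_character (hψc : Continuous ψ) {n : ℕ} {φ : UpperPairs F n → ℂ}
    (h : IsSB φ) : Integrable (fun w : UpperPairs F n => φ w *
      (ψ (-superSum (fillMatrix 0 (· < ·) w.1)) : ℂ)) (upperPairsMeasure μ n) := by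
  have hc : Continuous fun w : UpperPairs F n =>
      (ψ (-superSum (fillMatrix 0 (· < ·) w.1)) : ℂ) := by
    have h1 := hψc.comp (continuous_superSum_fill (F := F) n).neg
    exact continuous_induced_dom.comp h1
  have : BorelSpace (UpperPairs F n) := inferInstance
  have : IsFiniteMeasureOnCompacts (upperPairsMeasure μ n) := by
    unfold upperPairsMeasure; infer_instance
  exact (IsSB.integrable h _).mul_bdd (c := 1) hc.aestronglyMeasurable
    (Filter.Eventually.of_forall fun p => (Circle.norm_coe _).le)

theorem measurePreserving_joinPair (k : ℕ) :
    MeasurePreserving (joinPair (F := F) (k := k))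
      ((upperPairsMeasure μ k).prod ((piMeasure μ (Fin k)).prod (piMeasure μ (Fin k))))
      (upperPairsMeasure μ (k + 1)) := by
  have h1 := (measurePreserving_joinFun (μ := μ) (upperSplit k)).prod
    (measurePreserving_joinFun (μ := μ) (upperSplit k))
  have h2 : MeasurePreserving (fun q : UpperPairs F k × ((Fin k → F) × (Fin k → F)) =>
      ((q.1.1, q.2.1), (q.1.2, q.2.2)))
      ((upperPairsMeasure μ k).prod ((piMeasure μ (Fin k)).prod (piMeasure μ (Fin k))))
      (((piMeasure μ {p : Fin k × Fin k // p.1 < p.2}).prod (piMeasure μ (Fin k))).prod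
        ((piMeasure μ {p : Fin k × Fin k // p.1 < p.2}).prod (piMeasure μ (Fin k)))) := by
    have hm : Measurable (fun q : UpperPairs F k × ((Fin k → F) × (Fin k → F)) =>
      ((q.1.1, q.2.1), (q.1.2, q.2.2))) := by fun_prop
    refine ⟨hm, Measure.ext_of_lintegral _ fun f hf => ?_⟩
    have hfm : Measurable fun q : UpperPairs F k × ((Fin k → F) × (Fin k → F)) =>
      f ((q.1.1, q.2.1), (q.1.2, q.2.2)) := hf.comp hm
    rw [lintegral_map hf hm, lintegral_prod _ hfm.aemeasurable,
      lintegral_prod _ hf.aemeasurable, lintegral_prod, lintegral_prod]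
    · refine lintegral_congr fun a => ?_
      have h3 : ∀ b, ∫⁻ p : (Fin k → F) × (Fin k → F), f ((a, p.1), (b, p.2))
          ∂((piMeasure μ (Fin k)).prod (piMeasure μ (Fin k))) =
          ∫⁻ c, ∫⁻ d, f ((a, c), (b, d)) ∂(piMeasure μ (Fin k)) ∂(piMeasure μ (Fin k)) :=
        fun b => lintegral_prod _ (hf.comp (by fun_prop)).aemeasurable
      simp only [h3]
      rw [lintegral_lintegral_swap]
      · refine lintegral_congr fun c => ?_
        exact (lintegral_prod (fun z : _ × _ => f ((a, c), z))
          (hf.comp (by fun_prop)).aemeasurable).symm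
      · have h4 : Measurable fun z : ((({p : Fin k × Fin k // p.1 < p.2} → F) × (Fin k → F)) ×
            (Fin k → F)) => f ((a, z.1.2), (z.1.1, z.2)) := hf.comp (by fun_prop)
        exact h4.lintegral_prod_right'.aemeasurable
    · exact hf.lintegral_prod_right'.aemeasurable
    · exact hfm.lintegral_prod_right'.aemeasurable
  exact h1.comp h2

theorem integral_mulVec_prod (hs : HasNormScaling μ) {κ : Type*} [Fintype κ] [DecidableEq κ]
    {M : Matrix κ κ F} (hM : M.det ≠ 0) {f : (κ → F) × (κ → F) → ℂ} (hf : Measurable f) :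
    ∫ p, f (M *ᵥ p.1, M *ᵥ p.2) ∂((piMeasure μ κ).prod (piMeasure μ κ)) =
      (((‖M.det‖ ^ 2)⁻¹ : ℝ) : ℂ) * ∫ p, f p ∂((piMeasure μ κ).prod (piMeasure μ κ)) := by
  have hm : Measurable (Prod.map M.mulVec M.mulVec) :=
    (measurable_mulVec M).prodMap (measurable_mulVec M)
  have h1 : ((piMeasure μ κ).prod (piMeasure μ κ)).map (Prod.map M.mulVec M.mulVec) =
      (‖M.det‖ₑ ^ 2)⁻¹ • ((piMeasure μ κ).prod (piMeasure μ κ)) := by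
    rw [← Measure.map_prod_map _ _ (measurable_mulVec M) (measurable_mulVec M),
      map_mulVec_piMeasure hs hM, Measure.prod_smul_left, Measure.prod_smul_right, smul_smul, sq,
      ENNReal.mul_inv (Or.inl (by simpa using hM)) (Or.inl (by simp))]
  have h2 := integral_map (f := f) hm.aemeasurable
    (μ := (piMeasure μ κ).prod (piMeasure μ κ)) hf.aestronglyMeasurable
  rw [h1, integral_smul_measure] at h2
  refine h2.symm.trans ?_
  rw [Complex.real_smul, ENNReal.toReal_inv, ENNReal.toReal_pow, toReal_enorm]

namespace IsShalikaEquivariant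

variable {e m : ℕ} {Ψ : GL (Fin (m + 2) ⊕ Fin (m + 2)) F → ℂ}

theorem isSB_joinPair (h : IsShalikaEquivariant ψ e Ψ) (g : GL (Fin (m + 2) ⊕ Fin (m + 2)) F) :
    IsSB fun q => Ψ (g * complBlock (joinPair q)) :=
  (h.isSB g).comp (fun v l => ⟨joinPair l, joinPair_add v l, (norm_joinPair l).le⟩)
    fun v => (norm_joinPair v).ge

theorem isSB_colBlock (h : IsShalikaEquivariant ψ e Ψ) (g : GL (Fin (m + 2) ⊕ Fin (m + 2)) F) :
    IsSB fun p => Ψ (g * colBlock p) := by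
  simp only [colBlock_eq]
  exact (h.isSB_joinPair g).comp (L := fun p => ((0 : UpperPairs F (m + 1)), p))
    (fun v l => ⟨(0, l), by simp, by simp [Prod.norm_def]⟩) fun v => by simp [Prod.norm_def]

theorem measurable_colBlock (h : IsShalikaEquivariant ψ e Ψ) (hψc : Continuous ψ)
    (g : GL (Fin (m + 2) ⊕ Fin (m + 2)) F) :
    Measurable fun p : (Fin (m + 1) → F) × (Fin (m + 1) → F) =>
      Ψ (g * colBlock p) * (ψ (-p.1 (Fin.last m)) : ℂ) :=
  ((h.isSB_colBlock g).continuous.mul (by fun_prop)).measurable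

end IsShalikaEquivariant

/-- The integral of `Ψ` along the complement of the Shalika subgroup. -/
def complIntegral (μ : Measure F) (ψ : AddChar F Circle) {n : ℕ} (Ψ : GL (Fin n ⊕ Fin n) F → ℂ)
    (ξ : GL (Fin n ⊕ Fin n) F) : ℂ :=
  ∫ w, Ψ (ξ⁻¹ * complBlock w) * (ψ (-superSum (fillMatrix 0 (· < ·) w.1)) : ℂ)
    ∂(upperPairsMeasure μ n)

/-- The integral of `Ψ` along the last columns of the complement. -/
def colIntegral (μ : Measure F) (ψ : AddChar F Circle) {m : ℕ}
    (Ψ : GL (Fin (m + 2) ⊕ Fin (m + 2)) F → ℂ)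
    (ξ : GL (Fin (m + 2) ⊕ Fin (m + 2)) F) (g : GL (Fin (m + 1) ⊕ Fin (m + 1)) F) : ℂ :=
  ∫ p, Ψ (ξ⁻¹ * blockEmb g * colBlock p) * (ψ (-p.1 (Fin.last m)) : ℂ)
    ∂((piMeasure μ (Fin (m + 1))).prod (piMeasure μ (Fin (m + 1))))

variable {e m : ℕ} {Ψ : GL (Fin (m + 2) ⊕ Fin (m + 2)) F → ℂ}

theorem IsUpperUnip.mulVec_last {u : Matrix (Fin (m + 1)) (Fin (m + 1)) F} (hu : IsUpperUnip u)
    (c : Fin (m + 1) → F) : (u *ᵥ c) (Fin.last m) = c (Fin.last m) := by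
  have h : ∀ j, u (Fin.last m) j = (1 : Matrix (Fin (m + 1)) (Fin (m + 1)) F) (Fin.last m) j :=
    fun j => hu _ j (Fin.le_last j)
  rw [Matrix.mulVec, dotProduct, Finset.sum_congr rfl fun j _ => by rw [h j]]
  exact congrFun (one_mulVec c) (Fin.last m)

theorem mirabolic_mulVec_last (γ : mirabolic F (m + 1)) (c : Fin (m + 1) → F) :
    ((γ : GL (Fin (m + 1)) F).val *ᵥ c) (Fin.last m) = c (Fin.last m) := by
  have h : ∀ j, (γ : GL (Fin (m + 1)) F).val (Fin.last m) j =
      (1 : Matrix (Fin (m + 1)) (Fin (m + 1)) F) (Fin.last m) j :=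
    fun j => γ.2 _ j (by simp)
  rw [Matrix.mulVec, dotProduct, Finset.sum_congr rfl fun j _ => by rw [h j]]
  exact congrFun (one_mulVec c) (Fin.last m)

/-- The substitution of the columns by 1 + D has determinant 1 and fixes their last coordinate, the
only one that the character sees. -/
theorem colIntegral_mul_complBlock (hs : HasNormScaling μ) (hψc : Continuous ψ)
    (h : IsShalikaEquivariant ψ e Ψ)
    (ξ : GL (Fin (m + 2) ⊕ Fin (m + 2)) F) (g : GL (Fin (m + 1) ⊕ Fin (m + 1)) F)
    (w : UpperPairs F (m + 1)) :
    colIntegral μ ψ Ψ ξ (g * complBlock w) =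
      ∫ p, Ψ (ξ⁻¹ * blockEmb g * complBlock (joinPair (w, p))) * (ψ (-p.1 (Fin.last m)) : ℂ)
        ∂((piMeasure μ (Fin (m + 1))).prod (piMeasure μ (Fin (m + 1)))) := by
  have hu := isUpperUnip_fillMatrix w.2
  have hdet : (fillMatrix 1 (· < ·) w.2).det ≠ 0 := by rw [hu.det]; exact one_ne_zero
  have hm : Measurable fun p : (Fin (m + 1) → F) × (Fin (m + 1) → F) =>
      Ψ (ξ⁻¹ * blockEmb g * complBlock (joinPair (w, p))) * (ψ (-p.1 (Fin.last m)) : ℂ) := by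
    have h1 := (h.isSB_joinPair (ξ⁻¹ * blockEmb g)).continuous
    have h2 : Continuous fun p : (Fin (m + 1) → F) × (Fin (m + 1) → F) => (w, p) := by fun_prop
    exact ((h1.comp h2).mul (by fun_prop)).measurable
  have h3 := integral_mulVec_prod (μ := μ) hs hdet hm
  rw [hu.det, norm_one, one_pow, inv_one, Complex.ofReal_one, one_mul] at h3
  rw [← h3, colIntegral]
  refine integral_congr_ae (Filter.Eventually.of_forall fun p => ?_)
  simp only [hu.mulVec_last]
  rw [blockEmb_mul, ← blockEmb_complBlock_mul_colBlock]
  simp only [mul_assoc]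

/-- Moving (γ 0; 0 γ) past the two columns multiplies both by γ, with Jacobian |det γ|⁻², which
raises the exponent by 2. The character survives because a mirabolic γ preserves last coordinates.
For an upper block, the columns undergo a shear that preserves the measure. -/
theorem colIntegral_equivariant (hs : HasNormScaling μ) (hψc : Continuous ψ)
    (h : IsShalikaEquivariant ψ e Ψ) (ξ : GL (Fin (m + 2) ⊕ Fin (m + 2)) F) :
    IsShalikaEquivariant ψ (e + 2) (colIntegral μ ψ Ψ ξ) where
  upper g X := by
    have h1 : ∀ p : (Fin (m + 1) → F) × (Fin (m + 1) → F),
        Ψ (ξ⁻¹ * blockEmb (g * upperBlock X) * colBlock p) =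
          (ψ (Matrix.trace X) : ℂ) * Ψ (ξ⁻¹ * blockEmb g * colBlock (p.1, p.2 - X *ᵥ p.1)) := by
      intro p
      rw [blockEmb_mul, mul_assoc, mul_assoc, blockEmb_upperBlock_mul_colBlock, ← mul_assoc,
        ← mul_assoc, h.upper, ← mul_assoc, h.diag, mirabolicMk_val, det_border_row_zero, trace_border]
      simp [mul_assoc]
    have hm := h.measurable_colBlock hψc (ξ⁻¹ * blockEmb g)
    have hint : Integrable (fun p : (Fin (m + 1) → F) × (Fin (m + 1) → F) =>
        Ψ (ξ⁻¹ * blockEmb g * colBlock p) * (ψ (-p.1 (Fin.last m)) : ℂ))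
        ((piMeasure μ (Fin (m + 1))).prod (piMeasure μ (Fin (m + 1)))) :=
      ((h.isSB_colBlock _).integrable _).mul_bdd (c := 1)
        (by fun_prop : Continuous fun p : (Fin (m + 1) → F) × (Fin (m + 1) → F) =>
          (ψ (-p.1 (Fin.last m)) : ℂ)).aestronglyMeasurable
        (Filter.Eventually.of_forall fun p => (Circle.norm_coe _).le)
    have hmp : MeasurePreserving (fun p : (Fin (m + 1) → F) × (Fin (m + 1) → F) =>
        (p.1, p.2 - X *ᵥ p.1)) ((piMeasure μ (Fin (m + 1))).prod (piMeasure μ (Fin (m + 1))))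
        ((piMeasure μ (Fin (m + 1))).prod (piMeasure μ (Fin (m + 1)))) := by
      refine (MeasurePreserving.id _).skew_product
        (g := fun c (d : Fin (m + 1) → F) => d - X *ᵥ c) ?_ ?_
      · exact measurable_snd.sub ((measurable_mulVec X).comp measurable_fst)
      · refine Filter.Eventually.of_forall fun c => ?_
        simp only [sub_eq_add_neg]
        exact map_add_right_eq_self _ _
    have h2 := integral_map hmp.measurable.aemeasurable
      (by rw [hmp.map_eq]; exact hint.1)
    rw [hmp.map_eq] at h2
    simp only [colIntegral, h1, mul_assoc (ψ (Matrix.trace X) : ℂ)]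
    rw [integral_const_mul, h2]
  diag g γ := by
    have hdet := det_ne_zero (γ : GL (Fin (m + 1)) F)
    have h1 : ∀ p : (Fin (m + 1) → F) × (Fin (m + 1) → F),
        Ψ (ξ⁻¹ * blockEmb (g * diagBlock (γ : GL (Fin (m + 1)) F)) * colBlock p) *
          (ψ (-p.1 (Fin.last m)) : ℂ) =
          (((‖(γ : GL (Fin (m + 1)) F).val.det‖ ^ e)⁻¹ : ℝ) : ℂ) *
            (Ψ (ξ⁻¹ * blockEmb g * colBlock ((γ : GL (Fin (m + 1)) F).val *ᵥ p.1,
            (γ : GL (Fin (m + 1)) F).val *ᵥ p.2)) *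
              (ψ (-((γ : GL (Fin (m + 1)) F).val *ᵥ p.1) (Fin.last m)) : ℂ)) := by
      intro p
      have h2 := h.diag (ξ⁻¹ * blockEmb g * colBlock ((γ : GL (Fin (m + 1)) F).val *ᵥ p.1,
            (γ : GL (Fin (m + 1)) F).val *ᵥ p.2)) (mirabolicMk 0 (γ : GL (Fin (m + 1)) F))
      rw [mirabolicMk_val, det_border_row_zero, mul_one] at h2
      rw [blockEmb_mul, mul_assoc, mul_assoc, blockEmb_diagBlock, diagBlock_mul_colBlock, ← mul_assoc,
        ← mul_assoc, glEmb, h2, mirabolic_mulVec_last]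
      ring
    simp only [colIntegral, h1]
    rw [integral_const_mul, integral_mulVec_prod hs hdet (h.measurable_colBlock hψc _), ← mul_assoc,
      ← Complex.ofReal_mul, ← mul_inv, ← pow_add]
  isSB g := by
    simp only [colIntegral_mul_complBlock hs hψc h]
    exact IsSB.integral_right (h.isSB_joinPair (ξ⁻¹ * blockEmb g)) _ _

/-- Fubini for the splitting of the complement into its last columns and the rest: the superdiagonal
sum is that of the smaller matrix plus the bottom entry of the column. -/
theorem complIntegral_colIntegral (hs : HasNormScaling μ) (hψc : Continuous ψ)
    (h : IsShalikaEquivariant ψ e Ψ) (ξ : GL (Fin (m + 2) ⊕ Fin (m + 2)) F)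
    (η : GL (Fin (m + 1) ⊕ Fin (m + 1)) F) :
    complIntegral μ ψ (colIntegral μ ψ Ψ ξ) η = complIntegral μ ψ Ψ (blockEmb η * ξ) := by
  have hmp := measurePreserving_joinPair (μ := μ) (m + 1)
  have hint : Integrable (fun w : UpperPairs F (m + 2) => Ψ ((blockEmb η * ξ)⁻¹ * complBlock w) *
      (ψ (-superSum (fillMatrix 0 (· < ·) w.1)) : ℂ)) (upperPairsMeasure μ (m + 2)) :=
    integrable_mul_character hψc (h.isSB _)
  have h1 := integral_map hmp.measurable.aemeasurable (by rw [hmp.map_eq]; exact hint.1)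
  rw [hmp.map_eq] at h1
  rw [complIntegral, complIntegral, h1]
  refine Eq.trans ?_ (integral_prod _ ((hmp.integrable_comp hint.1).2 hint)).symm
  refine integral_congr_ae (Filter.Eventually.of_forall fun w => ?_)
  simp only
  rw [colIntegral_mul_complBlock hs hψc h, ← integral_mul_const]
  refine integral_congr_ae (Filter.Eventually.of_forall fun p => ?_)
  simp only
  rw [Function.comp_apply, superSum_joinPair, _root_.mul_inv_rev, ← blockEmb_inv, neg_add, AddChar.map_add_eq_mul,
    Circle.coe_mul]
  ring

end Inversion

/-! ### Fourier inversion in the last columns -/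

section InversionInduction

variable {F : Type*} [NontriviallyNormedField F] [ProperSpace F] [MeasurableSpace F] [BorelSpace F]
  {ψ : AddChar F Circle} {μ : Measure F} [μ.IsAddHaarMeasure]

theorem rowGL_mulVec_last {m : ℕ} {y : Fin (m + 1) → F} (hy : y (Fin.last m) ≠ 0)
    (c : Fin (m + 1) → F) : ((rowGL y).val *ᵥ c) (Fin.last m) = y ⬝ᵥ c := by
  rw [rowGL_val hy, Matrix.mulVec, dotProduct, dotProduct, Fin.sum_univ_castSucc,
    Fin.sum_univ_castSucc]
  simp

/-- Substituting `rowGL y` into both columns gives |y_last|⁻², and equivariance under the same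
matrix on the right gives |y_last|⁻ᵉ. The last coordinate of the transformed column is y · c, so the
fixed character becomes the Fourier kernel at y. -/
theorem colIntegral_rowGL {e m : ℕ} {Ψ : GL (Fin (m + 2) ⊕ Fin (m + 2)) F → ℂ}
    (hs : HasNormScaling μ) (hψc : Continuous ψ) (h : IsShalikaEquivariant ψ e Ψ)
    (x : Fin (m + 1) → F) {y : Fin (m + 1) → F} (hy : y (Fin.last m) ≠ 0) :
    (((‖y (Fin.last m)‖ ^ (e + 2))⁻¹ : ℝ) : ℂ) *
      colIntegral μ ψ Ψ (diagBlock (glEmb (rowGL y)) * upperBlock (border 0 0 x 0)) 1 =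
      ∫ p, Ψ ((upperBlock (border 0 0 x 0))⁻¹ * colBlock p) * (ψ (-(y ⬝ᵥ p.1)) : ℂ)
        ∂((piMeasure μ (Fin (m + 1))).prod (piMeasure μ (Fin (m + 1)))) := by
  set ξ := diagBlock (glEmb (rowGL y)) * upperBlock (border 0 0 x 0) with hξ
  have hdet : (rowGL y).val.det ≠ 0 := det_ne_zero _
  have hm := h.measurable_colBlock hψc (ξ⁻¹ * blockEmb 1)
  have h1 := integral_mulVec_prod (μ := μ) hs hdet hm
  rw [det_rowGL hy] at h1
  have h2 : ∀ p : (Fin (m + 1) → F) × (Fin (m + 1) → F),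
      Ψ (ξ⁻¹ * blockEmb 1 * colBlock ((rowGL y).val *ᵥ p.1, (rowGL y).val *ᵥ p.2)) *
        (ψ (-((rowGL y).val *ᵥ p.1) (Fin.last m)) : ℂ) = ((‖y (Fin.last m)‖ ^ e : ℝ) : ℂ) *
        (Ψ ((upperBlock (border 0 0 x 0))⁻¹ * colBlock p) * (ψ (-(y ⬝ᵥ p.1)) : ℂ)) := by
    intro p
    have h3 : ξ⁻¹ * blockEmb 1 * colBlock ((rowGL y).val *ᵥ p.1, (rowGL y).val *ᵥ p.2) *
        diagBlock (mirabolicMk 0 (rowGL y) : GL (Fin (m + 2)) F) =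
        (upperBlock (border 0 0 x 0))⁻¹ * colBlock p := by
      have h4 := diagBlock_mul_colBlock (rowGL y) p
      rw [glEmb] at h4
      rw [mul_assoc, ← h4, blockEmb_one, mul_one, hξ, _root_.mul_inv_rev, glEmb, mul_assoc,
        inv_mul_cancel_left]
    have h5 := h.diag (ξ⁻¹ * blockEmb 1 * colBlock ((rowGL y).val *ᵥ p.1, (rowGL y).val *ᵥ p.2))
      (mirabolicMk 0 (rowGL y))
    rw [h3, mirabolicMk_val, det_border_row_zero, mul_one, det_rowGL hy] at h5
    have h6 : ((‖y (Fin.last m)‖ ^ e : ℝ) : ℂ) ≠ 0 := by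
      exact_mod_cast pow_ne_zero _ (norm_ne_zero_iff.2 hy)
    rw [rowGL_mulVec_last hy, h5, Complex.ofReal_inv]
    field_simp
  simp only [h2] at h1
  rw [integral_const_mul] at h1
  have h7 : colIntegral μ ψ Ψ ξ 1 = ((‖y (Fin.last m)‖ ^ (e + 2) : ℝ) : ℂ) *
      ∫ p, Ψ ((upperBlock (border 0 0 x 0))⁻¹ * colBlock p) * (ψ (-(y ⬝ᵥ p.1)) : ℂ)
        ∂((piMeasure μ (Fin (m + 1))).prod (piMeasure μ (Fin (m + 1)))) := by
    have h8 : ((‖y (Fin.last m)‖ ^ 2 : ℝ) : ℂ) ≠ 0 := by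
      exact_mod_cast pow_ne_zero _ (norm_ne_zero_iff.2 hy)
    rw [pow_add, mul_comm (‖y (Fin.last m)‖ ^ e), Complex.ofReal_mul, mul_assoc, h1,
      Complex.ofReal_inv, mul_inv_cancel_left₀ h8]
    rfl
  have h9 : ((‖y (Fin.last m)‖ ^ (e + 2) : ℝ) : ℂ) ≠ 0 := by
    exact_mod_cast pow_ne_zero _ (norm_ne_zero_iff.2 hy)
  rw [h7, Complex.ofReal_inv, inv_mul_cancel_left₀ h9]

variable [IsUltrametricDist F]

/-- Inversion in the pair (c, y) sets c = 0. Then the row x commutes past d at the cost of ψ(-x ·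
d), and inversion in the pair (d, x) sets d = 0. -/
theorem integral_colBlock {e m : ℕ} {Ψ : GL (Fin (m + 2) ⊕ Fin (m + 2)) F → ℂ}
    (hψc : Continuous ψ) (hψ : ψ ≠ 1) (hμ : IsSelfDual ψ μ) (h : IsShalikaEquivariant ψ e Ψ) :
    ∫ x, ∫ y, ∫ p, Ψ ((upperBlock (border 0 0 x 0))⁻¹ * colBlock p) * (ψ (-(y ⬝ᵥ p.1)) : ℂ)
        ∂((piMeasure μ (Fin (m + 1))).prod (piMeasure μ (Fin (m + 1))))
        ∂(piMeasure μ (Fin (m + 1))) ∂(piMeasure μ (Fin (m + 1))) = Ψ 1 := by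
  have h1 : ∀ x : Fin (m + 1) → F,
      ∫ y, ∫ p, Ψ ((upperBlock (border 0 0 x 0))⁻¹ * colBlock p) * (ψ (-(y ⬝ᵥ p.1)) : ℂ)
        ∂((piMeasure μ (Fin (m + 1))).prod (piMeasure μ (Fin (m + 1))))
        ∂(piMeasure μ (Fin (m + 1))) =
      ∫ d, Ψ (colBlock (0, d)) * (ψ (-(x ⬝ᵥ d)) : ℂ) ∂(piMeasure μ (Fin (m + 1))) := by
    intro x
    have hsb := h.isSB_colBlock (upperBlock (border 0 0 x 0))⁻¹
    have h2 : ∀ y : Fin (m + 1) → F,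
        ∫ p, Ψ ((upperBlock (border 0 0 x 0))⁻¹ * colBlock p) * (ψ (-(y ⬝ᵥ p.1)) : ℂ)
          ∂((piMeasure μ (Fin (m + 1))).prod (piMeasure μ (Fin (m + 1)))) =
        ∫ c, (∫ d, Ψ ((upperBlock (border 0 0 x 0))⁻¹ * colBlock (c, d)) * 1
          ∂(piMeasure μ (Fin (m + 1)))) * (ψ (-(y ⬝ᵥ c)) : ℂ) ∂(piMeasure μ (Fin (m + 1))) := by
      intro y
      rw [integral_prod]
      · refine integral_congr_ae (Filter.Eventually.of_forall fun c => ?_)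
        simp only [mul_one]
        rw [integral_mul_const]
      · have hc : Continuous fun p : (Fin (m + 1) → F) × (Fin (m + 1) → F) =>
            (ψ (-(y ⬝ᵥ p.1)) : ℂ) := by
          unfold dotProduct
          fun_prop
        exact (hsb.integrable _).mul_bdd (c := 1) hc.aestronglyMeasurable
          (Filter.Eventually.of_forall fun p => (Circle.norm_coe _).le)
    simp only [h2]
    rw [fourier_inversion hψc hψ hμ (hsb.integral_right (piMeasure μ (Fin (m + 1))) fun _ => 1)]
    refine integral_congr_ae (Filter.Eventually.of_forall fun d => ?_)
    simp only [mul_one]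
    rw [← upperBlock_neg, border_neg, neg_zero, neg_zero, neg_zero, upperBlock_mul_colBlock_zero,
      h.upper, trace_border, Matrix.trace_zero, zero_add, neg_dotProduct, mul_comm]
  simp only [h1]
  have hsb : IsSB fun d : Fin (m + 1) → F => Ψ (colBlock (0, d)) := by
    have h3 := (h.isSB_colBlock 1).comp (L := fun d : Fin (m + 1) → F => ((0 : Fin (m + 1) → F), d))
      (fun v l => ⟨(0, l), by simp, by simp [Prod.norm_def]⟩) fun v => by simp [Prod.norm_def]
    simpa only [one_mul] using h3
  rw [fourier_inversion hψc hψ hμ hsb]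
  exact congrArg Ψ colBlock_zero

end InversionInduction

/-! ### The measure on the coset representatives and its recursion -/

section FlagMeasure

variable {F : Type*} [NontriviallyNormedField F] [ProperSpace F] [MeasurableSpace F] [BorelSpace F]
  {μ : Measure F} [μ.IsAddHaarMeasure]

variable (μ) in
/-- The measure on the Shalika subgroup of the mirabolic group modulo upper triangular matrices,
twisted by a power of the determinant. -/
def flagMeasure (e m : ℕ) : Measure (GL (Fin (m + 1) ⊕ Fin (m + 1)) F) :=
  (((lowerMeasure μ m).withDensity fun b => (‖b.val.det‖ₑ ^ e)⁻¹).prod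
    (strictLowerMeasure μ (m + 1))).map fun p =>
      upperBlock (p.2 : Matrix (Fin (m + 1)) (Fin (m + 1)) F) * diagBlock (glEmb p.1)

theorem measurable_flag {m : ℕ} : Measurable fun p : GL (Fin m) F × strictLower F (m + 1) =>
    upperBlock (p.2 : Matrix (Fin (m + 1)) (Fin (m + 1)) F) * diagBlock (glEmb p.1) :=
  (measurable_upperBlock.comp (measurable_subtype_coe.comp measurable_snd)).mul
    (measurable_diagBlock.comp (measurable_glEmb measurable_fst))

theorem measurable_enorm_det_pow_inv {m : ℕ} (e : ℕ) :
    Measurable fun b : GL (Fin m) F => (‖b.val.det‖ₑ ^ e)⁻¹ :=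
  ((measurable_det (measurable_gl_val measurable_id)).enorm.pow_const e).inv

theorem lintegral_flagMeasure {e m : ℕ} {f : GL (Fin (m + 1) ⊕ Fin (m + 1)) F → ℝ≥0∞}
    (hf : Measurable f) : ∫⁻ ξ, f ξ ∂(flagMeasure μ e m) =
      ∫⁻ b, (‖b.val.det‖ₑ ^ e)⁻¹ * ∫⁻ X, f (upperBlock (fillMatrix 0 (fun i j => j < i) X) *
        diagBlock (glEmb b)) ∂(piMeasure μ _) ∂(lowerMeasure μ m) := by
  have h1 : Measurable fun p : GL (Fin m) F × strictLower F (m + 1) =>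
      f (upperBlock (p.2 : Matrix (Fin (m + 1)) (Fin (m + 1)) F) * diagBlock (glEmb p.1)) :=
    hf.comp measurable_flag
  rw [flagMeasure, lintegral_map hf measurable_flag, lintegral_prod _ h1.aemeasurable,
    lintegral_withDensity_eq_lintegral_mul _ (measurable_enorm_det_pow_inv e)
      h1.lintegral_prod_right']
  refine lintegral_congr fun b => ?_
  rw [Pi.mul_apply]
  congr 1
  exact lintegral_strictLowerMeasure (h1.comp measurable_prodMk_left)

theorem flag_conj {k : ℕ} (x : Fin k → F) (β : GL (Fin k) F) :
    diagBlock (glEmb β) * upperBlock (border 0 0 (x ᵥ* β.val) 0) =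
      upperBlock (border 0 0 x 0) * diagBlock (glEmb β) := by
  have h2 : (x ᵥ* β.val) ᵥ* β⁻¹.val = x := by
    rw [vecMul_vecMul, ← Units.val_mul, mul_inv_cancel, Units.val_one, vecMul_one]
  have h1 : (glEmb β).val * border 0 0 (x ᵥ* β.val) 0 * (glEmb β).inv = border 0 0 x 0 := by
    have h3 : (glEmb β).inv = border β⁻¹.val 0 0 1 := by
      rw [← glEmb_val, glEmb_inv]; rfl
    rw [h3, glEmb_val, border_mul, border_mul]
    simp only [vecMulVec_zero, mulVec_zero, smul_zero,
      zero_vecMul, one_smul, dotProduct_zero, mul_zero, add_zero, zero_add, h2]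
    congr 1 <;> (try ext) <;> simp
  rw [diagBlock_mul_upperBlock, h1]

/-- Separates the last row x of X and the last row y of the lower triangular matrix from a coset
representative of larger size. The row x appears multiplied by β = `glEmb b * rowGL y`, since it has
to cross (β 0; 0 β). -/
theorem flag_step {m : ℕ} (b : GL (Fin m) F) (X : Matrix (Fin (m + 1)) (Fin (m + 1)) F)
    (y x : Fin (m + 1) → F) :
    blockEmb (upperBlock X * diagBlock (glEmb b)) * (diagBlock (glEmb (rowGL y)) *
      upperBlock (border 0 0 (x ᵥ* (glEmb b * rowGL y).val) 0)) =
      upperBlock (border X 0 x 0) * diagBlock (glEmb (glEmb b * rowGL y)) := by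
  have h1 : border X 0 x 0 = border X 0 0 0 + border (0 : Matrix (Fin (m + 1)) (Fin (m + 1)) F)
      0 x 0 := by
    rw [border_add]; simp
  rw [h1, upperBlock_add, mul_assoc, ← flag_conj x (glEmb b * rowGL y), blockEmb_mul,
    blockEmb_upperBlock, blockEmb_diagBlock, glEmb_mul (glEmb b), diagBlock_mul]
  simp only [mul_assoc]

theorem measurable_blockEmb {k : ℕ} : Measurable (blockEmb (F := F) (k := k)) := by
  have h := measurable_gl_val (measurable_id (α := GL (Fin k ⊕ Fin k) F))
  have hb : ∀ s t : Fin k → Fin k ⊕ Fin k,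
      Measurable fun g : GL (Fin k ⊕ Fin k) F => Matrix.of fun i j => g.val (s i) (t j) :=
    fun s t => measurable_matrix_iff.2 fun i j => measurable_matrix_apply h _ _
  exact measurable_fromBlocks_iff
    (measurable_border (hb Sum.inl Sum.inl) measurable_const measurable_const measurable_const)
    (measurable_border (hb Sum.inl Sum.inr) measurable_const measurable_const measurable_const)
    (measurable_border (hb Sum.inr Sum.inl) measurable_const measurable_const measurable_const)
    (measurable_border (hb Sum.inr Sum.inr) measurable_const measurable_const measurable_const)
    fun _ => rfl

theorem measurable_flag_succ {m : ℕ} : Measurable fun q : GL (Fin (m + 1) ⊕ Fin (m + 1)) F ×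
      ((Fin (m + 1) → F) × (Fin (m + 1) → F)) =>
      blockEmb q.1 * (diagBlock (glEmb (rowGL q.2.1)) * upperBlock (border 0 0 q.2.2 0)) := by
  refine (measurable_blockEmb.comp measurable_fst).mul (Measurable.mul ?_ ?_)
  · exact measurable_diagBlock.comp (measurable_glEmb
      (measurable_rowGL.comp (measurable_fst.comp measurable_snd)))
  · exact measurable_upperBlock.comp (measurable_border measurable_const measurable_const
      (measurable_snd.comp measurable_snd) measurable_const)

instance sFinite_flagMeasure (e m : ℕ) : SFinite (flagMeasure μ e m) := by
  unfold flagMeasure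
  infer_instance

variable (μ) in
/-- The measure on the last rows in the recursive description of `flagMeasure`. -/
def rowMeasure (e m : ℕ) : Measure ((Fin (m + 1) → F) × (Fin (m + 1) → F)) :=
  ((piMeasure μ (Fin (m + 1))).withDensity fun y => (‖y (Fin.last m)‖ₑ ^ (e + 2))⁻¹).prod
    (piMeasure μ (Fin (m + 1)))

instance sFinite_rowMeasure (e m : ℕ) : SFinite (rowMeasure μ e m) := by
  exact Measure.prod.instSFinite

theorem lintegral_vecMul (hs : HasNormScaling μ) {k : ℕ} (β : GL (Fin k) F)
    {f : (Fin k → F) → ℝ≥0∞} (hf : Measurable f) :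
    ∫⁻ x, f (x ᵥ* β.val) ∂(piMeasure μ (Fin k)) =
      ‖β.val.det‖ₑ⁻¹ * ∫⁻ x, f x ∂(piMeasure μ (Fin k)) := by
  have h := lintegral_mulVec (μ := μ) hs (M := β.valᵀ)
    (by rw [det_transpose]; exact det_ne_zero β) hf
  simpa only [mulVec_transpose, det_transpose] using h

theorem lintegral_rowMeasure {e m : ℕ} {f : (Fin (m + 1) → F) × (Fin (m + 1) → F) → ℝ≥0∞}
    (hf : Measurable f) : ∫⁻ p, f p ∂(rowMeasure μ e m) =
      ∫⁻ y, (‖y (Fin.last m)‖ₑ ^ (e + 2))⁻¹ * ∫⁻ x, f (y, x) ∂(piMeasure μ (Fin (m + 1)))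
        ∂(piMeasure μ (Fin (m + 1))) := by
  have hd : Measurable fun y : Fin (m + 1) → F => (‖y (Fin.last m)‖ₑ ^ (e + 2))⁻¹ :=
    ((measurable_pi_apply _).enorm.pow_const _).inv
  rw [rowMeasure, lintegral_prod _ hf.aemeasurable,
    lintegral_withDensity_eq_lintegral_mul _ hd hf.lintegral_prod_right']
  rfl

attribute [local irreducible] upperBlock diagBlock glEmb rowGL blockEmb border fillMatrix

/-- Besides the twist |det|⁻ᵉ there is one inverse factor from the recursive definition of the lower
triangular measure and one from the substitution x ↦ xβ. Both involve |det b| and |y_last|, so the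
two exponents become e + 2. -/
theorem flagMeasure_succ (hs : HasNormScaling μ) (e m : ℕ) :
    flagMeasure μ e (m + 1) = ((flagMeasure μ (e + 2) m).prod (rowMeasure μ e m)).map fun q =>
      blockEmb q.1 * (diagBlock (glEmb (rowGL q.2.1)) * upperBlock (border 0 0 q.2.2 0)) := by
  refine Measure.ext_of_lintegral _ fun f hf => ?_
  have hf1 : Measurable fun q : GL (Fin (m + 1) ⊕ Fin (m + 1)) F ×
      ((Fin (m + 1) → F) × (Fin (m + 1) → F)) =>
      f (blockEmb q.1 * (diagBlock (glEmb (rowGL q.2.1)) * upperBlock (border 0 0 q.2.2 0))) :=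
    hf.comp measurable_flag_succ
  have hfl : Measurable fun p : GL (Fin (m + 1)) F × strictLower F (m + 1 + 1) =>
      f (upperBlock (p.2 : Matrix (Fin (m + 1 + 1)) (Fin (m + 1 + 1)) F) *
        diagBlock (glEmb p.1)) := hf.comp measurable_flag
  have hfl2 : Measurable fun p : GL (Fin (m + 1)) F ×
      ({p : Fin (m + 1 + 1) × Fin (m + 1 + 1) // p.2 < p.1} → F) =>
      f (upperBlock (fillMatrix 0 (fun i j => j < i) p.2) * diagBlock (glEmb p.1)) :=
    hfl.comp (measurable_fst.prodMk (measurable_strictLowerOfCoords.comp measurable_snd))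
  have hfl3 : Measurable fun b : GL (Fin (m + 1)) F => (‖b.val.det‖ₑ ^ e)⁻¹ *
      ∫⁻ X, f (upperBlock (fillMatrix 0 (fun i j => j < i) X) * diagBlock (glEmb b))
        ∂(piMeasure μ {p : Fin (m + 1 + 1) × Fin (m + 1 + 1) // p.2 < p.1}) :=
    (measurable_enorm_det_pow_inv e).mul hfl2.lintegral_prod_right'
  rw [lintegral_flagMeasure hf, lintegral_lowerMeasure_succ hfl3,
    lintegral_map hf measurable_flag_succ, lintegral_prod _ hf1.aemeasurable,
    lintegral_flagMeasure hf1.lintegral_prod_right']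
  refine lintegral_congr fun b => ?_
  obtain ⟨T, hT, hTm⟩ : ∃ T : (({p : Fin (m + 1) × Fin (m + 1) // p.2 < p.1} → F) ×
      (Fin (m + 1) → F)) × (Fin (m + 1) → F) → ℝ≥0∞, (∀ X y x, T ((X, y), x) =
        f (blockEmb (upperBlock (fillMatrix 0 (fun i j => j < i) X) * diagBlock (glEmb b)) *
          (diagBlock (glEmb (rowGL y)) * upperBlock (border 0 0 x 0)))) ∧ Measurable T := by
    refine ⟨fun z => f (blockEmb (upperBlock (fillMatrix 0 (fun i j => j < i) z.1.1) *
      diagBlock (glEmb b)) * (diagBlock (glEmb (rowGL z.1.2)) * upperBlock (border 0 0 z.2 0))),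
      fun _ _ _ => rfl, ?_⟩
    have h1 : Measurable fun z : (({p : Fin (m + 1) × Fin (m + 1) // p.2 < p.1} → F) ×
        (Fin (m + 1) → F)) × (Fin (m + 1) → F) =>
        upperBlock (fillMatrix 0 (fun i j => j < i) z.1.1) * diagBlock (glEmb b) :=
      (measurable_upperBlock.comp ((measurable_fillMatrix 0 (fun i j => j < i)).comp
        (measurable_fst.comp measurable_fst))).mul measurable_const
    have h2 : Measurable fun z : (({p : Fin (m + 1) × Fin (m + 1) // p.2 < p.1} → F) ×
        (Fin (m + 1) → F)) × (Fin (m + 1) → F) => (z.1.2, z.2) := by fun_prop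
    have h3 := h1.prodMk h2
    have h4 := measurable_flag_succ.comp h3
    exact hf.comp h4
  have hTm1 : Measurable fun p : ({p : Fin (m + 1) × Fin (m + 1) // p.2 < p.1} → F) ×
      (Fin (m + 1) → F) => ∫⁻ x, T (p, x) ∂(piMeasure μ (Fin (m + 1))) :=
    hTm.lintegral_prod_right'
  have hTX : ∀ X, Measurable fun q : (Fin (m + 1) → F) × (Fin (m + 1) → F) => T ((X, q.1), q.2) :=
    fun X => hTm.comp (by fun_prop)
  have hTXy : ∀ X y, Measurable fun x : Fin (m + 1) → F => T ((X, y), x) :=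
    fun X y => hTm.comp (by fun_prop)
  have hd : Measurable fun y : Fin (m + 1) → F => (‖y (Fin.last m)‖ₑ ^ (e + 2))⁻¹ :=
    ((measurable_pi_apply _).enorm.pow_const _).inv
  have hR : ∀ X : {p : Fin (m + 1) × Fin (m + 1) // p.2 < p.1} → F,
      ∫⁻ q, f (blockEmb (upperBlock (fillMatrix 0 (fun i j => j < i) X) * diagBlock (glEmb b)) *
          (diagBlock (glEmb (rowGL q.1)) * upperBlock (border 0 0 q.2 0))) ∂(rowMeasure μ e m) =
      ∫⁻ y, (‖y (Fin.last m)‖ₑ ^ (e + 2))⁻¹ * ∫⁻ x, T ((X, y), x) ∂(piMeasure μ (Fin (m + 1)))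
        ∂(piMeasure μ (Fin (m + 1))) := fun X => by
    rw [← lintegral_rowMeasure (hTX X)]
    simp only [hT]
  simp only [hR]
  rw [lintegral_lintegral_swap (((hd.comp measurable_snd).mul hTm1).aemeasurable)]
  have hb0 : b.val.det ≠ 0 := det_ne_zero b
  have hb1 : ‖b.val.det‖ₑ ≠ 0 := by simpa using hb0
  -- The three factors are, in order, the weight in the lower triangular measure, the twist, and the
  -- Jacobian of x ↦ xβ.
  have hpow : (‖b.val.det‖ₑ ^ (e + 2))⁻¹ = ‖b.val.det‖ₑ⁻¹ * ((‖b.val.det‖ₑ ^ e)⁻¹ *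
      ‖b.val.det‖ₑ⁻¹) := by
    rw [← ENNReal.mul_inv (Or.inr (by simp)) (Or.inl (by simp)),
      ← ENNReal.mul_inv (Or.inl hb1) (Or.inl (by simp))]
    ring_nf
  rw [hpow, mul_assoc]
  congr 1
  rw [← lintegral_const_mul' _ _ (by finiteness)]
  refine lintegral_congr_ae ((ae_ne_zero (Fin.last m)).mono fun y hy => ?_)
  simp only
  have hy1 : ‖y (Fin.last m)‖ₑ ≠ 0 := by simpa using hy
  have hdet : (glEmb b * rowGL y).val.det = b.val.det * y (Fin.last m) := by
    rw [Units.val_mul, det_mul, det_glEmb, det_rowGL hy]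
  have hX : ∫⁻ X, f (upperBlock (fillMatrix 0 (fun i j => j < i) X) *
      diagBlock (glEmb (glEmb b * rowGL y)))
        ∂(piMeasure μ {p : Fin (m + 1 + 1) × Fin (m + 1 + 1) // p.2 < p.1}) =
      ‖(glEmb b * rowGL y).val.det‖ₑ⁻¹ * ∫⁻ X, ∫⁻ x, T ((X, y), x)
        ∂(piMeasure μ (Fin (m + 1))) ∂(piMeasure μ {p : Fin (m + 1) × Fin (m + 1) // p.2 < p.1}) := by
    have hm : Measurable fun X : {p : Fin (m + 1 + 1) × Fin (m + 1 + 1) // p.2 < p.1} → F =>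
        f (upperBlock (fillMatrix 0 (fun i j => j < i) X) *
          diagBlock (glEmb (glEmb b * rowGL y))) := hfl2.comp measurable_prodMk_left
    rw [lintegral_joinFun (lowerSplit (m + 1)) hm, ← lintegral_const_mul']
    · refine lintegral_congr fun X => ?_
      rw [← lintegral_vecMul hs _ (hTXy X y)]
      refine lintegral_congr fun x => ?_
      rw [hT, flag_step, ← fillMatrix_joinFun_lower, border_zero]
    · rw [hdet]
      simp [hb0, hy]
  rw [hX, hdet, enorm_mul, lintegral_const_mul' _ _ (by simp [hy])]
  have hA : (‖y (Fin.last m)‖ₑ ^ (e + 2))⁻¹ = ‖y (Fin.last m)‖ₑ⁻¹ *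
      ((‖y (Fin.last m)‖ₑ ^ e)⁻¹ * ‖y (Fin.last m)‖ₑ⁻¹) := by
    rw [← ENNReal.mul_inv (Or.inr (by simp)) (Or.inl (by simp)),
      ← ENNReal.mul_inv (Or.inl hy1) (Or.inl (by simp))]
    ring_nf
  rw [hA, mul_pow, ENNReal.mul_inv (Or.inr (by simp)) (Or.inl (by simp)),
    ENNReal.mul_inv (Or.inl hb1) (Or.inl (by simp))]
  ring

end FlagMeasure

/-! ### The inversion formula -/

section InversionTheorem

variable {F : Type*} [NontriviallyNormedField F] [ProperSpace F] [MeasurableSpace F] [BorelSpace F]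
  {ψ : AddChar F Circle} {μ : Measure F} [μ.IsAddHaarMeasure] [IsUltrametricDist F]

/-- Base of the induction: in size one the group of coset representatives is reduced to a point. -/
theorem flagMeasure_zero (e : ℕ) : flagMeasure μ e 0 = Measure.dirac 1 := by
  refine Measure.ext_of_lintegral _ fun f hf => ?_
  have hd : Measurable fun b : GL (Fin 0) F => (‖b.val.det‖ₑ ^ e)⁻¹ *
      ∫⁻ X, f (upperBlock (fillMatrix 0 (fun i j => j < i) X) * diagBlock (glEmb b))
        ∂(piMeasure μ {p : Fin (0 + 1) × Fin (0 + 1) // p.2 < p.1}) := by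
    have h1 : ∀ b : GL (Fin 0) F, b = 1 := fun g => Units.ext (Subsingleton.elim _ _)
    have h2 : (fun b : GL (Fin 0) F => (‖b.val.det‖ₑ ^ e)⁻¹ *
      ∫⁻ X, f (upperBlock (fillMatrix 0 (fun i j => j < i) X) * diagBlock (glEmb b))
        ∂(piMeasure μ {p : Fin (0 + 1) × Fin (0 + 1) // p.2 < p.1})) = fun _ =>
      (‖(1 : GL (Fin 0) F).val.det‖ₑ ^ e)⁻¹ *
      ∫⁻ X, f (upperBlock (fillMatrix 0 (fun i j => j < i) X) * diagBlock (glEmb 1))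
        ∂(piMeasure μ {p : Fin (0 + 1) × Fin (0 + 1) // p.2 < p.1}) :=
      funext fun b => by rw [h1 b]
    rw [h2]
    exact measurable_const
  have hem : IsEmpty {p : Fin (0 + 1) × Fin (0 + 1) // p.2 < p.1} :=
    ⟨fun p => absurd p.2 (by have := p.1.1.2; have := p.1.2.2; omega)⟩
  have h3 : ∀ X : {p : Fin (0 + 1) × Fin (0 + 1) // p.2 < p.1} → F,
      upperBlock (fillMatrix 0 (fun i j => j < i) X) * diagBlock (glEmb 1) = 1 := fun X => by
    have h4 : fillMatrix (0 : Matrix (Fin (0 + 1)) (Fin (0 + 1)) F) (fun i j => j < i) X = 0 := by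
      ext i j
      have : ¬ j < i := fun h => hem.false ⟨(i, j), h⟩
      simp [fillMatrix, this]
    rw [h4, upperBlock_zero, glEmb_one, diagBlock_one, one_mul]
  rw [lintegral_flagMeasure hf, lowerMeasure, lintegral_dirac' _ hd, lintegral_dirac' _ hf]
  simp only [h3]
  simp [piMeasure]

theorem complIntegral_one {Ψ : GL (Fin 1 ⊕ Fin 1) F → ℂ} :
    complIntegral μ ψ Ψ 1 = Ψ 1 := by
  have hem : IsEmpty {p : Fin 1 × Fin 1 // p.1 < p.2} :=
    ⟨fun p => absurd p.2 (by have := p.1.1.2; have := p.1.2.2; omega)⟩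
  have h1 : ∀ w : UpperPairs F 1, w = 0 := fun w => Subsingleton.elim _ _
  have h2 : ∀ w : UpperPairs F 1, Ψ (1⁻¹ * complBlock w) *
      (ψ (-superSum (fillMatrix 0 (· < ·) w.1)) : ℂ) = Ψ 1 := fun w => by
    rw [h1 w, complBlock_zero, Prod.fst_zero, fillMatrix_zero_coords 0 (fun _ _ _ => rfl)]
    simp [superSum]
  rw [complIntegral]
  simp only [h2]
  rw [integral_const]
  have : (upperPairsMeasure μ 1).real Set.univ = 1 := by
    rw [Measure.real, upperPairsMeasure, ← Set.univ_prod_univ, Measure.prod_prod]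
    simp [piMeasure]
  rw [this, one_smul]

theorem integral_rowMeasure {e m : ℕ} {g : (Fin (m + 1) → F) × (Fin (m + 1) → F) → ℂ}
    (hg : Integrable g (rowMeasure μ e m)) : ∫ p, g p ∂(rowMeasure μ e m) =
      ∫ x, ∫ y, (((‖y (Fin.last m)‖ ^ (e + 2))⁻¹ : ℝ) : ℂ) * g (y, x)
        ∂(piMeasure μ (Fin (m + 1))) ∂(piMeasure μ (Fin (m + 1))) := by
  have hd : Measurable fun y : Fin (m + 1) → F => (‖y (Fin.last m)‖ₑ ^ (e + 2))⁻¹ :=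
    ((measurable_pi_apply _).enorm.pow_const _).inv
  rw [rowMeasure] at hg ⊢
  rw [integral_prod_symm _ hg]
  refine integral_congr_ae (Filter.Eventually.of_forall fun x => ?_)
  simp only
  rw [integral_withDensity_eq_integral_toReal_smul hd
    ((ae_ne_zero (Fin.last m)).mono fun y hy =>
      ENNReal.inv_lt_top.2 (ENNReal.pow_pos (enorm_pos.2 hy) _))]
  refine integral_congr_ae (Filter.Eventually.of_forall fun y => ?_)
  simp only
  rw [Complex.real_smul, ENNReal.toReal_inv, ENNReal.toReal_pow, toReal_enorm]

/-- Induction on the size. For almost every last row (y, x) the induction hypothesis evaluates the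
integral over the smaller representatives at the identity, and Fourier inversion then integrates
over (y, x). Integrability cannot be dropped, since it justifies this order of integration. -/
theorem integral_flagMeasure (hs : HasNormScaling μ) (hψc : Continuous ψ) (hψ : ψ ≠ 1)
    (hμ : IsSelfDual ψ μ) (m e : ℕ) {Ψ : GL (Fin (m + 1) ⊕ Fin (m + 1)) F → ℂ}
    (h : IsShalikaEquivariant ψ e Ψ) (hint : Integrable (complIntegral μ ψ Ψ) (flagMeasure μ e m)) :
    ∫ ξ, complIntegral μ ψ Ψ ξ ∂(flagMeasure μ e m) = Ψ 1 := by
  induction m generalizing e with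
  | zero =>
    rw [flagMeasure_zero] at hint ⊢
    rw [integral_dirac]
    exact complIntegral_one
  | succ m ih =>
    rw [flagMeasure_succ hs] at hint ⊢
    have hm : AEMeasurable _ ((flagMeasure μ (e + 2) m).prod (rowMeasure μ e m)) :=
      measurable_flag_succ.aemeasurable
    rw [integral_map hm hint.1]
    have hint2 := (integrable_map_measure hint.1 hm).1 hint
    have h1 : ∀ q : GL (Fin (m + 1) ⊕ Fin (m + 1)) F × ((Fin (m + 1) → F) × (Fin (m + 1) → F)),
        complIntegral μ ψ Ψ (blockEmb q.1 *
          (diagBlock (glEmb (rowGL q.2.1)) * upperBlock (border 0 0 q.2.2 0))) =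
        complIntegral μ ψ (colIntegral μ ψ Ψ
          (diagBlock (glEmb (rowGL q.2.1)) * upperBlock (border 0 0 q.2.2 0))) q.1 := fun q =>
      (complIntegral_colIntegral hs hψc h _ _).symm
    have hint3 : Integrable (fun q : GL (Fin (m + 1) ⊕ Fin (m + 1)) F ×
        ((Fin (m + 1) → F) × (Fin (m + 1) → F)) => complIntegral μ ψ (colIntegral μ ψ Ψ
          (diagBlock (glEmb (rowGL q.2.1)) * upperBlock (border 0 0 q.2.2 0))) q.1)
        ((flagMeasure μ (e + 2) m).prod (rowMeasure μ e m)) :=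
      hint2.congr (Filter.Eventually.of_forall h1)
    simp only [h1]
    rw [integral_prod_symm _ hint3]
    -- Integrability on the product passes to almost every slice, which is what the induction
    -- hypothesis requires; the exponent there is e + 2.
    have h2 : ∀ᵐ p ∂(rowMeasure μ e m), ∫ η, complIntegral μ ψ (colIntegral μ ψ Ψ
          (diagBlock (glEmb (rowGL p.1)) * upperBlock (border 0 0 p.2 0))) η
          ∂(flagMeasure μ (e + 2) m) = colIntegral μ ψ Ψ
          (diagBlock (glEmb (rowGL p.1)) * upperBlock (border 0 0 p.2 0)) 1 := by
      filter_upwards [hint3.prod_left_ae] with p hp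
      exact ih (e + 2) (colIntegral_equivariant hs hψc h _) hp
    -- The density of the row measure is exactly the factor needed to turn the column integral at
    -- the identity into a Fourier transform in y.
    rw [integral_congr_ae h2, integral_rowMeasure (hint3.integral_prod_right.congr h2),
      ← integral_colBlock hψc hψ hμ h]
    refine integral_congr_ae (Filter.Eventually.of_forall fun x => ?_)
    refine integral_congr_ae ((ae_ne_zero (Fin.last m)).mono fun y hy => ?_)
    exact colIntegral_rowGL hs hψc h x hy

end InversionTheorem

/-! ### Boundedness -/

section Boundedness

variable {F : Type*} [NontriviallyNormedField F] [IsUltrametricDist F]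

theorem norm_det_le {ι : Type*} [Fintype ι] [DecidableEq ι] {A : Matrix ι ι F} {R : ℝ}
    (hR : 0 ≤ R) (hA : MatBdd A R) : ‖A.det‖ ≤ R ^ Fintype.card ι := by
  rw [det_apply]
  refine IsUltrametricDist.norm_sum_le_of_forall_le_of_nonneg (by positivity) fun σ _ => ?_
  have h1 : ‖Equiv.Perm.sign σ • ∏ i, A (σ i) i‖ = ‖∏ i, A (σ i) i‖ := by
    rcases Int.units_eq_one_or (Equiv.Perm.sign σ) with h | h <;> simp [h]
  rw [h1, norm_prod]
  calc ∏ i, ‖A (σ i) i‖ ≤ ∏ _i : ι, R :=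
        Finset.prod_le_prod (fun _ _ => norm_nonneg _) fun i _ => hA _ _
    _ = R ^ Fintype.card ι := by simp

/-- Each coefficient is the determinant of A with one row replaced by a basis vector; R ≥ 1 also
covers the entry 1 of this row. -/
theorem MatBdd.adjugate {ι : Type*} [Fintype ι] [DecidableEq ι] {A : Matrix ι ι F} {R : ℝ}
    (hA : MatBdd A R) (hR : 1 ≤ R) : MatBdd A.adjugate (R ^ Fintype.card ι) := fun i j => by
  rw [adjugate_apply]
  refine norm_det_le (zero_le_one.trans hR) fun k l => ?_
  by_cases hk : k = j
  · subst hk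
    rw [updateRow_self]
    by_cases hl : l = i
    · subst hl; simpa using hR
    · rw [Pi.single_eq_of_ne hl, norm_zero]; linarith
  · rw [updateRow_ne hk]; exact hA k l

theorem boundedGL_mul {ι : Type*} [Fintype ι] [DecidableEq ι] {g h : GL ι F} {R S : ℝ} (hR : 0 ≤ R)
    (hS : 0 ≤ S) (hg : g ∈ boundedGL ι F R) (hh : h ∈ boundedGL ι F S) :
    g * h ∈ boundedGL ι F (R * S) :=
  ⟨hg.1.mul hh.1 hR hS, by
    rw [_root_.mul_inv_rev, mul_comm R S]; exact hh.2.mul hg.2 hS hR⟩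

theorem boundedGL_inv {ι : Type*} [Fintype ι] [DecidableEq ι] {g : GL ι F} {R : ℝ}
    (hg : g ∈ boundedGL ι F R) : g⁻¹ ∈ boundedGL ι F R := ⟨hg.2, by rw [inv_inv]; exact hg.1⟩

theorem conjShuffle_mem_boundedGL {n : ℕ} {A : GL (Fin n ⊕ Fin n) F} {R : ℝ} :
    conjShuffle n A ∈ boundedGL (Fin (2 * n)) F R ↔ A ∈ boundedGL (Fin n ⊕ Fin n) F R := by
  have h : ∀ A : GL (Fin n ⊕ Fin n) F, MatBdd (conjShuffle n A).val R ↔ MatBdd A.val R := fun A => by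
    constructor
    · intro h i j
      rw [← conjShuffle_apply]
      exact h _ _
    · intro h i j
      obtain ⟨i, rfl⟩ := (shuffle n).surjective i
      obtain ⟨j, rfl⟩ := (shuffle n).surjective j
      rw [conjShuffle_apply]
      exact h _ _
  rw [boundedGL, boundedGL, Set.mem_ofPred_eq, Set.mem_ofPred_eq, h A, ← map_inv, h A⁻¹]

/-- The factorization is proper. The blocks of the product bound γ, Zγ and Cγ, and the lower right
block of the inverse bounds γ⁻¹U⁻¹, where U = 1 + D. Multiplying by γ bounds U⁻¹; as det U = 1, U is
the adjugate of U⁻¹ and is bounded; then γ⁻¹ = (γ⁻¹U⁻¹)U is bounded, hence Z and C. -/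
theorem exists_bdd_factors (n : ℕ) {R : ℝ} (hR : 1 ≤ R) : ∃ S : ℝ, 1 ≤ S ∧
    ∀ (w : UpperPairs F n) (Z : Matrix (Fin n) (Fin n) F) (γ : GL (Fin n) F),
      complBlock w * (upperBlock Z * diagBlock γ) ∈ boundedGL (Fin n ⊕ Fin n) F R →
      γ ∈ boundedGL (Fin n) F S ∧ MatBdd Z S ∧ MatBdd (fillMatrix 0 (· < ·) w.1) S ∧
        MatBdd (fillMatrix 1 (· < ·) w.2) S := by
  have hR0 : 0 ≤ R := zero_le_one.trans hR
  set Q : ℝ := (R * R) ^ Fintype.card (Fin n) with hQ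
  have hRR : 1 ≤ R * R := one_le_mul_of_one_le_of_one_le hR hR
  have hQ1 : 1 ≤ Q := one_le_pow₀ hRR
  have hQ0 : 0 ≤ Q := zero_le_one.trans hQ1
  have hRQ : 1 ≤ R * Q := one_le_mul_of_one_le_of_one_le hR hQ1
  have hS1 : R ≤ R * (R * Q) := le_mul_of_one_le_right hR0 hRQ
  have hS2 : Q ≤ R * (R * Q) := by
    rw [← mul_assoc]; exact le_mul_of_one_le_left hQ0 hRR
  have hS3 : R * Q ≤ R * (R * Q) := le_mul_of_one_le_left (zero_le_one.trans hRQ) hR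
  refine ⟨R * (R * Q), hR.trans hS1, fun w Z γ h => ?_⟩
  set U := (unipOfCoords w.2 : GL (Fin n) F) with hU
  have hUu : IsUpperUnip U.val := isUpperUnip_fillMatrix w.2
  have hval : (complBlock w * (upperBlock Z * diagBlock γ)).val = Matrix.fromBlocks γ.val
      (Z * γ.val) (fillMatrix 0 (· < ·) w.1 * γ.val)
      (fillMatrix 0 (· < ·) w.1 * (Z * γ.val) + fillMatrix 1 (· < ·) w.2 * γ.val) := by
    rw [Units.val_mul, upperBlock_mul_diagBlock_val, complBlock_val]
    simp [Matrix.fromBlocks_multiply]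
  have hinv : ((complBlock w * (upperBlock Z * diagBlock γ))⁻¹).val.toBlocks₂₂ =
      γ⁻¹.val * U⁻¹.val := by
    have h1 : ((complBlock w)⁻¹).val = Matrix.fromBlocks 1 0
      (-(U.inv * fillMatrix 0 (· < ·) w.1)) U.inv := rfl
    have h2 : ((upperBlock Z * diagBlock γ)⁻¹).val = Matrix.fromBlocks γ.inv (-(γ.inv * Z)) 0
        γ.inv := by
      rw [_root_.mul_inv_rev, Units.val_mul]
      change Matrix.fromBlocks γ.inv 0 0 γ.inv * Matrix.fromBlocks 1 (-Z) 0 1 = _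
      simp [Matrix.fromBlocks_multiply]
    rw [_root_.mul_inv_rev, Units.val_mul, h1, h2, Matrix.fromBlocks_multiply,
      Matrix.toBlocks_fromBlocks₂₂]
    simp only [Matrix.zero_mul, zero_add]
    rfl
  obtain ⟨hb, hb'⟩ := h
  rw [hval] at hb
  have hγ : MatBdd γ.val R := fun i j => hb (Sum.inl i) (Sum.inl j)
  have hZγ : MatBdd (Z * γ.val) R := fun i j => hb (Sum.inl i) (Sum.inr j)
  have hCγ : MatBdd (fillMatrix 0 (· < ·) w.1 * γ.val) R := fun i j => hb (Sum.inr i) (Sum.inl j)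
  have hγU : MatBdd (γ⁻¹.val * U⁻¹.val) R := by
    rw [← hinv]
    exact fun i j => hb' (Sum.inr i) (Sum.inr j)
  have hUi : MatBdd U⁻¹.val (R * R) := by
    have h1 := hγ.mul hγU hR0 hR0
    rwa [← Matrix.mul_assoc, ← Units.val_mul, mul_inv_cancel, Units.val_one, Matrix.one_mul] at h1
  have hUb : MatBdd U.val Q := by
    have h1 : U.val = adjugate U⁻¹.val := by
      have h2 : (U⁻¹.val).det = 1 := IsUpperUnip.det (isUpperUnip_inv (unipOfCoords w.2))
      have h3 : U⁻¹.val * adjugate U⁻¹.val = 1 := by rw [mul_adjugate, h2, one_smul]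
      have h4 := congrArg (U.val * ·) h3
      simp only [← Matrix.mul_assoc, Matrix.mul_one] at h4
      rw [← Units.val_mul, mul_inv_cancel, Units.val_one, Matrix.one_mul] at h4
      exact h4.symm
    rw [h1]
    exact hUi.adjugate hRR
  have hγi : MatBdd γ⁻¹.val (R * Q) := by
    have h1 := hγU.mul hUb hR0 hQ0
    rwa [Matrix.mul_assoc, ← Units.val_mul, inv_mul_cancel, Units.val_one, Matrix.mul_one] at h1
  have hcancel : ∀ A : Matrix (Fin n) (Fin n) F, A * γ.val * γ⁻¹.val = A := fun A => by
    rw [Matrix.mul_assoc, ← Units.val_mul, mul_inv_cancel, Units.val_one, Matrix.mul_one]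
  refine ⟨⟨hγ.mono hS1, hγi.mono hS3⟩, ?_, ?_, hUb.mono hS2⟩
  · have h1 := hZγ.mul hγi hR0 (zero_le_one.trans hRQ)
    rwa [hcancel] at h1
  · have h1 := hCγ.mul hγi hR0 (zero_le_one.trans hRQ)
    rwa [hcancel] at h1

theorem norm_coords_le {n : ℕ} {A : Matrix (Fin n) (Fin n) F} {S : ℝ} (hS : 0 ≤ S)
    {x : {p : Fin n × Fin n // p.1 < p.2} → F} (h : MatBdd (fillMatrix A (· < ·) x) S) :
    ‖x‖ ≤ S := by
  refine (pi_norm_le_iff_of_nonneg hS).2 fun p => ?_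
  have h1 := h p.1.1 p.1.2
  simpa [fillMatrix, p.2] using h1

variable [ProperSpace F] [MeasurableSpace F] [BorelSpace F] {μ : Measure F} [μ.IsAddHaarMeasure]

theorem measurableSet_matBdd {n : ℕ} (R : ℝ) :
    MeasurableSet {A : Matrix (Fin n) (Fin n) F | MatBdd A R} := by
  have h : {A : Matrix (Fin n) (Fin n) F | MatBdd A R} =
      ⋂ i, ⋂ j, {A : Matrix (Fin n) (Fin n) F | ‖A i j‖ ≤ R} := by
    ext A; simp [MatBdd]
  rw [h]
  exact MeasurableSet.iInter fun i => MeasurableSet.iInter fun j =>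
    measurableSet_le (measurable_matrix_apply measurable_id i j).norm measurable_const

theorem matrixMeasure_bdd_lt_top {n : ℕ} (R : ℝ) :
    matrixMeasure μ n {A : Matrix (Fin n) (Fin n) F | MatBdd A R} < ∞ := by
  have h : {A : Matrix (Fin n) (Fin n) F | MatBdd A R} = Set.univ.pi fun _ : Fin n =>
      {x : Fin n → F | ∀ k, ‖x k‖ ≤ R} := by
    ext A
    exact ⟨fun h i _ j => h i j, fun h i j => h i trivial j⟩
  rw [h, matrixMeasure]
  refine (Measure.pi_pi (fun _ : Fin n => piMeasure μ (Fin n)) _).trans_lt ?_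
  exact ENNReal.prod_lt_top fun _ _ => piMeasure_bdd_lt_top R

theorem glMeasure_boundedGL_lt_top {n : ℕ} {R : ℝ} (hR : 0 ≤ R) :
    glMeasure μ n (boundedGL (Fin n) F R) < ∞ := by
  have hm := measurableSet_boundedGL (ι := Fin n) (F := F) R
  rw [glMeasure, withDensity_apply _ hm]
  have hb : ∀ g ∈ boundedGL (Fin n) F R, (‖g.val.det‖ₑ ^ n)⁻¹ ≤ ENNReal.ofReal ((R ^ n) ^ n) := by
    intro g hg
    have h1 : ‖(g⁻¹).val.det‖ ≤ R ^ n := by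
      simpa using norm_det_le hR hg.2
    have h2 : ‖(g⁻¹).val.det‖ₑ = ‖g.val.det‖ₑ⁻¹ := by
      have h3 : g.val.det * (g⁻¹).val.det = 1 := by
        rw [← det_mul, ← Units.val_mul, mul_inv_cancel, Units.val_one, det_one]
      rw [eq_inv_of_mul_eq_one_right h3, enorm_inv (det_ne_zero g)]
    rw [ENNReal.inv_pow, ← h2, ENNReal.ofReal_pow (by positivity)]
    gcongr
    rw [← ofReal_norm]
    exact ENNReal.ofReal_le_ofReal h1
  refine (setLIntegral_mono measurable_const hb).trans_lt ?_
  rw [lintegral_const, Measure.restrict_apply_univ]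
  refine ENNReal.mul_lt_top ENNReal.ofReal_lt_top ?_
  rw [measurableEmbedding_gl_val.comap_apply]
  refine (measure_mono ?_).trans_lt (matrixMeasure_bdd_lt_top (μ := μ) (n := n) R)
  rintro _ ⟨g, hg, rfl⟩
  exact hg.1

variable (μ) in
/-- The volume of the set of the pairs of an element of the complement and of an element of the
Shalika subgroup whose product is bounded. -/
def boundedVolume (n : ℕ) (R : ℝ) : ℝ≥0∞ :=
  ∫⁻ g, ∫⁻ Z, ∫⁻ w, (boundedGL (Fin n ⊕ Fin n) F R).indicator 1
    (complBlock w * (upperBlock Z * diagBlock g)) ∂(upperPairsMeasure μ n)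
      ∂(matrixMeasure μ n) ∂(glMeasure μ n)

/-- By properness of the factorization the indicator is dominated by a product of indicators of
bounded sets in the three variables. -/
theorem boundedVolume_lt_top (n : ℕ) {R : ℝ} (hR : 1 ≤ R) : boundedVolume μ n R < ∞ := by
  obtain ⟨S, hS, h⟩ := exists_bdd_factors (F := F) n hR
  have hS0 : 0 ≤ S := zero_le_one.trans hS
  set A := boundedGL (Fin n) F S
  set B := {Z : Matrix (Fin n) (Fin n) F | MatBdd Z S}
  set D : Set (UpperPairs F n) := {x | ∀ k, ‖x k‖ ≤ S} ×ˢ {x | ∀ k, ‖x k‖ ≤ S}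
  have hDm : MeasurableSet D := by
    have : MeasurableSet {x : {p : Fin n × Fin n // p.1 < p.2} → F | ∀ k, ‖x k‖ ≤ S} := by
      have h1 : {x : {p : Fin n × Fin n // p.1 < p.2} → F | ∀ k, ‖x k‖ ≤ S} =
        ⋂ k, {x | ‖x k‖ ≤ S} := by ext x; simp
      rw [h1]
      exact MeasurableSet.iInter fun k => measurableSet_le (measurable_pi_apply k).norm
        measurable_const
    exact this.prod this
  have h1 : ∀ g Z w, (boundedGL (Fin n ⊕ Fin n) F R).indicator (1 : GL (Fin n ⊕ Fin n) F → ℝ≥0∞)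
      (complBlock w * (upperBlock Z * diagBlock g)) ≤
      A.indicator 1 g * (B.indicator 1 Z * D.indicator 1 w) := by
    intro g Z w
    by_cases hm : complBlock w * (upperBlock Z * diagBlock g) ∈ boundedGL (Fin n ⊕ Fin n) F R
    · obtain ⟨hg, hZ, hC, hU⟩ := h w Z g hm
      have hw : w ∈ D := ⟨fun k => (norm_le_pi_norm w.1 k).trans (norm_coords_le hS0 hC),
        fun k => (norm_le_pi_norm w.2 k).trans (norm_coords_le hS0 hU)⟩
      have hg' : g ∈ A := hg
      have hZ' : Z ∈ B := hZ
      rw [Set.indicator_of_mem hm, Set.indicator_of_mem hg', Set.indicator_of_mem hZ',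
        Set.indicator_of_mem hw]
      simp
    · rw [Set.indicator_of_notMem hm]
      exact zero_le
  have hAm : MeasurableSet A := measurableSet_boundedGL S
  have hBm : MeasurableSet B := measurableSet_matBdd S
  refine (lintegral_mono fun g => lintegral_mono fun Z => lintegral_mono fun w =>
    h1 g Z w).trans_lt ?_
  have hA1 : Measurable (A.indicator (1 : GL (Fin n) F → ℝ≥0∞)) := measurable_one.indicator hAm
  have hB1 : Measurable (B.indicator (1 : Matrix (Fin n) (Fin n) F → ℝ≥0∞)) :=
    measurable_one.indicator hBm
  have hD1 : Measurable (D.indicator (1 : UpperPairs F n → ℝ≥0∞)) := measurable_one.indicator hDm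
  have h2 : ∀ g Z, ∫⁻ w, A.indicator 1 g * (B.indicator 1 Z * D.indicator 1 w)
      ∂(upperPairsMeasure μ n) = A.indicator 1 g * (B.indicator 1 Z * upperPairsMeasure μ n D) := by
    intro g Z
    rw [lintegral_const_mul _ (hD1.const_mul _), lintegral_const_mul _ hD1,
      lintegral_indicator_one hDm]
  simp only [h2]
  have h3 : ∀ g, ∫⁻ Z, A.indicator 1 g * (B.indicator 1 Z * upperPairsMeasure μ n D)
      ∂(matrixMeasure μ n) = A.indicator 1 g * (matrixMeasure μ n B * upperPairsMeasure μ n D) := by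
    intro g
    rw [lintegral_const_mul _ (hB1.mul_const _), lintegral_mul_const _ hB1,
      lintegral_indicator_one hBm]
  simp only [h3]
  rw [lintegral_mul_const _ hA1, lintegral_indicator_one hAm]
  refine ENNReal.mul_lt_top (glMeasure_boundedGL_lt_top hS0)
    (ENNReal.mul_lt_top (matrixMeasure_bdd_lt_top S) ?_)
  rw [upperPairsMeasure, Measure.prod_prod]
  exact ENNReal.mul_lt_top (piMeasure_bdd_lt_top S) (piMeasure_bdd_lt_top S)

end Boundedness

/-! ### The integral over the Shalika subgroup -/

section ShalikaIntegral

variable {F : Type*} [NontriviallyNormedField F] [ProperSpace F] [MeasurableSpace F] [BorelSpace F]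
  {ψ : AddChar F Circle} {μ : Measure F} [μ.IsAddHaarMeasure] {n : ℕ}

theorem measurable_toShalika :
    Measurable fun y : GL (Fin n) F × Matrix (Fin n) (Fin n) F => toShalika y.2 y.1 :=
  Measurable.subtype_mk (measurable_shalikaMk measurable_snd measurable_fst)

theorem coe_toShalika (X : Matrix (Fin n) (Fin n) F) (γ : GL (Fin n) F) :
    (toShalika X γ : GL (Fin (2 * n)) F) = conjShuffle n (upperBlock X * diagBlock γ) := rfl

attribute [local irreducible] toShalika conjShuffle

theorem lintegral_shalikaMeasure {f : shalika F n → ℝ≥0∞} (hf : Measurable f) :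
    ∫⁻ s, f s ∂(shalikaMeasure μ n) =
      ∫⁻ g, ∫⁻ Z, f (toShalika Z g) ∂(matrixMeasure μ n) ∂(glMeasure μ n) := by
  have hf' : Measurable fun y : GL (Fin n) F × Matrix (Fin n) (Fin n) F =>
      f (toShalika y.2 y.1) := hf.comp measurable_toShalika
  rw [shalikaMeasure, lintegral_map hf measurable_toShalika, lintegral_prod _ hf'.aemeasurable]

/-- Left translation by (X, g₀) acts by g ↦ g₀g and Z ↦ g₀Zg₀⁻¹ + X, and conjugation preserves dZ.
-/
theorem isMulLeftInvariant_shalikaMeasure (hs : HasNormScaling μ) :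
    (shalikaMeasure μ n).IsMulLeftInvariant := by
  refine ⟨fun s => Measure.ext_of_lintegral _ fun f hf => ?_⟩
  have hm : Measurable fun t : shalika F n => s * t := measurable_const_mul s
  have hfm : Measurable fun t : shalika F n => f (s * t) := hf.comp hm
  obtain ⟨X, g₀, rfl⟩ := exists_eq_toShalika s
  rw [lintegral_map hf hm, lintegral_shalikaMeasure hfm, lintegral_shalikaMeasure hf]
  have hf' : Measurable fun y : GL (Fin n) F × Matrix (Fin n) (Fin n) F =>
      f (toShalika y.2 y.1) := hf.comp measurable_toShalika
  have hg : Measurable fun g : GL (Fin n) F => ∫⁻ Z, f (toShalika Z g) ∂(matrixMeasure μ n) :=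
    hf'.lintegral_prod_right'
  rw [← lintegral_glMeasure_mul_left hs g₀ hg]
  refine lintegral_congr fun g => ?_
  have h1 : Measurable fun Z : Matrix (Fin n) (Fin n) F => f (toShalika Z (g₀ * g)) :=
    hf'.comp measurable_prodMk_left
  have h2 : Measurable fun Z : Matrix (Fin n) (Fin n) F => f (toShalika (Z + X) (g₀ * g)) :=
    h1.comp (measurable_matrix_iff.2 fun i j => by
      simp only [Matrix.add_apply]
      exact (measurable_matrix_apply measurable_id i j).add_const _)
  rw [← lintegral_matrixMeasure_add X h1, ← lintegral_matrixMeasure_conj hs g₀ h2]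
  refine lintegral_congr fun Z => ?_
  rw [toShalika_mul, add_comm]

/-- The function `g ↦ ∫_{H_n} f(g s) θ(s)⁻¹ ds`, in terms of blocks. -/
def shalikaIntegral (μ : Measure F) (ψ : AddChar F Circle) (f : GL (Fin (2 * n)) F → ℂ)
    (g : GL (Fin n ⊕ Fin n) F) : ℂ :=
  ∫ s : shalika F n, f (conjShuffle n g * (s : GL (Fin (2 * n)) F)) * (theta ψ s : ℂ)⁻¹
    ∂(shalikaMeasure μ n)

theorem shalikaIntegral_mul (hs : HasNormScaling μ) (f : GL (Fin (2 * n)) F → ℂ)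
    (g : GL (Fin n ⊕ Fin n) F) (X : Matrix (Fin n) (Fin n) F) (γ : GL (Fin n) F) :
    shalikaIntegral μ ψ f (g * (upperBlock X * diagBlock γ)) =
      (ψ (Matrix.trace X) : ℂ) * shalikaIntegral μ ψ f g := by
  have := isMulLeftInvariant_shalikaMeasure (n := n) hs
  rw [shalikaIntegral, shalikaIntegral, ← integral_const_mul]
  rw [← integral_mul_left_eq_self (μ := shalikaMeasure μ n) (fun s : shalika F n =>
    (ψ (Matrix.trace X) : ℂ) *
      (f (conjShuffle n g * (s : GL (Fin (2 * n)) F)) * (theta ψ s : ℂ)⁻¹)) (toShalika X γ)]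
  refine integral_congr_ae (Filter.Eventually.of_forall fun s => ?_)
  simp only
  rw [theta_mul, theta_shalikaMk, map_mul, Subgroup.coe_mul, Circle.coe_mul, mul_inv, mul_assoc]
  rw [coe_toShalika]
  have h2 : (ψ (Matrix.trace X) : ℂ) ≠ 0 := Circle.coe_ne_zero _
  field_simp

variable [IsUltrametricDist F]

/-- A Lebesgue number of the cover of a compact ball by the level sets makes local constancy
uniform. -/
theorem isSB_of_isSchwartzBruhat {E : Type*} [SeminormedAddCommGroup E] [ProperSpace E] {φ : E → ℂ}
    (h1 : IsLocallyConstant φ) {R : ℝ} (hR : ∀ v, R < ‖v‖ → φ v = 0) : IsSB φ := by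
  refine ⟨?_, R, hR⟩
  -- The ball has radius R + 1, and translations are limited to norm 1, so that outside it neither v
  -- nor v + l meets the support.
  obtain ⟨δ, hδ, h⟩ := lebesgue_number_lemma_of_metric (isCompact_closedBall (0 : E) (R + 1))
    (c := fun z : ℂ => φ ⁻¹' {z}) (fun z => h1.isOpen_fiber z)
    (fun v _ => Set.mem_iUnion.2 ⟨φ v, rfl⟩)
  refine ⟨min (δ / 2) 1, lt_min (half_pos hδ) one_pos, fun v l hl => ?_⟩
  by_cases hv : v ∈ Metric.closedBall (0 : E) (R + 1)
  · obtain ⟨z, hz⟩ := h v hv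
    have h2 : φ v = z := hz (Metric.mem_ball_self hδ)
    have h3 : φ (v + l) = z := hz (by
      rw [Metric.mem_ball, dist_eq_norm, add_sub_cancel_left]
      exact (hl.trans (min_le_left _ _)).trans_lt (half_lt_self hδ))
    rw [h2, h3]
  · rw [Metric.mem_closedBall, dist_zero_right, not_le] at hv
    have h4 : ‖v‖ - ‖l‖ ≤ ‖v + l‖ := by
      have := norm_sub_le (v + l) l
      rw [add_sub_cancel_right] at this
      linarith
    have h5 := hl.trans (min_le_right _ _)
    rw [hR v (by linarith), hR (v + l) (by linarith)]

theorem continuous_complBlock : Continuous (complBlock : UpperPairs F n → GL (Fin n ⊕ Fin n) F) := by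
  rw [isEmbedding_gl_val.continuous_iff]
  refine continuous_matrix fun i j => ?_
  simp only [Function.comp_apply, complBlock_val]
  rcases i with i | i <;> rcases j with j | j
  · exact continuous_const
  · exact continuous_const
  · by_cases hij : i < j
    · simp only [Matrix.fromBlocks_apply₂₁, fillMatrix, Matrix.of_apply, hij, dite_true]
      fun_prop
    · simp only [Matrix.fromBlocks_apply₂₁, fillMatrix, Matrix.of_apply, hij, dite_false]
      fun_prop
  · by_cases hij : i < j
    · simp only [Matrix.fromBlocks_apply₂₂, fillMatrix, Matrix.of_apply, hij, dite_true]
      fun_prop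
    · simp only [Matrix.fromBlocks_apply₂₂, fillMatrix, Matrix.of_apply, hij, dite_false]
      fun_prop

/-- Equivariance is the invariance of the measure on H_n, with exponent 0 because θ is trivial on
the diagonal blocks. Along the complement, the support is bounded by properness of the
factorization, and local constancy comes from that of f. -/
theorem isShalikaEquivariant_shalikaIntegral (hs : HasNormScaling μ) {f : GL (Fin (2 * n)) F → ℂ}
    (hf : IsSchwartzBruhat f) : IsShalikaEquivariant ψ 0 (shalikaIntegral (n := n) μ ψ f) where
  upper g X := by
    have h := shalikaIntegral_mul (ψ := ψ) hs f g X 1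
    rwa [diagBlock_one, mul_one] at h
  diag g γ := by
    have h := shalikaIntegral_mul (ψ := ψ) hs f g 0 (γ : GL (Fin n) F)
    rw [upperBlock_zero, one_mul, Matrix.trace_zero] at h
    rw [h]
    simp
  isSB g := by
    obtain ⟨R, hR, hfR⟩ := hf.exists_support_bdd
    obtain ⟨k, hk⟩ := exists_mem_boundedGL g⁻¹
    have hkR : 1 ≤ max 1 (k * R) := le_max_left _ _
    obtain ⟨S, hS, hfac⟩ := exists_bdd_factors (F := F) n hkR
    obtain ⟨ε, hε, hinv⟩ := hf.exists_left_invariant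
    refine isSB_of_isSchwartzBruhat (R := S) ?_ ?_
    · refine (IsLocallyConstant.iff_eventually_eq _).2 fun w => ?_
      -- Passing from w to w' amounts to multiplying the argument of f on the left by g(w'w⁻¹)g⁻¹,
      -- uniformly in s; this is near 1 for w' near w.
      have hc : Continuous fun w' : UpperPairs F n => conjShuffle n g *
          (conjShuffle n (complBlock w') * (conjShuffle n (complBlock w))⁻¹) * (conjShuffle n g)⁻¹ := by
        have hcs : Continuous (conjShuffle (F := F) n) := by
          rw [isEmbedding_gl_val.continuous_iff]
          refine continuous_matrix fun i j => ?_
          obtain ⟨i, rfl⟩ := (shuffle n).surjective i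
          obtain ⟨j, rfl⟩ := (shuffle n).surjective j
          simp only [Function.comp_apply, conjShuffle_apply]
          exact continuous_gl_apply i j
        have := hcs.comp (continuous_complBlock (F := F) (n := n))
        exact (continuous_const.mul (this.mul continuous_const)).mul continuous_const
      have h1 := hc.tendsto w
      rw [mul_inv_cancel, mul_one, mul_inv_cancel] at h1
      filter_upwards [h1.eventually_mem (nearOne_mem_nhds hε)] with w' hw'
      rw [shalikaIntegral, shalikaIntegral]
      refine integral_congr_ae (Filter.Eventually.of_forall fun s => ?_)
      have h2 := hinv _ hw' (conjShuffle n (g * complBlock w) * (s : GL (Fin (2 * n)) F))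
      simp only
      rw [← h2, map_mul, map_mul]
      congr 2
      group
    · intro w hw
      have h0 : ∀ s : shalika F n, f (conjShuffle n (g * complBlock w) *
          (s : GL (Fin (2 * n)) F)) = 0 := by
        intro s
        by_contra hne
        obtain ⟨X, γ, rfl⟩ := exists_eq_toShalika s
        have h1 := hfR _ hne
        have h2 : conjShuffle n (g * complBlock w) * (toShalika X γ : GL (Fin (2 * n)) F) =
            conjShuffle n (g * (complBlock w * (upperBlock X * diagBlock γ))) := by
          rw [← mul_assoc, map_mul _ (g * complBlock w), coe_toShalika]
        rw [h2, conjShuffle_mem_boundedGL] at h1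
        have h3 := boundedGL_mul k.cast_nonneg (zero_le_one.trans hR) hk h1
        rw [inv_mul_cancel_left] at h3
        obtain ⟨-, -, hC, hU⟩ := hfac w X γ ⟨h3.1.mono (le_max_right _ _), h3.2.mono (le_max_right _ _)⟩
        have hS0 : 0 ≤ S := zero_le_one.trans hS
        refine absurd hw (not_lt.2 ?_)
        exact max_le (norm_coords_le hS0 hC) (norm_coords_le hS0 hU)
      rw [shalikaIntegral]
      simp only [h0, zero_mul, integral_zero]

/-- If ξ⁻¹A lies in the support of f, then A is bounded in terms of ξ and the support. The estimate
depends on ξ only through the bound S, as the convergence argument requires. -/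
theorem lintegral_enorm_le {f : GL (Fin (2 * n)) F → ℂ} (hf : IsSchwartzBruhat f) :
    ∃ (M : ℝ≥0∞) (R : ℝ), M < ∞ ∧ 1 ≤ R ∧ ∀ (S : ℝ), 1 ≤ S → ∀ ξ ∈ boundedGL (Fin n ⊕ Fin n) F S,
      ∫⁻ g, ∫⁻ Z, ∫⁻ w, ‖f (conjShuffle n (ξ⁻¹ * (complBlock w * (upperBlock Z * diagBlock g))))‖ₑ
        ∂(upperPairsMeasure μ n) ∂(matrixMeasure μ n) ∂(glMeasure μ n) ≤
        M * boundedVolume μ n (S * R) := by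
  obtain ⟨R, hR, hfR⟩ := hf.exists_support_bdd
  obtain ⟨M, hM, hfM⟩ := hf.exists_norm_le
  refine ⟨ENNReal.ofReal M, R, ENNReal.ofReal_lt_top, hR, fun S hS ξ hξ => ?_⟩
  have h1 : ∀ A : GL (Fin n ⊕ Fin n) F, ‖f (conjShuffle n (ξ⁻¹ * A))‖ₑ ≤
      ENNReal.ofReal M * (boundedGL (Fin n ⊕ Fin n) F (S * R)).indicator 1 A := fun A => by
    by_cases h0 : f (conjShuffle n (ξ⁻¹ * A)) = 0
    · rw [h0]; simp
    · have h2 := hfR _ h0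
      rw [conjShuffle_mem_boundedGL] at h2
      have h3 := boundedGL_mul (zero_le_one.trans hS) (zero_le_one.trans hR) hξ h2
      rw [mul_inv_cancel_left] at h3
      rw [Set.indicator_of_mem h3, Pi.one_apply, mul_one, ← ofReal_norm]
      exact ENNReal.ofReal_le_ofReal (hfM _)
  rw [boundedVolume, ← lintegral_const_mul' _ _ ENNReal.ofReal_ne_top]
  refine lintegral_mono fun g => ?_
  rw [← lintegral_const_mul' _ _ ENNReal.ofReal_ne_top]
  refine lintegral_mono fun Z => ?_
  rw [← lintegral_const_mul' _ _ ENNReal.ofReal_ne_top]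
  exact lintegral_mono fun w => h1 _

end ShalikaIntegral

/-! ### The unfolding identity -/

section UnfoldIdentity

variable {F : Type*} [NontriviallyNormedField F] [ProperSpace F] [MeasurableSpace F] [BorelSpace F]
  {ψ : AddChar F Circle} {μ : Measure F} [μ.IsAddHaarMeasure] {n : ℕ}

theorem measurable_lower_unip : Measurable fun q : (GL (Fin n) F × strictLower F n) ×
    unip F (2 * n) => ((q.2 : GL (Fin (2 * n)) F) *
      shalikaMk (q.1.2 : Matrix (Fin n) (Fin n) F) q.1.1,
      superSum (q.2 : GL (Fin (2 * n)) F).val) := by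
  have h1 : Measurable fun q : (GL (Fin n) F × strictLower F n) × unip F (2 * n) =>
      (q.2 : GL (Fin (2 * n)) F) := measurable_subtype_coe.comp measurable_snd
  have h2 : Measurable fun q : (GL (Fin n) F × strictLower F n) × unip F (2 * n) =>
      shalikaMk (q.1.2 : Matrix (Fin n) (Fin n) F) q.1.1 :=
    measurable_shalikaMk (measurable_subtype_coe.comp (measurable_snd.comp measurable_fst))
      (measurable_fst.comp measurable_fst)
  exact (h1.mul h2).prodMk (measurable_superSum (measurable_gl_val h1))

theorem measurable_shalika_compl : Measurable fun q : (GL (Fin n) F × Matrix (Fin n) (Fin n) F) ×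
    UpperPairs F n => (conjShuffle n (complBlock q.2 * (upperBlock q.1.2 * diagBlock q.1.1)),
      superSum (fillMatrix 0 (· < ·) q.2.1) + Matrix.trace q.1.2) := by
  have h1 : Measurable fun q : (GL (Fin n) F × Matrix (Fin n) (Fin n) F) × UpperPairs F n =>
      upperBlock q.1.2 * diagBlock q.1.1 :=
    (measurable_upperBlock.comp (measurable_snd.comp measurable_fst)).mul
      (measurable_diagBlock.comp (measurable_fst.comp measurable_fst))
  have h2 : Measurable fun q : (GL (Fin n) F × Matrix (Fin n) (Fin n) F) × UpperPairs F n =>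
      complBlock q.2 := measurable_complBlock.comp measurable_snd
  exact (measurable_conjShuffle (h2.mul h1)).prodMk
    ((measurable_superSum ((measurable_fillMatrix 0 (· < ·)).comp
      (measurable_fst.comp measurable_snd))).add (measurable_trace
        (measurable_snd.comp measurable_fst)))

attribute [local irreducible] toShalika conjShuffle shalikaMk upperBlock diagBlock complBlock
  superSum fillMatrix boundedVolume glMeasure matrixMeasure unipMeasure lowerMeasure
  strictLowerMeasure

/-- Stating the unfolding as an equality of image measures on GL × F transfers it at once to
complex-valued functions, together with their integrability. -/
theorem unfold_measure_eq (hs : HasNormScaling μ) :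
    (((lowerMeasure μ n).prod (strictLowerMeasure μ n)).prod (unipMeasure μ (2 * n))).map
      (fun q => ((q.2 : GL (Fin (2 * n)) F) * shalikaMk (q.1.2 : Matrix (Fin n) (Fin n) F) q.1.1,
        superSum (q.2 : GL (Fin (2 * n)) F).val)) =
    (((glMeasure μ n).prod (matrixMeasure μ n)).prod (upperPairsMeasure μ n)).map
      (fun q => (conjShuffle n (complBlock q.2 * (upperBlock q.1.2 * diagBlock q.1.1)),
        superSum (fillMatrix 0 (· < ·) q.2.1) + Matrix.trace q.1.2)) := by
  refine Measure.ext_of_lintegral _ fun T hT => ?_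
  have h1 : Measurable fun q : (GL (Fin n) F × strictLower F n) × unip F (2 * n) =>
      T ((q.2 : GL (Fin (2 * n)) F) * shalikaMk (q.1.2 : Matrix (Fin n) (Fin n) F) q.1.1,
        superSum (q.2 : GL (Fin (2 * n)) F).val) := hT.comp measurable_lower_unip
  have h2 : Measurable fun q : (GL (Fin n) F × Matrix (Fin n) (Fin n) F) × UpperPairs F n =>
      T (conjShuffle n (complBlock q.2 * (upperBlock q.1.2 * diagBlock q.1.1)),
        superSum (fillMatrix 0 (· < ·) q.2.1) + Matrix.trace q.1.2) :=
    hT.comp measurable_shalika_compl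
  rw [lintegral_map hT measurable_lower_unip, lintegral_map hT measurable_shalika_compl,
    lintegral_prod _ h1.aemeasurable, lintegral_prod _ h2.aemeasurable,
    lintegral_prod _ h1.lintegral_prod_right'.aemeasurable,
    lintegral_prod _ h2.lintegral_prod_right'.aemeasurable]
  exact lintegral_unfold hs hT

theorem psiUnip_inv_coe {k : ℕ} (u : unip F k) :
    (psiUnip ψ u : ℂ)⁻¹ = (ψ (-superSum (u : GL (Fin k) F).val) : ℂ) := by
  rw [psiUnip_eq, AddChar.map_neg_eq_inv, Circle.coe_inv]

variable [IsUltrametricDist F]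

set_option maxHeartbeats 1000000 in
theorem integrable_shalika_compl (hψc : Continuous ψ) {f : GL (Fin (2 * n)) F → ℂ}
    (hf : IsSchwartzBruhat f) (ξ : GL (Fin n ⊕ Fin n) F) :
    Integrable (fun q : (GL (Fin n) F × Matrix (Fin n) (Fin n) F) × UpperPairs F n =>
      f ((conjShuffle n ξ)⁻¹ * conjShuffle n (complBlock q.2 * (upperBlock q.1.2 *
        diagBlock q.1.1))) * (ψ (-(superSum (fillMatrix 0 (· < ·) q.2.1) + Matrix.trace q.1.2)) : ℂ))
      (((glMeasure μ n).prod (matrixMeasure μ n)).prod (upperPairsMeasure μ n)) := by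
  have hK : Measurable fun p : GL (Fin (2 * n)) F × F =>
      f ((conjShuffle n ξ)⁻¹ * p.1) * (ψ (-p.2) : ℂ) :=
    (hf.measurable.comp (measurable_const.mul measurable_fst)).mul
      ((measurable_character hψc).comp measurable_snd.neg)
  have hm : Measurable (fun q : (GL (Fin n) F × Matrix (Fin n) (Fin n) F) × UpperPairs F n =>
      f ((conjShuffle n ξ)⁻¹ * conjShuffle n (complBlock q.2 * (upperBlock q.1.2 *
        diagBlock q.1.1))) *
          (ψ (-(superSum (fillMatrix 0 (· < ·) q.2.1) + Matrix.trace q.1.2)) : ℂ)) :=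
    hK.comp measurable_shalika_compl
  refine ⟨hm.aestronglyMeasurable, ?_⟩
  rw [hasFiniteIntegral_iff_enorm, lintegral_prod _ hm.enorm.aemeasurable,
    lintegral_prod _ hm.enorm.lintegral_prod_right'.aemeasurable]
  obtain ⟨M, R, hM, hR, hle⟩ := lintegral_enorm_le (μ := μ) hf
  obtain ⟨k, hk⟩ := exists_mem_boundedGL ξ
  have hk1 : (1 : ℝ) ≤ max 1 (k : ℝ) := le_max_left _ _
  have h1 := hle (max 1 k) hk1 ξ ⟨hk.1.mono (le_max_right _ _), hk.2.mono (le_max_right _ _)⟩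
  refine lt_of_eq_of_lt ?_ (h1.trans_lt (ENNReal.mul_lt_top hM
    (boundedVolume_lt_top n (one_le_mul_of_one_le_of_one_le hk1 hR))))
  refine lintegral_congr fun g => lintegral_congr fun Z => lintegral_congr fun w => ?_
  simp only
  rw [enorm_mul, ← map_inv, ← map_mul]
  have : ‖(ψ (-(superSum (fillMatrix 0 (· < ·) w.1) + Matrix.trace Z)) : ℂ)‖ₑ = 1 := by
    rw [← ofReal_norm, Circle.norm_coe, ENNReal.ofReal_one]
  rw [this, mul_one]

theorem integrable_lower_unip (hs : HasNormScaling μ) (hψc : Continuous ψ)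
    {f : GL (Fin (2 * n)) F → ℂ} (hf : IsSchwartzBruhat f) (ξ : GL (Fin n ⊕ Fin n) F) :
    Integrable (fun q : (GL (Fin n) F × strictLower F n) × unip F (2 * n) =>
      f ((conjShuffle n ξ)⁻¹ * ((q.2 : GL (Fin (2 * n)) F) *
        shalikaMk (q.1.2 : Matrix (Fin n) (Fin n) F) q.1.1)) *
        (ψ (-superSum (q.2 : GL (Fin (2 * n)) F).val) : ℂ))
      (((lowerMeasure μ n).prod (strictLowerMeasure μ n)).prod (unipMeasure μ (2 * n))) ∧
    ∫ q : (GL (Fin n) F × strictLower F n) × unip F (2 * n),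
      f ((conjShuffle n ξ)⁻¹ * ((q.2 : GL (Fin (2 * n)) F) *
        shalikaMk (q.1.2 : Matrix (Fin n) (Fin n) F) q.1.1)) *
        (ψ (-superSum (q.2 : GL (Fin (2 * n)) F).val) : ℂ)
      ∂(((lowerMeasure μ n).prod (strictLowerMeasure μ n)).prod (unipMeasure μ (2 * n))) =
    ∫ q : (GL (Fin n) F × Matrix (Fin n) (Fin n) F) × UpperPairs F n,
      f ((conjShuffle n ξ)⁻¹ * conjShuffle n (complBlock q.2 * (upperBlock q.1.2 *
        diagBlock q.1.1))) * (ψ (-(superSum (fillMatrix 0 (· < ·) q.2.1) + Matrix.trace q.1.2)) : ℂ)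
      ∂(((glMeasure μ n).prod (matrixMeasure μ n)).prod (upperPairsMeasure μ n)) := by
  have hK : Measurable fun p : GL (Fin (2 * n)) F × F =>
      f ((conjShuffle n ξ)⁻¹ * p.1) * (ψ (-p.2) : ℂ) :=
    (hf.measurable.comp (measurable_const.mul measurable_fst)).mul
      ((measurable_character hψc).comp measurable_snd.neg)
  have h1 := (integrable_map_measure hK.aestronglyMeasurable
    measurable_shalika_compl.aemeasurable).2 (integrable_shalika_compl (μ := μ) hψc hf ξ)
  have h2 := integral_map (μ := ((glMeasure μ n).prod (matrixMeasure μ n)).prod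
    (upperPairsMeasure μ n)) measurable_shalika_compl.aemeasurable hK.aestronglyMeasurable
  rw [← unfold_measure_eq hs] at h1 h2
  refine ⟨(integrable_map_measure hK.aestronglyMeasurable
    measurable_lower_unip.aemeasurable).1 h1, ?_⟩
  refine Eq.trans ?_ h2
  exact (integral_map measurable_lower_unip.aemeasurable hK.aestronglyMeasurable).symm

theorem whittaker_eq {f : GL (Fin (2 * n)) F → ℂ} (ξ : GL (Fin n ⊕ Fin n) F)
    (t : GL (Fin (2 * n)) F) : whittaker μ ψ f (conjShuffle n ξ) t = ∫ u : unip F (2 * n),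
      f ((conjShuffle n ξ)⁻¹ * ((u : GL (Fin (2 * n)) F) * t)) *
        (ψ (-superSum (u : GL (Fin (2 * n)) F).val) : ℂ) ∂(unipMeasure μ (2 * n)) := by
  rw [whittaker]
  refine integral_congr_ae (Filter.Eventually.of_forall fun u => ?_)
  simp only
  rw [psiUnip_inv_coe, mul_assoc]

/-- The outcome of unfolding: N ∩ H and the coset space recombine into an integral over H, which is
Ψ evaluated at ξ⁻¹w, followed by the integral over w against ψ⁻¹. -/
theorem integral_whittaker (hs : HasNormScaling μ) (hψc : Continuous ψ)
    {f : GL (Fin (2 * n)) F → ℂ} (hf : IsSchwartzBruhat f) (ξ : GL (Fin n ⊕ Fin n) F) :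
    ∫ p : GL (Fin n) F × strictLower F n, whittaker μ ψ f (conjShuffle n ξ)
      (shalikaMk (p.2 : Matrix (Fin n) (Fin n) F) p.1)
      ∂((lowerMeasure μ n).prod (strictLowerMeasure μ n)) =
      complIntegral μ ψ (shalikaIntegral μ ψ f) ξ := by
  obtain ⟨hint, heq⟩ := integrable_lower_unip (μ := μ) hs hψc hf ξ
  simp only [whittaker_eq]
  rw [← integral_prod _ hint, heq, integral_prod_symm _ (integrable_shalika_compl hψc hf ξ),
    complIntegral]
  refine integral_congr_ae (Filter.Eventually.of_forall fun w => ?_)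
  have hm : Measurable fun s : shalika F n => f (conjShuffle n (ξ⁻¹ * complBlock w) *
      (s : GL (Fin (2 * n)) F)) * (theta ψ s : ℂ)⁻¹ :=
    (hf.measurable.comp (measurable_const.mul measurable_subtype_coe)).mul
      (measurable_theta hψc).inv
  simp only
  rw [shalikaIntegral, shalikaMeasure, integral_map measurable_toShalika.aemeasurable
    hm.aestronglyMeasurable, ← integral_mul_const]
  refine integral_congr_ae (Filter.Eventually.of_forall fun p => ?_)
  simp only
  rw [theta_shalikaMk, coe_toShalika, ← map_mul, ← map_inv, ← map_mul, mul_assoc, neg_add,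
    AddChar.map_add_eq_mul, Circle.coe_mul, AddChar.map_neg_eq_inv ψ (Matrix.trace p.2),
    Circle.coe_inv, mul_assoc ξ⁻¹ (complBlock w)]
  ring

theorem lintegral_unfold_prod (hs : HasNormScaling μ) {T : GL (Fin (2 * n)) F → ℝ≥0∞}
    (hT : Measurable T) :
    ∫⁻ p : GL (Fin n) F × strictLower F n, ∫⁻ u : unip F (2 * n),
      T ((u : GL (Fin (2 * n)) F) * shalikaMk (p.2 : Matrix (Fin n) (Fin n) F) p.1)
      ∂(unipMeasure μ (2 * n)) ∂((lowerMeasure μ n).prod (strictLowerMeasure μ n)) =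
    ∫⁻ g, ∫⁻ Z, ∫⁻ w, T (conjShuffle n (complBlock w * (upperBlock Z * diagBlock g)))
      ∂(upperPairsMeasure μ n) ∂(matrixMeasure μ n) ∂(glMeasure μ n) := by
  have h0 : Measurable fun p : GL (Fin (2 * n)) F × F => T p.1 := hT.comp measurable_fst
  rw [← lintegral_unfold hs h0]
  have h1 : Measurable fun q : (GL (Fin n) F × strictLower F n) × unip F (2 * n) =>
      T ((q.2 : GL (Fin (2 * n)) F) * shalikaMk (q.1.2 : Matrix (Fin n) (Fin n) F) q.1.1) :=
    hT.comp (measurable_fst.comp measurable_lower_unip)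
  exact lintegral_prod _ h1.lintegral_prod_right'.aemeasurable

theorem enorm_whittaker_le {f : GL (Fin (2 * n)) F → ℂ} (ξ : GL (Fin n ⊕ Fin n) F)
    (t : GL (Fin (2 * n)) F) : ‖whittaker μ ψ f (conjShuffle n ξ) t‖ₑ ≤
      ∫⁻ u : unip F (2 * n), ‖f ((conjShuffle n ξ)⁻¹ * ((u : GL (Fin (2 * n)) F) * t))‖ₑ
        ∂(unipMeasure μ (2 * n)) := by
  rw [whittaker_eq]
  refine (enorm_integral_le_lintegral_enorm _).trans (le_of_eq (lintegral_congr fun u => ?_))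
  rw [enorm_mul]
  have : ‖(ψ (-superSum (u : GL (Fin (2 * n)) F).val) : ℂ)‖ₑ = 1 := by
    rw [← ofReal_norm, Circle.norm_coe, ENNReal.ofReal_one]
  rw [this, mul_one]

/-- The same unfolding after taking absolute values inside the integral that defines W_f. -/
theorem lintegral_whittaker_le (hs : HasNormScaling μ) {f : GL (Fin (2 * n)) F → ℂ}
    (hf : IsSchwartzBruhat f) (ξ : GL (Fin n ⊕ Fin n) F) :
    ∫⁻ p : GL (Fin n) F × strictLower F n, ‖whittaker μ ψ f (conjShuffle n ξ)
      (shalikaMk (p.2 : Matrix (Fin n) (Fin n) F) p.1)‖ₑ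
      ∂((lowerMeasure μ n).prod (strictLowerMeasure μ n)) ≤
    ∫⁻ g, ∫⁻ Z, ∫⁻ w, ‖f (conjShuffle n (ξ⁻¹ * (complBlock w * (upperBlock Z * diagBlock g))))‖ₑ
        ∂(upperPairsMeasure μ n) ∂(matrixMeasure μ n) ∂(glMeasure μ n) := by
  have hT : Measurable fun x : GL (Fin (2 * n)) F => ‖f ((conjShuffle n ξ)⁻¹ * x)‖ₑ :=
    (hf.measurable.comp (measurable_const.mul measurable_id)).enorm
  have h1 : ∀ A : GL (Fin n ⊕ Fin n) F, f (conjShuffle n (ξ⁻¹ * A)) =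
      f ((conjShuffle n ξ)⁻¹ * conjShuffle n A) := fun A => by rw [map_mul, map_inv]
  simp only [h1]
  refine le_trans (lintegral_mono fun p => ?_) (lintegral_unfold_prod hs hT).le
  exact enorm_whittaker_le ξ _

end UnfoldIdentity

/-! ### Integral matrices -/

section IntegralMatrices

variable {F : Type*} [NontriviallyNormedField F] [IsUltrametricDist F]

theorem norm_det_eq_one {ι : Type*} [Fintype ι] [DecidableEq ι] {g : GL ι F}
    (hg : g ∈ boundedGL ι F 1) : ‖g.val.det‖ = 1 := by
  have h1 := norm_det_le zero_le_one hg.1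
  have h2 := norm_det_le zero_le_one hg.2
  rw [one_pow] at h1 h2
  have h3 : ‖g.val.det‖ * ‖(g⁻¹).val.det‖ = 1 := by
    rw [← norm_mul, ← det_mul, ← Units.val_mul, mul_inv_cancel, Units.val_one, det_one, norm_one]
  nlinarith [norm_nonneg g.val.det, norm_nonneg (g⁻¹).val.det]

theorem mem_boundedGL_one {ι : Type*} [Fintype ι] [DecidableEq ι] {g : GL ι F}
    (hg : MatBdd g.val 1) (hd : ‖g.val.det‖ = 1) : g ∈ boundedGL ι F 1 := by
  refine ⟨hg, fun i j => ?_⟩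
  rw [Matrix.coe_units_inv, Matrix.inv_def, Matrix.smul_apply, smul_eq_mul, norm_mul,
    Ring.inverse_eq_inv', norm_inv, hd, inv_one, one_mul]
  simpa using hg.adjugate le_rfl i j

theorem boundedGL_one_mul {ι : Type*} [Fintype ι] [DecidableEq ι] {g h : GL ι F}
    (hg : g ∈ boundedGL ι F 1) (hh : h ∈ boundedGL ι F 1) : g * h ∈ boundedGL ι F 1 := by
  simpa using boundedGL_mul zero_le_one zero_le_one hg hh

end IntegralMatrices

/-! ### Invariance of the integral over the lower triangular matrices -/

section LowerInvariance

variable {F : Type*} [NontriviallyNormedField F] [ProperSpace F] [MeasurableSpace F] [BorelSpace F]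
  {μ : Measure F} [μ.IsAddHaarMeasure]

theorem lintegral_glMeasure_mul_right (hs : HasNormScaling μ) {n : ℕ} (g₀ : GL (Fin n) F)
    {f : GL (Fin n) F → ℝ≥0∞} (hf : Measurable f) :
    ∫⁻ g, f (g * g₀) ∂(glMeasure μ n) = ∫⁻ g, f g ∂(glMeasure μ n) := by
  have hd : Measurable fun A : Matrix (Fin n) (Fin n) F => (‖A.det‖ₑ ^ n)⁻¹ :=
    ((measurable_det measurable_id).enorm.pow_const n).inv
  have hm : Measurable fun A : Matrix (Fin n) (Fin n) F =>
      Set.indicator {A | A.det ≠ 0} (fun A => (‖A.det‖ₑ ^ n)⁻¹ * f (toGL A)) A :=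
    (hd.mul (hf.comp measurable_toGL)).indicator measurableSet_det_ne_zero
  have hf' : Measurable fun g => f (g * g₀) := hf.comp (measurable_mul_const g₀)
  rw [lintegral_glMeasure hf, lintegral_glMeasure hf',
    ← lintegral_indicator measurableSet_det_ne_zero, ← lintegral_indicator measurableSet_det_ne_zero]
  have h := lintegral_matrixMeasure_mul hs 1 g₀ hm
  have h0 : ‖g₀.val.det‖ₑ ^ n ≠ 0 := pow_ne_zero _ (by simpa using det_ne_zero g₀)
  have h1 : ‖g₀.val.det‖ₑ ^ n ≠ ∞ := ENNReal.pow_ne_top (by simp)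
  rw [Units.val_one, Matrix.det_one, enorm_one, one_pow, one_mul] at h
  have h2 := congrArg (fun t => ‖g₀.val.det‖ₑ ^ n * t) h
  simp only [← mul_assoc, ENNReal.mul_inv_cancel h0 h1, one_mul] at h2
  rw [← h2, ← lintegral_const_mul _ (by
    refine hm.comp ?_
    exact measurable_matrix_mul measurable_id measurable_const)]
  refine lintegral_congr fun A => ?_
  by_cases hA : A.det = 0
  · simp [hA, Set.indicator]
  · have hA' : (A * g₀.val).det ≠ 0 := by
      rw [Matrix.det_mul]; exact mul_ne_zero hA (det_ne_zero g₀)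
    rw [Set.indicator_of_mem (show A ∈ {A | A.det ≠ 0} from hA),
      Set.indicator_of_mem (show A * g₀.val ∈ {A | A.det ≠ 0} from hA'), Matrix.det_mul, enorm_mul,
      mul_pow, mul_comm (‖A.det‖ₑ ^ n), ENNReal.mul_inv (Or.inl h0) (Or.inl h1), ← mul_assoc,
      ← mul_assoc, ENNReal.mul_inv_cancel h0 h1, one_mul]
    congr 2
    exact (toGL_eq (by rw [Units.val_mul, toGL_val hA])).symm

variable [IsUltrametricDist F]

/-- For a left N-invariant function this is an integral over N\G, where right translation by all of
G makes sense. The weight w divided by its coset integral A lifts it to an integral over the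
unimodular group G, which is right invariant. -/
theorem lintegral_lowerMeasure_mul_right (hs : HasNormScaling μ) {m : ℕ} (p : GL (Fin m) F)
    {Φ : GL (Fin m) F → ℝ≥0∞} (hΦ : Measurable Φ)
    (hinv : ∀ (u : unip F m) b, Φ ((u : GL (Fin m) F) * b) = Φ b) :
    ∫⁻ b, Φ (b * p) ∂(lowerMeasure μ m) = ∫⁻ b, Φ b ∂(lowerMeasure μ m) := by
  obtain ⟨w, hw, hw0, hw1⟩ := exists_weight (ν := unipMeasure μ m)
    (S := fun k : ℕ => boundedGL (Fin m) F k)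
    (c := fun k => unipMeasure μ m {u | MatBdd (u : GL (Fin m) F).val ((k : ℝ) * k)})
    (fun k => measurableSet_boundedGL (k : ℝ)) exists_mem_boundedGL
    (fun _ => (unipMeasure_bdd_lt_top _).ne)
    (fun k g => unipMeasure_coset_le hs k.cast_nonneg g) unipMeasure_univ_ne_zero
  obtain ⟨A, hA, hAm⟩ : ∃ A : GL (Fin m) F → ℝ≥0∞,
      (∀ g, A g = ∫⁻ u : unip F m, w ((u : GL (Fin m) F) * g) ∂(unipMeasure μ m)) ∧ Measurable A :=
    ⟨_, fun _ => rfl, measurable_lintegral_mul hw⟩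
  have hAinv : ∀ (u : unip F m) b, A ((u : GL (Fin m) F) * b) = A b := fun u b => by
    rw [hA, hA, ← lintegral_unip_mul_right hs u
      (f := fun v : unip F m => w ((v : GL (Fin m) F) * b))
      (hw.comp (measurable_subtype_coe.mul_const b))]
    refine lintegral_congr fun v => ?_
    rw [Subgroup.coe_mul, mul_assoc]
  have hG : Measurable fun g => Φ g * (A g)⁻¹ * w g := (hΦ.mul hAm.inv).mul hw
  have key : ∀ p : GL (Fin m) F, ∫⁻ b, Φ (b * p) ∂(lowerMeasure μ m) =
      ∫⁻ g, Φ (g * p) * (A (g * p))⁻¹ * w (g * p) ∂(glMeasure μ m) := fun p => by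
    rw [lintegral_glMeasure_eq_lower hs (f := fun g => Φ (g * p) * (A (g * p))⁻¹ * w (g * p))
      (hG.comp (measurable_mul_const p))]
    refine lintegral_congr fun b => ?_
    simp only [mul_assoc (_ : GL (Fin m) F) b p, hinv, hAinv]
    have hwm : Measurable fun u : unip F m => w ((u : GL (Fin m) F) * (b * p)) :=
      hw.comp (measurable_subtype_coe.mul_const (b * p))
    rw [lintegral_const_mul _ hwm, ← hA,
      mul_assoc, ENNReal.inv_mul_cancel (by rw [hA]; exact hw0 _) (by rw [hA]; exact hw1 _), mul_one]
  rw [key p, lintegral_glMeasure_mul_right hs p hG]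
  have h1 := key 1
  simp only [mul_one] at h1
  exact h1.symm

/-- The integral matrices contain every matrix close to the identity, and non-empty open sets have
positive measure. -/
theorem glMeasure_boundedGL_ne_zero (n : ℕ) : glMeasure μ n (boundedGL (Fin n) F 1) ≠ 0 := by
  have hm := measurableSet_boundedGL (ι := Fin n) (F := F) 1
  have hd : Measurable fun g : GL (Fin n) F => (‖g.val.det‖ₑ ^ n)⁻¹ :=
    ((measurable_det (measurable_gl_val measurable_id)).enorm.pow_const n).inv
  rw [glMeasure, Ne, withDensity_apply_eq_zero hd, Set.inter_eq_self_of_subset_right (fun g _ => by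
    simp), measurableEmbedding_gl_val.comap_apply]
  have hpos : (matrixMeasure μ n).IsOpenPosMeasure := by
    have h1 : (Measure.pi fun _ : Fin n => μ).IsOpenPosMeasure := inferInstance
    exact Measure.pi.isOpenPosMeasure fun _ : Fin n => Measure.pi fun _ : Fin n => μ
  set U : Set (Matrix (Fin n) (Fin n) F) :=
    {A | (∀ i j, ‖A i j - (1 : Matrix (Fin n) (Fin n) F) i j‖ < 1) ∧ ‖A.det - 1‖ < 1} with hU
  have hUo : IsOpen U := by
    have h1 : U = (⋂ i, ⋂ j, {A : Matrix (Fin n) (Fin n) F |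
        ‖A i j - (1 : Matrix (Fin n) (Fin n) F) i j‖ < 1}) ∩ {A | ‖A.det - 1‖ < 1} := by
      ext A; simp [hU]
    rw [h1]
    refine (isOpen_iInter_of_finite fun i => isOpen_iInter_of_finite fun j => ?_).inter ?_
    · exact isOpen_lt ((continuous_id.matrix_elem i j).sub continuous_const).norm continuous_const
    · exact isOpen_lt (continuous_id.matrix_det.sub continuous_const).norm continuous_const
  refine fun h0 => (hUo.measure_pos (matrixMeasure μ n) ⟨1, by simp [hU]⟩).ne'
    (measure_mono_null ?_ h0)
  rintro A ⟨hA, hdet⟩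
  have hdet1 : ‖A.det‖ = 1 := by
    have h2 : ‖(1 : F) + (A.det - 1)‖ = max ‖(1 : F)‖ ‖A.det - 1‖ :=
      IsUltrametricDist.norm_add_eq_max_of_norm_ne_norm (by rw [norm_one]; exact hdet.ne')
    rw [add_sub_cancel, norm_one, max_eq_left hdet.le] at h2
    exact h2
  have hdet0 : A.det ≠ 0 := fun h => by rw [h, norm_zero] at hdet1; exact zero_ne_one hdet1
  refine ⟨toGL A, mem_boundedGL_one ?_ ?_, toGL_val hdet0⟩
  · rw [toGL_val hdet0]
    intro i j
    have h1 : ‖(1 : Matrix (Fin n) (Fin n) F) i j‖ ≤ 1 := by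
      rw [Matrix.one_apply]; split_ifs <;> simp
    have h2 := norm_sub_le_max_norm (A i j - (1 : Matrix (Fin n) (Fin n) F) i j)
      (-(1 : Matrix (Fin n) (Fin n) F) i j)
    rw [sub_neg_eq_add, sub_add_cancel, norm_neg] at h2
    exact h2.trans (max_le (hA i j).le h1)
  · rw [toGL_val hdet0, hdet1]

variable (μ) in
/-- The integral of a function over the right translates by integral matrices. -/
def integralAverage {m : ℕ} (Φ : GL (Fin m) F → ℝ≥0∞) (b : GL (Fin m) F) : ℝ≥0∞ :=
  ∫⁻ k, (boundedGL (Fin m) F 1).indicator (fun k => Φ (b * k)) k ∂(glMeasure μ m)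

theorem measurable_average_integrand {m : ℕ} {Φ : GL (Fin m) F → ℝ≥0∞} (hΦ : Measurable Φ) :
    Measurable fun p : GL (Fin m) F × GL (Fin m) F =>
      (boundedGL (Fin m) F 1).indicator (fun k => Φ (p.1 * k)) p.2 := by
  have h1 : Measurable fun p : GL (Fin m) F × GL (Fin m) F =>
      (Prod.snd ⁻¹' boundedGL (Fin m) F 1).indicator
        (fun p : GL (Fin m) F × GL (Fin m) F => Φ (p.1 * p.2)) p :=
    (hΦ.comp (measurable_fst.mul measurable_snd)).indicator
      (measurable_snd (measurableSet_boundedGL 1))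
  exact h1

theorem measurable_integralAverage {m : ℕ} {Φ : GL (Fin m) F → ℝ≥0∞} (hΦ : Measurable Φ) :
    Measurable (integralAverage μ Φ) :=
  (measurable_average_integrand hΦ).lintegral_prod_right'

theorem integralAverage_mul_right (hs : HasNormScaling μ) {m : ℕ} {Φ : GL (Fin m) F → ℝ≥0∞}
    (hΦ : Measurable Φ) (b : GL (Fin m) F) {k : GL (Fin m) F} (hk : k ∈ boundedGL (Fin m) F 1) :
    integralAverage μ Φ (b * k) = integralAverage μ Φ b := by
  have hm : Measurable fun x : GL (Fin m) F =>
      (boundedGL (Fin m) F 1).indicator (fun k => Φ (b * k)) x :=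
    (hΦ.comp (measurable_const_mul b)).indicator (measurableSet_boundedGL 1)
  rw [integralAverage, integralAverage, ← lintegral_glMeasure_mul_left hs k hm]
  refine lintegral_congr fun x => ?_
  have : k * x ∈ boundedGL (Fin m) F 1 ↔ x ∈ boundedGL (Fin m) F 1 :=
    ⟨fun h => by simpa using boundedGL_one_mul (boundedGL_inv hk) h, boundedGL_one_mul hk⟩
  by_cases hx : x ∈ boundedGL (Fin m) F 1
  · rw [Set.indicator_of_mem hx, Set.indicator_of_mem (this.2 hx), mul_assoc]
  · rw [Set.indicator_of_notMem hx, Set.indicator_of_notMem (fun h => hx (this.1 h))]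

theorem integralAverage_unip_mul {m : ℕ} {Φ : GL (Fin m) F → ℝ≥0∞}
    (hinv : ∀ (u : unip F m) b, Φ ((u : GL (Fin m) F) * b) = Φ b) (u : unip F m)
    (b : GL (Fin m) F) : integralAverage μ Φ ((u : GL (Fin m) F) * b) = integralAverage μ Φ b := by
  simp only [integralAverage, mul_assoc, hinv]

/-- Fubini, together with the right invariance just proved, applied to each integral k. Finiteness
can thus be tested on the average, which is right invariant under the integral matrices. -/
theorem lintegral_integralAverage (hs : HasNormScaling μ) {m : ℕ} {Φ : GL (Fin m) F → ℝ≥0∞}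
    (hΦ : Measurable Φ) (hinv : ∀ (u : unip F m) b, Φ ((u : GL (Fin m) F) * b) = Φ b) :
    ∫⁻ b, integralAverage μ Φ b ∂(lowerMeasure μ m) =
      (∫⁻ b, Φ b ∂(lowerMeasure μ m)) * glMeasure μ m (boundedGL (Fin m) F 1) := by
  simp only [integralAverage]
  rw [lintegral_lintegral_swap (measurable_average_integrand hΦ).aemeasurable,
    ← lintegral_indicator_const (measurableSet_boundedGL 1)]
  refine lintegral_congr fun k => ?_
  by_cases hk : k ∈ boundedGL (Fin m) F 1
  · simp only [Set.indicator_of_mem hk]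
    exact lintegral_lowerMeasure_mul_right hs k hΦ hinv
  · simp only [Set.indicator_of_notMem hk, lintegral_zero]

end LowerInvariance

/-! ### Iwasawa coordinates on the lower triangular matrices -/

section Iwasawa

variable {F : Type*} [NontriviallyNormedField F]

/-- The diagonal matrix with the given coefficients, as an element of `GL_n` (if they are not
zero). -/
def diagGL {n : ℕ} (a : Fin n → F) : GL (Fin n) F := toGL (Matrix.diagonal a)

theorem diagGL_val {n : ℕ} {a : Fin n → F} (ha : ∀ i, a i ≠ 0) :
    (diagGL a).val = Matrix.diagonal a :=
  toGL_val (by rw [Matrix.det_diagonal]; exact Finset.prod_ne_zero_iff.2 fun i _ => ha i)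

theorem diagGL_inv_val {n : ℕ} {a : Fin n → F} (ha : ∀ i, a i ≠ 0) :
    ((diagGL a)⁻¹).val = Matrix.diagonal fun i => (a i)⁻¹ := by
  have h : Matrix.diagonal (fun i => (a i)⁻¹) * (diagGL a).val = 1 := by
    rw [diagGL_val ha, Matrix.diagonal_mul_diagonal]
    simp [ha]
  have h2 := congrArg (· * ((diagGL a)⁻¹).val) h
  simp only [Matrix.mul_assoc, ← Units.val_mul, mul_inv_cancel, Units.val_one, Matrix.mul_one,
    Matrix.one_mul] at h2
  exact h2.symm

theorem diagGL_const_mul {n : ℕ} {z : F} (hz : z ≠ 0) (g : GL (Fin n) F) :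
    (diagGL (fun _ => z) * g).val = z • g.val := by
  rw [Units.val_mul, diagGL_val fun _ => hz]
  ext i j
  rw [Matrix.diagonal_mul, Matrix.smul_apply, smul_eq_mul]

theorem diagGL_const_comm {n : ℕ} {z : F} (hz : z ≠ 0) (g : GL (Fin n) F) :
    diagGL (fun _ => z) * g = g * diagGL (fun _ => z) := by
  apply Units.ext
  rw [diagGL_const_mul hz, Units.val_mul, diagGL_val fun _ => hz]
  ext i j
  rw [Matrix.mul_diagonal, Matrix.smul_apply, smul_eq_mul, mul_comm]

theorem exists_eq_mirabolicMk {m : ℕ} {q : GL (Fin (m + 1)) F}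
    (hq : ∀ j, q.val (Fin.last m) j = (1 : Matrix (Fin (m + 1)) (Fin (m + 1)) F) (Fin.last m) j) :
    ∃ (v : Fin m → F) (p : GL (Fin m) F), q = (mirabolicMk v p : GL (Fin (m + 1)) F) := by
  have h := border_self q.val
  have h3 : (fun j : Fin m => q.val (Fin.last m) j.castSucc) = 0 := by
    funext j
    rw [hq, Matrix.one_apply_ne (Fin.castSucc_lt_last j).ne']; rfl
  have h4 : q.val (Fin.last m) (Fin.last m) = 1 := by rw [hq, Matrix.one_apply_eq]
  rw [h3, h4] at h
  have hd : (Matrix.of fun i j => q.val (Fin.castSucc i) (Fin.castSucc j)).det ≠ 0 := by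
    have h5 := det_ne_zero q
    rwa [← h, det_border_row_zero, mul_one] at h5
  refine ⟨fun i => q.val i.castSucc (Fin.last m),
    toGL (Matrix.of fun i j => q.val (Fin.castSucc i) (Fin.castSucc j)), Units.ext ?_⟩
  rw [mirabolicMk_val, toGL_val hd]
  exact h.symm

theorem glEmb_mul_mirabolicMk {m : ℕ} (b p : GL (Fin m) F) (v : Fin m → F) :
    ∃ u : unip F (m + 1), glEmb b * (mirabolicMk v p : GL (Fin (m + 1)) F) =
      (u : GL (Fin (m + 1)) F) * glEmb (b * p) := by
  refine ⟨⟨mirabolicMk (b.val *ᵥ v) 1, fun i j hij => ?_⟩, Units.ext ?_⟩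
  · rw [mirabolicMk_val, Units.val_one]
    induction i using Fin.lastCases with
    | last => rw [← border_one]; induction j using Fin.lastCases <;> simp [border]
    | cast i =>
      induction j using Fin.lastCases with
      | last => exact absurd hij (not_le.2 (Fin.castSucc_lt_last i))
      | cast j => rw [← border_one]; simp [border]
  · rw [Units.val_mul, Units.val_mul, glEmb_val, glEmb_val, mirabolicMk_val, mirabolicMk_val,
      border_mul, border_mul, Units.val_mul, Units.val_one]
    simp

theorem glEmb_mem_unip {m : ℕ} (u : unip F m) : glEmb (u : GL (Fin m) F) ∈ unip F (m + 1) := by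
  intro i j hij
  rw [glEmb_val]
  induction i using Fin.lastCases with
  | last => rw [← border_one]; induction j using Fin.lastCases <;> simp [border]
  | cast i =>
    induction j using Fin.lastCases with
    | last => exact absurd hij (not_le.2 (Fin.castSucc_lt_last i))
    | cast j =>
      rw [← border_one]
      have := u.2 i j (Fin.castSucc_le_castSucc_iff.1 hij)
      simpa [border] using this

theorem glEmb_mem_boundedGL {m : ℕ} {k : GL (Fin m) F} {R : ℝ} (hR : 1 ≤ R)
    (hk : k ∈ boundedGL (Fin m) F R) : glEmb k ∈ boundedGL (Fin (m + 1)) F R := by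
  have h : ∀ {g : GL (Fin m) F}, MatBdd g.val R → MatBdd (glEmb g).val R := fun {g} hg i j => by
    have hR0 : 0 ≤ R := zero_le_one.trans hR
    rw [glEmb_val]
    induction i using Fin.lastCases with
    | last => induction j using Fin.lastCases <;> simp [border, hR, hR0]
    | cast i =>
      induction j using Fin.lastCases with
      | last => simpa [border] using hR0
      | cast j => simpa [border] using hg i j
  exact ⟨h hk.1, by rw [← glEmb_inv]; exact h hk.2⟩

variable [IsUltrametricDist F]

/-- A permutation brings the coefficient 1 to the last place, and there the identity matrix with its
last row replaced has determinant 1. -/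
theorem exists_integral_row {m : ℕ} {r : Fin (m + 1) → F} (hr : ∀ i, ‖r i‖ ≤ 1)
    {i₀ : Fin (m + 1)} (h₀ : r i₀ = 1) :
    ∃ k ∈ boundedGL (Fin (m + 1)) F 1, ∀ j, k.val (Fin.last m) j = r j := by
  set σ : Equiv.Perm (Fin (m + 1)) := Equiv.swap i₀ (Fin.last m)
  set s : Fin (m + 1) → F := fun j => r (σ j)
  have hs : s (Fin.last m) = 1 := by simp [s, σ, h₀]
  have hs0 : s (Fin.last m) ≠ 0 := by rw [hs]; exact one_ne_zero
  have hPd : (σ.permMatrix F).det = Equiv.Perm.sign σ := Matrix.det_permutation σ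
  have hPn : ‖(σ.permMatrix F).det‖ = 1 := by
    rw [hPd]
    rcases Int.units_eq_one_or (Equiv.Perm.sign σ) with h | h <;> simp [h]
  have hP0 : (σ.permMatrix F).det ≠ 0 := fun h => by rw [h, norm_zero] at hPn; exact zero_ne_one hPn
  refine ⟨rowGL s * toGL (σ.permMatrix F), boundedGL_one_mul (mem_boundedGL_one ?_ ?_)
    (mem_boundedGL_one ?_ ?_), fun j => ?_⟩
  · rw [rowGL_val hs0]
    intro i j
    induction i using Fin.lastCases with
    | last => induction j using Fin.lastCases <;> simp [border, s, hr]
    | cast i =>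
      induction j using Fin.lastCases with
      | last => simp [border]
      | cast j => simp only [border]; simp [Matrix.one_apply]; split_ifs <;> simp
  · rw [det_rowGL hs0, hs, norm_one]
  · rw [toGL_val hP0]
    intro i j
    simp only [Equiv.Perm.permMatrix, PEquiv.toMatrix_apply]
    split_ifs <;> simp
  · rw [toGL_val hP0, hPn]
  · rw [Units.val_mul, toGL_val hP0, rowGL_val hs0]
    have h1 : ∀ l, border 1 0 (fun i : Fin m => s i.castSucc) (s (Fin.last m)) (Fin.last m) l = s l :=
      fun l => by induction l using Fin.lastCases <;> simp [border]
    simp only [Matrix.mul_apply, h1, Equiv.Perm.permMatrix, PEquiv.toMatrix_apply]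
    rw [Finset.sum_eq_single (σ j)]
    · simp [s, σ]
    · intro l _ hl
      rw [if_neg, mul_zero]
      simp only [Equiv.toPEquiv_apply, Option.mem_def, Option.some.injEq]
      rintro rfl
      exact hl (by simp [σ])
    · simp

/-- One step of the Iwasawa decomposition. For a coordinate z of y of maximal norm, y/z is the last
row of an invertible integral matrix k. Removing z and k leaves a matrix with the same last row as
the identity, which is mirabolic. -/
theorem exists_rowGL_eq {m : ℕ} {y : Fin (m + 1) → F} (hy : y (Fin.last m) ≠ 0) :
    ∃ (i₀ : Fin (m + 1)) (v : Fin m → F) (p : GL (Fin m) F), y i₀ ≠ 0 ∧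
      (∀ i, ‖y i‖ ≤ ‖y i₀‖) ∧ ∃ k ∈ boundedGL (Fin (m + 1)) F 1,
        rowGL y = diagGL (fun _ => y i₀) * (mirabolicMk v p : GL (Fin (m + 1)) F) * k := by
  obtain ⟨i₀, hi⟩ := Finite.exists_max fun i => ‖y i‖
  have hz : y i₀ ≠ 0 := fun h => hy (by simpa [h] using hi (Fin.last m))
  obtain ⟨k, hk, hkr⟩ := exists_integral_row (r := fun j => (y i₀)⁻¹ * y j) (i₀ := i₀) (fun i => by
    rw [norm_mul, norm_inv, inv_mul_le_one₀ (norm_pos_iff.2 hz)]; exact hi i) (inv_mul_cancel₀ hz)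
  have hlast : ∀ l, (rowGL y).val (Fin.last m) l = y l := fun l => by
    rw [rowGL_val hy]
    induction l using Fin.lastCases <;> simp [border]
  obtain ⟨v, p, hvp⟩ := exists_eq_mirabolicMk (q := (diagGL fun _ => y i₀)⁻¹ * rowGL y * k⁻¹)
    (fun j => by
      have h1 : (1 : Matrix (Fin (m + 1)) (Fin (m + 1)) F) = k.val * (k⁻¹).val := by
        rw [← Units.val_mul, mul_inv_cancel, Units.val_one]
      rw [h1, Units.val_mul, Units.val_mul, diagGL_inv_val fun _ => hz, Matrix.mul_apply,
        Matrix.mul_apply]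
      refine Finset.sum_congr rfl fun l _ => ?_
      rw [Matrix.diagonal_mul, hlast, hkr])
  refine ⟨i₀, v, p, hz, hi, k, hk, ?_⟩
  rw [← hvp]
  group

end Iwasawa

/-! ### An integrability criterion in Iwasawa coordinates -/

section LowerBound

variable {F : Type*} [NontriviallyNormedField F]

/-- The product of the absolute values of the positive roots at a diagonal matrix. -/
def rootWeight {k : ℕ} (a : Fin k → F) : ℝ≥0∞ :=
  ∏ p : {p : Fin k × Fin k // p.1 < p.2}, ‖a p.1.1 / a p.1.2‖ₑ

/-- The new roots are those that pair a coordinate z b_i with the final 1; the old ones do not see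
the common factor z. -/
theorem rootWeight_snoc {k : ℕ} (b : Fin k → F) {z : F} (hz : z ≠ 0) :
    rootWeight (Fin.snoc (fun i => z * b i) 1 : Fin (k + 1) → F) =
      rootWeight b * (‖z‖ₑ ^ k * ∏ i, ‖b i‖ₑ) := by
  rw [rootWeight, ← (upperSplit k).symm.prod_comp, Fintype.prod_sum_type, rootWeight]
  congr 1
  · refine Finset.prod_congr rfl fun p _ => ?_
    change ‖(Fin.snoc (fun i => z * b i) 1 : Fin (k + 1) → F) p.1.1.castSucc /
      (Fin.snoc (fun i => z * b i) 1 : Fin (k + 1) → F) p.1.2.castSucc‖ₑ = _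
    rw [Fin.snoc_castSucc, Fin.snoc_castSucc, mul_div_mul_left _ _ hz]
  · have h : ∀ i : Fin k, ‖(Fin.snoc (fun i => z * b i) 1 : Fin (k + 1) → F) i.castSucc /
      (Fin.snoc (fun i => z * b i) 1 : Fin (k + 1) → F) (Fin.last k)‖ₑ = ‖z‖ₑ * ‖b i‖ₑ := fun i => by
      rw [Fin.snoc_castSucc, Fin.snoc_last, div_one, enorm_mul]
    refine (Finset.prod_congr rfl fun i _ => h i).trans ?_
    rw [Finset.prod_mul_distrib, Finset.prod_const, Finset.card_univ, Fintype.card_fin]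

variable [ProperSpace F] [MeasurableSpace F] [BorelSpace F] {μ : Measure F} [μ.IsAddHaarMeasure]
  [IsUltrametricDist F]

/-- Insert the Iwasawa decomposition of `rowGL y`: k disappears by right invariance, the unipotent
part of the mirabolic factor by left invariance, and p by right translation of b. Comparing
determinants gives |y_last| = |z|^{m+1} |det p|, which accounts for the new weight. -/
theorem lintegral_lower_row (hs : HasNormScaling μ) {m : ℕ} {Φ : GL (Fin (m + 1)) F → ℝ≥0∞}
    (hΦ : Measurable Φ) (hN : ∀ (u : unip F (m + 1)) b, Φ ((u : GL (Fin (m + 1)) F) * b) = Φ b)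
    (hK : ∀ b, ∀ k ∈ boundedGL (Fin (m + 1)) F 1, Φ (b * k) = Φ b) {y : Fin (m + 1) → F}
    (hy : y (Fin.last m) ≠ 0) : ∃ i₀, y i₀ ≠ 0 ∧ (∀ i, ‖y i‖ ≤ ‖y i₀‖) ∧
      ‖y (Fin.last m)‖ₑ⁻¹ * ∫⁻ b, ‖b.val.det‖ₑ⁻¹ * Φ (glEmb b * rowGL y) ∂(lowerMeasure μ m) =
      (‖y i₀‖ₑ ^ (m + 1))⁻¹ *
        ∫⁻ b, ‖b.val.det‖ₑ⁻¹ * Φ (diagGL (fun _ => y i₀) * glEmb b) ∂(lowerMeasure μ m) := by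
  obtain ⟨i₀, v, p, hz, hi, k, hk, heq⟩ := exists_rowGL_eq hy
  refine ⟨i₀, hz, hi, ?_⟩
  have h1 : ∀ b : GL (Fin m) F, Φ (glEmb b * rowGL y) =
      Φ (diagGL (fun _ => y i₀) * glEmb (b * p)) := fun b => by
    obtain ⟨u, hu⟩ := glEmb_mul_mirabolicMk b p v
    rw [heq, ← mul_assoc, hK _ k hk, ← mul_assoc, ← diagGL_const_comm hz, mul_assoc, hu, ← mul_assoc,
      diagGL_const_comm hz, mul_assoc, hN]
  have hm : Measurable fun b : GL (Fin m) F =>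
      ‖b.val.det‖ₑ⁻¹ * Φ (diagGL (fun _ => y i₀) * glEmb b) :=
    (measurable_det (measurable_gl_val measurable_id)).enorm.inv.mul
      (hΦ.comp ((measurable_glEmb measurable_id).const_mul _))
  have hd : ‖y (Fin.last m)‖ₑ = ‖y i₀‖ₑ ^ (m + 1) * ‖p.val.det‖ₑ := by
    have h2 := congrArg (fun g : GL (Fin (m + 1)) F => ‖g.val.det‖ₑ) heq
    simp only [Units.val_mul, Matrix.det_mul, enorm_mul] at h2
    rw [det_rowGL hy, diagGL_val (fun _ => hz), Matrix.det_diagonal, mirabolicMk_val,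
      det_border_row_zero, mul_one, Finset.prod_const, Finset.card_univ, Fintype.card_fin,
      enorm_pow] at h2
    have h3 : ‖k.val.det‖ₑ = 1 := by rw [← ofReal_norm, norm_det_eq_one hk, ENNReal.ofReal_one]
    rw [h2, h3, mul_one]
  have hp0 : ‖p.val.det‖ₑ ≠ 0 := by simpa using det_ne_zero p
  have hp1 : ‖p.val.det‖ₑ ≠ ∞ := by simp
  have h2 : ∀ b : GL (Fin m) F, ‖b.val.det‖ₑ⁻¹ * Φ (glEmb b * rowGL y) = ‖p.val.det‖ₑ *
      (‖(b * p).val.det‖ₑ⁻¹ * Φ (diagGL (fun _ => y i₀) * glEmb (b * p))) := fun b => by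
    rw [h1, Units.val_mul, Matrix.det_mul, enorm_mul, mul_comm ‖b.val.det‖ₑ,
      ENNReal.mul_inv (Or.inl hp0) (Or.inl hp1), ← mul_assoc, ← mul_assoc,
      ENNReal.mul_inv_cancel hp0 hp1, one_mul]
  simp only [h2]
  have hm' : Measurable fun b : GL (Fin m) F =>
      ‖(b * p).val.det‖ₑ⁻¹ * Φ (diagGL (fun _ => y i₀) * glEmb (b * p)) :=
    hm.comp (measurable_mul_const p)
  rw [lintegral_const_mul _ hm',
    lintegral_lowerMeasure_mul_right hs p hm, ← mul_assoc, hd]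
  · congr 1
    rw [ENNReal.mul_inv (Or.inr hp1) (Or.inr hp0), mul_assoc, ENNReal.inv_mul_cancel hp0 hp1,
      mul_one]
  · intro u b
    have hu : (u : GL (Fin m) F).val.det = 1 := (isUpperUnip_coe u).det
    have h3 := hN ⟨_, glEmb_mem_unip u⟩ (diagGL (fun _ => y i₀) * glEmb b)
    rw [Units.val_mul, Matrix.det_mul, hu, one_mul, glEmb_mul, ← mul_assoc,
      diagGL_const_comm hz, mul_assoc, h3]

theorem diagGL_const_mul_glEmb {m : ℕ} {z : F} (hz : z ≠ 0) {a : Fin m → F} (ha : ∀ i, a i ≠ 0) :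
    diagGL (fun _ => z) * glEmb (diagGL a) =
      diagGL fun i => z * (Fin.snoc a 1 : Fin (m + 1) → F) i := by
  have h0 : ∀ i, z * (Fin.snoc a 1 : Fin (m + 1) → F) i ≠ 0 := fun i => by
    induction i using Fin.lastCases with
    | last => simpa using hz
    | cast i => simpa using ⟨hz, ha i⟩
  apply Units.ext
  rw [diagGL_const_mul hz, diagGL_val h0, glEmb_val, diagGL_val ha]
  refine border_ext (fun i j => ?_) (fun i => ?_) (fun j => ?_) ?_
  · by_cases h : i = j
    · subst h; simp [border]
    · have h' : i.castSucc ≠ j.castSucc := fun h2 => h (Fin.castSucc_injective _ h2)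
      rw [Matrix.diagonal_apply_ne _ h']
      simp [border, Matrix.diagonal_apply_ne _ h]
  · simp [border]
  · simp [border, Matrix.diagonal_apply_ne _ (Fin.castSucc_lt_last j).ne']
  · simp [border]

attribute [local irreducible] glEmb rowGL diagGL toGL

/-- A function on `GL_m` which is left invariant under the unipotent group and right invariant under
the integral matrices, with the given bound on the diagonal matrices, is integrable on the quotient. -/
theorem lintegral_lowerMeasure_le (hs : HasNormScaling μ) (R : ℝ) (m : ℕ) :
    ∃ V : ℝ≥0∞, V < ∞ ∧ ∀ (C : ℝ≥0∞) (Φ : GL (Fin m) F → ℝ≥0∞), Measurable Φ →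
      (∀ (u : unip F m) b, Φ ((u : GL (Fin m) F) * b) = Φ b) →
      (∀ b, ∀ k ∈ boundedGL (Fin m) F 1, Φ (b * k) = Φ b) →
      (∀ a : Fin m → F, (∀ i, a i ≠ 0) →
        Φ (diagGL a) ≤ C * rootWeight (Fin.snoc a 1 : Fin (m + 1) → F)) →
      (∀ a : Fin m → F, (∀ i, a i ≠ 0) → (∃ i : Fin m, R * ‖(Fin.snoc a 1 : Fin (m + 1) → F) i.succ‖ <
        ‖(Fin.snoc a 1 : Fin (m + 1) → F) i.castSucc‖) → Φ (diagGL a) = 0) →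
      ∫⁻ b, Φ b ∂(lowerMeasure μ m) ≤ C * V := by
  induction m with
  | zero =>
    refine ⟨1, ENNReal.one_lt_top, fun C Φ hΦ _ _ hb _ => ?_⟩
    rw [lowerMeasure, lintegral_dirac' _ hΦ]
    have h := hb 0 (fun i => i.elim0)
    have h1 : diagGL (0 : Fin 0 → F) = 1 := Units.ext (by ext i; exact i.elim0)
    have h2 : rootWeight (Fin.snoc (0 : Fin 0 → F) 1 : Fin 1 → F) = 1 := by
      rw [rootWeight]
      refine Finset.prod_eq_one fun p _ => absurd p.2 ?_
      have h1 := p.1.1.2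
      have h2 := p.1.2.2
      rw [Fin.lt_def]
      omega
    rwa [h1, h2] at h
  | succ m ih =>
    obtain ⟨V, hV, hle⟩ := ih
    -- The last row contributes the volume of a ball. Beyond radius R the function vanishes by the
    -- support condition at the last root, and inside all powers of |z| cancel.
    refine ⟨V * piMeasure μ (Fin (m + 1)) {y | ∀ i, ‖y i‖ ≤ R},
      ENNReal.mul_lt_top hV (piMeasure_bdd_lt_top R), fun C Φ hΦ hN hK hb h0 => ?_⟩
    have hB : MeasurableSet {y : Fin (m + 1) → F | ∀ i, ‖y i‖ ≤ R} := by
      have : {y : Fin (m + 1) → F | ∀ i, ‖y i‖ ≤ R} = ⋂ i, {y | ‖y i‖ ≤ R} := by ext; simp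
      rw [this]
      exact MeasurableSet.iInter fun i => measurableSet_le (measurable_pi_apply i).norm
        measurable_const
    have hmΦ : Measurable fun q : GL (Fin m) F × (Fin (m + 1) → F) => Φ (glEmb q.1 * rowGL q.2) :=
      hΦ.comp ((measurable_glEmb measurable_fst).mul (measurable_rowGL.comp measurable_snd))
    have hdm : Measurable fun q : GL (Fin m) F × (Fin (m + 1) → F) => ‖q.1.val.det‖ₑ⁻¹ :=
      (measurable_det (measurable_gl_val measurable_fst)).enorm.inv
    have hym : Measurable fun q : GL (Fin m) F × (Fin (m + 1) → F) => ‖q.2 (Fin.last m)‖ₑ⁻¹ :=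
      ((measurable_pi_apply _).comp measurable_snd).enorm.inv
    rw [lintegral_lowerMeasure_succ hΦ]
    have e1 : ∀ b : GL (Fin m) F, ‖b.val.det‖ₑ⁻¹ * ∫⁻ y, ‖y (Fin.last m)‖ₑ⁻¹ *
        Φ (glEmb b * rowGL y) ∂(piMeasure μ (Fin (m + 1))) = ∫⁻ y, ‖y (Fin.last m)‖ₑ⁻¹ *
          (‖b.val.det‖ₑ⁻¹ * Φ (glEmb b * rowGL y)) ∂(piMeasure μ (Fin (m + 1))) := fun b => by
      have h1 : Measurable fun y : Fin (m + 1) → F => ‖y (Fin.last m)‖ₑ⁻¹ *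
        Φ (glEmb b * rowGL y) := (measurable_pi_apply _).enorm.inv.mul
          (hΦ.comp (measurable_rowGL.const_mul _))
      rw [← lintegral_const_mul _ h1]
      exact lintegral_congr fun y => by ring
    simp only [e1]
    rw [lintegral_lintegral_swap (hym.mul (hdm.mul hmΦ)).aemeasurable, ← mul_assoc,
      ← lintegral_indicator_const hB]
    refine lintegral_mono_ae ?_
    filter_upwards [ae_ne_zero (μ := μ) (Fin.last m)] with y hy
    have h1 : Measurable fun b : GL (Fin m) F => ‖b.val.det‖ₑ⁻¹ * Φ (glEmb b * rowGL y) :=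
      (measurable_det (measurable_gl_val measurable_id)).enorm.inv.mul
        (hΦ.comp ((measurable_glEmb measurable_id).mul_const _))
    rw [lintegral_const_mul _ h1]
    obtain ⟨i₀, hz, hi, heq⟩ := lintegral_lower_row hs hΦ hN hK hy
    rw [heq]
    have hz0 : ‖y i₀‖ₑ ^ (m + 1) ≠ 0 := pow_ne_zero _ (by simpa using hz)
    have hz1 : ‖y i₀‖ₑ ^ (m + 1) ≠ ∞ := ENNReal.pow_ne_top (by simp)
    set z := y i₀
    have hm : Measurable fun b : GL (Fin m) F =>
        ‖b.val.det‖ₑ⁻¹ * Φ (diagGL (fun _ => z) * glEmb b) :=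
      (measurable_det (measurable_gl_val measurable_id)).enorm.inv.mul
        (hΦ.comp ((measurable_glEmb measurable_id).const_mul _))
    have hNz : ∀ (u : unip F m) (b : GL (Fin m) F), ‖((u : GL (Fin m) F) * b).val.det‖ₑ⁻¹ *
        Φ (diagGL (fun _ => z) * glEmb ((u : GL (Fin m) F) * b)) =
        ‖b.val.det‖ₑ⁻¹ * Φ (diagGL (fun _ => z) * glEmb b) := fun u b => by
      have h3 := hN ⟨_, glEmb_mem_unip u⟩ (diagGL (fun _ => z) * glEmb b)
      rw [Units.val_mul, Matrix.det_mul, (isUpperUnip_coe u).det, one_mul, glEmb_mul, ← mul_assoc,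
        diagGL_const_comm hz, mul_assoc, h3]
    have hKz : ∀ b, ∀ k ∈ boundedGL (Fin m) F 1, ‖(b * k).val.det‖ₑ⁻¹ *
        Φ (diagGL (fun _ => z) * glEmb (b * k)) =
        ‖b.val.det‖ₑ⁻¹ * Φ (diagGL (fun _ => z) * glEmb b) := fun b k hk => by
      have h3 : ‖k.val.det‖ₑ = 1 := by rw [← ofReal_norm, norm_det_eq_one hk, ENNReal.ofReal_one]
      rw [Units.val_mul, Matrix.det_mul, enorm_mul, h3, mul_one, glEmb_mul, ← mul_assoc,
        hK _ _ (glEmb_mem_boundedGL le_rfl hk)]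
    have hsn : ∀ a : Fin m → F, (∀ i, a i ≠ 0) →
        ∀ i, z * (Fin.snoc a 1 : Fin (m + 1) → F) i ≠ 0 := fun a ha i => by
      induction i using Fin.lastCases with
      | last => simpa using hz
      | cast i => simpa using ⟨hz, ha i⟩
    by_cases hzR : ‖z‖ ≤ R
    · rw [Set.indicator_of_mem (show y ∈ {y | ∀ i, ‖y i‖ ≤ R} from fun i => (hi i).trans hzR)]
      -- Appending z multiplies the root weight by |z|^{m+1} |det a|. The second factor is cancelled
      -- by the weight |det b|⁻¹, and the first goes into the constant.
      have h2 := hle (C * ‖z‖ₑ ^ (m + 1)) _ hm hNz hKz (fun a ha => ?_) (fun a ha hR => ?_)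
      · calc _ ≤ (‖z‖ₑ ^ (m + 1))⁻¹ * (C * ‖z‖ₑ ^ (m + 1) * V) := by gcongr
          _ = (‖z‖ₑ ^ (m + 1))⁻¹ * ‖z‖ₑ ^ (m + 1) * (C * V) := by ring
          _ = C * V := by rw [ENNReal.inv_mul_cancel hz0 hz1, one_mul]
      · rw [diagGL_const_mul_glEmb hz ha]
        have h3 := hb _ (hsn a ha)
        rw [rootWeight_snoc _ hz, Fin.prod_univ_castSucc] at h3
        simp only [Fin.snoc_castSucc, Fin.snoc_last, enorm_one, mul_one] at h3
        have hd0 : ∏ i, ‖a i‖ₑ ≠ 0 := Finset.prod_ne_zero_iff.2 fun i _ => by simpa using ha i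
        have hd1 : ∏ i, ‖a i‖ₑ ≠ ∞ := ENNReal.prod_ne_top fun i _ => by simp
        have hd : ‖(diagGL a).val.det‖ₑ = ∏ i, ‖a i‖ₑ := by
          rw [diagGL_val ha, Matrix.det_diagonal, ← ofReal_norm, norm_prod,
            ENNReal.ofReal_prod_of_nonneg fun _ _ => norm_nonneg _]
          simp only [ofReal_norm]
        rw [hd]
        calc _ ≤ (∏ i, ‖a i‖ₑ)⁻¹ * (C * (rootWeight (Fin.snoc a 1 : Fin (m + 1) → F) *
              (‖z‖ₑ ^ (m + 1) * ∏ i, ‖a i‖ₑ))) := by gcongr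
          _ = (∏ i, ‖a i‖ₑ)⁻¹ * (∏ i, ‖a i‖ₑ) *
              (C * ‖z‖ₑ ^ (m + 1) * rootWeight (Fin.snoc a 1 : Fin (m + 1) → F)) := by ring
          _ = _ := by rw [ENNReal.inv_mul_cancel hd0 hd1, one_mul]
      · obtain ⟨i, hi2⟩ := hR
        rw [diagGL_const_mul_glEmb hz ha, h0 _ (hsn a ha) ⟨i.castSucc, ?_⟩, mul_zero]
        rw [Fin.snoc_castSucc, Fin.succ_castSucc, Fin.snoc_castSucc, norm_mul, norm_mul]
        have := mul_lt_mul_of_pos_left hi2 (norm_pos_iff.2 hz)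
        linarith
    · have hv : ∀ a : Fin m → F, (∀ i, a i ≠ 0) → ‖(diagGL a).val.det‖ₑ⁻¹ *
          Φ (diagGL (fun _ => z) * glEmb (diagGL a)) = 0 := fun a ha => by
        rw [diagGL_const_mul_glEmb hz ha, h0 _ (hsn a ha) ⟨Fin.last m, ?_⟩, mul_zero]
        rw [Fin.succ_last, Fin.snoc_last, Fin.snoc_castSucc, Fin.snoc_last]
        simpa using hzR
      -- Vanishing on all diagonal matrices is the induction hypothesis with constant `0`.
      have h2 := hle 0 _ hm hNz hKz (fun a ha => by rw [hv a ha]; exact zero_le)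
        (fun a ha _ => hv a ha)
      rw [zero_mul, nonpos_iff_eq_zero] at h2
      rw [h2, mul_zero]
      exact zero_le

end LowerBound

/-! ### Vanishing of the Whittaker function -/

section Vanishing

variable {F : Type*} [NontriviallyNormedField F]

/-- The transvection with coefficient `t` at `(a, b)`. -/
def transGL {ι : Type*} [Fintype ι] [DecidableEq ι] {a b : ι} (hab : a ≠ b) (t : F) : GL ι F where
  val := Matrix.transvection a b t
  inv := Matrix.transvection a b (-t)
  val_inv := by
    rw [Matrix.transvection_mul_transvection_same _ _ hab, add_neg_cancel, Matrix.transvection_zero]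
  inv_val := by
    rw [Matrix.transvection_mul_transvection_same _ _ hab, neg_add_cancel, Matrix.transvection_zero]

theorem transGL_inv {ι : Type*} [Fintype ι] [DecidableEq ι] {a b : ι} (hab : a ≠ b) (t : F) :
    (transGL hab t)⁻¹ = transGL hab (-t) := Units.ext rfl

theorem conj_transGL_apply {ι : Type*} [Fintype ι] [DecidableEq ι] {a b : ι} (hab : a ≠ b) (t : F)
    (g : GL ι F) (x y : ι) : (g * transGL hab t * g⁻¹).val x y =
      (1 : Matrix ι ι F) x y + t * (g.val x a * (g⁻¹).val b y) := by
  have h : (g * transGL hab t * g⁻¹).val = 1 + g.val * Matrix.single a b t * (g⁻¹).val := by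
    rw [Units.val_mul, Units.val_mul]
    change g.val * (1 + Matrix.single a b t) * (g⁻¹).val = _
    rw [Matrix.mul_add, Matrix.mul_one, Matrix.add_mul, ← Units.val_mul, mul_inv_cancel,
      Units.val_one]
  rw [h, Matrix.add_apply, Matrix.mul_apply, Finset.sum_eq_single b]
  · rw [Matrix.mul_single_apply_same]
    ring
  · intro k _ hk
    rw [Matrix.mul_single_apply_of_ne _ _ _ _ _ hk, zero_mul]
  · simp

theorem superSum_conj_transGL {n : ℕ} {a b : Fin n ⊕ Fin n} (hab : a ≠ b) (t : F)
    (ξ : GL (Fin n ⊕ Fin n) F) : superSum (conjShuffle n (ξ * transGL hab t * ξ⁻¹)).val =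
      t * (∑ i, ξ.val (Sum.inl i) a * (ξ⁻¹).val b (Sum.inr i) +
        superSum (Matrix.of fun i j => ξ.val (Sum.inr i) a * (ξ⁻¹).val b (Sum.inl j))) := by
  rw [superSum_conjShuffle, mul_add, Matrix.trace, Finset.mul_sum, superSum, superSum,
    Finset.mul_sum]
  congr 1
  · refine Finset.sum_congr rfl fun i _ => ?_
    rw [Matrix.diag_apply, Matrix.toBlocks₁₂, Matrix.of_apply, conj_transGL_apply,
      Matrix.one_apply_ne (by simp), zero_add]
  · refine Finset.sum_congr rfl fun i _ => ?_
    rw [Finset.mul_sum]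
    refine Finset.sum_congr rfl fun j _ => ?_
    rw [Matrix.toBlocks₂₁, Matrix.of_apply, Matrix.of_apply, conj_transGL_apply,
      Matrix.one_apply_ne (by simp), zero_add, mul_ite, mul_zero]

theorem conj_transGL_mem_unip {n : ℕ} {a b : Fin n ⊕ Fin n} (hab : a ≠ b) (t : F)
    {ξ : GL (Fin n ⊕ Fin n) F} (hN : ∀ x y, shuffle n y ≤ shuffle n x →
      ξ.val x a * (ξ⁻¹).val b y = 0) : conjShuffle n (ξ * transGL hab t * ξ⁻¹) ∈ unip F (2 * n) := by
  intro i j hij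
  obtain ⟨x, rfl⟩ := (shuffle n).surjective i
  obtain ⟨y, rfl⟩ := (shuffle n).surjective j
  have h := conjShuffle_apply (ξ * transGL hab t * ξ⁻¹) x y
  rw [conj_transGL_apply, hN x y hij, mul_zero, add_zero] at h
  refine h.trans ?_
  simp only [Matrix.one_apply, EmbeddingLike.apply_eq_iff_eq]

theorem conjShuffle_mem_nearOne {n : ℕ} {A : GL (Fin n ⊕ Fin n) F} {ε : ℝ}
    (hA : A ∈ nearOne (Fin n ⊕ Fin n) F ε) : conjShuffle n A ∈ nearOne (Fin (2 * n)) F ε := by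
  have h : ∀ A : GL (Fin n ⊕ Fin n) F, MatBdd (A.val - 1) ε →
      MatBdd ((conjShuffle n A).val - 1) ε := fun A hA i j => by
    obtain ⟨i, rfl⟩ := (shuffle n).surjective i
    obtain ⟨j, rfl⟩ := (shuffle n).surjective j
    have := hA i j
    rw [Matrix.sub_apply] at this ⊢
    rw [conjShuffle_apply]
    simpa only [Matrix.one_apply, EmbeddingLike.apply_eq_iff_eq] using this
  exact ⟨h _ hA.1, by rw [← map_inv]; exact h _ hA.2⟩

/-- The deviation from the identity is t times a column of g⁻¹ times a row of g, hence at most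
S²|t|. -/
theorem conj_transGL_mem_nearOne {ι : Type*} [Fintype ι] [DecidableEq ι] {a b : ι} (hab : a ≠ b)
    {t : F} {g : GL ι F} {S ε : ℝ} (hS : 0 ≤ S) (hg : g ∈ boundedGL ι F S) (ht : S * S * ‖t‖ ≤ ε) :
    g⁻¹ * transGL hab t * g ∈ nearOne ι F ε := by
  have h : ∀ s : F, ‖s‖ = ‖t‖ → MatBdd ((g⁻¹ * transGL hab s * g).val - 1) ε := fun s hst x y => by
    have h1 := conj_transGL_apply hab s g⁻¹ x y
    rw [inv_inv] at h1
    rw [Matrix.sub_apply, h1, add_sub_cancel_left, norm_mul, norm_mul, hst, mul_comm]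
    refine le_trans ?_ ht
    gcongr
    · exact hg.2 x a
    · exact hg.1 b y
  refine ⟨h t rfl, ?_⟩
  have h2 : (g⁻¹ * transGL hab t * g)⁻¹ = g⁻¹ * transGL hab (-t) * g := by
    rw [← transGL_inv]; group
  rw [h2]
  exact h _ (norm_neg t)

variable [ProperSpace F] [MeasurableSpace F] [BorelSpace F] {μ : Measure F}
  [μ.IsAddHaarMeasure] {ψ : AddChar F Circle} {n : ℕ}

/-- Let e be the transvection. Since g⁻¹eg is near 1, right translation by it does not change W_f;
but it equals left translation by ξeξ⁻¹, an element of N_{2n} that multiplies W_f by a value of ψ⁻¹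
different from 1. -/
theorem whittaker_eq_zero (hs : HasNormScaling μ) (hψc : Continuous ψ) {f : GL (Fin (2 * n)) F → ℂ}
    (hf : Measurable f) {ε : ℝ} (hε : ∀ k ∈ nearOne (Fin (2 * n)) F ε, ∀ g, f (k * g) = f g)
    {ξ g : GL (Fin n ⊕ Fin n) F} {a b : Fin n ⊕ Fin n} (hab : a ≠ b) {t : F} {S : ℝ} (hS : 0 ≤ S)
    (hg : g ∈ boundedGL (Fin n ⊕ Fin n) F S) (ht : S * S * ‖t‖ ≤ ε)
    (hN : ∀ x y, shuffle n y ≤ shuffle n x → ξ.val x a * (ξ⁻¹).val b y = 0)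
    (hψt : ψ (t * (∑ i, ξ.val (Sum.inl i) a * (ξ⁻¹).val b (Sum.inr i) +
        superSum (Matrix.of fun i j => ξ.val (Sum.inr i) a * (ξ⁻¹).val b (Sum.inl j)))) ≠ 1)
    (τ : GL (Fin (2 * n)) F) : whittaker μ ψ f (conjShuffle n (ξ * g)) τ = 0 := by
  have h1 := whittaker_left_invariant (μ := μ) (ψ := ψ)
    (k := conjShuffle n (g⁻¹ * transGL hab t * g)) (fun x => hε _ (nearOne_inv
    (conjShuffle_mem_nearOne (conj_transGL_mem_nearOne hab hS hg ht))) x) (conjShuffle n (ξ * g)) τ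
  have h2 : ξ * g * (g⁻¹ * transGL hab t * g) = ξ * transGL hab t * ξ⁻¹ * (ξ * g) := by group
  have h3 := whittaker_unip_mul (μ := μ) hs hψc hf ⟨_, conj_transGL_mem_unip hab t hN⟩ 1
    (conjShuffle n (ξ * g)) τ
  rw [← map_mul, h2] at h1
  rw [Subgroup.coe_one, one_mul, ← map_mul, h1, psiUnip_eq, psiUnip_eq] at h3
  simp only [superSum_conj_transGL] at h3
  have h4 : superSum ((1 : unip F (2 * n)) : GL (Fin (2 * n)) F).val = 0 := by
    rw [superSum]
    refine Finset.sum_eq_zero fun i _ => Finset.sum_eq_zero fun j _ => ?_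
    split_ifs with h
    · exact Matrix.one_apply_ne fun h' => by rw [h'] at h; omega
    · rfl
  rw [h4, AddChar.map_zero_eq_one, Circle.coe_one, mul_one] at h3
  by_contra h0
  refine hψt (Subtype.ext ?_)
  have h5 := mul_right_cancel₀ h0 ((one_mul _).trans h3)
  exact inv_eq_one.1 h5.symm

variable (μ ψ) in
/-- The integral of the absolute value of the Whittaker function over the second variable. -/
def whittakerMass (f : GL (Fin (2 * n)) F → ℂ) (ξ : GL (Fin n ⊕ Fin n) F) : ℝ≥0∞ :=
  ∫⁻ p : GL (Fin n) F × strictLower F n, ‖whittaker μ ψ f (conjShuffle n ξ)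
    (shalikaMk (p.2 : Matrix (Fin n) (Fin n) F) p.1)‖ₑ
    ∂((lowerMeasure μ n).prod (strictLowerMeasure μ n))

/-- If the superdiagonal sum were too large, some t with S²|t| ≤ ε would make the character
non-trivial and the Whittaker function zero. The root vector (a, b) remains free, to be chosen for
each coordinate that has to be bounded. -/
theorem norm_le_of_whittakerMass_ne_zero (hs : HasNormScaling μ) (hψc : Continuous ψ) (hψ : ψ ≠ 1)
    {f : GL (Fin (2 * n)) F → ℂ} (hf : IsSchwartzBruhat f) : ∃ B : ℝ, 0 < B ∧
    ∀ (S : ℝ), 1 ≤ S → ∀ (ξ g : GL (Fin n ⊕ Fin n) F) (a b : Fin n ⊕ Fin n), a ≠ b →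
    g ∈ boundedGL (Fin n ⊕ Fin n) F S →
    (∀ x y, shuffle n y ≤ shuffle n x → ξ.val x a * (ξ⁻¹).val b y = 0) →
    whittakerMass μ ψ f (ξ * g) ≠ 0 →
    ‖∑ i, ξ.val (Sum.inl i) a * (ξ⁻¹).val b (Sum.inr i) +
        superSum (Matrix.of fun i j => ξ.val (Sum.inr i) a * (ξ⁻¹).val b (Sum.inl j))‖ ≤ B * (S * S) := by
  obtain ⟨ε, hε, hinv⟩ := hf.exists_left_invariant
  obtain ⟨A, hA, hne⟩ := exists_character_ne_one hψ
  refine ⟨A / ε, div_pos hA hε, fun S hS ξ g a b hab hg hN hne0 => ?_⟩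
  by_contra! hlt
  have hS0 : 0 < S * S := by positivity
  -- The radius ε/S² is the largest for which the conjugate by g is guaranteed to stay ε-close to 1;
  -- this produces the constant (A/ε)S².
  obtain ⟨t, ht, hψt⟩ := hne (ε / (S * S)) _ (by positivity) (lt_of_eq_of_lt (by field_simp) hlt)
  refine hne0 ?_
  rw [whittakerMass]
  refine (lintegral_congr fun p => ?_).trans lintegral_zero
  rw [whittaker_eq_zero hs hψc hf.measurable hinv hab (zero_le_one.trans hS) hg ?_ hN hψt, enorm_zero]
  rw [le_div_iff₀ hS0] at ht
  linarith

end Vanishing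

/-! ### The support of the Whittaker function -/

section Support

variable {F : Type*} [NontriviallyNormedField F] {n : ℕ}

theorem diagBlock_mul_upperBlock_val (g : GL (Fin n) F) (X : Matrix (Fin n) (Fin n) F) :
    (diagBlock g * upperBlock X : GL (Fin n ⊕ Fin n) F).val =
      Matrix.fromBlocks g.val (g.val * X) 0 g.val := by
  rw [Units.val_mul]
  simp [upperBlock, diagBlock, Matrix.fromBlocks_multiply]

theorem diagBlock_mul_upperBlock_inv_val (g : GL (Fin n) F) (X : Matrix (Fin n) (Fin n) F) :
    ((diagBlock g * upperBlock X : GL (Fin n ⊕ Fin n) F)⁻¹).val =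
      Matrix.fromBlocks (g⁻¹).val (-X * (g⁻¹).val) 0 (g⁻¹).val := by
  rw [_root_.mul_inv_rev, ← upperBlock_neg, ← diagBlock_inv, upperBlock_mul_diagBlock_val]

theorem matBdd_fromBlocks {A B C D : Matrix (Fin n) (Fin n) F} {R : ℝ} (hA : MatBdd A R)
    (hB : MatBdd B R) (hC : MatBdd C R) (hD : MatBdd D R) :
    MatBdd (Matrix.fromBlocks A B C D) R := by
  rintro (i | i) (j | j)
  · exact hA i j
  · exact hB i j
  · exact hC i j
  · exact hD i j

theorem matBdd_zero {ι κ : Type*} {R : ℝ} (hR : 0 ≤ R) : MatBdd (0 : Matrix ι κ F) R :=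
  fun i j => by rw [Matrix.zero_apply, norm_zero]; exact hR

theorem matBdd_one {ι : Type*} [DecidableEq ι] {R : ℝ} (hR : 1 ≤ R) :
    MatBdd (1 : Matrix ι ι F) R := fun i j => by
  rw [Matrix.one_apply]
  split_ifs
  · simpa using hR
  · simpa using zero_le_one.trans hR

theorem upperBlock_mem_boundedGL {X : Matrix (Fin n) (Fin n) F} {R : ℝ} (hR : 1 ≤ R)
    (hX : MatBdd X R) : upperBlock X ∈ boundedGL (Fin n ⊕ Fin n) F R := by
  have hR0 := zero_le_one.trans hR
  exact ⟨matBdd_fromBlocks (matBdd_one hR) hX (matBdd_zero hR0) (matBdd_one hR),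
    matBdd_fromBlocks (matBdd_one hR) (fun i j => by
      rw [Matrix.neg_apply, norm_neg]; exact hX i j) (matBdd_zero hR0) (matBdd_one hR)⟩

theorem diagBlock_mem_boundedGL {g : GL (Fin n) F} {R : ℝ} (hR : 0 ≤ R)
    (hg : g ∈ boundedGL (Fin n) F R) : diagBlock g ∈ boundedGL (Fin n ⊕ Fin n) F R :=
  ⟨matBdd_fromBlocks hg.1 (matBdd_zero hR) (matBdd_zero hR) hg.1,
    matBdd_fromBlocks hg.2 (matBdd_zero hR) (matBdd_zero hR) hg.2⟩

variable [ProperSpace F] [MeasurableSpace F] [BorelSpace F] [IsUltrametricDist F] {μ : Measure F}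
  [μ.IsAddHaarMeasure] {ψ : AddChar F Circle}

theorem upperBlock_mul_diagBlock_mem_boundedGL {X : Matrix (Fin n) (Fin n) F} {R : ℝ} (hR : 1 ≤ R)
    (hX : MatBdd X R) {k : GL (Fin n) F} (hk : k ∈ boundedGL (Fin n) F 1) :
    upperBlock X * diagBlock k ∈ boundedGL (Fin n ⊕ Fin n) F R := by
  have := boundedGL_mul (zero_le_one.trans hR) zero_le_one (upperBlock_mem_boundedGL hR hX)
    (diagBlock_mem_boundedGL zero_le_one hk)
  rwa [mul_one] at this

/-- Rows are bounded from the bottom up, l counting those already treated. For the entry (i, j) the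
root vector lies in the lower right block at position (j, i). Conjugated by diag(A) and by the rows
of x up to i, it lands in N_{2n} with superdiagonal sum exactly x_{ij}, since the factors A_i and
A_i⁻¹ cancel; the result is therefore uniform in A. -/
theorem exists_strictLower_bound (hs : HasNormScaling μ) (hψc : Continuous ψ) (hψ : ψ ≠ 1)
    {f : GL (Fin (2 * n)) F → ℂ} (hf : IsSchwartzBruhat f) (l : ℕ) : ∃ R : ℝ, 1 ≤ R ∧
      ∀ (A : Fin n → F), (∀ i, A i ≠ 0) → ∀ x ∈ strictLower F n, ∀ k ∈ boundedGL (Fin n) F 1,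
        whittakerMass μ ψ f (diagBlock (diagGL A) * upperBlock x * diagBlock k) ≠ 0 →
        ∀ i j : Fin n, n ≤ (i : ℕ) + l → ‖x i j‖ ≤ R := by
  obtain ⟨B, hB, hle⟩ := norm_le_of_whittakerMass_ne_zero (μ := μ) hs hψc hψ hf
  induction l with
  | zero => exact ⟨1, le_rfl, fun _ _ _ _ _ _ _ i _ h => absurd i.2 (by omega)⟩
  | succ l ih =>
    obtain ⟨R, hR, hRx⟩ := ih
    refine ⟨max R (B * (R * R)), le_max_of_le_left hR, fun A hA x hx k hk h0 i j hij => ?_⟩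
    by_cases hil : n ≤ (i : ℕ) + l
    · exact (hRx A hA x hx k hk h0 i j hil).trans (le_max_left _ _)
    rcases le_or_gt i j with hji | hji
    · rw [hx i j hji, norm_zero]
      exact (zero_le_one.trans hR).trans (le_max_left _ _)
    refine le_trans ?_ (le_max_right _ _)
    -- The rows below i, bounded by induction, are put in the factor g. Keeping them in ξ would take
    -- the conjugated root vector out of N_{2n}.
    set y : Matrix (Fin n) (Fin n) F := Matrix.of fun r c => if r ≤ i then x r c else 0 with hy
    set z : Matrix (Fin n) (Fin n) F := Matrix.of fun r c => if r ≤ i then 0 else x r c with hz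
    have hyz : x = y + z := by
      ext r c
      rw [Matrix.add_apply, hy, hz, Matrix.of_apply, Matrix.of_apply]
      split_ifs <;> simp
    have hzR : MatBdd z R := fun r c => by
      rw [hz, Matrix.of_apply]
      split_ifs with h
      · rw [norm_zero]; exact zero_le_one.trans hR
      · refine hRx A hA x hx k hk h0 r c ?_
        rw [Fin.le_def] at h
        omega
    have heq : diagBlock (diagGL A) * upperBlock x * diagBlock k =
        (diagBlock (diagGL A) * upperBlock y) * (upperBlock z * diagBlock k) := by
      rw [hyz, upperBlock_add]; simp only [mul_assoc]
    have h1 : ∀ r : Fin n, ((diagBlock (diagGL A) * upperBlock y : GL (Fin n ⊕ Fin n) F).val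
        (Sum.inl r) (Sum.inr j)) = A r * y r j := fun r => by
      rw [diagBlock_mul_upperBlock_val, diagGL_val hA, Matrix.fromBlocks_apply₁₂,
        Matrix.diagonal_mul]
    have h2 : ∀ r : Fin n, ((diagBlock (diagGL A) * upperBlock y : GL (Fin n ⊕ Fin n) F).val
        (Sum.inr r) (Sum.inr j)) = Matrix.diagonal A r j := fun r => by
      rw [diagBlock_mul_upperBlock_val, diagGL_val hA, Matrix.fromBlocks_apply₂₂]
    have h3 : ∀ r : Fin n, (((diagBlock (diagGL A) * upperBlock y : GL (Fin n ⊕ Fin n) F)⁻¹).val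
        (Sum.inr i) (Sum.inl r)) = 0 := fun r => by
      rw [diagBlock_mul_upperBlock_inv_val, Matrix.fromBlocks_apply₂₁, Matrix.zero_apply]
    have h4 : ∀ r : Fin n, (((diagBlock (diagGL A) * upperBlock y : GL (Fin n ⊕ Fin n) F)⁻¹).val
        (Sum.inr i) (Sum.inr r)) = Matrix.diagonal (fun i => (A i)⁻¹) i r := fun r => by
      rw [diagBlock_mul_upperBlock_inv_val, Matrix.fromBlocks_apply₂₂, diagGL_inv_val hA]
    have h5 := hle R hR (diagBlock (diagGL A) * upperBlock y) (upperBlock z * diagBlock k)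
      (Sum.inr j) (Sum.inr i) (by simpa using hji.ne)
      (upperBlock_mul_diagBlock_mem_boundedGL hR hzR hk) (fun s t hst => ?_) (heq ▸ h0)
    · have h6 : superSum (Matrix.of fun r c =>
          (diagBlock (diagGL A) * upperBlock y : GL (Fin n ⊕ Fin n) F).val (Sum.inr r) (Sum.inr j) *
          ((diagBlock (diagGL A) * upperBlock y : GL (Fin n ⊕ Fin n) F)⁻¹).val
            (Sum.inr i) (Sum.inl c)) = 0 := by
        simp only [h3, mul_zero]
        exact (Finset.sum_eq_zero fun _ _ => Finset.sum_eq_zero fun _ _ => by simp)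
      rw [h6, add_zero, Finset.sum_eq_single i] at h5
      · rw [h1, h4, Matrix.diagonal_apply_eq, hy, Matrix.of_apply, if_pos le_rfl, mul_comm (A i),
          mul_assoc, mul_inv_cancel₀ (hA i), mul_one] at h5
        exact h5
      · intro r _ hr
        rw [h4, Matrix.diagonal_apply_ne _ hr.symm, mul_zero]
      · simp
    · rcases t with t | t
      · rw [h3, mul_zero]
      · by_cases hti : t = i
        · subst hti
          rcases s with s | s
          · rw [h1, hy, Matrix.of_apply, if_neg, mul_zero, zero_mul]
            simp only [shuffle, Equiv.coe_fn_mk, Sum.elim_inl, Sum.elim_inr, Fin.mk_le_mk] at hst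
            rw [Fin.le_def]
            omega
          · rw [h2, Matrix.diagonal_apply_ne, zero_mul]
            rintro rfl
            simp only [shuffle, Equiv.coe_fn_mk, Sum.elim_inr, Fin.mk_le_mk] at hst
            rw [Fin.lt_def] at hji
            omega
        · rw [h4, Matrix.diagonal_apply_ne _ (Ne.symm hti), mul_zero]

/-- The root vector in the lower left block at (i, i+1) sits on the superdiagonal after shuffling,
and conjugation by diag(A) scales it by A_i/A_{i+1}. The bounded factors x and k are put into g. -/
theorem exists_root_bound (hs : HasNormScaling μ) (hψc : Continuous ψ) (hψ : ψ ≠ 1)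
    {f : GL (Fin (2 * n)) F → ℂ} (hf : IsSchwartzBruhat f) {R : ℝ} (hR : 1 ≤ R) : ∃ R' : ℝ,
      ∀ (A : Fin n → F), (∀ i, A i ≠ 0) → ∀ x : Matrix (Fin n) (Fin n) F, MatBdd x R →
        ∀ k ∈ boundedGL (Fin n) F 1,
        whittakerMass μ ψ f (diagBlock (diagGL A) * upperBlock x * diagBlock k) ≠ 0 →
        ∀ i j : Fin n, (i : ℕ) + 1 = j → ‖A i‖ ≤ R' * ‖A j‖ := by
  obtain ⟨B, hB, hle⟩ := norm_le_of_whittakerMass_ne_zero (μ := μ) hs hψc hψ hf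
  refine ⟨B * (R * R), fun A hA x hx k hk h0 i j hij => ?_⟩
  have h1 : ∀ r : Fin n, (diagBlock (diagGL A)).val (Sum.inl r) (Sum.inr i) = 0 := fun r => rfl
  have h2 : ∀ r : Fin n, (diagBlock (diagGL A)).val (Sum.inr r) (Sum.inr i) =
      Matrix.diagonal A r i := fun r => congrFun (congrFun (diagGL_val hA) r) i
  have h3 : ∀ r : Fin n, ((diagBlock (diagGL A))⁻¹).val (Sum.inl j) (Sum.inl r) =
      Matrix.diagonal (fun i => (A i)⁻¹) j r := fun r =>
    congrFun (congrFun (diagGL_inv_val hA) j) r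
  have h4 : ∀ r : Fin n, ((diagBlock (diagGL A))⁻¹).val (Sum.inl j) (Sum.inr r) = 0 := fun r => rfl
  rw [mul_assoc] at h0
  have h5 := hle R hR (diagBlock (diagGL A)) (upperBlock x * diagBlock k) (Sum.inr i) (Sum.inl j)
    (by simp) (upperBlock_mul_diagBlock_mem_boundedGL hR hx hk) (fun s t hst => ?_) h0
  · have h6 : ∑ r, (diagBlock (diagGL A)).val (Sum.inl r) (Sum.inr i) *
        ((diagBlock (diagGL A))⁻¹).val (Sum.inl j) (Sum.inr r) = 0 :=
      Finset.sum_eq_zero fun r _ => by rw [h1, zero_mul]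
    rw [h6, zero_add, superSum, Finset.sum_eq_single i, Finset.sum_eq_single j, if_pos hij,
      Matrix.of_apply, h2, h3, Matrix.diagonal_apply_eq, Matrix.diagonal_apply_eq, norm_mul,
      norm_inv, ← div_eq_mul_inv, div_le_iff₀ (norm_pos_iff.2 (hA j))] at h5
    · exact h5
    · intro c _ hc
      rw [Matrix.of_apply, h3, Matrix.diagonal_apply_ne _ hc.symm, mul_zero, ite_self]
    · simp
    · intro r _ hr
      refine Finset.sum_eq_zero fun c _ => ?_
      rw [Matrix.of_apply, h2, Matrix.diagonal_apply_ne _ hr, zero_mul, ite_self]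
    · simp
  · rcases s with s | s
    · rw [h1, zero_mul]
    · by_cases hsi : s = i
      · subst hsi
        rcases t with t | t
        · rw [h3, Matrix.diagonal_apply_ne, mul_zero]
          rintro rfl
          simp only [shuffle, Equiv.coe_fn_mk, Sum.elim_inl, Sum.elim_inr, Fin.mk_le_mk] at hst
          omega
        · rw [h4, mul_zero]
      · rw [h2, Matrix.diagonal_apply_ne _ hsi, zero_mul]

end Support

/-! ### Convergence of the double integral -/

section Convergence

variable {F : Type*} [NontriviallyNormedField F] {n : ℕ}

theorem diagBlock_inv_mul_complBlock {A : Fin n → F} (hA : ∀ i, A i ≠ 0) (w : UpperPairs F n) :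
    (diagBlock (diagGL A))⁻¹ * complBlock w = complBlock
      (fun p => A p.1.2 / A p.1.1 * w.1 p, fun p => A p.1.2 / A p.1.1 * w.2 p) *
        (diagBlock (diagGL A))⁻¹ := by
  rw [inv_mul_eq_iff_eq_mul, ← mul_assoc, eq_mul_inv_iff_mul_eq]
  apply Units.ext
  have hd : (diagBlock (diagGL A)).val = Matrix.fromBlocks (Matrix.diagonal A) 0 0
      (Matrix.diagonal A) := by
    rw [← diagGL_val hA]; rfl
  rw [Units.val_mul, Units.val_mul, complBlock_val, complBlock_val, hd, Matrix.fromBlocks_multiply,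
    Matrix.fromBlocks_multiply]
  simp only [Matrix.zero_mul, Matrix.mul_zero, add_zero, zero_add, Matrix.one_mul, Matrix.mul_one]
  congr 1
  · ext i j
    rw [Matrix.mul_diagonal, Matrix.diagonal_mul]
    simp only [fillMatrix, Matrix.of_apply]
    split_ifs with h
    · field_simp [hA i]
    · simp
  · ext i j
    rw [Matrix.mul_diagonal, Matrix.diagonal_mul]
    simp only [fillMatrix, Matrix.of_apply]
    split_ifs with h
    · field_simp [hA i]
    · by_cases hij : i = j
      · subst hij; simp
      · simp [Matrix.one_apply_ne hij]

theorem prod_root_inv {A : Fin n → F} (hA : ∀ i, A i ≠ 0) :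
    (∏ p : {p : Fin n × Fin n // p.1 < p.2}, ‖A p.1.2 / A p.1.1‖ₑ)⁻¹ = rootWeight A := by
  refine (ENNReal.eq_inv_of_mul_eq_one_left ?_).symm
  rw [rootWeight, ← Finset.prod_mul_distrib]
  refine Finset.prod_eq_one fun p _ => ?_
  rw [← enorm_mul, div_mul_div_comm, mul_comm (A p.1.1), div_self (mul_ne_zero (hA _) (hA _)),
    enorm_one]

theorem rootWeight_ne_zero {A : Fin n → F} (hA : ∀ i, A i ≠ 0) : rootWeight A ≠ 0 :=
  Finset.prod_ne_zero_iff.2 fun p _ => by simpa using ⟨hA p.1.1, hA p.1.2⟩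

theorem rootWeight_ne_top (A : Fin n → F) : rootWeight A ≠ ∞ :=
  ENNReal.prod_ne_top fun p _ => by simp

variable [ProperSpace F] [MeasurableSpace F] [BorelSpace F] {μ : Measure F} [μ.IsAddHaarMeasure]

theorem lintegral_upperPairs_diag (hs : HasNormScaling μ) {A : Fin n → F} (hA : ∀ i, A i ≠ 0)
    {E : UpperPairs F n → ℝ≥0∞} (hE : Measurable E) :
    ∫⁻ w, E (fun p => A p.1.2 / A p.1.1 * w.1 p, fun p => A p.1.2 / A p.1.1 * w.2 p)
      ∂(upperPairsMeasure μ n) = rootWeight A ^ 2 * ∫⁻ w, E w ∂(upperPairsMeasure μ n) := by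
  have hD : ∀ p : {p : Fin n × Fin n // p.1 < p.2}, A p.1.2 / A p.1.1 ≠ 0 :=
    fun p => div_ne_zero (hA _) (hA _)
  have hmul : Measurable fun (x : {p : Fin n × Fin n // p.1 < p.2} → F) p =>
      A p.1.2 / A p.1.1 * x p :=
    measurable_pi_lambda _ fun p => (measurable_pi_apply p).const_mul _
  have h1 : Measurable fun w : UpperPairs F n =>
      E (fun p => A p.1.2 / A p.1.1 * w.1 p, fun p => A p.1.2 / A p.1.1 * w.2 p) :=
    hE.comp ((hmul.comp measurable_fst).prodMk (hmul.comp measurable_snd))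
  rw [upperPairsMeasure, lintegral_prod _ h1.aemeasurable, lintegral_prod _ hE.aemeasurable]
  have h2 : ∀ x : {p : Fin n × Fin n // p.1 < p.2} → F,
      ∫⁻ y, E (fun p => A p.1.2 / A p.1.1 * x p, fun p => A p.1.2 / A p.1.1 * y p) ∂(piMeasure μ _) =
      rootWeight A * ∫⁻ y, E (fun p => A p.1.2 / A p.1.1 * x p, y) ∂(piMeasure μ _) := fun x => by
    have h3 : Measurable fun y => E (fun p => A p.1.2 / A p.1.1 * x p, y) :=
      hE.comp measurable_prodMk_left
    rw [lintegral_diag hs hD h3, prod_root_inv hA]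
  simp only [h2]
  have h4 : Measurable fun x => ∫⁻ y, E (x, y) ∂(piMeasure μ _) := hE.lintegral_prod_right'
  have h5 : Measurable fun x : {p : Fin n × Fin n // p.1 < p.2} → F =>
      ∫⁻ y, E (fun p => A p.1.2 / A p.1.1 * x p, y) ∂(piMeasure μ _) := h4.comp hmul
  rw [lintegral_const_mul _ h5, lintegral_diag hs hD h4, prod_root_inv hA, ← mul_assoc, sq]

/-- Commute diag(A)⁻¹ to the right through w, Z and g. The last two substitutions preserve the
measures, while w consists of two strictly upper triangular matrices whose coordinates are scaled by
A_j/A_i; each contributes one root weight. -/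
theorem lintegral_compl_diag (hs : HasNormScaling μ) {A : Fin n → F} (hA : ∀ i, A i ≠ 0)
    {G : GL (Fin n ⊕ Fin n) F → ℝ≥0∞} (hG : Measurable G) :
    ∫⁻ g, ∫⁻ Z, ∫⁻ w, G ((diagBlock (diagGL A))⁻¹ * (complBlock w * (upperBlock Z * diagBlock g)))
      ∂(upperPairsMeasure μ n) ∂(matrixMeasure μ n) ∂(glMeasure μ n) =
    rootWeight A ^ 2 * ∫⁻ g, ∫⁻ Z, ∫⁻ w, G (complBlock w * (upperBlock Z * diagBlock g))
      ∂(upperPairsMeasure μ n) ∂(matrixMeasure μ n) ∂(glMeasure μ n) := by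
  have h0 : Measurable fun q : (GL (Fin n) F × Matrix (Fin n) (Fin n) F) × UpperPairs F n =>
      complBlock q.2 * (upperBlock q.1.2 * diagBlock q.1.1) :=
    (measurable_complBlock.comp measurable_snd).mul
      ((measurable_upperBlock.comp (measurable_snd.comp measurable_fst)).mul
        (measurable_diagBlock.comp (measurable_fst.comp measurable_fst)))
  obtain ⟨E, hE, hEm⟩ : ∃ E : GL (Fin n) F → Matrix (Fin n) (Fin n) F → UpperPairs F n → ℝ≥0∞,
      (∀ g Z w, E g Z w = G (complBlock w * (upperBlock Z * diagBlock g))) ∧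
      Measurable fun q : (GL (Fin n) F × Matrix (Fin n) (Fin n) F) × UpperPairs F n =>
        E q.1.1 q.1.2 q.2 :=
    ⟨fun g Z w => G (complBlock w * (upperBlock Z * diagBlock g)), fun _ _ _ => rfl, hG.comp h0⟩
  have h1 : ∀ g Z w, G ((diagBlock (diagGL A))⁻¹ * (complBlock w * (upperBlock Z * diagBlock g))) =
      E ((diagGL A)⁻¹ * g) (((diagGL A)⁻¹).val * Z * ((diagGL A)⁻¹).inv)
        (fun p => A p.1.2 / A p.1.1 * w.1 p, fun p => A p.1.2 / A p.1.1 * w.2 p) := fun g Z w => by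
    rw [hE, ← mul_assoc, diagBlock_inv_mul_complBlock hA, diagBlock_mul, mul_assoc, ← diagBlock_inv,
      ← mul_assoc (diagBlock (diagGL A)⁻¹), diagBlock_mul_upperBlock, mul_assoc (upperBlock _)]
  simp only [h1, ← hE]
  obtain ⟨J, hJ, hJm⟩ : ∃ J : GL (Fin n) F → Matrix (Fin n) (Fin n) F → ℝ≥0∞,
      (∀ g Z, J g Z = ∫⁻ w, E g Z w ∂(upperPairsMeasure μ n)) ∧
      Measurable fun q : GL (Fin n) F × Matrix (Fin n) (Fin n) F => J q.1 q.2 :=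
    ⟨_, fun _ _ => rfl, hEm.lintegral_prod_right'⟩
  have h2 : ∀ g Z, ∫⁻ w : UpperPairs F n,
      E g Z (fun p => A p.1.2 / A p.1.1 * w.1 p, fun p => A p.1.2 / A p.1.1 * w.2 p)
      ∂(upperPairsMeasure μ n) = rootWeight A ^ 2 * J g Z := fun g Z => by
    have h3 : Measurable fun w => E g Z w := hEm.comp (measurable_prodMk_left (x := (g, Z)))
    rw [lintegral_upperPairs_diag hs hA h3, hJ]
  simp only [h2, ← hJ]
  have h4 : ∀ g, ∫⁻ Z, rootWeight A ^ 2 * J g (((diagGL A)⁻¹).val * Z * ((diagGL A)⁻¹).inv)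
      ∂(matrixMeasure μ n) = rootWeight A ^ 2 * ∫⁻ Z, J g Z ∂(matrixMeasure μ n) := fun g => by
    have h5 : Measurable fun Z => J g Z := hJm.comp measurable_prodMk_left
    rw [lintegral_const_mul' _ _ (ENNReal.pow_ne_top (rootWeight_ne_top A)),
      lintegral_matrixMeasure_conj hs _ h5]
  simp only [h4]
  have h6 : Measurable fun g => ∫⁻ Z, J g Z ∂(matrixMeasure μ n) := hJm.lintegral_prod_right'
  rw [lintegral_const_mul' _ _ (ENNReal.pow_ne_top (rootWeight_ne_top A)),
    lintegral_glMeasure_mul_left hs _ h6]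

variable [IsUltrametricDist F] {ψ : AddChar F Circle}

/-- After unfolding, all dependence on A is in the rescaling of the complement; what is left is
bounded uniformly for κ in a bounded set. -/
theorem whittakerMass_le (hs : HasNormScaling μ) {f : GL (Fin (2 * n)) F → ℂ}
    (hf : IsSchwartzBruhat f) {R : ℝ} (hR : 1 ≤ R) : ∃ C : ℝ≥0∞, C < ∞ ∧
      ∀ A : Fin n → F, (∀ i, A i ≠ 0) → ∀ κ ∈ boundedGL (Fin n ⊕ Fin n) F R,
        whittakerMass μ ψ f (diagBlock (diagGL A) * κ) ≤ C * rootWeight A ^ 2 := by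
  obtain ⟨M, R₀, hM, hR₀, hle⟩ := lintegral_enorm_le (μ := μ) hf
  refine ⟨M * boundedVolume μ n (R * R₀), ENNReal.mul_lt_top hM
    (boundedVolume_lt_top n (one_le_mul_of_one_le_of_one_le hR hR₀)), fun A hA κ hκ => ?_⟩
  have hG : Measurable fun x : GL (Fin n ⊕ Fin n) F => ‖f (conjShuffle n (κ⁻¹ * x))‖ₑ :=
    (hf.measurable.comp (measurable_conjShuffle (measurable_id.const_mul _))).enorm
  have h1 := lintegral_whittaker_le (μ := μ) (ψ := ψ) hs hf (diagBlock (diagGL A) * κ)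
  simp only [_root_.mul_inv_rev, mul_assoc] at h1
  rw [lintegral_compl_diag hs hA hG] at h1
  refine h1.trans ?_
  rw [mul_comm]
  gcongr
  exact hle R hR κ hκ

theorem measurable_whittakerMass (hψc : Continuous ψ) {f : GL (Fin (2 * n)) F → ℂ}
    (hf : Measurable f) : Measurable (whittakerMass μ ψ f) := by
  have h1 : Measurable fun q : GL (Fin n ⊕ Fin n) F × (GL (Fin n) F × strictLower F n) =>
      (conjShuffle n q.1, shalikaMk (q.2.2 : Matrix (Fin n) (Fin n) F) q.2.1) :=
    (measurable_conjShuffle measurable_fst).prodMk (measurable_shalikaMk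
      (measurable_subtype_coe.comp (measurable_snd.comp measurable_snd))
      (measurable_fst.comp measurable_snd))
  have h2 : Measurable fun q : GL (Fin n ⊕ Fin n) F × (GL (Fin n) F × strictLower F n) =>
      ‖whittaker μ ψ f (conjShuffle n q.1) (shalikaMk (q.2.2 : Matrix (Fin n) (Fin n) F) q.2.1)‖ₑ :=
    ((measurable_whittaker hψc hf).comp h1).enorm
  exact h2.lintegral_prod_right'

theorem whittakerMass_congr_unip (hs : HasNormScaling μ) (hψc : Continuous ψ)
    {f : GL (Fin (2 * n)) F → ℂ} (hf : Measurable f) {ξ η : GL (Fin n ⊕ Fin n) F}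
    {v : GL (Fin (2 * n)) F} (hv : v ∈ unip F (2 * n))
    (h : conjShuffle n ξ = v * conjShuffle n η) : whittakerMass μ ψ f ξ = whittakerMass μ ψ f η := by
  rw [whittakerMass, whittakerMass]
  refine lintegral_congr fun p => ?_
  have h1 := whittaker_unip_mul (μ := μ) hs hψc hf ⟨v, hv⟩ 1 (conjShuffle n η)
    (shalikaMk (p.2 : Matrix (Fin n) (Fin n) F) p.1)
  rw [Subgroup.coe_one, one_mul] at h1
  rw [h, h1, enorm_mul, enorm_mul]
  have h2 : ∀ u : unip F (2 * n), ‖(psiUnip ψ u : ℂ)‖ₑ = 1 := fun u => by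
    rw [← ofReal_norm, Circle.norm_coe, ENNReal.ofReal_one]
  have h3 : ‖(psiUnip ψ ⟨v, hv⟩ : ℂ)⁻¹‖ₑ = 1 := by
    rw [← ofReal_norm, norm_inv, Circle.norm_coe, inv_one, ENNReal.ofReal_one]
  rw [h2, h3, one_mul, one_mul]

end Convergence

/-! ### Integrability over the mirabolic coset space -/

section ConvergenceLower

variable {F : Type*} [NontriviallyNormedField F] [ProperSpace F] [MeasurableSpace F] [BorelSpace F]
  [IsUltrametricDist F] {μ : Measure F} [μ.IsAddHaarMeasure] {ψ : AddChar F Circle} {m : ℕ}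

variable (μ ψ) in
/-- The integral of `whittakerMass` over the strictly lower triangular matrices. -/
def massIntegral (f : GL (Fin (2 * (m + 1))) F → ℂ) (b : GL (Fin m) F) : ℝ≥0∞ :=
  ∫⁻ X : strictLower F (m + 1), whittakerMass μ ψ f
    (upperBlock (X : Matrix (Fin (m + 1)) (Fin (m + 1)) F) * diagBlock (glEmb b))
    ∂(strictLowerMeasure μ (m + 1))

attribute [local irreducible] whittakerMass upperBlock diagBlock glEmb diagGL

theorem measurable_massIntegral_integrand (hψc : Continuous ψ) {f : GL (Fin (2 * (m + 1))) F → ℂ}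
    (hf : Measurable f) : Measurable fun q : GL (Fin m) F × strictLower F (m + 1) =>
      whittakerMass μ ψ f
        (upperBlock (q.2 : Matrix (Fin (m + 1)) (Fin (m + 1)) F) * diagBlock (glEmb q.1)) :=
  (measurable_whittakerMass hψc hf).comp measurable_flag

theorem measurable_massIntegral (hψc : Continuous ψ) {f : GL (Fin (2 * (m + 1))) F → ℂ}
    (hf : Measurable f) : Measurable (massIntegral μ ψ f) :=
  (measurable_massIntegral_integrand hψc hf).lintegral_prod_right'

/-- Moving u to the left of X leaves an element of N_{2n}, invisible to absolute values, and a
unimodular change of X. -/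
theorem massIntegral_unip_mul (hs : HasNormScaling μ) (hψc : Continuous ψ)
    {f : GL (Fin (2 * (m + 1))) F → ℂ} (hf : Measurable f) (u : unip F m) (b : GL (Fin m) F) :
    massIntegral μ ψ f ((u : GL (Fin m) F) * b) = massIntegral μ ψ f b := by
  have hm : Measurable fun X : strictLower F (m + 1) => whittakerMass μ ψ f
      (upperBlock (X : Matrix (Fin (m + 1)) (Fin (m + 1)) F) * diagBlock (glEmb b)) :=
    (measurable_massIntegral_integrand hψc hf).comp measurable_prodMk_left
  set U : unip F (m + 1) := ⟨_, glEmb_mem_unip u⟩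
  rw [massIntegral, massIntegral,
    ← (measurePreserving_strictLower_conj (μ := μ) hs U).lintegral_comp hm]
  refine lintegral_congr fun X => ?_
  obtain ⟨v, hv, -, -, h⟩ := shalikaMk_unip_mul (X : Matrix (Fin (m + 1)) (Fin (m + 1)) F) U (glEmb b)
  rw [glEmb_mul]
  exact whittakerMass_congr_unip hs hψc hf hv h

theorem prod_root_lower {n : ℕ} (A : Fin n → F) :
    ∏ p : {p : Fin n × Fin n // p.2 < p.1}, ‖A p.1.2 / A p.1.1‖ₑ = rootWeight A := by
  refine Fintype.prod_equiv ⟨fun p => ⟨(p.1.2, p.1.1), p.2⟩, fun p => ⟨(p.1.2, p.1.1), p.2⟩,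
    fun _ => rfl, fun _ => rfl⟩ _ _ fun p => rfl

theorem diag_conj_strictLower {n : ℕ} {A : Fin n → F} (hA : ∀ i, A i ≠ 0)
    (x : {p : Fin n × Fin n // p.2 < p.1} → F) :
    upperBlock (fillMatrix 0 (fun i j => j < i) x) * diagBlock (diagGL A) =
      diagBlock (diagGL A) * upperBlock (fillMatrix 0 (fun i j => j < i)
        fun p => A p.1.2 / A p.1.1 * x p) := by
  rw [diagBlock_mul_upperBlock]
  congr 2
  change _ = _ * ((diagGL A)⁻¹).val
  rw [diagGL_val hA, diagGL_inv_val hA]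
  ext i j
  rw [Matrix.mul_diagonal, Matrix.diagonal_mul]
  simp only [fillMatrix, Matrix.of_apply]
  split_ifs with h
  · field_simp [hA i, hA j]
  · simp

/-- Moving diag(A), with A = (a, 1), to the left of X scales its entries by A_j/A_i for j < i, which
costs the inverse of the root weight. -/
theorem massIntegral_diag (hs : HasNormScaling μ) (hψc : Continuous ψ)
    {f : GL (Fin (2 * (m + 1))) F → ℂ} (hf : Measurable f) {a : Fin m → F} (ha : ∀ i, a i ≠ 0)
    (k : GL (Fin m) F) : massIntegral μ ψ f (diagGL a * k) =
      (rootWeight (Fin.snoc a 1 : Fin (m + 1) → F))⁻¹ * ∫⁻ x, whittakerMass μ ψ f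
        (diagBlock (diagGL (Fin.snoc a 1 : Fin (m + 1) → F)) *
          upperBlock (fillMatrix 0 (fun i j => j < i) x) * diagBlock (glEmb k)) ∂(piMeasure μ _) := by
  have hA : ∀ i, (Fin.snoc a 1 : Fin (m + 1) → F) i ≠ 0 := fun i => by
    induction i using Fin.lastCases with
    | last => simp
    | cast i => simpa using ha i
  have h1 : glEmb (diagGL a) = diagGL (Fin.snoc a 1 : Fin (m + 1) → F) := by
    have h2 := diagGL_const_mul_glEmb (one_ne_zero (α := F)) ha
    simp only [one_mul] at h2
    rw [← h2]
    have h3 : diagGL (fun _ : Fin (m + 1) => (1 : F)) = 1 :=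
      Units.ext (by rw [diagGL_val fun _ => one_ne_zero, Matrix.diagonal_one, Units.val_one])
    rw [h3, one_mul]
  have hm : Measurable fun X : strictLower F (m + 1) => whittakerMass μ ψ f
      (upperBlock (X : Matrix (Fin (m + 1)) (Fin (m + 1)) F) * diagBlock (glEmb (diagGL a * k))) :=
    (measurable_massIntegral_integrand hψc hf).comp measurable_prodMk_left
  rw [massIntegral, lintegral_strictLowerMeasure hm]
  set A : Fin (m + 1) → F := Fin.snoc a 1
  have hm2 : Measurable fun x : {p : Fin (m + 1) × Fin (m + 1) // p.2 < p.1} → F =>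
      diagBlock (diagGL A) * upperBlock (fillMatrix 0 (fun i j => j < i) x) * diagBlock (glEmb k) := by
    have h4 : Measurable fun x : {p : Fin (m + 1) × Fin (m + 1) // p.2 < p.1} → F =>
        upperBlock (fillMatrix 0 (fun i j => j < i) x) :=
      measurable_upperBlock.comp (measurable_fillMatrix 0 fun i j => j < i)
    exact (h4.const_mul _).mul_const _
  have hm3 : Measurable fun x : {p : Fin (m + 1) × Fin (m + 1) // p.2 < p.1} → F =>
      whittakerMass μ ψ f (diagBlock (diagGL A) *
        upperBlock (fillMatrix 0 (fun i j => j < i) x) * diagBlock (glEmb k)) :=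
    (measurable_whittakerMass hψc hf).comp hm2
  rw [← prod_root_lower, ← lintegral_diag hs (fun p => div_ne_zero (hA _) (hA _)) hm3]
  refine lintegral_congr fun x => ?_
  rw [glEmb_mul, h1, diagBlock_mul, ← mul_assoc]
  change whittakerMass μ ψ f (upperBlock (fillMatrix 0 (fun i j => j < i) x) * _ * _) = _
  rw [diag_conj_strictLower hA]

theorem fillMatrix_mem_strictLower {n : ℕ} (x : {p : Fin n × Fin n // p.2 < p.1} → F) :
    fillMatrix 0 (fun i j => j < i) x ∈ strictLower F n := (strictLowerOfCoords x).2

/-- The square of the root weight from the complement loses one factor to the integral over X. Only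
bounded X contribute, so this integral adds no more than a finite volume. -/
theorem exists_massIntegral_bound (hs : HasNormScaling μ) (hψc : Continuous ψ) (hψ : ψ ≠ 1)
    {f : GL (Fin (2 * (m + 1))) F → ℂ} (hf : IsSchwartzBruhat f) : ∃ (C : ℝ≥0∞) (R : ℝ), C < ∞ ∧
      ∀ a : Fin m → F, (∀ i, a i ≠ 0) → ∀ k ∈ boundedGL (Fin m) F 1,
        massIntegral μ ψ f (diagGL a * k) ≤ C * rootWeight (Fin.snoc a 1 : Fin (m + 1) → F) ∧
        ((∃ i : Fin m, R * ‖(Fin.snoc a 1 : Fin (m + 1) → F) i.succ‖ <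
          ‖(Fin.snoc a 1 : Fin (m + 1) → F) i.castSucc‖) → massIntegral μ ψ f (diagGL a * k) = 0) := by
  obtain ⟨S, hS, hx⟩ := exists_strictLower_bound (μ := μ) hs hψc hψ hf (m + 1)
  obtain ⟨R, hr⟩ := exists_root_bound (μ := μ) hs hψc hψ hf hS
  obtain ⟨C, hC, hle⟩ := whittakerMass_le (μ := μ) (ψ := ψ) hs hf hS
  set V := piMeasure μ {p : Fin (m + 1) × Fin (m + 1) // p.2 < p.1} {x | ∀ p, ‖x p‖ ≤ S} with hV
  refine ⟨C * V, R, ENNReal.mul_lt_top hC (piMeasure_bdd_lt_top S), fun a ha k hk => ?_⟩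
  have hA : ∀ i, (Fin.snoc a 1 : Fin (m + 1) → F) i ≠ 0 := fun i => by
    induction i using Fin.lastCases with
    | last => simp
    | cast i => simpa using ha i
  rw [massIntegral_diag hs hψc hf.measurable ha]
  set A : Fin (m + 1) → F := Fin.snoc a 1
  have hk' := glEmb_mem_boundedGL le_rfl hk
  have hB : MeasurableSet {x : {p : Fin (m + 1) × Fin (m + 1) // p.2 < p.1} → F | ∀ p, ‖x p‖ ≤ S} := by
    have : {x : {p : Fin (m + 1) × Fin (m + 1) // p.2 < p.1} → F | ∀ p, ‖x p‖ ≤ S} =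
        ⋂ p, {x | ‖x p‖ ≤ S} := by ext; simp
    rw [this]
    exact MeasurableSet.iInter fun p => measurableSet_le (measurable_pi_apply p).norm
      measurable_const
  have hbd : ∀ x : {p : Fin (m + 1) × Fin (m + 1) // p.2 < p.1} → F, whittakerMass μ ψ f
      (diagBlock (diagGL A) * upperBlock (fillMatrix 0 (fun i j => j < i) x) *
        diagBlock (glEmb k)) ≠ 0 → MatBdd (fillMatrix 0 (fun i j => j < i) x) S := fun x h0 i j =>
    hx A hA _ (fillMatrix_mem_strictLower x) _ hk' h0 i j (by omega)
  constructor
  · have h1 : ∫⁻ x, whittakerMass μ ψ f (diagBlock (diagGL A) *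
        upperBlock (fillMatrix 0 (fun i j => j < i) x) * diagBlock (glEmb k)) ∂(piMeasure μ _) ≤
        C * rootWeight A ^ 2 * V := by
      rw [hV, ← lintegral_indicator_const hB]
      refine lintegral_mono fun x => ?_
      by_cases h0 : whittakerMass μ ψ f (diagBlock (diagGL A) *
        upperBlock (fillMatrix 0 (fun i j => j < i) x) * diagBlock (glEmb k)) = 0
      · rw [h0]; exact zero_le
      · have h2 := hbd x h0
        rw [Set.indicator_of_mem, mul_assoc]
        · exact hle A hA _ (upperBlock_mul_diagBlock_mem_boundedGL hS h2 hk')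
        · intro p
          have h3 := h2 p.1.1 p.1.2
          simpa [fillMatrix, p.2] using h3
    calc _ ≤ (rootWeight A)⁻¹ * (C * rootWeight A ^ 2 * V) := by gcongr
      _ = (rootWeight A)⁻¹ * rootWeight A * (C * V * rootWeight A) := by ring
      _ = _ := by
        rw [ENNReal.inv_mul_cancel (rootWeight_ne_zero hA) (rootWeight_ne_top A), one_mul]
  · rintro ⟨i, hi⟩
    refine mul_eq_zero_of_right _ ((lintegral_congr fun x => ?_).trans lintegral_zero)
    by_contra h0
    exact absurd (hr A hA _ (hbd x h0) _ hk' h0 i.castSucc i.succ (by simp)) (not_le.2 hi)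

/-- The bounds on diag(a)k are uniform in integral k, so they pass to the average over k, which
satisfies the invariance required by the criterion in Iwasawa coordinates. -/
theorem lintegral_massIntegral_lt_top (hs : HasNormScaling μ) (hψc : Continuous ψ) (hψ : ψ ≠ 1)
    {f : GL (Fin (2 * (m + 1))) F → ℂ} (hf : IsSchwartzBruhat f) :
    ∫⁻ b, massIntegral μ ψ f b ∂(lowerMeasure μ m) < ∞ := by
  obtain ⟨C, R, hC, hb⟩ := exists_massIntegral_bound (μ := μ) hs hψc hψ hf
  obtain ⟨V, hV, hle⟩ := lintegral_lowerMeasure_le (μ := μ) hs R m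
  have hm := measurable_massIntegral (μ := μ) hψc hf.measurable
  have hinv := massIntegral_unip_mul (μ := μ) hs hψc hf.measurable
  have hK := measurableSet_boundedGL (ι := Fin m) (F := F) 1
  have h1 := hle (C * glMeasure μ m (boundedGL (Fin m) F 1)) (integralAverage μ (massIntegral μ ψ f))
    (measurable_integralAverage hm) (integralAverage_unip_mul hinv)
    (fun b k hk => integralAverage_mul_right hs hm b hk) (fun a ha => ?_) (fun a ha hR => ?_)
  · rw [lintegral_integralAverage hs hm hinv] at h1
    -- The criterion bounds the integral times the volume of the integral matrices; as this volume
    -- is not zero, an infinite integral would contradict the bound.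
    by_contra! htop
    rw [top_le_iff] at htop
    rw [htop, ENNReal.top_mul (glMeasure_boundedGL_ne_zero m), top_le_iff] at h1
    exact (ENNReal.mul_lt_top (ENNReal.mul_lt_top hC (glMeasure_boundedGL_lt_top zero_le_one)) hV).ne h1
  · calc _ ≤ ∫⁻ k, (boundedGL (Fin m) F 1).indicator
          (fun _ => C * rootWeight (Fin.snoc a 1 : Fin (m + 1) → F)) k ∂(glMeasure μ m) := by
          refine lintegral_mono fun k => ?_
          by_cases hk : k ∈ boundedGL (Fin m) F 1
          · rw [Set.indicator_of_mem hk, Set.indicator_of_mem hk]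
            exact (hb a ha k hk).1
          · rw [Set.indicator_of_notMem hk, Set.indicator_of_notMem hk]
      _ = _ := by rw [lintegral_indicator_const hK]; ring
  · refine (lintegral_congr fun k => ?_).trans lintegral_zero
    by_cases hk : k ∈ boundedGL (Fin m) F 1
    · rw [Set.indicator_of_mem hk, (hb a ha k hk).2 hR]
    · rw [Set.indicator_of_notMem hk]

end ConvergenceLower

/-! ### The linear period -/

section LinearPeriodIdentity

variable {F : Type*} [NontriviallyNormedField F] [ProperSpace F] [MeasurableSpace F] [BorelSpace F]
  [IsUltrametricDist F] {μ : Measure F} [μ.IsAddHaarMeasure] {ψ : AddChar F Circle} {n m : ℕ}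

/-- The integrand vanishes unless u lies in g₁ · supp(f) · g₂⁻¹, which is bounded. -/
theorem integrable_whittaker_integrand (hψc : Continuous ψ) {k : ℕ} {f : GL (Fin k) F → ℂ}
    (hf : IsSchwartzBruhat f) (g₁ g₂ : GL (Fin k) F) :
    Integrable (fun u : unip F k => f (g₁⁻¹ * (u : GL (Fin k) F) * g₂) * (psiUnip ψ u : ℂ)⁻¹)
      (unipMeasure μ k) := by
  obtain ⟨M, hM, hfM⟩ := hf.exists_norm_le
  obtain ⟨R, hR, hfR⟩ := hf.exists_support_bdd
  obtain ⟨k₁, h₁⟩ := exists_mem_boundedGL g₁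
  obtain ⟨k₂, h₂⟩ := exists_mem_boundedGL g₂
  refine ⟨(measurable_whittaker_integrand_right hψc hf.measurable g₁ g₂).aestronglyMeasurable, ?_⟩
  rw [hasFiniteIntegral_iff_enorm]
  refine lt_of_le_of_lt (lintegral_mono (g := {u : unip F k |
    MatBdd (u : GL (Fin k) F).val (k₁ * R * k₂)}.indicator fun _ => ENNReal.ofReal M) fun u => ?_) ?_
  · have h1 : ‖(psiUnip ψ u : ℂ)⁻¹‖ₑ = 1 := by
      rw [← ofReal_norm, norm_inv, Circle.norm_coe, inv_one, ENNReal.ofReal_one]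
    rw [enorm_mul, h1, mul_one]
    by_cases h0 : f (g₁⁻¹ * (u : GL (Fin k) F) * g₂) = 0
    · rw [h0, enorm_zero]; exact zero_le
    · have hR0 := zero_le_one.trans hR
      have h2 := boundedGL_mul (mul_nonneg k₁.cast_nonneg hR0) k₂.cast_nonneg
        (boundedGL_mul k₁.cast_nonneg hR0 h₁ (hfR _ h0)) (boundedGL_inv h₂)
      have h3 : g₁ * (g₁⁻¹ * (u : GL (Fin k) F) * g₂) * g₂⁻¹ = u := by group
      rw [h3] at h2
      rw [Set.indicator_of_mem (show u ∈ {u : unip F k |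
        MatBdd (u : GL (Fin k) F).val (k₁ * R * k₂)} from h2.1), ← ofReal_norm]
      exact ENNReal.ofReal_le_ofReal (hfM _)
  · rw [lintegral_indicator_const (measurableSet_unip_matBdd _)]
    exact ENNReal.mul_lt_top ENNReal.ofReal_lt_top (unipMeasure_bdd_lt_top _)

/-- Properness of the factorization, with trivial complement factor, bounds both g and X on the
support. -/
theorem integrable_shalika (hψc : Continuous ψ) {f : GL (Fin (2 * n)) F → ℂ}
    (hf : IsSchwartzBruhat f) :
    Integrable (fun s : shalika F n => f (s : GL (Fin (2 * n)) F) * (theta ψ s : ℂ)⁻¹)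
      (shalikaMeasure μ n) := by
  obtain ⟨M, hM, hfM⟩ := hf.exists_norm_le
  obtain ⟨R, hR, hfR⟩ := hf.exists_support_bdd
  obtain ⟨S, hS, hfac⟩ := exists_bdd_factors (F := F) n hR
  have hm : Measurable fun s : shalika F n => f (s : GL (Fin (2 * n)) F) * (theta ψ s : ℂ)⁻¹ :=
    (hf.measurable.comp measurable_subtype_coe).mul (measurable_theta hψc).inv
  refine ⟨hm.aestronglyMeasurable, ?_⟩
  rw [hasFiniteIntegral_iff_enorm, lintegral_shalikaMeasure hm.enorm]
  set V := matrixMeasure μ n {Z | MatBdd Z S}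
  have h1 : ∀ g, ∫⁻ Z, ‖f (toShalika Z g : GL (Fin (2 * n)) F) * (theta ψ (toShalika Z g) : ℂ)⁻¹‖ₑ
      ∂(matrixMeasure μ n) ≤ (boundedGL (Fin n) F S).indicator (fun _ => ENNReal.ofReal M * V) g := by
    intro g
    have h2 : ∀ Z, f (toShalika Z g : GL (Fin (2 * n)) F) ≠ 0 →
        g ∈ boundedGL (Fin n) F S ∧ MatBdd Z S := fun Z h0 => by
      have h3 := hfR _ h0
      rw [coe_toShalika, conjShuffle_mem_boundedGL] at h3
      have h4 := hfac 0 Z g (by rwa [complBlock_zero, one_mul])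
      exact ⟨h4.1, h4.2.1⟩
    by_cases hg : g ∈ boundedGL (Fin n) F S
    · rw [Set.indicator_of_mem hg, ← lintegral_indicator_const (measurableSet_matBdd S)]
      refine lintegral_mono fun Z => ?_
      have h5 : ‖(theta ψ (toShalika Z g) : ℂ)⁻¹‖ₑ = 1 := by
        rw [← ofReal_norm, norm_inv, Circle.norm_coe, inv_one, ENNReal.ofReal_one]
      rw [enorm_mul, h5, mul_one]
      by_cases h0 : f (toShalika Z g : GL (Fin (2 * n)) F) = 0
      · rw [h0, enorm_zero]; exact zero_le
      · rw [Set.indicator_of_mem (show Z ∈ {Z | MatBdd Z S} from (h2 Z h0).2), ← ofReal_norm]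
        exact ENNReal.ofReal_le_ofReal (hfM _)
    · rw [Set.indicator_of_notMem hg]
      refine le_of_eq ((lintegral_congr fun Z => ?_).trans lintegral_zero)
      by_cases h0 : f (toShalika Z g : GL (Fin (2 * n)) F) = 0
      · rw [h0, zero_mul, enorm_zero]
      · exact absurd (h2 Z h0).1 hg
  refine (lintegral_mono h1).trans_lt ?_
  rw [lintegral_indicator_const (measurableSet_boundedGL S)]
  exact ENNReal.mul_lt_top (ENNReal.mul_lt_top ENNReal.ofReal_lt_top (matrixMeasure_bdd_lt_top S))
    (glMeasure_boundedGL_lt_top (zero_le_one.trans hS))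

theorem measurable_mk_toShalika : Measurable fun q : GL (Fin n) F × strictLower F n =>
    (Quotient.mk _ (toShalika (q.2 : Matrix (Fin n) (Fin n) F) q.1) : ShalikaQuot F n) :=
  measurable_quotient_mk''.comp (Measurable.subtype_mk
    (measurable_shalikaMk (measurable_subtype_coe.comp measurable_snd) measurable_fst))

theorem measurable_mk_toShalikaP : Measurable fun p : GL (Fin m) F × strictLower F (m + 1) =>
    (Quotient.mk _ (toShalikaP (p.2 : Matrix (Fin (m + 1)) (Fin (m + 1)) F) (mirabolicMk 0 p.1)) :
      ShalikaPQuot F (m + 1)) :=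
  measurable_quotient_mk''.comp (Measurable.subtype_mk
    (measurable_shalikaMk (measurable_subtype_coe.comp measurable_snd)
      (measurable_subtype_coe.comp (measurable_mirabolicMk measurable_const measurable_fst))))

/-- On representatives with strictly lower triangular X the character θ is trivial, so only the
Whittaker function remains. -/
theorem unfoldedIntegrand_strictLower (hs : HasNormScaling μ) (hψc : Continuous ψ)
    {f : GL (Fin (2 * (m + 1))) F → ℂ} (hf : Measurable f) (p : GL (Fin m) F × strictLower F (m + 1))
    (q : GL (Fin (m + 1)) F × strictLower F (m + 1)) :
    unfoldedIntegrand μ ψ f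
      (Quotient.mk _ (toShalikaP (p.2 : Matrix (Fin (m + 1)) (Fin (m + 1)) F) (mirabolicMk 0 p.1)))
      (Quotient.mk _ (toShalika (q.2 : Matrix (Fin (m + 1)) (Fin (m + 1)) F) q.1)) =
    whittaker μ ψ f (conjShuffle (m + 1) (upperBlock (p.2 : Matrix (Fin (m + 1)) (Fin (m + 1)) F) *
      diagBlock (glEmb p.1))) (shalikaMk (q.2 : Matrix (Fin (m + 1)) (Fin (m + 1)) F) q.1) := by
  rw [unfoldedIntegrand_mk hs hψc hf, theta_shalikaMk, trace_strictLower]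
  have h1 : (mirabolicMk 0 p.1 : GL (Fin (m + 1)) F) = glEmb p.1 :=
    Units.ext (by rw [mirabolicMk_val, glEmb_val])
  have h2 : (toShalikaP (p.2 : Matrix (Fin (m + 1)) (Fin (m + 1)) F) (mirabolicMk 0 p.1) :
      GL (Fin (2 * (m + 1))) F) = conjShuffle (m + 1)
        (upperBlock (p.2 : Matrix (Fin (m + 1)) (Fin (m + 1)) F) * diagBlock (glEmb p.1)) := by
    rw [← h1]; rfl
  have h3 : theta ψ ⟨(toShalikaP (p.2 : Matrix (Fin (m + 1)) (Fin (m + 1)) F)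
      (mirabolicMk 0 p.1)).1, (toShalikaP (p.2 : Matrix (Fin (m + 1)) (Fin (m + 1)) F)
      (mirabolicMk 0 p.1)).2.1⟩ = 1 := by
    have h4 := theta_shalikaMk ψ (p.2 : Matrix (Fin (m + 1)) (Fin (m + 1)) F)
      (mirabolicMk 0 p.1 : GL (Fin (m + 1)) F)
    rw [trace_strictLower, AddChar.map_zero_eq_one] at h4
    exact h4
  rw [h3, h2, AddChar.map_zero_eq_one, Circle.coe_one, inv_one, mul_one, mul_one]
  rfl

attribute [local irreducible] whittaker conjShuffle shalikaMk upperBlock diagBlock glEmb toShalika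
  toShalikaP mirabolicMk unfoldedIntegrand complBlock

theorem measurable_whittaker_flag (hψc : Continuous ψ) {f : GL (Fin (2 * n)) F → ℂ}
    (hf : Measurable f) : Measurable fun q : GL (Fin n ⊕ Fin n) F × (GL (Fin n) F × strictLower F n) =>
      whittaker μ ψ f (conjShuffle n q.1) (shalikaMk (q.2.2 : Matrix (Fin n) (Fin n) F) q.2.1) := by
  have h1 : Measurable fun q : GL (Fin n ⊕ Fin n) F × (GL (Fin n) F × strictLower F n) =>
      (conjShuffle n q.1, shalikaMk (q.2.2 : Matrix (Fin n) (Fin n) F) q.2.1) :=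
    (measurable_conjShuffle measurable_fst).prodMk (measurable_shalikaMk
      (measurable_subtype_coe.comp (measurable_snd.comp measurable_snd))
      (measurable_fst.comp measurable_snd))
  exact (measurable_whittaker hψc hf).comp h1

theorem integrable_whittaker_prod (hs : HasNormScaling μ) (hψc : Continuous ψ) (hψ : ψ ≠ 1)
    {f : GL (Fin (2 * (m + 1))) F → ℂ} (hf : IsSchwartzBruhat f) :
    Integrable (fun q : (GL (Fin m) F × strictLower F (m + 1)) ×
        (GL (Fin (m + 1)) F × strictLower F (m + 1)) => whittaker μ ψ f
          (conjShuffle (m + 1) (upperBlock (q.1.2 : Matrix (Fin (m + 1)) (Fin (m + 1)) F) *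
            diagBlock (glEmb q.1.1)))
          (shalikaMk (q.2.2 : Matrix (Fin (m + 1)) (Fin (m + 1)) F) q.2.1))
      (((lowerMeasure μ m).prod (strictLowerMeasure μ (m + 1))).prod
        ((lowerMeasure μ (m + 1)).prod (strictLowerMeasure μ (m + 1)))) := by
  have h0 : Measurable fun q : (GL (Fin m) F × strictLower F (m + 1)) ×
      (GL (Fin (m + 1)) F × strictLower F (m + 1)) =>
      (upperBlock (q.1.2 : Matrix (Fin (m + 1)) (Fin (m + 1)) F) * diagBlock (glEmb q.1.1), q.2) :=
    (measurable_flag.comp measurable_fst).prodMk measurable_snd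
  have hm : Measurable fun q : (GL (Fin m) F × strictLower F (m + 1)) ×
        (GL (Fin (m + 1)) F × strictLower F (m + 1)) => whittaker μ ψ f
          (conjShuffle (m + 1) (upperBlock (q.1.2 : Matrix (Fin (m + 1)) (Fin (m + 1)) F) *
            diagBlock (glEmb q.1.1)))
          (shalikaMk (q.2.2 : Matrix (Fin (m + 1)) (Fin (m + 1)) F) q.2.1) :=
    (measurable_whittaker_flag hψc hf.measurable).comp h0
  refine ⟨hm.aestronglyMeasurable, ?_⟩
  rw [hasFiniteIntegral_iff_enorm, lintegral_prod _ hm.enorm.aemeasurable,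
    lintegral_prod _ hm.enorm.lintegral_prod_right'.aemeasurable]
  exact lintegral_massIntegral_lt_top hs hψc hψ hf

/-- Read through the unfolding identity, the function is an integral with parameter of the jointly
measurable Whittaker function. -/
theorem measurable_complIntegral_shalikaIntegral (hs : HasNormScaling μ) (hψc : Continuous ψ)
    {f : GL (Fin (2 * n)) F → ℂ} (hf : IsSchwartzBruhat f) :
    Measurable (complIntegral μ ψ (shalikaIntegral μ ψ f)) := by
  have h1 : (complIntegral μ ψ (shalikaIntegral μ ψ f)) = fun ξ =>
      ∫ p : GL (Fin n) F × strictLower F n, whittaker μ ψ f (conjShuffle n ξ)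
        (shalikaMk (p.2 : Matrix (Fin n) (Fin n) F) p.1)
        ∂((lowerMeasure μ n).prod (strictLowerMeasure μ n)) :=
    funext fun ξ => (integral_whittaker hs hψc hf ξ).symm
  rw [h1]
  exact (measurable_whittaker_flag hψc hf.measurable).stronglyMeasurable.integral_prod_right'.measurable

/-- The inner integral is the complement integral of Ψ by unfolding, and the inversion formula with
exponent 0 evaluates the outer one as Ψ(1). -/
theorem integral_integral_whittaker (hs : HasNormScaling μ) (hψc : Continuous ψ) (hψ : ψ ≠ 1)
    (hμ : IsSelfDual ψ μ) {f : GL (Fin (2 * (m + 1))) F → ℂ} (hf : IsSchwartzBruhat f) :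
    ∫ p : GL (Fin m) F × strictLower F (m + 1), ∫ q : GL (Fin (m + 1)) F × strictLower F (m + 1),
      whittaker μ ψ f (conjShuffle (m + 1) (upperBlock (p.2 : Matrix (Fin (m + 1)) (Fin (m + 1)) F) *
        diagBlock (glEmb p.1))) (shalikaMk (q.2 : Matrix (Fin (m + 1)) (Fin (m + 1)) F) q.1)
      ∂((lowerMeasure μ (m + 1)).prod (strictLowerMeasure μ (m + 1)))
      ∂((lowerMeasure μ m).prod (strictLowerMeasure μ (m + 1))) =
    ∫ s : shalika F (m + 1), f (s : GL (Fin (2 * (m + 1))) F) * (theta ψ s : ℂ)⁻¹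
      ∂(shalikaMeasure μ (m + 1)) := by
  have hmc := measurable_complIntegral_shalikaIntegral hs hψc hf
  have hint := (integrable_whittaker_prod hs hψc hψ hf).integral_prod_left
  simp only [integral_whittaker hs hψc hf] at hint ⊢
  have hflag : flagMeasure μ 0 m = ((lowerMeasure μ m).prod (strictLowerMeasure μ (m + 1))).map
      fun p => upperBlock (p.2 : Matrix (Fin (m + 1)) (Fin (m + 1)) F) * diagBlock (glEmb p.1) := by
    rw [flagMeasure]
    simp only [pow_zero, inv_one]
    rw [show (fun _ : GL (Fin m) F => (1 : ℝ≥0∞)) = 1 from rfl, withDensity_one]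
  have h1 : Integrable (complIntegral μ ψ (shalikaIntegral μ ψ f)) (flagMeasure μ 0 m) := by
    rw [hflag]
    exact (integrable_map_measure hmc.aestronglyMeasurable measurable_flag.aemeasurable).2 hint
  have h2 := integral_flagMeasure hs hψc hψ hμ m 0
    (isShalikaEquivariant_shalikaIntegral (ψ := ψ) hs hf) h1
  rw [hflag, integral_map measurable_flag.aemeasurable hmc.aestronglyMeasurable] at h2
  rw [h2, shalikaIntegral]
  simp only [map_one, one_mul]

/-- Both coset measures are images of products of lower triangular measures, so everything is
transported to these coordinates, where absolute convergence and the identity are known. -/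
theorem integrable_unfoldedIntegrand (hs : HasNormScaling μ) (hψc : Continuous ψ) (hψ : ψ ≠ 1)
    (hμ : IsSelfDual ψ μ) {f : GL (Fin (2 * (m + 1))) F → ℂ} (hf : IsSchwartzBruhat f) :
    Integrable (fun ξ : ShalikaPQuot F (m + 1) × ShalikaQuot F (m + 1) =>
      unfoldedIntegrand μ ψ f ξ.1 ξ.2)
      ((shalikaPQuotMeasure μ (m + 1)).prod (shalikaQuotMeasure μ (m + 1))) ∧
    ∫ s : shalika F (m + 1), f (s : GL (Fin (2 * (m + 1))) F) * (theta ψ s : ℂ)⁻¹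
      ∂(shalikaMeasure μ (m + 1)) =
    ∫ ξp : ShalikaPQuot F (m + 1), ∫ ξ : ShalikaQuot F (m + 1), unfoldedIntegrand μ ψ f ξp ξ
      ∂(shalikaQuotMeasure μ (m + 1)) ∂(shalikaPQuotMeasure μ (m + 1)) := by
  have hP : Measurable fun p : GL (Fin m) F × strictLower F (m + 1) => (Quotient.mk _
      (toShalikaP (p.2 : Matrix (Fin (m + 1)) (Fin (m + 1)) F) (mirabolicMk 0 p.1)) :
        ShalikaPQuot F (m + 1)) := measurable_mk_toShalikaP
  have hQ : Measurable fun q : GL (Fin (m + 1)) F × strictLower F (m + 1) => (Quotient.mk _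
      (toShalika (q.2 : Matrix (Fin (m + 1)) (Fin (m + 1)) F) q.1) : ShalikaQuot F (m + 1)) :=
    measurable_mk_toShalika
  have hm := measurable_unfoldedIntegrand (μ := μ) hs hψc hf
  have hsP : SFinite (shalikaPQuotMeasure μ (m + 1)) := by
    rw [shalikaPQuotMeasure_eq_map hs]; infer_instance
  have hsQ : SFinite (shalikaQuotMeasure μ (m + 1)) := by
    rw [shalikaQuotMeasure_eq_map hs]; infer_instance
  have hprod : (shalikaPQuotMeasure μ (m + 1)).prod (shalikaQuotMeasure μ (m + 1)) =
      (((lowerMeasure μ m).prod (strictLowerMeasure μ (m + 1))).prod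
        ((lowerMeasure μ (m + 1)).prod (strictLowerMeasure μ (m + 1)))).map (Prod.map
        (fun p => (Quotient.mk _ (toShalikaP (p.2 : Matrix (Fin (m + 1)) (Fin (m + 1)) F)
          (mirabolicMk 0 p.1)) : ShalikaPQuot F (m + 1)))
        (fun q => (Quotient.mk _ (toShalika (q.2 : Matrix (Fin (m + 1)) (Fin (m + 1)) F) q.1) :
          ShalikaQuot F (m + 1)))) := by
    rw [shalikaPQuotMeasure_eq_map hs, shalikaQuotMeasure_eq_map hs, Measure.map_prod_map _ _ hP hQ]
  have hcongr : (fun ξ : ShalikaPQuot F (m + 1) × ShalikaQuot F (m + 1) =>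
      unfoldedIntegrand μ ψ f ξ.1 ξ.2) ∘ (Prod.map
        (fun p : GL (Fin m) F × strictLower F (m + 1) => (Quotient.mk _ (toShalikaP
          (p.2 : Matrix (Fin (m + 1)) (Fin (m + 1)) F) (mirabolicMk 0 p.1)) : ShalikaPQuot F (m + 1)))
        (fun q : GL (Fin (m + 1)) F × strictLower F (m + 1) => (Quotient.mk _ (toShalika
          (q.2 : Matrix (Fin (m + 1)) (Fin (m + 1)) F) q.1) : ShalikaQuot F (m + 1)))) =
      fun q => whittaker μ ψ f
          (conjShuffle (m + 1) (upperBlock (q.1.2 : Matrix (Fin (m + 1)) (Fin (m + 1)) F) *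
            diagBlock (glEmb q.1.1)))
          (shalikaMk (q.2.2 : Matrix (Fin (m + 1)) (Fin (m + 1)) F) q.2.1) :=
    funext fun q => unfoldedIntegrand_strictLower hs hψc hf.measurable q.1 q.2
  have hintW := integrable_whittaker_prod (μ := μ) hs hψc hψ hf
  have hint : Integrable (fun ξ : ShalikaPQuot F (m + 1) × ShalikaQuot F (m + 1) =>
      unfoldedIntegrand μ ψ f ξ.1 ξ.2)
      ((shalikaPQuotMeasure μ (m + 1)).prod (shalikaQuotMeasure μ (m + 1))) := by
    rw [hprod, integrable_map_measure hm.aestronglyMeasurable (hP.prodMap hQ).aemeasurable, hcongr]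
    exact hintW
  refine ⟨hint, ?_⟩
  rw [← integral_integral_whittaker hs hψc hψ hμ hf, ← integral_prod _ hintW,
    ← integral_prod _ hint, hprod,
    integral_map (hP.prodMap hQ).aemeasurable hm.aestronglyMeasurable]
  exact integral_congr_ae (Filter.Eventually.of_forall fun q => (congrFun hcongr q).symm)

end LinearPeriodIdentity

end

end LinearPeriod

theorem mainTheorem7 {F : Type*} [NontriviallyNormedField F] [IsUltrametricDist F]
    [LocallyCompactSpace F] [CharZero F] [MeasurableSpace F] [BorelSpace F]
    (hF : LinearPeriod.IsNormalizedAbs F)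
    (ψ : AddChar F Circle) (hψc : Continuous ψ) (hψ : ψ ≠ 1)
    (μ : Measure F) [μ.IsAddHaarMeasure] (hμ : LinearPeriod.IsSelfDual ψ μ)
    (n : ℕ) (hn : 1 ≤ n) (f : GL (Fin (2 * n)) F → ℂ) (hf : LinearPeriod.IsSchwartzBruhat f) :
    -- the integral defining `W_f` converges absolutely
    (∀ g₁ g₂ : GL (Fin (2 * n)) F,
      Integrable (fun u : LinearPeriod.unip F (2 * n) =>
          f (g₁⁻¹ * (u : GL (Fin (2 * n)) F) * g₂) * (LinearPeriod.psiUnip ψ u : ℂ)⁻¹)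
        (LinearPeriod.unipMeasure μ (2 * n))) ∧
    -- the integral over `H_n` converges absolutely
    Integrable (fun s : LinearPeriod.shalika F n =>
        f (s : GL (Fin (2 * n)) F) * (LinearPeriod.theta ψ s : ℂ)⁻¹)
      (LinearPeriod.shalikaMeasure μ n) ∧
    -- the double integral converges absolutely
    Integrable (fun ξ : LinearPeriod.ShalikaPQuot F n × LinearPeriod.ShalikaQuot F n =>
        LinearPeriod.unfoldedIntegrand μ ψ f ξ.1 ξ.2)
      ((LinearPeriod.shalikaPQuotMeasure μ n).prod (LinearPeriod.shalikaQuotMeasure μ n)) ∧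
    -- the identity
    ∫ s : LinearPeriod.shalika F n,
        f (s : GL (Fin (2 * n)) F) * (LinearPeriod.theta ψ s : ℂ)⁻¹
        ∂(LinearPeriod.shalikaMeasure μ n) =
      ∫ ξp : LinearPeriod.ShalikaPQuot F n, ∫ ξ : LinearPeriod.ShalikaQuot F n,
        LinearPeriod.unfoldedIntegrand μ ψ f ξp ξ
        ∂(LinearPeriod.shalikaQuotMeasure μ n) ∂(LinearPeriod.shalikaPQuotMeasure μ n) := by
  have : ProperSpace F := ProperSpace.of_locallyCompactSpace F
  have hs := LinearPeriod.hasNormScaling_of_isNormalizedAbs (μ := μ) hF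
  -- With n = m + 1 the mirabolic group is U_{m+1}G_m, and lower triangular matrices of size m
  -- parametrize its cosets.
  obtain ⟨m, rfl⟩ := Nat.exists_eq_add_of_le' hn
  exact ⟨fun g₁ g₂ => LinearPeriod.integrable_whittaker_integrand hψc hf g₁ g₂,
    LinearPeriod.integrable_shalika hψc hf,
    LinearPeriod.integrable_unfoldedIntegrand hs hψc hψ hμ hf⟩
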